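/- Let $(X,\mathcal X,\nu)$ be a $\sigma$-finite measure space whose singletons are measurable and $\nu$-null. Let $(\mathbf d,\gamma)$ be a local Dirichlet structure with carré du champ on $L^2(\nu)$: $\epsilon[u]=\frac12\int\gamma[u]\,d\nu$ with domain $\mathbf d$ is a densely defined, closed, symmetric, nonnegative form on the real space $L^2(\nu)$ on which normal contractions operate; it is local, i.e. $\epsilon(F(u)-F(0),G(u)-G(0))=0$ for $u\in\mathbf d$ and $F,G\in C_c^\infty(\mathbb R)$ with disjoint supports; and $\gamma:\mathbf d\times\mathbf d\to L^1(\nu)$ is a positive symmetric bilinear map (with $\gamma[u]=\gamma[u,u]$) such that $\epsilon(fh,g)+\epsilon(gh,f)-\epsilon(h,fg)=\int h\,\gamma[f,g]\,d\nu$ for bounded $f,g,h\in\mathbf d$. Suppose that $\mathbf d$ is separable for the norm $(\|u\|^2+\epsilon[u])^{1/2}$, and let $(a,\mathcal D(a))$ be the generator: $a[u]=w\in L^2(\nu)$ iff $u\in\mathbf d$ and $\epsilon(u,v)=-\int wv\,d\nu$ for all $v\in\mathbf d$. Let $\Omega$ be the space of countable sums of Dirac masses on $X$, with the $\sigma$-field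 generated by the maps $\omega\mapsto\omega(B)$, $B\in\mathcal X$, let $N$ be the identity map $N_\omega=\omega$, and let $\mathbb P$ be the law on $\Omega$ under which $N$ is a Poisson random measure with intensity $\nu$. Write $N(h)=\int h\,dN$, and let $\tilde N:L^2(\nu)\to L^2(\mathbb P)$ be the continuous extension of $f\mapsto N(f)-\int f\,d\nu$, $f\in L^1\cap L^2(\nu)$. Let $$\mathcal D_0=\Big\{\sum_{p=1}^m\lambda_pe^{i\tilde N(f_p)}:\ m\ge1,\ \lambda_p\in\mathbb C,\ f_p\in\mathcal D(a)\cap L^1(\nu)\Big\}\subset L^2_{\mathbb C}(\mathbb P),$$ and for $F=\sum_p\lambda_pe^{i\tilde N(f_p)}$ in $\mathcal D_0$ put $$A_0[F]=\sum_p\lambda_pe^{i\tilde N(f_p)}\Big(i\tilde N(a[f_p])-\tfrac12N(\gamma[f_p])\Big).$$ 1. For $F=\sum_p\lambda_pe^{i\tilde N(f_p)}$ and $G=\sum_q\mu_qe^{i\tilde N(g_q)}$ in $\mathcal D_0$, with $\Phi'_p=i\lambda_pe^{i\tilde N(f_p)}$ and $\Psi'_q=i\mu_qe^{i\tilde N(g_q)}$,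 both integrands below are integrable and $$\mathbb E\big[A_0[F]\,\overline G\big]=-\tfrac12\,\mathbb E\sum_{p,q}\Phi'_p\,\overline{\Psi'_q}\,N(\gamma[f_p,g_q]).$$ 2. $\mathcal D_0$ is dense in $L^2_{\mathbb C}(\mathbb P)$. $A_0[F]$ depends only on $F\in\mathcal D_0$ and not on its representation, and $A_0$ is a linear map from $\mathcal D_0$ to $L^1_{\mathbb C}(\mathbb P)$ that is symmetric, $\mathbb E[A_0[F]\overline G]=\mathbb E[F\,\overline{A_0[G]}]$, and negative, $\mathbb E[A_0[F]\overline F]\le0$. 3. The hermitian form $(F,G)\mapsto-\mathbb E[A_0[F]\overline G]$ on $\mathcal D_0$ is closable in $L^2_{\mathbb C}(\mathbb P)$. Its closure is the hermitian extension of a local Dirichlet form $\mathcal E$ on the real space $L^2(\mathbb P)$, with domain $\mathbb D$, which admits a carré du champ operator $\Gamma$, $\mathcal E[F]=\frac12\mathbb E\,\Gamma[F]$. The operator $(A,\mathcal D(A))$ on $L^2_{\mathbb C}(\mathbb P)$ associated with this closure, $\mathcal E(F,G)=-\mathbb E[A[F]\overline G]$, is self-adjoint and is the Friedrichs extension of $A_0$: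 an element $F\in\mathcal D_0$ lies in $\mathcal D(A)$ if and only if $A_0[F]\in L^2_{\mathbb C}(\mathbb P)$, and then $A[F]=A_0[F]$. This is the case whenever $F=\sum_p\lambda_pe^{i\tilde N(f_p)}$ with all $\gamma[f_p]\in L^2(\nu)$. 4. For every $f\in\mathbf d$, $\tilde N(f)\in\mathbb D$ and $\Gamma[\tilde N(f)]=N(\gamma[f])$. -/

import Mathlib

open MeasureTheory ProbabilityTheory Filter Topology
open scoped ENNReal NNReal ComplexConjugate

noncomputable section

namespace PoissonDirichlet

/-! ### Dirichlet forms -/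

/-- A (symmetric) Dirichlet form on the real space `L²(μ)`: a closed densely defined nonnegative
symmetric bilinear form on which every normal contraction operates. -/
structure DirichletForm {Y : Type*} [MeasurableSpace Y] (μ : Measure Y) where
  /-- The domain. -/
  dom : Submodule ℝ (Lp ℝ 2 μ)
  /-- The bilinear form. -/
  form : dom →ₗ[ℝ] dom →ₗ[ℝ] ℝ
  symm : ∀ u v, form u v = form v u
  nonneg : ∀ u, 0 ≤ form u u
  dense : Dense (dom : Set (Lp ℝ 2 μ))
  /-- The domain is complete for the norm `(‖u‖² + form u u)^(1/2)`. -/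
  closed : ∀ u : ℕ → dom,
    (∀ r : ℝ, 0 < r → ∃ n₀, ∀ m ≥ n₀, ∀ n ≥ n₀,
      ‖(u m - u n : dom)‖ ^ 2 + form (u m - u n) (u m - u n) < r) →
    ∃ v : dom, Tendsto (fun n => ‖(u n - v : dom)‖ ^ 2 + form (u n - v) (u n - v)) atTop (𝓝 0)
  contraction : ∀ T : ℝ → ℝ, LipschitzWith 1 T → T 0 = 0 → ∀ u : dom,
    ∃ v : dom, ((v : Lp ℝ 2 μ) =ᵐ[μ] fun y => T ((u : Lp ℝ 2 μ) y)) ∧ form v v ≤ form u u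

/-- A local Dirichlet structure with carré du champ operator `γ`. -/
structure LocalDirichletStructure {Y : Type*} [MeasurableSpace Y] (μ : Measure Y)
    extends DirichletForm μ where
  /-- Locality: `form (F(u) - F(0)) (G(u) - G(0)) = 0` whenever `F` and `G` are smooth with
  disjoint compact supports. (Both functions lie in the domain because contractions operate.) -/
  isLocal : ∀ F G : ℝ → ℝ, ContDiff ℝ (⊤ : ℕ∞) F → ContDiff ℝ (⊤ : ℕ∞) G →
    HasCompactSupport F → HasCompactSupport G → Disjoint (tsupport F) (tsupport G) →
    ∀ u v w : dom,
      ((v : Lp ℝ 2 μ) =ᵐ[μ] fun y => F ((u : Lp ℝ 2 μ) y) - F 0) →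
      ((w : Lp ℝ 2 μ) =ᵐ[μ] fun y => G ((u : Lp ℝ 2 μ) y) - G 0) →
      form v w = 0
  /-- The carré du champ. Its continuity into `L¹` follows from `gamma_nonneg` and `energy`. -/
  gamma : dom →ₗ[ℝ] dom →ₗ[ℝ] Lp ℝ 1 μ
  gamma_symm : ∀ u v, gamma u v = gamma v u
  gamma_nonneg : ∀ u, 0 ≤ᵐ[μ] (gamma u u : Y → ℝ)
  energy : ∀ u, form u u = 1 / 2 * ∫ y, gamma u u y ∂μ
  /-- `form (fh) g + form (gh) f - form h (fg) = ∫ h γ[f,g] dμ` for bounded `f`, `g`, `h` in the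
  domain. (Bounded elements of the domain form an algebra because contractions operate.) -/
  gamma_spec : ∀ f g h fh gh fg : dom,
    MemLp (f : Lp ℝ 2 μ) ∞ μ → MemLp (g : Lp ℝ 2 μ) ∞ μ → MemLp (h : Lp ℝ 2 μ) ∞ μ →
    ((fh : Lp ℝ 2 μ) =ᵐ[μ] fun y => (f : Lp ℝ 2 μ) y * (h : Lp ℝ 2 μ) y) →
    ((gh : Lp ℝ 2 μ) =ᵐ[μ] fun y => (g : Lp ℝ 2 μ) y * (h : Lp ℝ 2 μ) y) →
    ((fg : Lp ℝ 2 μ) =ᵐ[μ] fun y => (f : Lp ℝ 2 μ) y * (g : Lp ℝ 2 μ) y) →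
    form fh g + form gh f - form h fg = ∫ y, (h : Lp ℝ 2 μ) y * gamma f g y ∂μ

namespace DirichletForm

variable {Y : Type*} [MeasurableSpace Y] {μ : Measure Y} (E : DirichletForm μ)

/-- The domain is separable for the norm `(‖u‖² + form u u)^(1/2)`. -/
def IsSeparable : Prop :=
  ∃ s : Set E.dom, s.Countable ∧ ∀ u : E.dom, ∀ r : ℝ, 0 < r →
    ∃ v ∈ s, ‖(u - v : E.dom)‖ ^ 2 + E.form (u - v) (u - v) < r

/-- The graph of the generator: pairs `(u, w)` with `u` in the domain of the form and
`form u v = -⟨w, v⟩` for all `v` in this domain. -/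
def generatorGraph : Submodule ℝ (Lp ℝ 2 μ × Lp ℝ 2 μ) where
  carrier := {z | ∃ h : z.1 ∈ E.dom, ∀ v : E.dom, E.form ⟨z.1, h⟩ v = -inner ℝ z.2 (v : Lp ℝ 2 μ)}
  add_mem' := by
    rintro ⟨u, w⟩ ⟨u', w'⟩ ⟨h, H⟩ ⟨h', H'⟩
    refine ⟨E.dom.add_mem h h', fun v => ?_⟩
    have e : (⟨u + u', E.dom.add_mem h h'⟩ : E.dom) = ⟨u, h⟩ + ⟨u', h'⟩ := rfl
    have h1 := H v
    have h2 := H' v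
    simp only [Prod.fst_add, Prod.snd_add, inner_add_left] at *
    rw [e, map_add, LinearMap.add_apply, h1, h2]
    ring
  zero_mem' := by
    refine ⟨E.dom.zero_mem, fun v => ?_⟩
    have e : (⟨0, E.dom.zero_mem⟩ : E.dom) = 0 := rfl
    simp only [Prod.fst_zero, Prod.snd_zero, inner_zero_left]
    rw [e, map_zero, LinearMap.zero_apply, neg_zero]
  smul_mem' := by
    rintro c ⟨u, w⟩ ⟨h, H⟩
    refine ⟨E.dom.smul_mem c h, fun v => ?_⟩
    have e : (⟨c • u, E.dom.smul_mem c h⟩ : E.dom) = c • ⟨u, h⟩ := rfl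
    have h1 := H v
    simp only [Prod.smul_fst, Prod.smul_snd, inner_smul_left] at *
    rw [e, map_smul, LinearMap.smul_apply, h1]
    simp

/-- The generator `(a, 𝒟(a))` of the form in `L²(μ)`. -/
def generator : Lp ℝ 2 μ →ₗ.[ℝ] Lp ℝ 2 μ := E.generatorGraph.toLinearPMap

theorem graph_generator : E.generator.graph = E.generatorGraph := by
  refine Submodule.toLinearPMap_graph_eq _ ?_
  rintro ⟨u, w⟩ ⟨h, H⟩ (rfl : u = 0)
  have e : (⟨0, h⟩ : E.dom) = 0 := rfl
  refine E.dense.eq_zero_of_inner_left ℝ fun v hv => ?_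
  have h1 := H ⟨v, hv⟩
  simp only at h1
  rw [e, map_zero, LinearMap.zero_apply] at h1
  linarith

theorem generator_domain_le : E.generator.domain ≤ E.dom := by
  rintro u ⟨z, ⟨h, _⟩, rfl⟩
  exact h

/-- `𝒟(a) ∩ L¹(μ)`. -/
def testDomain : Submodule ℝ (Lp ℝ 2 μ) where
  carrier := {f | f ∈ E.generator.domain ∧ Integrable f μ}
  add_mem' := by
    rintro f g ⟨hf, hf'⟩ ⟨hg, hg'⟩
    exact ⟨add_mem hf hg, (hf'.add hg').congr (Lp.coeFn_add f g).symm⟩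
  zero_mem' := ⟨zero_mem _, (integrable_zero Y ℝ μ).congr (Lp.coeFn_zero ℝ 2 μ).symm⟩
  smul_mem' := by
    rintro c f ⟨hf, hf'⟩
    exact ⟨Submodule.smul_mem _ c hf, (hf'.smul c).congr (Lp.coeFn_smul c f).symm⟩

/-- `a[f]` for `f ∈ 𝒟(a) ∩ L¹(μ)`. -/
def gen (f : E.testDomain) : Lp ℝ 2 μ := E.generator ⟨f, f.2.1⟩

/-- An element of `𝒟(a) ∩ L¹(μ)`, seen in the domain of the form. -/
def toDom (f : E.testDomain) : E.dom := ⟨f, E.generator_domain_le f.2.1⟩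

/-! The hermitian extension of the form to complex functions. -/

/-- Real part of a complex `L²` function. -/
def rePart (F : Lp ℂ 2 μ) : Lp ℝ 2 μ := Complex.reCLM.compLp F

/-- Imaginary part of a complex `L²` function. -/
def imPart (F : Lp ℂ 2 μ) : Lp ℝ 2 μ := Complex.imCLM.compLp F

theorem rePart_smul (c : ℂ) (F : Lp ℂ 2 μ) :
    rePart (c • F) = c.re • rePart F - c.im • imPart F := by
  apply Lp.ext
  filter_upwards [Complex.reCLM.coeFn_compLp (c • F), Complex.reCLM.coeFn_compLp F,
    Complex.imCLM.coeFn_compLp F, Lp.coeFn_smul c F, Lp.coeFn_sub (c.re • rePart F)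
    (c.im • imPart F), Lp.coeFn_smul c.re (rePart F), Lp.coeFn_smul c.im (imPart F)]
    with y h1 h2 h3 h4 h5 h6 h7
  rw [h5, Pi.sub_apply, h6, h7, Pi.smul_apply, Pi.smul_apply]
  unfold rePart imPart
  rw [h1, h2, h3, h4]
  simp

theorem imPart_smul (c : ℂ) (F : Lp ℂ 2 μ) :
    imPart (c • F) = c.re • imPart F + c.im • rePart F := by
  apply Lp.ext
  filter_upwards [Complex.imCLM.coeFn_compLp (c • F), Complex.reCLM.coeFn_compLp F,
    Complex.imCLM.coeFn_compLp F, Lp.coeFn_smul c F, Lp.coeFn_add (c.re • imPart F)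
    (c.im • rePart F), Lp.coeFn_smul c.re (imPart F), Lp.coeFn_smul c.im (rePart F)]
    with y h1 h2 h3 h4 h5 h6 h7
  rw [h5, Pi.add_apply, h6, h7, Pi.smul_apply, Pi.smul_apply]
  unfold rePart imPart
  rw [h1, h2, h3, h4]
  simp

/-- Complex functions whose real and imaginary parts lie in the domain. -/
def cdom : Submodule ℂ (Lp ℂ 2 μ) where
  carrier := {F | rePart F ∈ E.dom ∧ imPart F ∈ E.dom}
  add_mem' := by
    rintro F G ⟨h1, h2⟩ ⟨h3, h4⟩
    refine ⟨?_, ?_⟩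
    · have : rePart (F + G) = rePart F + rePart G :=
        (Complex.reCLM.compLpₗ (p := 2) (μ := μ)).map_add F G
      rw [this]; exact add_mem h1 h3
    · have : imPart (F + G) = imPart F + imPart G :=
        (Complex.imCLM.compLpₗ (p := 2) (μ := μ)).map_add F G
      rw [this]; exact add_mem h2 h4
  zero_mem' := by
    refine ⟨?_, ?_⟩
    · have : rePart (0 : Lp ℂ 2 μ) = 0 := (Complex.reCLM.compLpₗ (p := 2) (μ := μ)).map_zero
      rw [this]; exact zero_mem _
    · have : imPart (0 : Lp ℂ 2 μ) = 0 := (Complex.imCLM.compLpₗ (p := 2) (μ := μ)).map_zero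
      rw [this]; exact zero_mem _
  smul_mem' := by
    rintro c F ⟨h1, h2⟩
    refine ⟨?_, ?_⟩
    · rw [rePart_smul]
      exact sub_mem (E.dom.smul_mem _ h1) (E.dom.smul_mem _ h2)
    · rw [imPart_smul]
      exact add_mem (E.dom.smul_mem _ h2) (E.dom.smul_mem _ h1)

/-- The hermitian extension of the form, linear in `F` and antilinear in `G`. -/
def cform (F G : E.cdom) : ℂ :=
  ((E.form ⟨_, F.2.1⟩ ⟨_, G.2.1⟩ + E.form ⟨_, F.2.2⟩ ⟨_, G.2.2⟩ : ℝ) : ℂ) +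
    Complex.I * ((E.form ⟨_, F.2.2⟩ ⟨_, G.2.1⟩ - E.form ⟨_, F.2.1⟩ ⟨_, G.2.2⟩ : ℝ) : ℂ)

/-- The (closed) hermitian extension of `E` is the closure of the hermitian form `q` defined on
`D`: it extends `q`, and `D` is dense in its domain for the norm `(‖F‖² + form F F)^(1/2)`. -/
def IsClosureOf (D : Submodule ℂ (Lp ℂ 2 μ)) (q : D → D → ℂ) : Prop :=
  ∃ hD : D ≤ E.cdom,
    (∀ F G : D, E.cform ⟨F, hD F.2⟩ ⟨G, hD G.2⟩ = q F G) ∧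
    ∀ F : E.cdom, ∀ r : ℝ, 0 < r → ∃ G : D,
      ‖(F : Lp ℂ 2 μ) - G‖ ^ 2 + (E.cform (F - ⟨G, hD G.2⟩) (F - ⟨G, hD G.2⟩)).re < r

/-- `A` is the operator associated with the hermitian extension of `E`: `F ∈ 𝒟(A)` and `A F = H`
if and only if `F` is in the domain of the form and `form F G = -∫ H conj(G) dμ` for all `G` in
this domain. -/
def IsComplexGenerator (A : Lp ℂ 2 μ →ₗ.[ℂ] Lp ℂ 2 μ) : Prop :=
  ∀ F H : Lp ℂ 2 μ, (F, H) ∈ A.graph ↔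
    ∃ hF : F ∈ E.cdom, ∀ G : E.cdom,
      E.cform ⟨F, hF⟩ G = -∫ y, H y * conj ((G : Lp ℂ 2 μ) y) ∂μ

end DirichletForm

/-! ### Poisson random measures -/

/-- The configuration space: countable sums of Dirac masses. It carries the σ-field generated by
the maps `ω ↦ ω(B)`, `B` measurable. -/
abbrev Configuration (X : Type*) [MeasurableSpace X] : Type _ :=
  {ω : Measure X // ∃ (ι : Type) (_ : Countable ι) (x : ι → X),
    ω = Measure.sum fun i => Measure.dirac (x i)}

/-- `P` is the law of a Poisson random measure with intensity `ν`. -/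
structure IsPoissonLaw {X : Type*} [MeasurableSpace X] (ν : Measure X)
    (P : Measure (Configuration X)) : Prop where
  law : ∀ B : Set X, MeasurableSet B → ν B ≠ ∞ →
    P.map (fun ω => ω.1 B) = (poissonMeasure (ν B).toNNReal).map (fun n : ℕ => (n : ℝ≥0∞))
  indep : ∀ (n : ℕ) (B : Fin n → Set X), (∀ i, MeasurableSet (B i)) →
    Pairwise (fun i j => Disjoint (B i) (B j)) →
    iIndepFun (fun (i : Fin n) (ω : Configuration X) => ω.1 (B i)) P

section Poisson

variable {X : Type*} [MeasurableSpace X] {ν : Measure X}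

/-- `N(h) = ∫ h dN`. -/
def N (h : X → ℝ) (ω : Configuration X) : ℝ := ∫ x, h x ∂ω.1

theorem dense_integrable (ν : Measure X) : Dense {f : Lp ℝ 2 ν | Integrable f ν} := by
  refine (Lp.simpleFunc.dense (E := ℝ) (p := 2) (μ := ν) (by simp)).mono ?_
  intro f hf
  have h1 := Lp.simpleFunc.memLp (⟨f, hf⟩ : Lp.simpleFunc ℝ 2 ν)
  have h2 := (SimpleFunc.memLp_iff_integrable (by simp) (by simp)).1 h1
  exact h2.congr (Lp.simpleFunc.toSimpleFunc_eq_toFun (⟨f, hf⟩ : Lp.simpleFunc ℝ 2 ν))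

open Classical in
/-- The class in `L²(P)` of a square integrable function (and `0` otherwise). -/
def toL2 (P : Measure (Configuration X)) (h : Configuration X → ℝ) : Lp ℝ 2 P :=
  if hh : MemLp h 2 P then hh.toLp h else 0

/-- The compensated integral `Ñ(f)`, `f ∈ L²(ν)`: the extension by continuity, from
`L¹(ν) ∩ L²(ν)` to `L²(ν)`, of the map `f ↦ N(f) - ∫ f dν` with values in `L²(P)`. -/
def Ntilde (P : Measure (Configuration X)) : Lp ℝ 2 ν → Lp ℝ 2 P :=
  (dense_integrable ν).extend fun f =>
    toL2 P fun ω => N (f : Lp ℝ 2 ν) ω - ∫ x, (f : Lp ℝ 2 ν) x ∂ν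

/-- The random variable `e^{iÑ(f)}`. -/
def expN (P : Measure (Configuration X)) (f : Lp ℝ 2 ν) (ω : Configuration X) : ℂ :=
  Complex.exp (Complex.I * (Ntilde P f ω : ℂ))

theorem memLp_expN (P : Measure (Configuration X)) [IsFiniteMeasure P] (f : Lp ℝ 2 ν) :
    MemLp (expN P f) 2 P := by
  refine MemLp.of_bound (C := 1) ?_ (Eventually.of_forall fun ω => ?_)
  · exact ((by fun_prop : Continuous fun t : ℝ =>
      Complex.exp (Complex.I * (t : ℂ))).comp_aestronglyMeasurable
        (Lp.aestronglyMeasurable (Ntilde P f)))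
  · rw [expN, mul_comm, Complex.norm_exp_ofReal_mul_I]

variable (S : LocalDirichletStructure ν) (P : Measure (Configuration X))

/-- The pre-domain `𝒟₀`: finite sums `∑ λ_p e^{iÑ(f_p)}`, `λ_p ∈ ℂ`, `f_p ∈ 𝒟(a) ∩ L¹(ν)`. -/
def preDomain [IsFiniteMeasure P] : Submodule ℂ (Lp ℂ 2 P) :=
  Submodule.span ℂ (Set.range fun f : S.testDomain =>
    (memLp_expN P (f : Lp ℝ 2 ν)).toLp (expN P (f : Lp ℝ 2 ν)))

variable {m : ℕ} (lam : Fin m → ℂ) (f : Fin m → S.testDomain)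

/-- `∑ λ_p e^{iÑ(f_p)} = Φ(Ñ(f_1), …, Ñ(f_m))`, with `Φ(x) = ∑ λ_p e^{i x_p}`. -/
def expSum (ω : Configuration X) : ℂ := ∑ p, lam p * expN P (f p : Lp ℝ 2 ν) ω

/-- `Φ'_p = iλ_p e^{iÑ(f_p)}`, the `p`-th partial derivative of `Φ` at `(Ñ(f_1), …, Ñ(f_m))`. -/
def expSumDeriv (p : Fin m) (ω : Configuration X) : ℂ :=
  Complex.I * lam p * expN P (f p : Lp ℝ 2 ν) ω

/-- `∑ λ_p e^{iÑ(f_p)} (iÑ(a[f_p]) - ½ N(γ[f_p]))`. -/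
def A0Sum (ω : Configuration X) : ℂ :=
  ∑ p, lam p * expN P (f p : Lp ℝ 2 ν) ω *
    (Complex.I * (Ntilde P (S.gen (f p)) ω : ℂ) -
      1 / 2 * (N (S.gamma (S.toDom (f p)) (S.toDom (f p))) ω : ℂ))

end Poisson

end PoissonDirichlet

end

open PoissonDirichlet

/-! The exponentials multiply by e^{iÑ(f)} e^{iÑ(g)} = e^{iÑ(f+g)}, so the Poisson space carries an
algebra of bounded exponential sums on which everything is explicit. Differentiating the
characteristic functional E e^{iN(h)} = exp ∫ (e^{ih} - 1) dν turns expectations of exponentials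
times N(k) or Ñ(w) into integrals over ν. On the base space, the chain rule applied to cos and sin
gives i ∫ (e^{ih} - 1) a[g] dν = ½ ∫ e^{ih} γ[g,h] dν (`integral_exp_gen`). With h = f + g, the
diagonal term ½ N(γ[g]) cancels against the correction in A₀, and the integration by parts formula
remains (`integral_eval_mul_genSum`).

The chain rule for γ is not assumed: locality only says that ε vanishes on two functions of the same
u with disjoint supports. Slicing the range of u into short ramps leaves only near-diagonal
interactions, and in the limit 3 ε(u²,u²) = 4 ε(u,u³) (`form_sq_sq_eq`). The polarization of this
quartic identity is the Leibniz rule for γ integrated against a bounded element of the domain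
(`gamma_mul`). Polynomial approximation and truncation extend it to functions with bounded
continuous derivative (`form_comp`). The test functions 𝒟(a) ∩ L¹ form a core because the resolvent
is Markovian and hence preserves L¹ (`exists_testDomain_energy_lt`).

What happens above the base space is isolated in `DiffusionAlgebra`: a dense algebra of bounded
functions, a positive derivation into L¹, and a generator that is symmetric in the sense of
integration by parts but only L¹-valued. For an L²-valued symmetric operator closability would be
immediate. Here the sequence Fₙ → 0 is replaced by sin Fₙ, which is bounded, and the weight cos Fₙ
produced by the chain rule is removed with a weighted Cauchy–Schwarz inequality
(`tendsto_energy_zero_of_ae`). The carré du champ extends to the closure by continuity, with its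
chain rule. That chain rule gives locality and the defining identity of the carré du champ; with
lower semicontinuity of closed forms it also gives the contraction property
(`localDirichletStructure`).

The exponentials of a dense set of functions separate L¹(P) (`IsPoissonLaw.ae_eq_zero`), because the
variables Ñ(1_B) recover the counts ω(B) and characteristic functions determine finite measures.
This yields density of 𝒟₀. Combined with the symmetry of A₀, it shows that A₀[F] does not depend on
the representation of F, and that the operator of the closure agrees with A₀ wherever both are
defined. That operator is self-adjoint since it is symmetric, nonpositive and 1 - A is onto, by the
real resolvent applied to real and imaginary parts.

Finally Ñ(f) is unbounded and not itself an exponential sum. For a test function f it is the limit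
of t⁻¹ sin(tÑ(f)) as t → 0, whose carré du champ is cos²(tÑ(f)) N(γ[f]) → N(γ[f])
(`exists_Ntilde_testDomain`). The core property then reaches every f in the domain of ε
(`exists_Ntilde`). -/

noncomputable section

namespace PoissonDirichlet

/-! ### Closed forms on a real Hilbert space -/

/-- A closed nonnegative symmetric bilinear form on a real inner product space. -/
structure ClosedForm (H : Type*) [NormedAddCommGroup H] [InnerProductSpace ℝ H] where
  /-- The domain. -/
  dom : Submodule ℝ H
  /-- The bilinear form. -/
  form : dom →ₗ[ℝ] dom →ₗ[ℝ] ℝ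
  symm : ∀ u v, form u v = form v u
  nonneg : ∀ u, 0 ≤ form u u
  /-- The domain is complete for the norm `(‖u‖² + form u u)^(1/2)`. -/
  closed : ∀ u : ℕ → dom,
    (∀ r : ℝ, 0 < r → ∃ n₀, ∀ m ≥ n₀, ∀ n ≥ n₀,
      ‖(u m - u n : dom)‖ ^ 2 + form (u m - u n) (u m - u n) < r) →
    ∃ v : dom, Tendsto (fun n => ‖(u n - v : dom)‖ ^ 2 + form (u n - v) (u n - v)) atTop (𝓝 0)

/-- A Dirichlet form is a closed form. -/
def DirichletForm.toClosedForm {Y : Type*} [MeasurableSpace Y] {μ : Measure Y}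
    (E : DirichletForm μ) : ClosedForm (Lp ℝ 2 μ) where
  dom := E.dom
  form := E.form
  symm := E.symm
  nonneg := E.nonneg
  closed := E.closed

/-- Cauchy–Schwarz for a nonnegative symmetric bilinear form. -/
theorem sq_le_mul_of_nonneg {V : Type*} [AddCommGroup V] [Module ℝ V] (b : V →ₗ[ℝ] V →ₗ[ℝ] ℝ)
    (hs : ∀ u v, b u v = b v u) (hn : ∀ u, 0 ≤ b u u) (u v : V) :
    b u v ^ 2 ≤ b u u * b v v := by
  have h : ∀ t : ℝ, 0 ≤ b v v * (t * t) + (2 * b u v) * t + b u u := fun t => by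
    have := hn (u + t • v)
    simp only [map_add, map_smul, LinearMap.add_apply, LinearMap.smul_apply, smul_eq_mul,
      hs v u] at this
    nlinarith
  have := discrim_le_zero h
  unfold discrim at this
  nlinarith

namespace ClosedForm

variable {H : Type*} [NormedAddCommGroup H] [InnerProductSpace ℝ H] (E : ClosedForm H)

/-- The domain, with its Hilbert space structure. -/
def Space : Type _ := E.dom

instance : AddCommGroup E.Space := inferInstanceAs (AddCommGroup E.dom)
instance : Module ℝ E.Space := inferInstanceAs (Module ℝ E.dom)

/-- An element of the domain, seen in the Hilbert space. -/
def toSpace : E.dom ≃ₗ[ℝ] E.Space := LinearEquiv.refl ℝ E.dom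

/-- The inner product `⟨u, v⟩ + form u v`. -/
@[reducible]
def innerCore : InnerProductSpace.Core ℝ E.Space where
  inner u v := inner ℝ (E.toSpace.symm u : H) (E.toSpace.symm v : H) +
    E.form (E.toSpace.symm u) (E.toSpace.symm v)
  conj_inner_symm u v := by
    simp [real_inner_comm, E.symm]
  re_inner_nonneg u := by
    have := E.nonneg (E.toSpace.symm u)
    have := real_inner_self_nonneg (x := (E.toSpace.symm u : H))
    simp only [RCLike.re_to_real]
    positivity
  add_left u v w := by
    simp [inner_add_left]; ring
  smul_left u v r := by
    simp [inner_smul_left]; ring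
  definite u h := by
    have h1 := E.nonneg (E.toSpace.symm u)
    have h2 := real_inner_self_nonneg (x := (E.toSpace.symm u : H))
    have h3 : inner ℝ (E.toSpace.symm u : H) (E.toSpace.symm u : H) = 0 := by linarith
    have h4 := inner_self_eq_zero.1 h3
    have h5 : E.toSpace.symm u = 0 := Subtype.ext h4
    simpa using h5

instance : NormedAddCommGroup E.Space := E.innerCore.toNormedAddCommGroup
instance : InnerProductSpace ℝ E.Space := InnerProductSpace.ofCore E.innerCore.toCore

theorem inner_toSpace (u v : E.dom) :
    inner ℝ (E.toSpace u) (E.toSpace v) = inner ℝ (u : H) (v : H) + E.form u v := rfl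

theorem norm_toSpace_sq (u : E.dom) : ‖E.toSpace u‖ ^ 2 = ‖(u : H)‖ ^ 2 + E.form u u := by
  rw [← real_inner_self_eq_norm_sq, inner_toSpace, real_inner_self_eq_norm_sq]

theorem norm_le_norm_toSpace (u : E.dom) : ‖(u : H)‖ ≤ ‖E.toSpace u‖ := by
  have := E.norm_toSpace_sq u
  have := E.nonneg u
  exact le_of_sq_le_sq (by linarith) (norm_nonneg _)

theorem abs_form_le (u v : E.dom) : |E.form u v| ≤ √(E.form u u) * √(E.form v v) := by
  rw [← Real.sqrt_mul (E.nonneg u)]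
  exact Real.abs_le_sqrt (sq_le_mul_of_nonneg E.form E.symm E.nonneg u v)

theorem form_sub_le (u v : E.dom) : E.form (u - v) (u - v) ≤ 2 * E.form u u + 2 * E.form v v := by
  have := E.nonneg (u + v)
  simp only [map_add, map_sub, LinearMap.add_apply, LinearMap.sub_apply] at *
  linarith

instance : CompleteSpace E.Space := by
  refine Metric.complete_of_cauchySeq_tendsto fun u hu => ?_
  have h1 := Metric.cauchySeq_iff.1 hu
  obtain ⟨v, hv⟩ := E.closed (fun n => E.toSpace.symm (u n)) fun r hr => by
    obtain ⟨n₀, h⟩ := h1 (√r) (Real.sqrt_pos.2 hr)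
    refine ⟨n₀, fun m hm n hn => ?_⟩
    have h2 := h m hm n hn
    rw [dist_eq_norm] at h2
    have h3 := E.norm_toSpace_sq (E.toSpace.symm (u m) - E.toSpace.symm (u n))
    rw [map_sub, LinearEquiv.apply_symm_apply, LinearEquiv.apply_symm_apply] at h3
    change ‖((E.toSpace.symm (u m) - E.toSpace.symm (u n) : E.dom) : H)‖ ^ 2 + _ < r
    rw [← h3]
    exact (Real.lt_sqrt (norm_nonneg _)).1 h2
  refine ⟨E.toSpace v, ?_⟩
  rw [tendsto_iff_norm_sub_tendsto_zero]
  have h2 : Tendsto (fun n => √(‖u n - E.toSpace v‖ ^ 2)) atTop (𝓝 (√0)) := by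
    refine (Real.continuous_sqrt.tendsto 0).comp (hv.congr fun n => ?_)
    have h3 := E.norm_toSpace_sq (E.toSpace.symm (u n) - v)
    rw [map_sub, LinearEquiv.apply_symm_apply] at h3
    exact h3.symm
  simpa using h2

/-- The embedding of the domain. -/
def embed : E.Space →L[ℝ] H :=
  LinearMap.mkContinuous (E.dom.subtype ∘ₗ E.toSpace.symm.toLinearMap) 1 fun u => by
    simpa using E.norm_le_norm_toSpace (E.toSpace.symm u)

@[simp] theorem embed_toSpace (u : E.dom) : E.embed (E.toSpace u) = u := rfl

variable [CompleteSpace H]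

/-- The resolvent: `form (G w) v + ⟨G w, v⟩ = ⟨w, v⟩`. -/
def resolvent : H →L[ℝ] E.Space := E.embed.adjoint

theorem inner_resolvent (w : H) (v : E.Space) :
    inner ℝ (E.resolvent w) v = inner ℝ w (E.embed v) :=
  ContinuousLinearMap.adjoint_inner_left _ _ _

/-- The resolvent, with values in the domain. -/
def res (w : H) : E.dom := E.toSpace.symm (E.resolvent w)

theorem form_res (w : H) (v : E.dom) :
    E.form (E.res w) v = inner ℝ w (v : H) - inner ℝ (E.res w : H) (v : H) := by
  have h := E.inner_resolvent w (E.toSpace v)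
  have h' : E.resolvent w = E.toSpace (E.res w) := rfl
  rw [h', inner_toSpace, embed_toSpace] at h
  linarith

/-- A submodule of the domain containing the image under the resolvent of a dense set is dense
for the energy norm. -/
theorem exists_energy_lt_of_res_mem {W : Set H} (hW : Dense W) (K : Submodule ℝ E.dom)
    (hK : ∀ w ∈ W, E.res w ∈ K) (u : E.dom) {r : ℝ} (hr : 0 < r) :
    ∃ v ∈ K, ‖((u - v : E.dom) : H)‖ ^ 2 + E.form (u - v) (u - v) < r := by
  let K' : Submodule ℝ E.Space := K.map E.toSpace.toLinearMap
  have h : K'.topologicalClosure = ⊤ := by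
    rw [Submodule.topologicalClosure_eq_top_iff, Submodule.eq_bot_iff]
    intro v hv
    -- The energy inner product with `res w` is the `H` inner product with `w`. A vector orthogonal
    -- to all these resolvents is therefore orthogonal in `H` to a dense set.
    have h1 : ∀ w ∈ W, inner ℝ w (E.embed v) = 0 := fun w hw => by
      rw [← E.inner_resolvent]
      exact (Submodule.mem_orthogonal _ _).1 hv _ (Submodule.mem_map_of_mem (hK w hw))
    have h2 : E.embed v = 0 := by
      have hc : Continuous fun w => (inner ℝ w (E.embed v) : ℝ) := by fun_prop
      have := hc.ext_on hW continuous_const (g := fun _ => (0 : ℝ)) h1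
      exact inner_self_eq_zero.1 (congrFun this (E.embed v))
    have h3 : E.toSpace.symm v = 0 := Subtype.ext h2
    simpa using h3
  have hu : E.toSpace u ∈ K'.topologicalClosure := by rw [h]; trivial
  obtain ⟨x, ⟨v, hv, rfl⟩, hx⟩ := Metric.mem_closure_iff.1 hu (√r) (Real.sqrt_pos.2 hr)
  refine ⟨v, hv, ?_⟩
  rw [← norm_toSpace_sq, map_sub]
  rw [dist_eq_norm] at hx
  exact (Real.lt_sqrt (norm_nonneg _)).1 hx

/-- A sequence of the domain that converges in `H` and has bounded energy converges weakly. -/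
theorem tendsto_form {u : ℕ → E.dom} {v : E.dom}
    (hu : Tendsto (fun n => (u n : H)) atTop (𝓝 (v : H))) {C : ℝ}
    (hC : ∀ n, E.form (u n) (u n) ≤ C) (w : E.dom) :
    Tendsto (fun n => E.form (u n) w) atTop (𝓝 (E.form v w)) := by
  rw [Metric.tendsto_atTop]
  intro ε hε
  have hC0 : 0 ≤ C := (E.nonneg _).trans (hC 0)
  -- `D` dominates the energy of every `u n - v` by `form_sub_le`; the `+ 1` only makes it positive.
  set D := 2 * C + 2 * E.form v v + 1 with hD
  have hD0 : 0 < D := by have := E.nonneg v; positivity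
  have hs : 0 < (ε / 2) ^ 2 / D := by positivity
  obtain ⟨g, ⟨x, rfl⟩, hg⟩ := E.exists_energy_lt_of_res_mem (W := Set.univ) dense_univ
    (LinearMap.range (E.toSpace.symm.toLinearMap ∘ₗ E.resolvent.toLinearMap))
    (fun w _ => ⟨w, rfl⟩) w hs
  have hg' : E.form (w - E.res x) (w - E.res x) < (ε / 2) ^ 2 / D := by
    have := sq_nonneg ‖((w - E.res x : E.dom) : H)‖
    exact lt_of_le_of_lt (le_add_of_nonneg_left this) hg
  have h1 : Tendsto (fun n => inner ℝ (x - (E.res x : H)) (u n : H)) atTop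
      (𝓝 (inner ℝ (x - (E.res x : H)) (v : H))) := tendsto_const_nhds.inner hu
  obtain ⟨n₀, hn₀⟩ := Metric.tendsto_atTop.1 h1 (ε / 2) (by positivity)
  refine ⟨n₀, fun n hn => ?_⟩
  have h2 := hn₀ n hn
  rw [Real.dist_eq] at *
  -- Against a resolvent the form is an inner product of `H`, so there the strong convergence in `H`
  -- suffices. A general `w` is within small energy of a resolvent.
  have h3 : ∀ z : E.dom, inner ℝ (x - (E.res x : H)) (z : H) = E.form z (E.res x) := fun z => by
    rw [E.symm z, E.form_res, inner_sub_left]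
  rw [h3, h3] at h2
  have h4 : E.form (u n) w - E.form v w = E.form (u n - v) (w - E.res x) +
      (E.form (u n) (E.res x) - E.form v (E.res x)) := by
    simp only [map_sub, LinearMap.sub_apply]; ring
  have h5 : |E.form (u n - v) (w - E.res x)| < ε / 2 := by
    refine abs_lt_of_sq_lt_sq ?_ (by positivity)
    calc E.form (u n - v) (w - E.res x) ^ 2
        ≤ E.form (u n - v) (u n - v) * E.form (w - E.res x) (w - E.res x) :=
          sq_le_mul_of_nonneg E.form E.symm E.nonneg _ _
      _ ≤ D * E.form (w - E.res x) (w - E.res x) := by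
          gcongr
          · exact E.nonneg _
          · have := E.form_sub_le (u n) v
            have := hC n
            linarith
      _ < D * ((ε / 2) ^ 2 / D) := by gcongr
      _ = (ε / 2) ^ 2 := by field_simp
  rw [h4]
  exact (abs_add_le _ _).trans_lt (by linarith)

/-- A sequence of the domain that converges in `H` to `v`, with energies at most that of `v`,
converges for the energy norm. -/
theorem tendsto_form_sub {u : ℕ → E.dom} {v : E.dom}
    (hu : Tendsto (fun n => (u n : H)) atTop (𝓝 (v : H)))
    (hC : ∀ n, E.form (u n) (u n) ≤ E.form v v) :
    Tendsto (fun n => E.form (u n - v) (u n - v)) atTop (𝓝 0) := by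
  have h1 := (E.tendsto_form hu hC v).const_mul 2
  -- Expanding the energy of `u n - v` and bounding that of `u n` by that of `v` leaves exactly this
  -- expression, which vanishes by weak convergence.
  have h2 : Tendsto (fun n => 2 * E.form v v - 2 * E.form (u n) v) atTop (𝓝 0) := by
    have := (tendsto_const_nhds (x := 2 * E.form v v)).sub h1
    simpa using this
  refine squeeze_zero (fun n => E.nonneg _) (fun n => ?_) h2
  simp only [map_sub, LinearMap.sub_apply, E.symm v (u n)]
  linarith [hC n]

/-- Lower semicontinuity of a closed form. -/
theorem mem_dom_of_tendsto {u : ℕ → E.dom} {v : H}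
    (hu : Tendsto (fun n => (u n : H)) atTop (𝓝 v)) {C : ℝ}
    (hC : ∀ n, E.form (u n) (u n) ≤ C) : ∃ h : v ∈ E.dom, E.form ⟨v, h⟩ ⟨v, h⟩ ≤ C := by
  -- Banach–Alaoglu along an ultrafilter gives a weak limit point in the energy space, in a ball of
  -- radius √D. Testing against resolvents identifies it with `v`.
  have key : ∀ D : ℝ, (∀ᶠ n in atTop, ‖E.toSpace (u n)‖ ^ 2 ≤ D) →
      ∃ x : E.dom, (x : H) = v ∧ ‖E.toSpace x‖ ^ 2 ≤ D := by
    intro D hD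
    have hD0 : 0 ≤ D := by
      obtain ⟨n, hn⟩ := hD.exists
      exact (sq_nonneg _).trans hn
    let U := Ultrafilter.of (atTop : Filter ℕ)
    have hU : (U : Filter ℕ) ≤ atTop := Ultrafilter.of_le _
    let φ : ℕ → WeakDual ℝ E.Space := fun n =>
      StrongDual.toWeakDual (InnerProductSpace.toDual ℝ E.Space (E.toSpace (u n)))
    have hφ : (U.map φ : Filter (WeakDual ℝ E.Space)) ≤
        𝓟 (WeakDual.toStrongDual ⁻¹' Metric.closedBall 0 (√D)) := by
      rw [le_principal_iff]
      refine mem_map.2 (hU ?_)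
      filter_upwards [hD] with n hn
      have : ‖InnerProductSpace.toDual ℝ E.Space (E.toSpace (u n))‖ ≤ √D := by
        rw [LinearIsometryEquiv.norm_map]
        exact Real.le_sqrt_of_sq_le hn
      exact mem_closedBall_zero_iff.2 this
    obtain ⟨y, hy, hyU⟩ := (WeakDual.isCompact_closedBall (𝕜 := ℝ) (E := E.Space) 0
      (√D)).ultrafilter_le_nhds (U.map φ) hφ
    let x := (InnerProductSpace.toDual ℝ E.Space).symm (WeakDual.toStrongDual y)
    have hxn : ‖x‖ ≤ √D := by
      rw [LinearIsometryEquiv.norm_map]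
      simpa using hy
    have hlim : ∀ z : E.Space, Tendsto (fun n => (inner ℝ (E.toSpace (u n)) z : ℝ)) U
        (𝓝 (inner ℝ x z)) := fun z => by
      have h1 := ((WeakDual.eval_continuous (𝕜 := ℝ) z).tendsto y).comp (f := φ) hyU
      have h2 : (inner ℝ x z : ℝ) = y z := by
        rw [InnerProductSpace.toDual_symm_apply]; rfl
      rw [h2]
      exact h1
    refine ⟨E.toSpace.symm x, ?_, ?_⟩
    · refine ext_inner_left ℝ fun w => ?_
      have h1 := hlim (E.resolvent w)
      have h2 : Tendsto (fun n => (inner ℝ (E.toSpace (u n)) (E.resolvent w) : ℝ)) U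
          (𝓝 (inner ℝ w v)) := by
        have := (tendsto_const_nhds (x := w) (f := (U : Filter ℕ))).inner (𝕜 := ℝ) (hu.mono_left hU)
        refine this.congr fun n => ?_
        rw [real_inner_comm (E.resolvent w), E.inner_resolvent, embed_toSpace]
      have h3 := tendsto_nhds_unique h1 h2
      rw [real_inner_comm, E.inner_resolvent] at h3
      exact h3
    · rw [LinearEquiv.apply_symm_apply]
      calc ‖x‖ ^ 2 ≤ √D ^ 2 := by gcongr
        _ = D := Real.sq_sqrt hD0
  -- The slack `δ` is needed because `‖u n‖` only converges to `‖v‖`. The value `δ = 1` gives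
  -- membership, and then letting `δ` tend to `0` gives the bound `C`.
  have hbound : ∀ δ > 0, ∀ᶠ n in atTop, ‖E.toSpace (u n)‖ ^ 2 ≤ ‖v‖ ^ 2 + δ + C := by
    intro δ hδ
    have h1 : Tendsto (fun n => ‖(u n : H)‖ ^ 2) atTop (𝓝 (‖v‖ ^ 2)) := (hu.norm).pow 2
    filter_upwards [h1.eventually_lt_const (show ‖v‖ ^ 2 < ‖v‖ ^ 2 + δ by linarith)] with n hn
    rw [norm_toSpace_sq]
    linarith [hC n]
  obtain ⟨x, rfl, -⟩ := key _ (hbound 1 one_pos)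
  refine ⟨x.2, le_of_forall_pos_le_add fun δ hδ => ?_⟩
  obtain ⟨y, hy, hy'⟩ := key _ (hbound δ hδ)
  obtain rfl : y = x := Subtype.ext hy
  rw [norm_toSpace_sq] at hy'
  change E.form y y ≤ _
  linarith

end ClosedForm

end PoissonDirichlet
end

noncomputable section

namespace PoissonDirichlet

/-! ### The resolvent of a Dirichlet form -/

namespace DirichletForm

variable {Y : Type*} [MeasurableSpace Y] {μ : Measure Y} (E : DirichletForm μ)

/-- The resolvent `(1 - a)⁻¹`. -/
def res (w : Lp ℝ 2 μ) : E.dom := E.toClosedForm.res w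

theorem form_res (w : Lp ℝ 2 μ) (v : E.dom) :
    E.form (E.res w) v =
      inner ℝ w (v : Lp ℝ 2 μ) - inner ℝ (E.res w : Lp ℝ 2 μ) (v : Lp ℝ 2 μ) :=
  E.toClosedForm.form_res w v

theorem res_mem_generator_domain (w : Lp ℝ 2 μ) : (E.res w : Lp ℝ 2 μ) ∈ E.generator.domain := by
  have h : ((E.res w : Lp ℝ 2 μ), (E.res w : Lp ℝ 2 μ) - w) ∈ E.generator.graph := by
    rw [graph_generator]
    refine ⟨(E.res w).2, fun v => ?_⟩
    rw [inner_sub_left, neg_sub]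
    exact E.form_res w v
  exact LinearPMap.mem_domain_of_mem_graph h

theorem form_toDom (f : E.testDomain) (v : E.dom) :
    E.form (E.toDom f) v = -inner ℝ (E.gen f) (v : Lp ℝ 2 μ) := by
  have h : ((f : Lp ℝ 2 μ), E.gen f) ∈ E.generator.graph :=
    LinearPMap.mem_graph E.generator ⟨f, f.2.1⟩
  rw [graph_generator] at h
  obtain ⟨_, H⟩ := h
  exact H v

theorem inner_res_comm (w z : Lp ℝ 2 μ) :
    inner ℝ (E.res w : Lp ℝ 2 μ) z = inner ℝ w (E.res z : Lp ℝ 2 μ) := by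
  have h1 := E.form_res w (E.res z)
  have h2 := E.form_res z (E.res w)
  rw [E.symm, h2] at h1
  rw [real_inner_comm (E.res w : Lp ℝ 2 μ) (E.res z : Lp ℝ 2 μ)] at h1
  rw [real_inner_comm]
  linarith

/-- `res w` is the only minimizer of `form v v + ‖v - w‖²`. -/
theorem eq_res_of_le (w : Lp ℝ 2 μ) (v : E.dom) (h1 : E.form v v ≤ E.form (E.res w) (E.res w))
    (h2 : ‖(v : Lp ℝ 2 μ) - w‖ ≤ ‖(E.res w : Lp ℝ 2 μ) - w‖) :
    (v : Lp ℝ 2 μ) = E.res w := by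
  set u := E.res w with hu
  -- Tested on `v - u`, the weak equation cancels the linear terms of the two hypotheses; what is
  -- left is ‖v - u‖² + form (v - u) (v - u) ≤ 0.
  have h3 := E.form_res w (v - u)
  rw [← hu] at h3
  have h4 : ‖(v : Lp ℝ 2 μ) - w‖ ^ 2 = ‖(v : Lp ℝ 2 μ) - u‖ ^ 2 +
      2 * inner ℝ ((v : Lp ℝ 2 μ) - u) ((u : Lp ℝ 2 μ) - w) + ‖(u : Lp ℝ 2 μ) - w‖ ^ 2 := by
    rw [← norm_add_sq_real]; congr 2; abel
  have h5 : ‖(v : Lp ℝ 2 μ) - w‖ ^ 2 ≤ ‖(u : Lp ℝ 2 μ) - w‖ ^ 2 := by gcongr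
  have h6 : E.form v v = E.form u u + 2 * E.form u (v - u) + E.form (v - u) (v - u) := by
    simp only [map_sub, LinearMap.sub_apply, E.symm v u]; ring
  have h7 := E.nonneg (v - u)
  have h8 : inner ℝ ((v : Lp ℝ 2 μ) - u) ((u : Lp ℝ 2 μ) - w) = - E.form u (v - u) := by
    rw [h3, real_inner_comm, inner_sub_left, Submodule.coe_sub]; ring
  rw [h8] at h4
  have h9 : ‖(v : Lp ℝ 2 μ) - u‖ ^ 2 = 0 := le_antisymm (by linarith) (sq_nonneg _)
  exact sub_eq_zero.1 (norm_eq_zero.1 (pow_eq_zero_iff two_ne_zero |>.1 h9))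

/-- A contraction that does not increase the distance to `w` fixes `res w`. -/
theorem contraction_res_eq (w : Lp ℝ 2 μ) (T : ℝ → ℝ) (hT : LipschitzWith 1 T) (hT0 : T 0 = 0)
    (h : ∀ᵐ y ∂μ, ∀ t : ℝ, |T t - w y| ≤ |t - w y|) :
    ∀ᵐ y ∂μ, T ((E.res w : Lp ℝ 2 μ) y) = (E.res w : Lp ℝ 2 μ) y := by
  obtain ⟨v, hv, hv'⟩ := E.contraction T hT hT0 (E.res w)
  have := E.eq_res_of_le w v hv' ?_
  · rw [this] at hv
    filter_upwards [hv] with y hy using hy.symm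
  · refine Lp.norm_le_norm_of_ae_le ?_
    filter_upwards [hv, h, Lp.coeFn_sub (v : Lp ℝ 2 μ) w,
      Lp.coeFn_sub (E.res w : Lp ℝ 2 μ) w] with y h1 h2 h3 h4
    rw [h3, h4, Pi.sub_apply, Pi.sub_apply, h1]
    exact h2 _

/-- Replacing t by its positive part never increases the distance to a nonnegative number, so the
minimizer is unchanged by it. The upper bound below uses `min t 1` in the same way. -/
theorem res_nonneg (w : Lp ℝ 2 μ) (hw : 0 ≤ᵐ[μ] w) : 0 ≤ᵐ[μ] (E.res w : Lp ℝ 2 μ) := by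
  have := E.contraction_res_eq w (fun t => max t 0) (LipschitzWith.id.max_const 0) (by simp) ?_
  · filter_upwards [this] with y hy
    rw [← hy]; exact le_max_right _ _
  · filter_upwards [hw] with y hy t
    have hy' : 0 ≤ w y := hy
    rcases le_total t 0 with h | h
    · rw [max_eq_right h, abs_le]
      have := neg_abs_le (t - w y)
      constructor <;> linarith [abs_nonneg (t - w y)]
    · rw [max_eq_left h]

theorem res_le_one (w : Lp ℝ 2 μ) (hw : ∀ᵐ y ∂μ, w y ≤ 1) :
    ∀ᵐ y ∂μ, (E.res w : Lp ℝ 2 μ) y ≤ 1 := by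
  have := E.contraction_res_eq w (fun t => min t 1) (LipschitzWith.id.min_const 1) (by simp) ?_
  · filter_upwards [this] with y hy
    rw [← hy]; exact min_le_right _ _
  · filter_upwards [hw] with y hy t
    rcases le_total t 1 with h | h
    · rw [min_eq_left h]
    · rw [min_eq_right h, abs_le]
      have := le_abs_self (t - w y)
      constructor <;> linarith [abs_nonneg (t - w y)]

/-- Duality: by symmetry of the resolvent, ∫_B res w = ⟨w, res 1_B⟩ ≤ ∫ w, because res 1_B ≤ 1. The
bound is uniform over sets `B` of finite measure, and σ-finiteness exhausts the space with such
sets. -/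
theorem integrable_res_of_nonneg [SigmaFinite μ] (w : Lp ℝ 2 μ) (hw : 0 ≤ᵐ[μ] w)
    (hw1 : Integrable w μ) : Integrable (E.res w : Lp ℝ 2 μ) μ := by
  have h0 := E.res_nonneg w hw
  refine integrable_of_forall_fin_meas_le (ENNReal.ofReal (∫ y, w y ∂μ)) ENNReal.ofReal_lt_top
    (Lp.aestronglyMeasurable _) fun B hB hB' => ?_
  have hi : IntegrableOn (E.res w : Lp ℝ 2 μ) B μ :=
    integrableOn_Lp_of_measure_ne_top _ (by norm_num) hB'
  have e1 : ∫⁻ y in B, ‖(E.res w : Lp ℝ 2 μ) y‖ₑ ∂μ =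
      ENNReal.ofReal (∫ y in B, (E.res w : Lp ℝ 2 μ) y ∂μ) := by
    rw [ofReal_integral_eq_lintegral_ofReal hi (ae_restrict_of_ae h0)]
    refine lintegral_congr_ae (ae_restrict_of_ae ?_)
    filter_upwards [h0] with y hy
    exact Real.enorm_of_nonneg hy
  rw [e1]
  refine ENNReal.ofReal_le_ofReal ?_
  let b : Lp ℝ 2 μ := indicatorConstLp 2 hB hB' (1 : ℝ)
  have hb : b =ᵐ[μ] B.indicator fun _ => 1 := indicatorConstLp_coeFn
  have e2 : ∫ y in B, (E.res w : Lp ℝ 2 μ) y ∂μ = inner ℝ b (E.res w : Lp ℝ 2 μ) := by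
    rw [L2.inner_indicatorConstLp_one hB hB']
  have e3 : ∀ᵐ y ∂μ, (E.res b : Lp ℝ 2 μ) y ≤ 1 := by
    refine E.res_le_one b ?_
    filter_upwards [hb] with y hy
    rw [hy]
    exact Set.indicator_le_self' (fun _ _ => zero_le_one) _
  rw [e2, ← E.inner_res_comm, real_inner_comm, L2.inner_def]
  refine integral_mono_ae (L2.integrable_inner _ _) hw1 ?_
  filter_upwards [e3, hw] with y hy hy'
  simp only [RCLike.inner_apply, conj_trivial]
  exact mul_le_of_le_one_left hy' hy

theorem integrable_res [SigmaFinite μ] (w : Lp ℝ 2 μ) (hw1 : Integrable w μ) :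
    Integrable (E.res w : Lp ℝ 2 μ) μ := by
  have e : w = Lp.posPart w - Lp.negPart w := by
    apply Lp.ext
    filter_upwards [Lp.coeFn_sub (Lp.posPart w) (Lp.negPart w), Lp.coeFn_posPart w,
      Lp.coeFn_negPart w] with y h1 h2 h3
    rw [h1, Pi.sub_apply, h2, h3]
    rcases le_total (w y) 0 with h | h
    · simp [h]
    · simp [h]
  have hp : Integrable (Lp.posPart w) μ := by
    refine hw1.pos_part.congr ?_
    filter_upwards [Lp.coeFn_posPart w] with y h using h.symm
  have hn : Integrable (Lp.negPart w) μ := by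
    refine hw1.neg_part.congr ?_
    filter_upwards [Lp.coeFn_negPart w] with y h
    rw [h, ← max_neg_neg]; simp
  have e' : (E.res w : Lp ℝ 2 μ) = E.res (Lp.posPart w) - E.res (Lp.negPart w) := by
    conv_lhs => rw [e]
    simp only [res, ClosedForm.res, map_sub, Submodule.coe_sub]
  rw [e']
  refine ((E.integrable_res_of_nonneg _ ?_ hp).sub
    (E.integrable_res_of_nonneg _ ?_ hn)).congr (Lp.coeFn_sub _ _).symm
  · filter_upwards [Lp.coeFn_posPart w] with y h
    rw [h]; exact le_max_right _ _
  · filter_upwards [Lp.coeFn_negPart w] with y h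
    rw [h]; simp

/-- `𝒟(a) ∩ L¹` is dense in the domain for the energy norm. -/
theorem exists_testDomain_energy_lt [SigmaFinite μ] (u : E.dom) {r : ℝ} (hr : 0 < r) :
    ∃ f : E.testDomain, ‖((u - E.toDom f : E.dom) : Lp ℝ 2 μ)‖ ^ 2 +
      E.form (u - E.toDom f) (u - E.toDom f) < r := by
  obtain ⟨v, hv, h⟩ := E.toClosedForm.exists_energy_lt_of_res_mem (dense_integrable μ)
    (E.testDomain.comap E.dom.subtype)
    (fun w hw => ⟨E.res_mem_generator_domain w, E.integrable_res w hw⟩) u hr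
  exact ⟨⟨v, hv⟩, h⟩

/-- The energy norm dominates the L² norm, so the core is dense in the form domain, which is dense
in L². -/
theorem dense_testDomain [SigmaFinite μ] : Dense (E.testDomain : Set (Lp ℝ 2 μ)) := by
  rw [Metric.dense_iff]
  intro u r hr
  obtain ⟨v, hv, hv'⟩ := Metric.dense_iff.1 E.dense u (r / 2) (half_pos hr)
  obtain ⟨f, hf⟩ := E.exists_testDomain_energy_lt ⟨v, hv'⟩ (r := (r / 2) ^ 2) (by positivity)
  refine ⟨f, ?_, f.2⟩
  have h1 := E.nonneg (⟨v, hv'⟩ - E.toDom f)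
  have h2 : ‖v - (f : Lp ℝ 2 μ)‖ ^ 2 < (r / 2) ^ 2 := lt_of_le_of_lt (le_add_of_nonneg_right h1) hf
  have h3 := lt_of_pow_lt_pow_left₀ 2 (by positivity) h2
  rw [Metric.mem_ball] at *
  calc dist (f : Lp ℝ 2 μ) u ≤ dist (f : Lp ℝ 2 μ) v + dist v u := dist_triangle _ _ _
    _ < r / 2 + r / 2 := by
      rw [dist_comm, dist_eq_norm v]; linarith
    _ = r := by ring

end DirichletForm

end PoissonDirichlet
end

noncomputable section

namespace PoissonDirichlet

/-! ### Positive symmetric bilinear maps with values in `L¹` -/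

section Gamma

variable {Y V : Type*} [MeasurableSpace Y] {μ : Measure Y} [AddCommGroup V] [Module ℝ V]
  (γ : V →ₗ[ℝ] V →ₗ[ℝ] Lp ℝ 1 μ)

theorem integrable_coeFn_L1 {F : Type*} [NormedAddCommGroup F] (g : Lp F 1 μ) :
    Integrable g μ := L1.integrable_coeFn g

theorem integral_L1_add (f g : Lp ℝ 1 μ) :
    ∫ y, (f + g : Lp ℝ 1 μ) y ∂μ = ∫ y, f y ∂μ + ∫ y, g y ∂μ := by
  rw [integral_congr_ae (Lp.coeFn_add f g)]
  exact integral_add (integrable_coeFn_L1 f) (integrable_coeFn_L1 g)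

theorem integral_L1_smul (c : ℝ) (f : Lp ℝ 1 μ) :
    ∫ y, (c • f : Lp ℝ 1 μ) y ∂μ = c * ∫ y, f y ∂μ := by
  rw [integral_congr_ae (Lp.coeFn_smul c f)]
  exact integral_const_mul c _

/-- The bilinear form `∫ γ[u, v] dμ`. -/
def integralForm : V →ₗ[ℝ] V →ₗ[ℝ] ℝ :=
  LinearMap.mk₂ ℝ (fun u v => ∫ y, γ u v y ∂μ)
    (fun u u' v => by rw [map_add, LinearMap.add_apply, integral_L1_add])
    (fun c u v => by rw [map_smul, LinearMap.smul_apply, integral_L1_smul, smul_eq_mul])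
    (fun u v v' => by rw [map_add, integral_L1_add])
    (fun c u v => by rw [map_smul, integral_L1_smul, smul_eq_mul])

theorem integralForm_apply (u v : V) : integralForm γ u v = ∫ y, γ u v y ∂μ := rfl

theorem integralForm_nonneg (hp : ∀ u, 0 ≤ᵐ[μ] (γ u u : Y → ℝ)) (u : V) :
    0 ≤ integralForm γ u u := integral_nonneg_of_ae (hp u)

/-- Pointwise Cauchy–Schwarz inequality. -/
theorem gamma_sq_le (hs : ∀ u v, γ u v = γ v u) (hp : ∀ u, 0 ≤ᵐ[μ] (γ u u : Y → ℝ)) (u v : V) :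
    ∀ᵐ y ∂μ, γ u v y ^ 2 ≤ γ u u y * γ v v y := by
  -- Positivity of γ[u + q v] holds off a null set depending on `q`. Rational `q` keep the union of
  -- these sets null, and continuity then gives all real parameters.
  have h1 : ∀ q : ℚ, ∀ᵐ y ∂μ, 0 ≤ γ v v y * ((q : ℝ) * q) + (2 * γ u v y) * q + γ u u y := by
    intro q
    have e : γ (u + (q : ℝ) • v) (u + (q : ℝ) • v) =
        γ u u + (q : ℝ) • (γ u v + γ u v) + ((q : ℝ) * q) • γ v v := by
      simp only [map_add, map_smul, LinearMap.add_apply, LinearMap.smul_apply, hs v u, smul_add,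
        smul_smul]
      abel
    have h2 := hp (u + (q : ℝ) • v)
    rw [e] at h2
    filter_upwards [h2, Lp.coeFn_add (γ u u + (q : ℝ) • (γ u v + γ u v)) (((q : ℝ) * q) • γ v v),
      Lp.coeFn_add (γ u u) ((q : ℝ) • (γ u v + γ u v)), Lp.coeFn_smul (q : ℝ) (γ u v + γ u v),
      Lp.coeFn_add (γ u v) (γ u v), Lp.coeFn_smul ((q : ℝ) * q) (γ v v)] with y a1 a2 a3 a4 a5 a6
    rw [a2, Pi.add_apply, a3, Pi.add_apply, a4, Pi.smul_apply, a5, Pi.add_apply, a6,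
      Pi.smul_apply] at a1
    simp only [Pi.zero_apply, smul_eq_mul] at a1
    linarith
  filter_upwards [ae_all_iff.2 h1] with y hy
  have h3 : ∀ t : ℝ, 0 ≤ γ v v y * (t * t) + (2 * γ u v y) * t + γ u u y := by
    intro t
    have hc : Continuous fun t : ℝ => γ v v y * (t * t) + (2 * γ u v y) * t + γ u u y := by
      fun_prop
    refine Rat.denseRange_cast.induction_on (p := fun t : ℝ =>
      0 ≤ γ v v y * (t * t) + (2 * γ u v y) * t + γ u u y) t (isClosed_le continuous_const hc) hy
  have := discrim_le_zero h3
  unfold discrim at this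
  nlinarith

/-- The pointwise inequality bounds |γ[u,v]|, so γ[v] t² + 2|γ[u,v]| t + γ[u] is nonnegative almost
everywhere. Its integral is a nonnegative quadratic polynomial in t, and the discriminant gives the
bound for the L¹ norm itself. -/
theorem norm_gamma_sq_le (hs : ∀ u v, γ u v = γ v u) (hp : ∀ u, 0 ≤ᵐ[μ] (γ u u : Y → ℝ))
    (u v : V) : ‖γ u v‖ ^ 2 ≤ integralForm γ u u * integralForm γ v v := by
  have e : ‖γ u v‖ = ∫ y, |γ u v y| ∂μ := L1.norm_eq_integral_norm _
  have i1 := (integrable_coeFn_L1 (γ u v)).abs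
  have i2 := integrable_coeFn_L1 (γ u u)
  have i3 := integrable_coeFn_L1 (γ v v)
  have h : ∀ t : ℝ, 0 ≤ integralForm γ v v * (t * t) + (2 * ‖γ u v‖) * t + integralForm γ u u := by
    intro t
    have : integralForm γ v v * (t * t) + (2 * ‖γ u v‖) * t + integralForm γ u u =
        ∫ y, (γ v v y * (t * t) + (2 * |γ u v y|) * t + γ u u y) ∂μ := by
      rw [integral_add, integral_add, integral_mul_const, integral_mul_const, integral_const_mul, e]
      · rfl
      · exact i3.mul_const _
      · exact (i1.const_mul _).mul_const _
      · exact (i3.mul_const _).add ((i1.const_mul _).mul_const _)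
      · exact i2
    rw [this]
    refine integral_nonneg_of_ae ?_
    filter_upwards [gamma_sq_le γ hs hp u v, hp u, hp v] with y h1 h2 h3
    simp only [Pi.zero_apply] at *
    rw [← sq_abs] at h1
    -- Completing the square requires multiplying by γ[v] at `y`. Where it vanishes, the pointwise
    -- inequality makes γ[u,v] vanish too.
    by_cases hv : γ v v y = 0
    · rw [hv, mul_zero] at h1
      have : |γ u v y| = 0 := by nlinarith [abs_nonneg (γ u v y)]
      rw [hv, this]; linarith
    · have hv' : 0 < γ v v y := lt_of_le_of_ne h3 (Ne.symm hv)
      have : 0 ≤ γ v v y * (γ v v y * (t * t) + (2 * |γ u v y|) * t + γ u u y) := by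
        nlinarith [sq_nonneg (γ v v y * t + |γ u v y|)]
      exact nonneg_of_mul_nonneg_right this hv'
  have := discrim_le_zero h
  unfold discrim at this
  nlinarith

theorem norm_gamma_le (hs : ∀ u v, γ u v = γ v u) (hp : ∀ u, 0 ≤ᵐ[μ] (γ u u : Y → ℝ))
    (u v : V) : ‖γ u v‖ ≤ √(integralForm γ u u) * √(integralForm γ v v) := by
  rw [← Real.sqrt_mul (integralForm_nonneg γ hp u)]
  exact Real.le_sqrt_of_sq_le (norm_gamma_sq_le γ hs hp u v)

/-- Telescope γ[uₙ,vₙ] - γ[u₀,v₀] so that each term contains a difference, and apply the L¹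
Cauchy–Schwarz inequality. Allowing any filter makes double sequences available, which is how Cauchy
estimates are obtained below. -/
theorem tendsto_gamma {ι : Type*} {l : Filter ι} (hs : ∀ u v, γ u v = γ v u)
    (hp : ∀ u, 0 ≤ᵐ[μ] (γ u u : Y → ℝ)) {u v : ι → V} {u₀ v₀ : V}
    (hu : Tendsto (fun n => integralForm γ (u n - u₀) (u n - u₀)) l (𝓝 0))
    (hv : Tendsto (fun n => integralForm γ (v n - v₀) (v n - v₀)) l (𝓝 0)) :
    Tendsto (fun n => γ (u n) (v n)) l (𝓝 (γ u₀ v₀)) := by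
  rw [tendsto_iff_norm_sub_tendsto_zero]
  have su : Tendsto (fun n => √(integralForm γ (u n - u₀) (u n - u₀))) l (𝓝 0) := by
    rw [← Real.sqrt_zero]
    exact (Real.continuous_sqrt.tendsto 0).comp hu
  have sv : Tendsto (fun n => √(integralForm γ (v n - v₀) (v n - v₀))) l (𝓝 0) := by
    rw [← Real.sqrt_zero]
    exact (Real.continuous_sqrt.tendsto 0).comp hv
  have h := ((su.mul sv).add (su.mul_const (√(integralForm γ v₀ v₀)))).add
    (sv.const_mul (√(integralForm γ u₀ u₀)))
  simp only [mul_zero, zero_mul, add_zero] at h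
  refine squeeze_zero (fun _ => norm_nonneg _) (fun n => ?_) h
  have e : γ (u n) (v n) - γ u₀ v₀ =
      γ (u n - u₀) (v n - v₀) + γ (u n - u₀) v₀ + γ u₀ (v n - v₀) := by
    simp only [map_sub, LinearMap.sub_apply]; abel
  rw [e]
  refine (norm_add_le _ _).trans (add_le_add ((norm_add_le _ _).trans (add_le_add ?_ ?_)) ?_)
  all_goals exact norm_gamma_le γ hs hp _ _

end Gamma

/-! ### The algebra of classes of measurable functions -/

section AEEqFunAlgebra

variable {Y 𝕜 : Type*} [MeasurableSpace Y] {μ : Measure Y} [RCLike 𝕜]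

/-- This ring structure lets the bounded elements of a form domain be a `NonUnitalSubalgebra`, and
lets evaluation of exponential sums be an algebra homomorphism. -/
instance : CommRing (Y →ₘ[μ] 𝕜) :=
  { (inferInstance : AddCommGroup (Y →ₘ[μ] 𝕜)), (inferInstance : CommMonoid (Y →ₘ[μ] 𝕜)) with
    left_distrib := fun a b c => by
      apply AEEqFun.ext
      filter_upwards [AEEqFun.coeFn_mul a (b + c), AEEqFun.coeFn_add b c, AEEqFun.coeFn_mul a b,
        AEEqFun.coeFn_mul a c, AEEqFun.coeFn_add (a * b) (a * c)] with y h1 h2 h3 h4 h5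
      rw [h1, Pi.mul_apply, h2, Pi.add_apply, h5, Pi.add_apply, h3, h4, Pi.mul_apply, Pi.mul_apply,
        mul_add]
    right_distrib := fun a b c => by
      apply AEEqFun.ext
      filter_upwards [AEEqFun.coeFn_mul (a + b) c, AEEqFun.coeFn_add a b, AEEqFun.coeFn_mul a c,
        AEEqFun.coeFn_mul b c, AEEqFun.coeFn_add (a * c) (b * c)] with y h1 h2 h3 h4 h5
      rw [h1, Pi.mul_apply, h2, Pi.add_apply, h5, Pi.add_apply, h3, h4, Pi.mul_apply, Pi.mul_apply,
        add_mul]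
    zero_mul := fun a => by
      apply AEEqFun.ext
      filter_upwards [AEEqFun.coeFn_mul 0 a, AEEqFun.coeFn_zero (α := Y) (μ := μ) (β := 𝕜)]
        with y h1 h2
      rw [h1, Pi.mul_apply, h2, Pi.zero_apply, zero_mul]
    mul_zero := fun a => by
      apply AEEqFun.ext
      filter_upwards [AEEqFun.coeFn_mul a 0, AEEqFun.coeFn_zero (α := Y) (μ := μ) (β := 𝕜)]
        with y h1 h2
      rw [h1, Pi.mul_apply, h2, Pi.zero_apply, mul_zero] }

instance : Algebra 𝕜 (Y →ₘ[μ] 𝕜) :=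
  Algebra.ofModule
    (fun c a b => by
      apply AEEqFun.ext
      filter_upwards [AEEqFun.coeFn_mul (c • a) b, AEEqFun.coeFn_smul c a, AEEqFun.coeFn_mul a b,
        AEEqFun.coeFn_smul c (a * b)] with y h1 h2 h3 h4
      rw [h1, Pi.mul_apply, h2, h4, Pi.smul_apply, Pi.smul_apply, h3, Pi.mul_apply, smul_mul_assoc])
    (fun c a b => by
      apply AEEqFun.ext
      filter_upwards [AEEqFun.coeFn_mul a (c • b), AEEqFun.coeFn_smul c b, AEEqFun.coeFn_mul a b,
        AEEqFun.coeFn_smul c (a * b)] with y h1 h2 h3 h4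
      rw [h1, Pi.mul_apply, h2, h4, Pi.smul_apply, Pi.smul_apply, h3, Pi.mul_apply,
        mul_smul_comm])

end AEEqFunAlgebra

/-! ### Convergence of products -/

section Convergence

variable {Y : Type*} [MeasurableSpace Y] {μ : Measure Y}

/-- Multiplication of an `L¹`-convergent sequence by a bounded, almost everywhere convergent
sequence. -/
theorem tendsto_integral_norm_mul_sub {𝕜 ι : Type*} [RCLike 𝕜] {l : Filter ι} [l.NeBot]
    [l.IsCountablyGenerated] {φ : ι → Y → 𝕜} {φ₀ : Y → 𝕜}
    {g : ι → Y → 𝕜} {g₀ : Y → 𝕜} {C : ℝ} (hφ : ∀ n, AEStronglyMeasurable (φ n) μ)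
    (hC : ∀ n, ∀ᵐ y ∂μ, ‖φ n y‖ ≤ C)
    (hlim : ∀ᵐ y ∂μ, Tendsto (fun n => φ n y) l (𝓝 (φ₀ y)))
    (hg : ∀ n, Integrable (g n) μ) (hg₀ : Integrable g₀ μ)
    (h : Tendsto (fun n => ∫ y, ‖g n y - g₀ y‖ ∂μ) l (𝓝 0)) :
    Tendsto (fun n => ∫ y, ‖φ n y * g n y - φ₀ y * g₀ y‖ ∂μ) l (𝓝 0) := by
  have hφ₀ : AEStronglyMeasurable φ₀ μ := aestronglyMeasurable_of_tendsto_ae _ hφ hlim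
  have hC₀ : ∀ᵐ y ∂μ, ‖φ₀ y‖ ≤ C := by
    obtain ⟨ns, hns⟩ := exists_seq_tendsto l
    filter_upwards [hlim, ae_all_iff.2 fun k => hC (ns k)] with y h1 h2
    exact le_of_tendsto (h1.comp hns).norm (Eventually.of_forall h2)
  have i1 : ∀ n, Integrable (fun y => (φ n y - φ₀ y) * g₀ y) μ := fun n => by
    refine hg₀.bdd_mul (c := C + C) ((hφ n).sub hφ₀) ?_
    filter_upwards [hC n, hC₀] with y h1 h2
    exact (norm_sub_le _ _).trans (add_le_add h1 h2)
  have h2 : Tendsto (fun n => ∫ y, ‖(φ n y - φ₀ y) * g₀ y‖ ∂μ) l (𝓝 0) := by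
    have : Tendsto (fun n => ∫ y, ‖(φ n y - φ₀ y) * g₀ y‖ ∂μ) l (𝓝 (∫ y, (0 : ℝ) ∂μ)) := by
      refine tendsto_integral_filter_of_dominated_convergence (fun y => (C + C) * ‖g₀ y‖)
        (Eventually.of_forall fun n => (i1 n).norm.aestronglyMeasurable)
        (Eventually.of_forall fun n => ?_) (hg₀.norm.const_mul _) ?_
      · filter_upwards [hC n, hC₀] with y h1 h2
        rw [norm_norm, norm_mul]
        gcongr
        exact (norm_sub_le _ _).trans (add_le_add h1 h2)
      · filter_upwards [hlim] with y hy
        have := ((hy.sub_const (φ₀ y)).mul_const (g₀ y)).norm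
        simpa using this
    simpa using this
  have h3 := (h.const_mul C).add h2
  rw [mul_zero, add_zero] at h3
  refine squeeze_zero (fun n => integral_nonneg fun y => norm_nonneg _) (fun n => ?_) h3
  have i2 : Integrable (fun y => C * ‖g n y - g₀ y‖) μ := ((hg n).sub hg₀).norm.const_mul C
  rw [← integral_const_mul, ← integral_add i2 (i1 n).norm]
  refine integral_mono_of_nonneg (Eventually.of_forall fun y => norm_nonneg _)
    (i2.add (i1 n).norm) ?_
  filter_upwards [hC n] with y hy
  have e : φ n y * g n y - φ₀ y * g₀ y = φ n y * (g n y - g₀ y) + (φ n y - φ₀ y) * g₀ y := by ring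
  rw [e]
  refine (norm_add_le _ _).trans (add_le_add ?_ le_rfl)
  rw [norm_mul]
  gcongr

theorem tendsto_integral_of_norm_sub {F ι : Type*} [NormedAddCommGroup F] [NormedSpace ℝ F]
    {l : Filter ι} {g : ι → Y → F} {g₀ : Y → F}
    (hg : ∀ n, Integrable (g n) μ) (hg₀ : Integrable g₀ μ)
    (h : Tendsto (fun n => ∫ y, ‖g n y - g₀ y‖ ∂μ) l (𝓝 0)) :
    Tendsto (fun n => ∫ y, g n y ∂μ) l (𝓝 (∫ y, g₀ y ∂μ)) := by
  rw [tendsto_iff_norm_sub_tendsto_zero]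
  refine squeeze_zero (fun _ => norm_nonneg _) (fun n => ?_) h
  rw [← integral_sub (hg n) hg₀]
  exact norm_integral_le_integral_norm _

theorem tendsto_integral_norm_sub_of_L1 {F ι : Type*} [NormedAddCommGroup F] {l : Filter ι}
    {g : ι → Lp F 1 μ} {g₀ : Lp F 1 μ} (h : Tendsto g l (𝓝 g₀)) :
    Tendsto (fun n => ∫ y, ‖g n y - g₀ y‖ ∂μ) l (𝓝 0) := by
  refine (tendsto_iff_norm_sub_tendsto_zero.1 h).congr fun n => ?_
  rw [L1.norm_eq_integral_norm]
  refine integral_congr_ae ?_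
  filter_upwards [Lp.coeFn_sub (g n) g₀] with y hy
  rw [hy, Pi.sub_apply]

/-- A sequence of `L¹` that converges in mean to two functions: the limits agree. -/
theorem ae_eq_of_tendsto_integral_norm_sub {F ι : Type*} [NormedAddCommGroup F] {l : Filter ι}
    [l.NeBot] {g : ι → Y → F} {g₀ g₁ : Y → F} (hg : ∀ n, Integrable (g n) μ)
    (hg₀ : Integrable g₀ μ) (hg₁ : Integrable g₁ μ)
    (h₀ : Tendsto (fun n => ∫ y, ‖g n y - g₀ y‖ ∂μ) l (𝓝 0))
    (h₁ : Tendsto (fun n => ∫ y, ‖g n y - g₁ y‖ ∂μ) l (𝓝 0)) : g₀ =ᵐ[μ] g₁ := by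
  have h : ∫ y, ‖g₀ y - g₁ y‖ ∂μ ≤ 0 := by
    have h2 := h₀.add h₁
    rw [add_zero] at h2
    refine ge_of_tendsto h2 (Eventually.of_forall fun n => ?_)
    have i0 : Integrable (fun y => ‖g n y - g₀ y‖) μ := ((hg n).sub hg₀).norm
    have i1 : Integrable (fun y => ‖g n y - g₁ y‖) μ := ((hg n).sub hg₁).norm
    rw [← integral_add i0 i1]
    refine integral_mono_of_nonneg (ae_of_all _ fun y => norm_nonneg _) (i0.add i1)
      (ae_of_all _ fun y => ?_)
    simp only
    rw [← norm_sub_rev (g₀ y)]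
    simpa using norm_add_le (g₀ y - g n y) (g n y - g₁ y)
  have h3 := (integral_eq_zero_iff_of_nonneg (fun y => norm_nonneg _) (hg₀.sub hg₁).norm).1
    (le_antisymm h (integral_nonneg fun y => norm_nonneg _))
  filter_upwards [h3] with y hy
  simpa [sub_eq_zero] using hy

/-- An `L²`-convergent sequence has a subsequence converging almost everywhere. -/
theorem exists_seq_tendsto_ae_of_L2 {F : Type*} [NormedAddCommGroup F]
    {g : ℕ → Lp F 2 μ} {g₀ : Lp F 2 μ} (h : Tendsto g atTop (𝓝 g₀)) :
    ∃ ns : ℕ → ℕ, StrictMono ns ∧ ∀ᵐ y ∂μ, Tendsto (fun k => g (ns k) y) atTop (𝓝 (g₀ y)) :=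
  (tendstoInMeasure_of_tendsto_Lp h).exists_seq_tendsto_ae

end Convergence

end PoissonDirichlet
end

noncomputable section

namespace PoissonDirichlet

namespace DirichletForm

variable {Y : Type*} [MeasurableSpace Y] {μ : Measure Y} (E : DirichletForm μ)

/-! ### Functions operating on the domain -/

theorem form_smul_smul (c : ℝ) (u : E.dom) : E.form (c • u) (c • u) = c ^ 2 * E.form u u := by
  simp only [map_smul, LinearMap.smul_apply, smul_eq_mul]; ring

/-- Lipschitz functions vanishing at `0` operate on the domain. -/
theorem exists_lipschitz_comp (u : E.dom) {K : ℝ≥0} {φ : ℝ → ℝ} (hφ : LipschitzWith K φ)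
    (h0 : φ 0 = 0) :
    ∃ v : E.dom, ((v : Lp ℝ 2 μ) =ᵐ[μ] fun y => φ ((u : Lp ℝ 2 μ) y)) ∧
      E.form v v ≤ (K : ℝ) ^ 2 * E.form u u := by
  rcases eq_or_ne K 0 with rfl | hK
  · refine ⟨0, ?_, by simp⟩
    filter_upwards [Lp.coeFn_zero ℝ 2 μ] with y hy
    have := hφ.dist_le_mul ((u : Lp ℝ 2 μ) y) 0
    rw [h0, Real.dist_eq] at this
    simp only [NNReal.coe_zero, zero_mul, sub_zero] at this
    rw [Submodule.coe_zero, hy, abs_nonpos_iff.1 this]; rfl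
  · have hK' : (K : ℝ) ≠ 0 := by exact_mod_cast hK
    obtain ⟨v, hv, hv'⟩ := E.contraction (fun t => (K : ℝ)⁻¹ * φ t) (by
      refine LipschitzWith.of_dist_le_mul fun x y => ?_
      have := hφ.dist_le_mul x y
      rw [Real.dist_eq] at *
      rw [← mul_sub, abs_mul, abs_of_nonneg (by positivity), NNReal.coe_one, one_mul,
        inv_mul_le_iff₀ (by positivity)]
      exact this) (by simp [h0]) u
    refine ⟨(K : ℝ) • v, ?_, ?_⟩
    · filter_upwards [hv, Lp.coeFn_smul (K : ℝ) (v : Lp ℝ 2 μ)] with y h1 h2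
      rw [Submodule.coe_smul, h2, Pi.smul_apply, h1, smul_eq_mul, mul_inv_cancel_left₀ hK']
    · rw [form_smul_smul]
      gcongr

/-- Functions that are continuously differentiable operate on the bounded elements. -/
theorem exists_comp_of_bound (u : E.dom) {M K : ℝ} (hM : 0 ≤ M) (hK : 0 ≤ K)
    (hu : ∀ᵐ y ∂μ, |(u : Lp ℝ 2 μ) y| ≤ M) {φ φ' : ℝ → ℝ}
    (hφ : ∀ x, HasDerivAt φ (φ' x) x) (hb : ∀ x ∈ Set.Icc (-M) M, |φ' x| ≤ K) :
    ∃ v : E.dom, ((v : Lp ℝ 2 μ) =ᵐ[μ] fun y => φ ((u : Lp ℝ 2 μ) y) - φ 0) ∧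
      E.form v v ≤ K ^ 2 * E.form u u := by
  lift K to ℝ≥0 using hK
  have h1 : LipschitzOnWith K φ (Set.Icc (-M) M) :=
    (convex_Icc _ _).lipschitzOnWith_of_nnnorm_hasDerivWithin_le
      (fun x _ => (hφ x).hasDerivWithinAt) (fun x hx => by
        rw [← NNReal.coe_le_coe]; exact hb x hx)
  have hMM : -M ≤ M := by linarith
  -- Projecting onto [-M, M] first makes φ globally Lipschitz and does not change φ(u), since u
  -- takes its values there.
  have h2 : LipschitzWith K
      (fun x => φ ((Set.projIcc (-M) M hMM x : Set.Icc (-M) M) : ℝ) - φ 0) := by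
    refine LipschitzWith.of_dist_le_mul fun x y => ?_
    have h3 := h1.dist_le_mul _ (Set.projIcc (-M) M hMM x).2 _ (Set.projIcc (-M) M hMM y).2
    have h4 := (LipschitzWith.projIcc hMM).dist_le_mul x y
    rw [dist_sub_right]
    refine h3.trans ?_
    gcongr
    simpa [Subtype.dist_eq] using h4
  obtain ⟨v, hv, hv'⟩ := E.exists_lipschitz_comp u h2 (by
    rw [Set.projIcc_of_mem hMM ⟨by linarith, hM⟩]; simp)
  refine ⟨v, ?_, hv'⟩
  filter_upwards [hv, hu] with y h3 h4
  rw [h3, Set.projIcc_of_mem hMM (abs_le.1 h4)]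

theorem exists_sq (u : E.dom) {M : ℝ} (hu : ∀ᵐ y ∂μ, |(u : Lp ℝ 2 μ) y| ≤ M) :
    ∃ v : E.dom, (v : Lp ℝ 2 μ) =ᵐ[μ] fun y => (u : Lp ℝ 2 μ) y ^ 2 := by
  have hu' : ∀ᵐ y ∂μ, |(u : Lp ℝ 2 μ) y| ≤ |M| := hu.mono fun y h => h.trans (le_abs_self M)
  obtain ⟨v, hv, -⟩ := E.exists_comp_of_bound u (abs_nonneg M)
    (show 0 ≤ 2 * |M| by positivity) hu'
    (φ := fun x => x ^ 2) (φ' := fun x => 2 * x) (fun x => by simpa using hasDerivAt_pow 2 x)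
    (fun x hx => by 
      rw [abs_mul, abs_two]
      exact mul_le_mul_of_nonneg_left (abs_le.2 hx) zero_le_two)
  exact ⟨v, by simpa using hv⟩

/-- The algebra of bounded elements of the domain. -/
def bdom : NonUnitalSubalgebra ℝ (Y →ₘ[μ] ℝ) where
  carrier := {u | (∃ h : u ∈ Lp ℝ 2 μ, (⟨u, h⟩ : Lp ℝ 2 μ) ∈ E.dom) ∧ ∃ M : ℝ, ∀ᵐ y ∂μ, |u y| ≤ M}
  add_mem' := by
    rintro u v ⟨⟨h, h'⟩, M, hM⟩ ⟨⟨k, k'⟩, M', hM'⟩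
    refine ⟨⟨add_mem h k, E.dom.add_mem h' k'⟩, M + M', ?_⟩
    filter_upwards [hM, hM', AEEqFun.coeFn_add u v] with y h1 h2 h3
    rw [h3]
    exact (abs_add_le _ _).trans (add_le_add h1 h2)
  zero_mem' := by
    refine ⟨⟨zero_mem _, E.dom.zero_mem⟩, 0, ?_⟩
    filter_upwards [AEEqFun.coeFn_zero (α := Y) (μ := μ) (β := ℝ)] with y hy
    rw [hy]; simp
  smul_mem' := by
    rintro c u ⟨⟨h, h'⟩, M, hM⟩
    refine ⟨⟨(c • (⟨u, h⟩ : Lp ℝ 2 μ)).2, E.dom.smul_mem c h'⟩, |c| * M, ?_⟩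
    filter_upwards [hM, AEEqFun.coeFn_smul c u] with y h1 h2
    rw [h2, Pi.smul_apply, smul_eq_mul, abs_mul]
    gcongr
  mul_mem' := by
    rintro u v ⟨⟨h, h'⟩, M, hM⟩ ⟨⟨k, k'⟩, M', hM'⟩
    have hs : ∀ᵐ y ∂μ, |((⟨⟨u, h⟩, h'⟩ + ⟨⟨v, k⟩, k'⟩ : E.dom) : Lp ℝ 2 μ) y| ≤ M + M' := by
      filter_upwards [hM, hM', AEEqFun.coeFn_add u v] with y h1 h2 h3
      change |(u + v : Y →ₘ[μ] ℝ) y| ≤ _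
      rw [h3]
      exact (abs_add_le _ _).trans (add_le_add h1 h2)
    obtain ⟨a, ha⟩ := E.exists_sq ⟨⟨u, h⟩, h'⟩ hM
    obtain ⟨b, hb⟩ := E.exists_sq ⟨⟨v, k⟩, k'⟩ hM'
    obtain ⟨c, hc⟩ := E.exists_sq _ hs
    -- Squares operate on bounded elements, and products follow by polarization: uv = ½((u + v)² -
    -- u² - v²).
    have e : (((1 / 2 : ℝ) • (c - a - b) : E.dom) : Lp ℝ 2 μ).1 = u * v := by
      apply AEEqFun.ext
      filter_upwards [ha, hb, hc, AEEqFun.coeFn_add u v, AEEqFun.coeFn_mul u v,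
        AEEqFun.coeFn_smul (1 / 2 : ℝ) ((c : Lp ℝ 2 μ).1 - (a : Lp ℝ 2 μ).1 - (b : Lp ℝ 2 μ).1),
        AEEqFun.coeFn_sub ((c : Lp ℝ 2 μ).1 - (a : Lp ℝ 2 μ).1) (b : Lp ℝ 2 μ).1,
        AEEqFun.coeFn_sub (c : Lp ℝ 2 μ).1 (a : Lp ℝ 2 μ).1] with y h1 h2 h3 h4 h5 h6 h7 h8
      change ((1 / 2 : ℝ) • ((c : Lp ℝ 2 μ).1 - (a : Lp ℝ 2 μ).1 - (b : Lp ℝ 2 μ).1)) y = _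
      rw [h6, Pi.smul_apply, h7, Pi.sub_apply, h8, Pi.sub_apply, h5, Pi.mul_apply]
      change (c : Lp ℝ 2 μ).1 y = (u + v : Y →ₘ[μ] ℝ) y ^ 2 at h3
      change (a : Lp ℝ 2 μ).1 y = u y ^ 2 at h1
      change (b : Lp ℝ 2 μ).1 y = v y ^ 2 at h2
      rw [h1, h2, h3, h4, Pi.add_apply, smul_eq_mul]
      ring
    refine ⟨⟨e ▸ (((1 / 2 : ℝ) • (c - a - b) : E.dom) : Lp ℝ 2 μ).2, ?_⟩, |M| * |M'|, ?_⟩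
    · convert ((1 / 2 : ℝ) • (c - a - b) : E.dom).2
      exact e.symm
    · filter_upwards [hM, hM', AEEqFun.coeFn_mul u v] with y h1 h2 h3
      rw [h3, Pi.mul_apply, abs_mul]
      exact mul_le_mul (h1.trans (le_abs_self _)) (h2.trans (le_abs_self _)) (abs_nonneg _)
        (abs_nonneg _)

/-- A bounded element of the domain, seen in the domain. -/
def ofBdom : E.bdom →ₗ[ℝ] E.dom where
  toFun u := ⟨⟨u, u.2.1.choose⟩, u.2.1.choose_spec⟩
  map_add' _ _ := rfl
  map_smul' _ _ := rfl

theorem coeFn_ofBdom (u : E.bdom) : ((E.ofBdom u : Lp ℝ 2 μ) : Y → ℝ) = (u : Y →ₘ[μ] ℝ) := rfl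

theorem memLp_top_ofBdom (u : E.bdom) : MemLp (E.ofBdom u : Lp ℝ 2 μ) ∞ μ := by
  obtain ⟨M, hM⟩ := u.2.2
  exact memLp_top_of_bound (Lp.aestronglyMeasurable _) M hM

/-- The restriction of the form to bounded elements. -/
def bform : E.bdom →ₗ[ℝ] E.bdom →ₗ[ℝ] ℝ := E.form.compl₁₂ E.ofBdom E.ofBdom

theorem bform_symm (u v : E.bdom) : E.bform u v = E.bform v u := E.symm _ _

/-- A bounded element of the domain belongs to `bdom`. -/
def toBdom (u : E.dom) (hu : ∃ M : ℝ, ∀ᵐ y ∂μ, |(u : Lp ℝ 2 μ) y| ≤ M) : E.bdom :=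
  ⟨(u : Lp ℝ 2 μ).1, ⟨(u : Lp ℝ 2 μ).2, u.2⟩, hu⟩

end DirichletForm

/-! ### Smooth ramps -/

section Ramp

/-- A primitive of `Real.smoothTransition`. -/
def smoothRelu (x : ℝ) : ℝ := ∫ t in (0 : ℝ)..x, Real.smoothTransition t

theorem hasDerivAt_smoothRelu (x : ℝ) :
    HasDerivAt smoothRelu (Real.smoothTransition x) x :=
  (Real.smoothTransition.continuous.integral_hasStrictDerivAt 0 x).hasDerivAt

theorem contDiff_smoothRelu : ContDiff ℝ (⊤ : ℕ∞) smoothRelu := by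
  rw [contDiff_infty_iff_deriv]
  refine ⟨fun x => (hasDerivAt_smoothRelu x).differentiableAt, ?_⟩
  have : deriv smoothRelu = Real.smoothTransition := funext fun x => (hasDerivAt_smoothRelu x).deriv
  rw [this]
  exact Real.smoothTransition.contDiff

theorem smoothRelu_of_nonpos {x : ℝ} (hx : x ≤ 0) : smoothRelu x = 0 := by
  rw [smoothRelu, intervalIntegral.integral_congr (g := fun _ => (0 : ℝ))]
  · simp
  · intro t ht
    rw [Set.uIcc_of_ge hx] at ht
    exact Real.smoothTransition.zero_of_nonpos ht.2

/-- A smooth function that increases on `[0, 2]` and is constant elsewhere. -/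
def ramp (x : ℝ) : ℝ := smoothRelu x - smoothRelu (x - 1)

/-- The derivative of `ramp`. -/
def ramp' (x : ℝ) : ℝ := Real.smoothTransition x - Real.smoothTransition (x - 1)

theorem hasDerivAt_ramp (x : ℝ) : HasDerivAt ramp (ramp' x) x := by
  have h := (hasDerivAt_smoothRelu (x - 1)).comp x ((hasDerivAt_id x).sub_const 1)
  simp only [mul_one] at h
  exact (hasDerivAt_smoothRelu x).sub h

theorem contDiff_ramp : ContDiff ℝ (⊤ : ℕ∞) ramp :=
  contDiff_smoothRelu.sub (contDiff_smoothRelu.comp (contDiff_id.sub contDiff_const))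

theorem ramp'_nonneg (x : ℝ) : 0 ≤ ramp' x :=
  sub_nonneg.2 (Real.smoothTransition.monotone (by linarith))

theorem ramp'_le_one (x : ℝ) : ramp' x ≤ 1 := by
  have h1 := Real.smoothTransition.le_one x
  have h2 := Real.smoothTransition.nonneg (x - 1)
  unfold ramp'; linarith

theorem ramp'_of_nonpos {x : ℝ} (hx : x ≤ 0) : ramp' x = 0 := by
  rw [ramp', Real.smoothTransition.zero_of_nonpos hx,
    Real.smoothTransition.zero_of_nonpos (by linarith), sub_zero]

theorem ramp'_of_two_le {x : ℝ} (hx : 2 ≤ x) : ramp' x = 0 := by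
  rw [ramp', Real.smoothTransition.one_of_one_le (by linarith),
    Real.smoothTransition.one_of_one_le (by linarith), sub_self]

theorem ramp_of_nonpos {x : ℝ} (hx : x ≤ 0) : ramp x = 0 := by
  rw [ramp, smoothRelu_of_nonpos hx, smoothRelu_of_nonpos (by linarith), sub_zero]

theorem ramp_of_two_le {x : ℝ} (hx : 2 ≤ x) : ramp x = ramp 2 := by
  refine (convex_Ici (2 : ℝ)).is_const_of_fderivWithin_eq_zero (𝕜 := ℝ) (f := ramp)
    (fun y _ => (hasDerivAt_ramp y).differentiableAt.differentiableWithinAt) (fun y hy => ?_)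
    hx Set.self_mem_Ici
  have h1 : HasDerivWithinAt ramp 0 (Set.Ici 2) y := by
    rw [← ramp'_of_two_le hy]; exact (hasDerivAt_ramp y).hasDerivWithinAt
  have h2 := h1.hasFDerivWithinAt.fderivWithin ((uniqueDiffOn_Ici 2) y hy)
  rw [h2]; ext; simp

/-- The sum telescopes to σ(y + 1) - σ(y - n), with σ the smooth transition. The shift by 1 puts the
first term at the value 1 and the last at 0, so the translates form a partition of unity on [0, n].
-/
theorem sum_ramp' (n : ℕ) {y : ℝ} (h0 : 0 ≤ y) (hn : y ≤ n) :
    ∑ k ∈ Finset.range (n + 1), ramp' (y + 1 - k) = 1 := by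
  have h := Finset.sum_range_sub' (fun k : ℕ => Real.smoothTransition (y + 1 - k)) (n + 1)
  have e : ∀ k : ℕ, ramp' (y + 1 - k) = Real.smoothTransition (y + 1 - k) -
      Real.smoothTransition (y + 1 - (k + 1 : ℕ)) := fun k => by
    rw [ramp']; congr 2; push_cast; ring
  simp only [e]
  rw [h, Real.smoothTransition.one_of_one_le (by simpa using h0),
    Real.smoothTransition.zero_of_nonpos (by push_cast; linarith), sub_zero]

end Ramp

end PoissonDirichlet
end

/-! ### Locality as a quartic identity for the form -/

noncomputable section

namespace PoissonDirichlet

/-- A smooth function that increases on `[(k - 1)δ - M, (k + 1)δ - M]` and is constant elsewhere. -/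
def rampAt (M δ : ℝ) (k : ℕ) (x : ℝ) : ℝ := δ * ramp ((x + M) / δ + 1 - k)

theorem hasDerivAt_rampAt (M : ℝ) {δ : ℝ} (hδ : 0 < δ) (k : ℕ) (x : ℝ) :
    HasDerivAt (rampAt M δ k) (ramp' ((x + M) / δ + 1 - k)) x := by
  have h1 : HasDerivAt (fun x : ℝ => (x + M) / δ + 1 - k) (1 / δ) x :=
    ((((hasDerivAt_id x).add_const M).div_const δ).add_const 1).sub_const (k : ℝ)
  have h2 := ((hasDerivAt_ramp ((x + M) / δ + 1 - k)).comp x h1).const_mul δ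
  have e : δ * (ramp' ((x + M) / δ + 1 - k) * (1 / δ)) = ramp' ((x + M) / δ + 1 - k) := by
    field_simp
  rw [e] at h2
  exact h2

theorem contDiff_rampAt (M δ : ℝ) (k : ℕ) : ContDiff ℝ (⊤ : ℕ∞) (rampAt M δ k) := by
  refine contDiff_const.mul (contDiff_ramp.comp ?_)
  exact ((((contDiff_id.add contDiff_const)).div_const δ).add contDiff_const).sub contDiff_const

namespace LocalDirichletStructure

variable {Y : Type*} [MeasurableSpace Y] {μ : Measure Y} (S : LocalDirichletStructure μ)

/-- Only functions with disjoint compact supports may be used. The ramp of index `j` is constant to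
the right of its slope, so subtracting it from that constant leaves a function living on the left;
the ramp of index `k` lives on the right. The gap 3, rather than 2, keeps the closed supports from
touching. -/
theorem form_rampAt_eq_zero (u : S.dom) {M δ : ℝ} (hM : 0 ≤ M) (hδ : 0 < δ)
    (hu : ∀ᵐ y ∂μ, |(u : Lp ℝ 2 μ) y| ≤ M) {j k : ℕ} (hjk : j + 3 ≤ k) (v w : S.dom)
    (hv : (v : Lp ℝ 2 μ) =ᵐ[μ] fun y => rampAt M δ j ((u : Lp ℝ 2 μ) y) - rampAt M δ j 0)
    (hw : (w : Lp ℝ 2 μ) =ᵐ[μ] fun y => rampAt M δ k ((u : Lp ℝ 2 μ) y) - rampAt M δ k 0) :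
    S.form v w = 0 := by
  let σ := Real.smoothTransition
  -- The smooth cutoffs equal 1 on [-M, M], so they make the supports compact without changing the
  -- functions of u. The reversed sign of the first ramp is why locality is applied to `-v`.
  let F : ℝ → ℝ := fun x => (δ * ramp 2 - rampAt M δ j x) * σ (x + (M + 1))
  let G : ℝ → ℝ := fun x => rampAt M δ k x * σ (M + 1 - x)
  have hσ : ContDiff ℝ (⊤ : ℕ∞) σ := Real.smoothTransition.contDiff
  have hF : ContDiff ℝ (⊤ : ℕ∞) F := (contDiff_const.sub (contDiff_rampAt M δ j)).mul
    (hσ.comp (contDiff_id.add contDiff_const))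
  have hG : ContDiff ℝ (⊤ : ℕ∞) G := (contDiff_rampAt M δ k).mul
    (hσ.comp (contDiff_const.sub contDiff_id))
  have hFs : tsupport F ⊆ Set.Icc (-(M + 1)) ((j + 1) * δ - M) := by
    refine closure_minimal (fun x hx => ?_) isClosed_Icc
    by_contra h
    apply hx
    rw [Set.mem_Icc, not_and_or, not_le, not_le] at h
    rcases h with h | h
    · have : σ (x + (M + 1)) = 0 := Real.smoothTransition.zero_of_nonpos (by linarith)
      simp [F, this]
    · have : rampAt M δ j x = δ * ramp 2 := by
        rw [rampAt, ramp_of_two_le]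
        have : (j : ℝ) + 1 ≤ (x + M) / δ := by rw [le_div_iff₀ hδ]; linarith
        linarith
      simp [F, this]
  have hGs : tsupport G ⊆ Set.Icc ((k - 1) * δ - M) (M + 1) := by
    refine closure_minimal (fun x hx => ?_) isClosed_Icc
    by_contra h
    apply hx
    rw [Set.mem_Icc, not_and_or, not_le, not_le] at h
    rcases h with h | h
    · have : rampAt M δ k x = 0 := by
        rw [rampAt, ramp_of_nonpos, mul_zero]
        have : (x + M) / δ ≤ (k : ℝ) - 1 := by rw [div_le_iff₀ hδ]; linarith
        linarith
      simp [G, this]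
    · have : σ (M + 1 - x) = 0 := Real.smoothTransition.zero_of_nonpos (by linarith)
      simp [G, this]
  have hjk' : (j : ℝ) + 3 ≤ k := by exact_mod_cast hjk
  have hd : Disjoint (tsupport F) (tsupport G) := by
    refine Disjoint.mono hFs hGs ?_
    rw [Set.disjoint_left]
    rintro x ⟨-, h1⟩ ⟨h2, -⟩
    nlinarith
  have e1 : ∀ x : ℝ, |x| ≤ M → F x - F 0 = -(rampAt M δ j x - rampAt M δ j 0) := fun x hx => by
    have h1 : σ (x + (M + 1)) = 1 :=
      Real.smoothTransition.one_of_one_le (by linarith [(abs_le.1 hx).1])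
    have h2 : σ (0 + (M + 1)) = 1 := Real.smoothTransition.one_of_one_le (by linarith)
    simp only [F, h1, h2]; ring
  have e2 : ∀ x : ℝ, |x| ≤ M → G x - G 0 = rampAt M δ k x - rampAt M δ k 0 := fun x hx => by
    have h1 : σ (M + 1 - x) = 1 :=
      Real.smoothTransition.one_of_one_le (by linarith [(abs_le.1 hx).2])
    have h2 : σ (M + 1 - 0) = 1 := Real.smoothTransition.one_of_one_le (by linarith)
    simp only [G, h1, h2]; ring
  have h := S.isLocal F G hF hG (HasCompactSupport.of_support_subset_isCompact isCompact_Icc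
    (subset_closure.trans hFs)) (HasCompactSupport.of_support_subset_isCompact isCompact_Icc
    (subset_closure.trans hGs)) hd u (-v) w (by
      filter_upwards [hv, hu, Lp.coeFn_neg (v : Lp ℝ 2 μ)] with y h1 h2 h3
      rw [e1 _ h2, Submodule.coe_neg, h3, Pi.neg_apply, h1]) (by
      filter_upwards [hw, hu] with y h1 h2
      rw [e2 _ h2, h1])
  simpa using h

/-- The quadratic combination that vanishes because the contributions of distant values of `u`
to the form do. -/
theorem abs_sum_form_le {n : ℕ} (v : ℕ → S.dom) {A δ : ℝ} (hA : 0 ≤ A)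
    (hv : ∀ k, S.form (v k) (v k) ≤ A) (M : ℝ)
    (hloc : ∀ j k, j + 3 ≤ k → S.form (v j) (v k) = 0) :
    |3 * S.form (∑ k ∈ Finset.range (n + 1), (2 * (k * δ - M)) • v k)
        (∑ k ∈ Finset.range (n + 1), (2 * (k * δ - M)) • v k) -
      4 * S.form (∑ k ∈ Finset.range (n + 1), v k)
        (∑ k ∈ Finset.range (n + 1), (3 * (k * δ - M) ^ 2) • v k)| ≤
      6 * ((n + 1) * (5 * (4 * δ ^ 2 * A))) := by
  set x : ℕ → ℝ := fun k => k * δ - M with hx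
  set B : ℕ → ℕ → ℝ := fun j k => S.form (v j) (v k) with hB
  have hBs : ∀ j k, B j k = B k j := fun j k => S.symm _ _
  have e1 : S.form (∑ k ∈ Finset.range (n + 1), (2 * x k) • v k)
        (∑ k ∈ Finset.range (n + 1), (2 * x k) • v k) =
      ∑ j ∈ Finset.range (n + 1), ∑ k ∈ Finset.range (n + 1), 4 * (x j * x k) * B j k := by
    simp only [map_sum, map_smul, LinearMap.sum_apply, LinearMap.smul_apply, smul_eq_mul,
      Finset.mul_sum]
    rw [Finset.sum_comm]
    refine Finset.sum_congr rfl fun j _ => Finset.sum_congr rfl fun k _ => ?_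
    ring
  have e2 : S.form (∑ k ∈ Finset.range (n + 1), v k)
        (∑ k ∈ Finset.range (n + 1), (3 * x k ^ 2) • v k) =
      ∑ j ∈ Finset.range (n + 1), ∑ k ∈ Finset.range (n + 1), 3 * x k ^ 2 * B j k := by
    simp only [map_sum, map_smul, LinearMap.sum_apply, smul_eq_mul, Finset.mul_sum]
    rw [Finset.sum_comm]
  have e3 : ∑ j ∈ Finset.range (n + 1), ∑ k ∈ Finset.range (n + 1), 3 * x k ^ 2 * B j k =
      ∑ j ∈ Finset.range (n + 1), ∑ k ∈ Finset.range (n + 1), 3 * x j ^ 2 * B j k := by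
    rw [Finset.sum_comm]
    refine Finset.sum_congr rfl fun j _ => Finset.sum_congr rfl fun k _ => ?_
    rw [hBs]
  -- Symmetrizing turns 12 x_j x_k - 12 x_k² into -6 (x_j - x_k)². The weight vanishes on the
  -- diagonal, and locality removes everything far from it.
  have e4 : 3 * (∑ j ∈ Finset.range (n + 1), ∑ k ∈ Finset.range (n + 1), 4 * (x j * x k) * B j k) -
      4 * (∑ j ∈ Finset.range (n + 1), ∑ k ∈ Finset.range (n + 1), 3 * x k ^ 2 * B j k) =
      -6 * ∑ j ∈ Finset.range (n + 1), ∑ k ∈ Finset.range (n + 1), (x j - x k) ^ 2 * B j k := by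
    have : 4 * (∑ j ∈ Finset.range (n + 1), ∑ k ∈ Finset.range (n + 1), 3 * x k ^ 2 * B j k) =
      2 * (∑ j ∈ Finset.range (n + 1), ∑ k ∈ Finset.range (n + 1), 3 * x k ^ 2 * B j k) +
      2 * (∑ j ∈ Finset.range (n + 1), ∑ k ∈ Finset.range (n + 1), 3 * x j ^ 2 * B j k) := by
      rw [← e3]; ring
    rw [this]
    simp only [Finset.mul_sum, ← Finset.sum_sub_distrib, ← Finset.sum_add_distrib]
    refine Finset.sum_congr rfl fun j _ => Finset.sum_congr rfl fun k _ => ?_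
    ring
  have hBle : ∀ j k, |B j k| ≤ A := fun j k => by
    refine abs_le_of_sq_le_sq ?_ hA
    refine (sq_le_mul_of_nonneg S.form S.symm S.nonneg _ _).trans ?_
    rw [sq]
    exact mul_le_mul (hv j) (hv k) (S.nonneg _) hA
  -- Only |j - k| ≤ 2 contributes, at most five indices `k` for each `j`, and there (x_j - x_k)² ≤
  -- 4δ².
  have hterm : ∀ j k, |(x j - x k) ^ 2 * B j k| ≤
      if k ∈ Finset.Icc (j - 2) (j + 2) then 4 * δ ^ 2 * A else 0 := fun j k => by
    split_ifs with h
    · rw [abs_mul, abs_of_nonneg (sq_nonneg _)]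
      refine mul_le_mul ?_ (hBle j k) (abs_nonneg _) (by positivity)
      have h1 : |(j : ℝ) - k| ≤ 2 := by
        rw [Finset.mem_Icc] at h
        have h2 : (j : ℝ) ≤ k + 2 := by exact_mod_cast (by omega : j ≤ k + 2)
        have h3 : (k : ℝ) ≤ j + 2 := by exact_mod_cast h.2
        rw [abs_le]; constructor <;> linarith
      have h2 : ((j : ℝ) - k) ^ 2 ≤ 2 ^ 2 := sq_le_sq' (abs_le.1 h1).1 (abs_le.1 h1).2
      have : (x j - x k) ^ 2 = ((j : ℝ) - k) ^ 2 * δ ^ 2 := by simp only [hx]; ring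
      rw [this]
      nlinarith [sq_nonneg δ]
    · have : B j k = 0 := by
        rw [Finset.mem_Icc, not_and_or] at h
        rcases h with h | h
        · rw [hBs]; exact hloc k j (by omega)
        · exact hloc j k (by omega)
      rw [this]; simp
  rw [e1, e2, e4, abs_mul]
  norm_num
  refine (Finset.abs_sum_le_sum_abs _ _).trans ?_
  refine (Finset.sum_le_sum fun j _ => (Finset.abs_sum_le_sum_abs _ _).trans
    (Finset.sum_le_sum fun k _ => hterm j k)).trans ?_
  have hcard : ∀ j, ∑ k ∈ Finset.range (n + 1),
      (if k ∈ Finset.Icc (j - 2) (j + 2) then 4 * δ ^ 2 * A else 0) ≤ 5 * (4 * δ ^ 2 * A) := by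
    intro j
    rw [← Finset.sum_filter, Finset.sum_const, nsmul_eq_mul]
    have : ((Finset.range (n + 1)).filter fun k => k ∈ Finset.Icc (j - 2) (j + 2)).card ≤ 5 := by
      refine (Finset.card_le_card (t := Finset.Icc (j - 2) (j + 2)) fun k hk =>
        (Finset.mem_filter.1 hk).2).trans ?_
      rw [Nat.card_Icc]; omega
    have : (((Finset.range (n + 1)).filter fun k => k ∈ Finset.Icc (j - 2) (j + 2)).card : ℝ) ≤ 5 :=
      by exact_mod_cast this
    gcongr
  refine (Finset.sum_le_sum fun j _ => hcard j).trans ?_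
  simp

/-- A ramp of u lies in the domain only after its value at 0 is subtracted; the condition φ 0 = 0
makes the accumulated constants agree. -/
theorem ae_sub_sum (u : S.dom) {φ : ℝ → ℝ} (w : S.dom)
    (hw : (w : Lp ℝ 2 μ) =ᵐ[μ] fun y => φ ((u : Lp ℝ 2 μ) y)) {r : ℕ → ℝ → ℝ} {v : ℕ → S.dom}
    (hv : ∀ k, (v k : Lp ℝ 2 μ) =ᵐ[μ] fun y => r k ((u : Lp ℝ 2 μ) y) - r k 0)
    (c : ℕ → ℝ) (n : ℕ) (e : S.dom)
    (he : (e : Lp ℝ 2 μ) =ᵐ[μ] fun y =>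
      (φ ((u : Lp ℝ 2 μ) y) - ∑ k ∈ Finset.range n, c k * r k ((u : Lp ℝ 2 μ) y)) -
        (φ 0 - ∑ k ∈ Finset.range n, c k * r k 0)) (h0 : φ 0 = 0) :
    w = ∑ k ∈ Finset.range n, c k • v k + e := by
  apply Subtype.ext
  apply Lp.ext
  have h1 : ∀ᵐ y ∂μ, ((∑ k ∈ Finset.range n, c k • v k : S.dom) : Lp ℝ 2 μ) y =
      ∑ k ∈ Finset.range n, c k * (r k ((u : Lp ℝ 2 μ) y) - r k 0) := by
    have : ((∑ k ∈ Finset.range n, c k • v k : S.dom) : Lp ℝ 2 μ) =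
        ∑ k ∈ Finset.range n, c k • (v k : Lp ℝ 2 μ) := by simp
    rw [this]
    have h2 : ∀ k, ∀ᵐ y ∂μ, (c k • (v k : Lp ℝ 2 μ) : Lp ℝ 2 μ) y =
        c k * (r k ((u : Lp ℝ 2 μ) y) - r k 0) := fun k => by
      filter_upwards [Lp.coeFn_smul (c k) (v k : Lp ℝ 2 μ), hv k] with y h1 h2
      rw [h1, Pi.smul_apply, h2, smul_eq_mul]
    filter_upwards [Lp.coeFn_finsetSum (Finset.range n) fun k => c k • (v k : Lp ℝ 2 μ),
      ae_all_iff.2 h2] with y h3 h4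
    rw [h3, Finset.sum_apply]
    exact Finset.sum_congr rfl fun k _ => h4 k
  filter_upwards [hw, he, h1, Lp.coeFn_add ((∑ k ∈ Finset.range n, c k • v k : S.dom) : Lp ℝ 2 μ)
    (e : Lp ℝ 2 μ)] with y h1 h2 h3 h4
  rw [Submodule.coe_add, h4, Pi.add_apply, h1, h2, h3, h0]
  simp only [mul_sub, Finset.sum_sub_distrib]
  ring

set_option maxHeartbeats 800000 in
-- A chain rule would make both sides equal to 6 ∫ u² γ[u]; here the identity is proved first, from
-- locality alone. On a grid of step δ, φ(u) is replaced by the sum of the ramps v_k weighted by φ'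
-- at the nodes. The error has energy O(δ²), and for φ = x, x², x³ the near-diagonal remainder is
-- O(nδ²) = O(δ).
theorem form_sq_sq_eq (u u₂ u₃ : S.dom) {M : ℝ} (hM : 0 < M)
    (hu : ∀ᵐ y ∂μ, |(u : Lp ℝ 2 μ) y| ≤ M)
    (h₂ : (u₂ : Lp ℝ 2 μ) =ᵐ[μ] fun y => (u : Lp ℝ 2 μ) y ^ 2)
    (h₃ : (u₃ : Lp ℝ 2 μ) =ᵐ[μ] fun y => (u : Lp ℝ 2 μ) y ^ 3) :
    3 * S.form u₂ u₂ = 4 * S.form u u₃ := by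
  set A := S.form u u with hA
  have hA0 : 0 ≤ A := S.nonneg u
  -- The four summands collect, after multiplication by `n`, the cross term and the square of the
  -- error for u², the error for u³, and the near-diagonal sum.
  set C := 6 * √(S.form u₂ u₂) * √A * (4 * M) + 48 * M ^ 2 * A + 4 * A * (12 * M ^ 2) +
    960 * M ^ 2 * A with hC
  have main : ∀ n : ℕ, 0 < n → |3 * S.form u₂ u₂ - 4 * S.form u u₃| ≤ C / n := by
    intro n hn
    have hn' : (1 : ℝ) ≤ n := by exact_mod_cast hn
    have hn0 : (0 : ℝ) < n := by linarith
    set δ := 2 * M / n with hδ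
    have hδ0 : 0 < δ := by positivity
    have hδM : δ ≤ 2 * M := by rw [hδ, div_le_iff₀ hn0]; nlinarith
    have hnδ : n * δ = 2 * M := by rw [hδ]; field_simp
    choose v hv hv' using fun k : ℕ => S.exists_comp_of_bound u hM.le zero_le_one hu
      (hasDerivAt_rampAt M hδ0 k) (fun x _ => by
        rw [abs_of_nonneg (ramp'_nonneg _)]; exact ramp'_le_one _)
    have hvA : ∀ k, S.form (v k) (v k) ≤ A := fun k => by simpa using hv' k
    have hloc : ∀ j k, j + 3 ≤ k → S.form (v j) (v k) = 0 := fun j k hjk =>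
      S.form_rampAt_eq_zero u hM.le hδ0 hu hjk _ _ (hv j) (hv k)
    -- approximation of `φ(u)` by combinations of ramps
    have happ : ∀ (φ φ' : ℝ → ℝ) (c : ℕ → ℝ) (K : ℝ) (w : S.dom), 0 ≤ K → φ 0 = 0 →
        (∀ x, HasDerivAt φ (φ' x) x) →
        (∀ x ∈ Set.Icc (-M) M, ∀ k ∈ Finset.range (n + 1), |x - (k * δ - M)| ≤ δ →
          |φ' x - c k| ≤ K) →
        ((w : Lp ℝ 2 μ) =ᵐ[μ] fun y => φ ((u : Lp ℝ 2 μ) y)) →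
        ∃ e : S.dom, w = ∑ k ∈ Finset.range (n + 1), c k • v k + e ∧
          S.form e e ≤ K ^ 2 * A := by
      intro φ φ' c K w hK h0 hφ hb hw
      -- The derivative of the approximating sum is a convex combination of the `c k` at nodes
      -- within δ of x, by the partition of unity; its distance to φ' x is thus at most `K`.
      have hb' : ∀ x ∈ Set.Icc (-M) M,
          |φ' x - ∑ k ∈ Finset.range (n + 1), c k * ramp' ((x + M) / δ + 1 - k)| ≤ K := by
        intro x hx
        have hy0 : 0 ≤ (x + M) / δ := div_nonneg (by linarith [hx.1]) hδ0.le
        have hyn : (x + M) / δ ≤ n := by rw [div_le_iff₀ hδ0]; linarith [hx.2]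
        have h1 := sum_ramp' n hy0 hyn
        have e : φ' x - ∑ k ∈ Finset.range (n + 1), c k * ramp' ((x + M) / δ + 1 - k) =
            ∑ k ∈ Finset.range (n + 1), (φ' x - c k) * ramp' ((x + M) / δ + 1 - k) := by
          simp only [sub_mul, Finset.sum_sub_distrib, ← Finset.mul_sum]
          rw [h1, mul_one]
        rw [e]
        refine (Finset.abs_sum_le_sum_abs _ _).trans ?_
        calc ∑ k ∈ Finset.range (n + 1), |(φ' x - c k) * ramp' ((x + M) / δ + 1 - k)|
            ≤ ∑ k ∈ Finset.range (n + 1), K * ramp' ((x + M) / δ + 1 - k) := by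
              refine Finset.sum_le_sum fun k hk => ?_
              rw [abs_mul, abs_of_nonneg (ramp'_nonneg _)]
              by_cases hz : ramp' ((x + M) / δ + 1 - k) = 0
              · rw [hz]; simp
              · refine mul_le_mul_of_nonneg_right (hb x hx k hk ?_) (ramp'_nonneg _)
                have a1 : 0 < (x + M) / δ + 1 - k := by
                  by_contra h; exact hz (ramp'_of_nonpos (not_lt.1 h))
                have a2 : (x + M) / δ + 1 - k < 2 := by
                  by_contra h; exact hz (ramp'_of_two_le (not_lt.1 h))
                have a3 : |(x + M) / δ - k| ≤ 1 := by rw [abs_le]; constructor <;> linarith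
                have a4 : x - (k * δ - M) = ((x + M) / δ - k) * δ := by field_simp; ring
                rw [a4, abs_mul, abs_of_pos hδ0]
                nlinarith
          _ = K := by rw [← Finset.mul_sum, h1, mul_one]
      obtain ⟨e, he, he'⟩ := S.exists_comp_of_bound u hM.le hK hu
        (φ := fun x => φ x - ∑ k ∈ Finset.range (n + 1), c k * rampAt M δ k x)
        (φ' := fun x => φ' x - ∑ k ∈ Finset.range (n + 1), c k * ramp' ((x + M) / δ + 1 - k))
        (fun x => by
          refine (hφ x).sub ?_
          have := HasDerivAt.fun_sum (u := Finset.range (n + 1))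
            (fun k _ => (hasDerivAt_rampAt M hδ0 k x).const_mul (c k))
          exact this) hb'
      exact ⟨e, S.ae_sub_sum u w hw hv c (n + 1) e he h0, he'⟩
    -- For the identity all coefficients are 1 and the derivative is reproduced exactly, so `K = 0`.
    -- The error has no energy and drops out of every pairing.
    obtain ⟨e₁, he₁, he₁'⟩ := happ (fun x => x) (fun _ => 1) (fun _ => 1) 0 u le_rfl rfl
      (fun x => hasDerivAt_id x) (fun x _ k _ _ => by simp) (ae_of_all _ fun _ => rfl)
    obtain ⟨e₂, he₂, he₂'⟩ := happ (fun x => x ^ 2) (fun x => 2 * x)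
      (fun k => 2 * (k * δ - M)) (2 * δ) u₂ (by positivity) (by simp)
      (fun x => by simpa using hasDerivAt_pow 2 x) (fun x _ k _ h => by
        rw [← mul_sub, abs_mul, abs_two]; linarith) h₂
    obtain ⟨e₃, he₃, he₃'⟩ := happ (fun x => x ^ 3) (fun x => 3 * x ^ 2)
      (fun k => 3 * (k * δ - M) ^ 2) (6 * M * δ) u₃ (by positivity) (by simp)
      (fun x => by simpa using hasDerivAt_pow 3 x) (fun x hx k hk h => by
        have e : 3 * x ^ 2 - 3 * (k * δ - M) ^ 2 = 3 * (x - (k * δ - M)) * (x + (k * δ - M)) := by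
          ring
        have hk' : (k : ℝ) ≤ n := by exact_mod_cast Nat.lt_succ_iff.1 (Finset.mem_range.1 hk)
        have hk0 : (0 : ℝ) ≤ k := Nat.cast_nonneg k
        have b1 : |x + (k * δ - M)| ≤ 2 * M := by
          have : k * δ ≤ n * δ := by gcongr
          have : 0 ≤ k * δ := by positivity
          rw [abs_le]; constructor <;> linarith [hx.1, hx.2]
        rw [e, abs_mul, abs_mul, abs_of_pos (by norm_num : (0 : ℝ) < 3)]
        nlinarith [abs_nonneg (x - (k * δ - M)), abs_nonneg (x + (k * δ - M))]) h₃
    simp only [one_smul] at he₁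
    set s₁ := ∑ k ∈ Finset.range (n + 1), v k
    set s₂ := ∑ k ∈ Finset.range (n + 1), (2 * (k * δ - M)) • v k
    set s₃ := ∑ k ∈ Finset.range (n + 1), (3 * (k * δ - M) ^ 2) • v k
    have hsum := S.abs_sum_form_le (n := n) (δ := δ) v hA0 hvA M hloc
    have z₁ : ∀ w, S.form e₁ w = 0 := fun w => by
      have h1 := sq_le_mul_of_nonneg S.form S.symm S.nonneg e₁ w
      have h2 : S.form e₁ e₁ = 0 := le_antisymm (by simpa using he₁') (S.nonneg _)
      rw [h2, zero_mul] at h1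
      exact pow_eq_zero_iff two_ne_zero |>.1 (le_antisymm h1 (sq_nonneg _))
    have x₁ : 3 * S.form u₂ u₂ - 4 * S.form u u₃ =
        (3 * S.form s₂ s₂ - 4 * S.form s₁ s₃) + 6 * S.form u₂ e₂ - 3 * S.form e₂ e₂ -
          4 * S.form u e₃ := by
      have t1 : S.form s₂ s₂ = S.form u₂ u₂ - 2 * S.form u₂ e₂ + S.form e₂ e₂ := by
        have : s₂ = u₂ - e₂ := by rw [he₂]; abel
        rw [this]
        simp only [map_sub, LinearMap.sub_apply, S.symm e₂ u₂]; ring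
      have t2 : S.form s₁ s₃ = S.form u u₃ - S.form u e₃ := by
        have a1 : s₁ = u - e₁ := eq_sub_of_add_eq he₁.symm
        have a3 : s₃ = u₃ - e₃ := by rw [he₃]; abel
        rw [a1, map_sub, LinearMap.sub_apply, z₁, a3, map_sub]; ring
      rw [t1, t2]; ring
    have b₂ : |S.form u₂ e₂| ≤ √(S.form u₂ u₂) * (√A * (2 * δ)) := by
      refine (S.toClosedForm.abs_form_le u₂ e₂).trans ?_
      refine mul_le_mul_of_nonneg_left ?_ (Real.sqrt_nonneg _)
      refine Real.sqrt_le_iff.2 ⟨by positivity, ?_⟩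
      rw [mul_pow, Real.sq_sqrt hA0, mul_comm]; exact he₂'
    have b₃ : |S.form u e₃| ≤ A * (6 * M * δ) := by
      refine abs_le_of_sq_le_sq ?_ (by positivity)
      refine (sq_le_mul_of_nonneg S.form S.symm S.nonneg u e₃).trans ?_
      rw [← hA]
      nlinarith
    have b₄ : |S.form e₂ e₂| ≤ 8 * M * δ * A := by
      rw [abs_of_nonneg (S.nonneg _)]
      refine he₂'.trans ?_
      refine mul_le_mul_of_nonneg_right ?_ hA0
      nlinarith
    -- One factor δ is absorbed by the number of nodes, because (n + 1)δ ≤ 4M.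
    have b₁ : 6 * (((n : ℝ) + 1) * (5 * (4 * δ ^ 2 * A))) ≤ 480 * M * δ * A := by
      have : ((n : ℝ) + 1) * δ ≤ 4 * M := by linarith
      calc 6 * (((n : ℝ) + 1) * (5 * (4 * δ ^ 2 * A))) =
            120 * (((n : ℝ) + 1) * δ) * δ * A := by ring
        _ ≤ 120 * (4 * M) * δ * A := by gcongr
        _ = _ := by ring
    have hfin : C / n = 6 * (√(S.form u₂ u₂) * (√A * (2 * δ))) + 3 * (8 * M * δ * A) +
        4 * (A * (6 * M * δ)) + 480 * M * δ * A := by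
      rw [hC, hδ]; field_simp; ring
    rw [x₁, hfin]
    have t := hsum.trans b₁
    rw [abs_le] at *
    constructor <;> linarith [t.1, t.2, b₂.1, b₂.2, b₃.1, b₃.2, b₄.1, b₄.2]
  have hlim : Tendsto (fun n : ℕ => C / n) atTop (𝓝 0) := tendsto_const_div_atTop_nhds_zero_nat C
  have : |3 * S.form u₂ u₂ - 4 * S.form u u₃| ≤ 0 :=
    ge_of_tendsto hlim ((eventually_gt_atTop 0).mono main)
  linarith [abs_nonpos_iff.1 this]

end LocalDirichletStructure

end PoissonDirichlet
end

/-! ### Polarization and the Leibniz rule for γ -/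

noncomputable section

namespace PoissonDirichlet

/-- A symmetric function of four variables, additive in each of them, vanishes if it vanishes on
the diagonal. -/
theorem eq_zero_of_diag_eq_zero {V : Type*} [AddCommGroup V] (T : V → V → V → V → ℝ)
    (hadd : ∀ a a' b c d, T (a + a') b c d = T a b c d + T a' b c d)
    (h12 : ∀ a b c d, T a b c d = T b a c d) (h23 : ∀ a b c d, T a b c d = T a c b d)
    (h34 : ∀ a b c d, T a b c d = T a b d c) (h : ∀ u, T u u u u = 0) (a b c d : V) :
    T a b c d = 0 := by
  have hadd2 : ∀ a b b' c d, T a (b + b') c d = T a b c d + T a b' c d := fun a b b' c d => by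
    rw [h12, hadd, h12 b, h12 b']
  have hadd3 : ∀ a b c c' d, T a b (c + c') d = T a b c d + T a b c' d := fun a b c c' d => by
    rw [h23, hadd2, h23 a c, h23 a c']
  have hadd4 : ∀ a b c d d', T a b c (d + d') = T a b c d + T a b c d' := fun a b c d d' => by
    rw [h34, hadd3, h34 a b d, h34 a b d']
  -- Expanding the diagonal at u + v, u + 2v and u + 3v gives three independent linear equations for
  -- the three mixed terms. Additivity alone is used, so no scalars enter.
  have k1 : ∀ u v, T u u u v = 0 := fun u v => by
    have h1 := h (u + v)
    have h2 := h (u + v + v)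
    have h3 := h (u + v + v + v)
    have h4 := h u
    have h5 := h v
    have p1 : T u u v u = T u u u v := h34 _ _ _ _
    have p2 : T u v u u = T u u u v := by rw [h23, p1]
    have p3 : T v u u u = T u u u v := by rw [h12, p2]
    have q1 : T u v u v = T u u v v := h23 _ _ _ _
    have q2 : T v u u v = T u u v v := by rw [h12, q1]
    have q3 : T u v v u = T u u v v := by rw [h34, q1]
    have q4 : T v u v u = T u u v v := by rw [h12, q3]
    have q5 : T v v u u = T u u v v := by rw [h23, q4]
    have r1 : T v u v v = T u v v v := h12 _ _ _ _
    have r2 : T v v u v = T u v v v := by rw [h23, r1]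
    have r3 : T v v v u = T u v v v := by rw [h34, r2]
    simp only [hadd, hadd2, hadd3, hadd4, p1, p2, p3, q1, q2, q3, q4, q5, r1, r2, r3, h4, h5]
      at h1 h2 h3
    linarith
  -- The same elimination for the cubic form T u u u w, now with two mixed terms and the points u +
  -- v and u + 2v.
  have k2 : ∀ u v w, T u u v w = 0 := fun u v w => by
    have h1 := k1 (u + v) w
    have h2 := k1 (u + v + v) w
    have h3 := k1 u w
    have h4 := k1 v w
    have p1 : T u v u w = T u u v w := h23 _ _ _ _
    have p2 : T v u u w = T u u v w := by rw [h12, p1]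
    have q1 : T v u v w = T u v v w := h12 _ _ _ _
    have q2 : T v v u w = T u v v w := by rw [h23, q1]
    simp only [hadd, hadd2, hadd3, p1, p2, q1, q2, h3, h4] at h1 h2
    linarith
  have h1 := k2 (a + b) c d
  simp only [hadd, hadd2, k2, h12 b a] at h1
  linarith

namespace LocalDirichletStructure

variable {Y : Type*} [MeasurableSpace Y] {μ : Measure Y} (S : LocalDirichletStructure μ)

theorem bform_sq_sq_eq (u : S.bdom) :
    3 * S.bform (u * u) (u * u) = 4 * S.bform u (u * u * u) := by
  obtain ⟨M, hM⟩ := u.2.2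
  refine S.form_sq_sq_eq (S.ofBdom u) (S.ofBdom (u * u)) (S.ofBdom (u * u * u))
    (M := |M| + 1) (by positivity) ?_ ?_ ?_
  · filter_upwards [hM] with y hy
    exact hy.trans ((le_abs_self M).trans (by linarith))
  · filter_upwards [AEEqFun.coeFn_mul (u : Y →ₘ[μ] ℝ) u] with y hy
    rw [DirichletForm.coeFn_ofBdom, DirichletForm.coeFn_ofBdom]
    change ((u : Y →ₘ[μ] ℝ) * u : Y →ₘ[μ] ℝ) y = _
    rw [hy, Pi.mul_apply]; ring
  · filter_upwards [AEEqFun.coeFn_mul (u : Y →ₘ[μ] ℝ) u,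
      AEEqFun.coeFn_mul ((u : Y →ₘ[μ] ℝ) * (u : Y →ₘ[μ] ℝ)) (u : Y →ₘ[μ] ℝ)] with y h1 h2
    rw [DirichletForm.coeFn_ofBdom, DirichletForm.coeFn_ofBdom]
    change ((u : Y →ₘ[μ] ℝ) * u * u : Y →ₘ[μ] ℝ) y = _
    rw [h2, Pi.mul_apply, h1, Pi.mul_apply]; ring

/-- The difference of the two sides is symmetric and additive in each variable, and on the diagonal
it is the identity `bform_sq_sq_eq`. -/
theorem bform_polarized (f g h k : S.bdom) :
    S.bform f (g * h * k) + S.bform g (f * h * k) + S.bform h (f * g * k) +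
      S.bform k (f * g * h) =
    S.bform (f * g) (h * k) + S.bform (f * h) (g * k) + S.bform (f * k) (g * h) := by
  have key := eq_zero_of_diag_eq_zero (fun f g h k : S.bdom =>
    S.bform f (g * h * k) + S.bform g (f * h * k) + S.bform h (f * g * k) +
      S.bform k (f * g * h) -
    (S.bform (f * g) (h * k) + S.bform (f * h) (g * k) + S.bform (f * k) (g * h)))
    (fun a a' b c d => by
      simp only [add_mul, map_add, LinearMap.add_apply]; ring)
    (fun a b c d => by
      rw [mul_comm b a, S.bform_symm (b * c) (a * d), S.bform_symm (b * d) (a * c)]; ring)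
    (fun a b c d => by
      rw [mul_comm c b, mul_right_comm a c b]; ring)
    (fun a b c d => by
      rw [mul_comm d c, mul_right_comm b d c, mul_right_comm a d c]; ring)
    (fun u => by
      have := S.bform_sq_sq_eq u
      linarith) f g h k
  beta_reduce at key
  linarith

theorem integral_mul_gamma (f g h : S.bdom) :
    ∫ y, (h : Y →ₘ[μ] ℝ) y * S.gamma (S.ofBdom f) (S.ofBdom g) y ∂μ =
      S.bform (f * h) g + S.bform (g * h) f - S.bform h (f * g) :=
  (S.gamma_spec (S.ofBdom f) (S.ofBdom g) (S.ofBdom h) (S.ofBdom (f * h)) (S.ofBdom (g * h))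
    (S.ofBdom (f * g)) (S.memLp_top_ofBdom f) (S.memLp_top_ofBdom g) (S.memLp_top_ofBdom h)
    (AEEqFun.coeFn_mul (f : Y →ₘ[μ] ℝ) h) (AEEqFun.coeFn_mul (g : Y →ₘ[μ] ℝ) h)
    (AEEqFun.coeFn_mul (f : Y →ₘ[μ] ℝ) g)).symm

theorem integrable_bdom_mul (k : S.bdom) {θ : Y → ℝ} (hθ : Integrable θ μ) :
    Integrable (fun y => (k : Y →ₘ[μ] ℝ) y * θ y) μ := by
  obtain ⟨M, hM⟩ := k.2.2
  exact hθ.bdd_mul (c := M) (k : Y →ₘ[μ] ℝ).aestronglyMeasurable hM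

/-- The bounded elements of the domain separate the integrable functions. -/
theorem ae_eq_zero_of_forall_bdom [SigmaFinite μ] {θ : Y → ℝ} (hθ : Integrable θ μ)
    (h : ∀ k : S.bdom, ∫ y, (k : Y →ₘ[μ] ℝ) y * θ y ∂μ = 0) : θ =ᵐ[μ] 0 := by
  refine ae_eq_zero_of_forall_setIntegral_eq_of_sigmaFinite (fun _ _ _ => hθ.integrableOn)
    fun B hB hB' => ?_
  let b : Lp ℝ 2 μ := indicatorConstLp 2 hB hB'.ne (1 : ℝ)
  have hb : b =ᵐ[μ] B.indicator fun _ => 1 := indicatorConstLp_coeFn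
  obtain ⟨k, hk, hk'⟩ := mem_closure_iff_seq_limit.1 (S.dense b)
  obtain ⟨ns, -, hns⟩ := exists_seq_tendsto_ae_of_L2 hk'
  -- Truncating the approximations of the indicator to [0, 1] keeps them in the domain and bounds
  -- them by 1, so |θ| is a dominating function.
  let T : ℝ → ℝ := fun t => max 0 (min t 1)
  have hT : LipschitzWith 1 T := (LipschitzWith.id.min_const 1).const_max 0
  choose v hv _ using fun n => S.contraction T hT (by simp [T]) ⟨k (ns n), hk (ns n)⟩
  have hT1 : ∀ t, |T t| ≤ 1 := fun t => by
    rw [abs_of_nonneg (le_max_left _ _)]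
    exact max_le zero_le_one (min_le_right _ _)
  have hvb : ∀ n, ∃ M : ℝ, ∀ᵐ y ∂μ, |(v n : Lp ℝ 2 μ) y| ≤ M := fun n =>
    ⟨1, (hv n).mono fun y hy => by rw [hy]; exact hT1 _⟩
  have h0 : ∀ n, ∫ y, (v n : Lp ℝ 2 μ) y * θ y ∂μ = 0 := fun n => h (S.toBdom (v n) (hvb n))
  have hlim : Tendsto (fun n => ∫ y, (v n : Lp ℝ 2 μ) y * θ y ∂μ) atTop
      (𝓝 (∫ y, B.indicator (fun _ => 1) y * θ y ∂μ)) := by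
    refine tendsto_integral_of_dominated_convergence (fun y => ‖θ y‖)
      (fun n => (Lp.aestronglyMeasurable _).mul hθ.aestronglyMeasurable) hθ.norm (fun n => ?_) ?_
    · filter_upwards [hv n] with y hy
      rw [hy, norm_mul]
      exact mul_le_of_le_one_left (norm_nonneg _) (hT1 _)
    · filter_upwards [hns, ae_all_iff.2 hv, hb] with y h1 h2 h3
      refine Tendsto.mul_const _ ?_
      have h4 := (hT.continuous.tendsto (b y)).comp h1
      have h5 : T (b y) = B.indicator (fun _ => 1) y := by
        rw [h3]
        by_cases hy : y ∈ B <;> simp [hy, T]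
      rw [h5] at h4
      exact h4.congr fun n => (h2 n).symm
  simp only [h0] at hlim
  have h1 := tendsto_nhds_unique hlim tendsto_const_nhds
  rw [← integral_indicator hB, ← h1]
  refine integral_congr_ae (ae_of_all _ fun y => ?_)
  by_cases hy : y ∈ B <;> simp [hy]

/-- `γ` is a derivation on bounded elements. -/
theorem gamma_mul [SigmaFinite μ] (f g h : S.bdom) :
    S.gamma (S.ofBdom (f * g)) (S.ofBdom h) =ᵐ[μ] fun y =>
      (f : Y →ₘ[μ] ℝ) y * S.gamma (S.ofBdom g) (S.ofBdom h) y +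
        (g : Y →ₘ[μ] ℝ) y * S.gamma (S.ofBdom f) (S.ofBdom h) y := by
  have i1 := integrable_coeFn_L1 (S.gamma (S.ofBdom (f * g)) (S.ofBdom h))
  have i2 := S.integrable_bdom_mul f (integrable_coeFn_L1 (S.gamma (S.ofBdom g) (S.ofBdom h)))
  have i3 := S.integrable_bdom_mul g (integrable_coeFn_L1 (S.gamma (S.ofBdom f) (S.ofBdom h)))
  have key := S.ae_eq_zero_of_forall_bdom (i1.sub (i2.add i3)) fun k => by
    have e1 : ∫ y, (k : Y →ₘ[μ] ℝ) y * ((f : Y →ₘ[μ] ℝ) y *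
        S.gamma (S.ofBdom g) (S.ofBdom h) y) ∂μ =
        ∫ y, ((k * f : S.bdom) : Y →ₘ[μ] ℝ) y * S.gamma (S.ofBdom g) (S.ofBdom h) y ∂μ := by
      refine integral_congr_ae ?_
      filter_upwards [AEEqFun.coeFn_mul (k : Y →ₘ[μ] ℝ) f] with y hy
      change _ = ((k : Y →ₘ[μ] ℝ) * f : Y →ₘ[μ] ℝ) y * _
      rw [hy, Pi.mul_apply]; ring
    have e2 : ∫ y, (k : Y →ₘ[μ] ℝ) y * ((g : Y →ₘ[μ] ℝ) y *
        S.gamma (S.ofBdom f) (S.ofBdom h) y) ∂μ =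
        ∫ y, ((k * g : S.bdom) : Y →ₘ[μ] ℝ) y * S.gamma (S.ofBdom f) (S.ofBdom h) y ∂μ := by
      refine integral_congr_ae ?_
      filter_upwards [AEEqFun.coeFn_mul (k : Y →ₘ[μ] ℝ) g] with y hy
      change _ = ((k : Y →ₘ[μ] ℝ) * g : Y →ₘ[μ] ℝ) y * _
      rw [hy, Pi.mul_apply]; ring
    have i4 : Integrable (fun y => (k : Y →ₘ[μ] ℝ) y * ((f : Y →ₘ[μ] ℝ) y *
          S.gamma (S.ofBdom g) (S.ofBdom h) y) + (k : Y →ₘ[μ] ℝ) y * ((g : Y →ₘ[μ] ℝ) y *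
          S.gamma (S.ofBdom f) (S.ofBdom h) y)) μ :=
      (S.integrable_bdom_mul k i2).add (S.integrable_bdom_mul k i3)
    have e3 : ∫ y, (k : Y →ₘ[μ] ℝ) y * (S.gamma (S.ofBdom (f * g)) (S.ofBdom h) y -
        ((f : Y →ₘ[μ] ℝ) y * S.gamma (S.ofBdom g) (S.ofBdom h) y +
        (g : Y →ₘ[μ] ℝ) y * S.gamma (S.ofBdom f) (S.ofBdom h) y)) ∂μ =
        ∫ y, (k : Y →ₘ[μ] ℝ) y * S.gamma (S.ofBdom (f * g)) (S.ofBdom h) y ∂μ -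
        (∫ y, (k : Y →ₘ[μ] ℝ) y * ((f : Y →ₘ[μ] ℝ) y *
          S.gamma (S.ofBdom g) (S.ofBdom h) y) ∂μ +
        ∫ y, (k : Y →ₘ[μ] ℝ) y * ((g : Y →ₘ[μ] ℝ) y *
          S.gamma (S.ofBdom f) (S.ofBdom h) y) ∂μ) := by
      rw [← integral_add (S.integrable_bdom_mul k i2) (S.integrable_bdom_mul k i3),
        ← integral_sub (S.integrable_bdom_mul k i1) i4]
      refine integral_congr_ae (ae_of_all _ fun y => ?_)
      ring
    refine Eq.trans e3 ?_
    -- Absorbing f or g into the test function writes all three integrals through the form. After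
    -- the common terms cancel, the vanishing of the difference is exactly the polarized identity.
    rw [e1, e2, S.integral_mul_gamma, S.integral_mul_gamma, S.integral_mul_gamma]
    have := S.bform_polarized f g h k
    have a1 : f * g * k = g * (k * f) := by rw [mul_comm f g, mul_assoc, mul_comm f k]
    have a2 : f * g * k = f * (k * g) := by rw [mul_assoc, mul_comm g k]
    have a3 : h * (k * f) = f * h * k := by rw [mul_comm k f, ← mul_assoc, mul_comm h f]
    have a4 : h * (k * g) = g * h * k := by rw [mul_comm k g, ← mul_assoc, mul_comm h g]
    rw [← a1, ← a2, a3, a4, S.bform_symm (f * h * k) g, S.bform_symm (g * h * k) f,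
      S.bform_symm (f * g * k) h, mul_comm k f, mul_comm k g, mul_comm h k,
      S.bform_symm (k * h) (f * g), S.bform_symm (g * k) (f * h), mul_comm k h]
    linarith
  filter_upwards [key] with y hy
  exact sub_eq_zero.1 hy

end LocalDirichletStructure

end PoissonDirichlet
end

/-! ### Dominated convergence in L² -/

noncomputable section

namespace PoissonDirichlet

section L2

variable {Y 𝕜 : Type*} [MeasurableSpace Y] {μ : Measure Y} [RCLike 𝕜]

theorem L2_norm_sq (f : Lp 𝕜 2 μ) : ‖f‖ ^ 2 = ∫ y, ‖f y‖ ^ 2 ∂μ := by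
  have h : inner 𝕜 f f = ((∫ y, ‖f y‖ ^ 2 ∂μ : ℝ) : 𝕜) := by
    rw [L2.inner_def, ← integral_ofReal]
    refine integral_congr_ae (ae_of_all _ fun y => ?_)
    simp [inner_self_eq_norm_sq_to_K]
  rw [inner_self_eq_norm_sq_to_K] at h
  exact_mod_cast h

/-- Dominated convergence in `L²`. -/
theorem tendsto_L2_of_dominated {g : ℕ → Lp 𝕜 2 μ} {g₀ : Lp 𝕜 2 μ} (b : Lp 𝕜 2 μ)
    (hb : ∀ n, ∀ᵐ y ∂μ, ‖g n y - g₀ y‖ ≤ ‖b y‖)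
    (h : ∀ᵐ y ∂μ, Tendsto (fun n => g n y) atTop (𝓝 (g₀ y))) : Tendsto g atTop (𝓝 g₀) := by
  rw [tendsto_iff_norm_sub_tendsto_zero]
  have h1 : Tendsto (fun n => ‖g n - g₀‖ ^ 2) atTop (𝓝 (∫ _, (0 : ℝ) ∂μ)) := by
    simp only [L2_norm_sq]
    refine tendsto_integral_of_dominated_convergence (fun y => ‖b y‖ ^ 2)
      (fun n => ((Lp.aestronglyMeasurable _).norm.pow 2))
      ((Lp.memLp b).integrable_norm_pow (by norm_num))
      (fun n => ?_) ?_
    · filter_upwards [hb n, Lp.coeFn_sub (g n) g₀] with y h1 h2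
      rw [h2, Pi.sub_apply, Real.norm_of_nonneg (by positivity)]
      gcongr
    · filter_upwards [h, ae_all_iff.2 fun n => Lp.coeFn_sub (g n) g₀] with y h1 h2
      have := ((h1.sub_const (g₀ y)).norm).pow 2
      simp only [sub_self, norm_zero] at this
      simp only [h2, Pi.sub_apply]
      simpa using this
  have h2 : Tendsto (fun n => √(‖g n - g₀‖ ^ 2)) atTop (𝓝 (√0)) := by
    refine (Real.continuous_sqrt.tendsto 0).comp ?_
    simpa using h1
  simpa using h2

end L2

/-! ### Polynomial approximation -/

theorem exists_polynomial_derivative_eq (q : Polynomial ℝ) :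
    ∃ p : Polynomial ℝ, p.derivative = q := by
  induction q using Polynomial.induction_on' with
  | add p q hp hq =>
    obtain ⟨a, rfl⟩ := hp
    obtain ⟨b, rfl⟩ := hq
    exact ⟨a + b, by simp⟩
  | monomial n a =>
    refine ⟨Polynomial.monomial (n + 1) (a / (n + 1)), ?_⟩
    rw [Polynomial.derivative_monomial]
    have : ((n : ℝ) + 1) ≠ 0 := by positivity
    simp [div_mul_cancel₀ a this]

/-- A continuously differentiable function is approximated, together with its derivative, by
polynomials. -/
theorem exists_polynomial_near_deriv {φ φ' : ℝ → ℝ} (hφ : ∀ x, HasDerivAt φ (φ' x) x)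
    (hφ' : Continuous φ') {M : ℝ} (hM : 0 ≤ M) {ε : ℝ} (hε : 0 < ε) :
    ∃ p : Polynomial ℝ, p.eval 0 = φ 0 ∧
      (∀ x ∈ Set.Icc (-M) M, |p.derivative.eval x - φ' x| ≤ ε) ∧
      ∀ x ∈ Set.Icc (-M) M, |p.eval x - φ x| ≤ ε * |x| := by
  obtain ⟨q, hq⟩ := exists_polynomial_near_of_continuousOn (-M) M φ' hφ'.continuousOn ε hε
  obtain ⟨p, rfl⟩ := exists_polynomial_derivative_eq q
  refine ⟨p + Polynomial.C (φ 0 - p.eval 0), by simp, fun x hx => by simpa using (hq x hx).le,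
    fun x hx => ?_⟩
  have h1 : ∀ x ∈ Set.Icc (-M) M, HasDerivWithinAt
      (fun x => (p + Polynomial.C (φ 0 - p.eval 0)).eval x - φ x)
      (p.derivative.eval x - φ' x) (Set.Icc (-M) M) x := fun x _ => by
    have := (p + Polynomial.C (φ 0 - p.eval 0)).hasDerivAt x
    simp only [Polynomial.derivative_add, Polynomial.derivative_C, add_zero] at this
    exact (this.sub (hφ x)).hasDerivWithinAt
  have h2 := (convex_Icc (-M) M).norm_image_sub_le_of_norm_hasDerivWithin_le h1
    (fun x hx => (hq x hx).le) (x := 0) (y := x) ⟨by linarith, hM⟩ hx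
  simpa using h2

namespace DirichletForm

variable {Y : Type*} [MeasurableSpace Y] {μ : Measure Y} (E : DirichletForm μ)

/-- Every element of the domain is the limit, for the energy norm, of its truncations. -/
theorem exists_truncation (u : E.dom) : ∃ t : ℕ → E.dom,
    (∀ n, ∀ᵐ y ∂μ, |(t n : Lp ℝ 2 μ) y| ≤ n) ∧
    (∀ n, ∀ᵐ y ∂μ, |(t n : Lp ℝ 2 μ) y| ≤ |(u : Lp ℝ 2 μ) y|) ∧
    (∀ᵐ y ∂μ, Tendsto (fun n => (t n : Lp ℝ 2 μ) y) atTop (𝓝 ((u : Lp ℝ 2 μ) y))) ∧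
    (∀ n, E.form (t n) (t n) ≤ E.form u u) ∧
    Tendsto (fun n => E.form (t n - u) (t n - u)) atTop (𝓝 0) := by
  have hT : ∀ n : ℕ, LipschitzWith 1 (fun t : ℝ => max (-(n : ℝ)) (min t n)) := fun n =>
    (LipschitzWith.id.min_const _).const_max _
  choose t ht ht' using fun n : ℕ => E.contraction _ (hT n) (by simp) u
  have hle : ∀ (n : ℕ) (x : ℝ), |max (-(n : ℝ)) (min x n)| ≤ |x| := fun n x => by
    have := (hT n).dist_le_mul x 0
    simpa [Real.dist_eq] using this
  have hlim : ∀ᵐ y ∂μ, Tendsto (fun n => (t n : Lp ℝ 2 μ) y) atTop (𝓝 ((u : Lp ℝ 2 μ) y)) := by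
    filter_upwards [ae_all_iff.2 ht] with y hy
    simp only [hy]
    refine tendsto_const_nhds.congr' ?_
    obtain ⟨N, hN⟩ := exists_nat_ge |(u : Lp ℝ 2 μ) y|
    filter_upwards [eventually_ge_atTop N] with n hn
    have hn' : |(u : Lp ℝ 2 μ) y| ≤ n := hN.trans (by exact_mod_cast hn)
    rw [min_eq_left (abs_le.1 hn').2, max_eq_right (abs_le.1 hn').1]
  refine ⟨t, fun n => ?_, fun n => ?_, hlim, ht', ?_⟩
  · filter_upwards [ht n] with y hy
    rw [hy, abs_le]
    exact ⟨le_max_left _ _, max_le (by linarith [Nat.cast_nonneg (α := ℝ) n]) (min_le_right _ _)⟩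
  · filter_upwards [ht n] with y hy
    rw [hy]; exact hle n _
  -- Truncation never increases the energy, so L² convergence is automatically energy convergence.
  · refine E.toClosedForm.tendsto_form_sub ?_ ht'
    refine tendsto_L2_of_dominated ((2 : ℝ) • (u : Lp ℝ 2 μ)) (fun n => ?_) hlim
    filter_upwards [ht n, Lp.coeFn_smul (2 : ℝ) (u : Lp ℝ 2 μ)] with y h1 h2
    rw [h1, h2, Pi.smul_apply, smul_eq_mul, norm_mul]
    refine (norm_sub_le _ _).trans ?_
    have := hle n ((u : Lp ℝ 2 μ) y)
    simp only [Real.norm_eq_abs, abs_two]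
    linarith

end DirichletForm

/-! ### The chain rule on the base space -/

namespace LocalDirichletStructure

variable {Y : Type*} [MeasurableSpace Y] {μ : Measure Y} (S : LocalDirichletStructure μ)

theorem form_eq_integral_gamma (u v : S.dom) : S.form u v = 1 / 2 * ∫ y, S.gamma u v y ∂μ := by
  have e : ∀ w, S.form w w = 1 / 2 * integralForm S.gamma w w := S.energy
  have h1 := e (u + v)
  have h2 := e u
  have h3 := e v
  have h4 : integralForm S.gamma v u = integralForm S.gamma u v := by
    rw [integralForm_apply, integralForm_apply, S.gamma_symm]
  simp only [map_add, LinearMap.add_apply, S.symm v u, h4] at h1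
  rw [← integralForm_apply]
  linarith

variable [SigmaFinite μ]

/-- The bounded elements form an algebra without unit, since constants need not be in L². Hence only
polynomials without constant term are used, written X q, and the Leibniz rule gives the induction on
the degree. -/
theorem exists_mul_eval (u : S.bdom) (q : Polynomial ℝ) : ∃ w : S.bdom,
    ((w : Y →ₘ[μ] ℝ) =ᵐ[μ] fun y => (u : Y →ₘ[μ] ℝ) y * q.eval ((u : Y →ₘ[μ] ℝ) y)) ∧
    ∀ h : S.bdom, S.gamma (S.ofBdom w) (S.ofBdom h) =ᵐ[μ] fun y =>
      (Polynomial.X * q).derivative.eval ((u : Y →ₘ[μ] ℝ) y) *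
        S.gamma (S.ofBdom u) (S.ofBdom h) y := by
  induction q using Polynomial.induction_on with
  | C a =>
    refine ⟨a • u, ?_, fun h => ?_⟩
    · filter_upwards [AEEqFun.coeFn_smul a (u : Y →ₘ[μ] ℝ)] with y hy
      change (a • (u : Y →ₘ[μ] ℝ)) y = _
      rw [hy]
      simp [mul_comm]
    · rw [map_smul, map_smul, LinearMap.smul_apply]
      filter_upwards [Lp.coeFn_smul a (S.gamma (S.ofBdom u) (S.ofBdom h))] with y hy
      rw [hy]
      simp
  | add p q hp hq =>
    obtain ⟨v, hv, hv'⟩ := hp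
    obtain ⟨w, hw, hw'⟩ := hq
    refine ⟨v + w, ?_, fun h => ?_⟩
    · filter_upwards [AEEqFun.coeFn_add (v : Y →ₘ[μ] ℝ) w, hv, hw] with y h1 h2 h3
      change ((v : Y →ₘ[μ] ℝ) + w) y = _
      rw [h1, Pi.add_apply, h2, h3, Polynomial.eval_add, mul_add]
    · rw [map_add, map_add, LinearMap.add_apply]
      filter_upwards [Lp.coeFn_add (S.gamma (S.ofBdom v) (S.ofBdom h))
        (S.gamma (S.ofBdom w) (S.ofBdom h)), hv' h, hw' h] with y h1 h2 h3
      rw [h1, Pi.add_apply, h2, h3, mul_add, Polynomial.derivative_add, Polynomial.eval_add,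
        add_mul]
  | monomial n a hn =>
    obtain ⟨w, hw, hw'⟩ := hn
    refine ⟨u * w, ?_, fun h => ?_⟩
    · filter_upwards [AEEqFun.coeFn_mul (u : Y →ₘ[μ] ℝ) w, hw] with y h1 h2
      change ((u : Y →ₘ[μ] ℝ) * w) y = _
      rw [h1, Pi.mul_apply, h2]
      simp only [Polynomial.eval_mul, Polynomial.eval_C, Polynomial.eval_pow, Polynomial.eval_X]
      ring
    · filter_upwards [S.gamma_mul u w h, hw, hw' h] with y h1 h2 h3
      rw [h1, h2, h3]
      simp only [Polynomial.derivative_mul, Polynomial.derivative_X, Polynomial.derivative_C,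
        Polynomial.derivative_X_pow, Polynomial.eval_mul, Polynomial.eval_C, Polynomial.eval_pow,
        Polynomial.eval_X, Polynomial.eval_add, Polynomial.eval_one, Polynomial.eval_zero]
      cases n with
      | zero => simp; ring
      | succ m => simp; ring

/-- The chain rule, for bounded functions and in integrated form. -/
theorem form_comp_of_bdom (u h : S.bdom) {φ φ' : ℝ → ℝ} (hφ : ∀ x, HasDerivAt φ (φ' x) x)
    (hφ' : Continuous φ') (h0 : φ 0 = 0) (v : S.dom)
    (hv : (v : Lp ℝ 2 μ) =ᵐ[μ] fun y => φ ((u : Y →ₘ[μ] ℝ) y)) :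
    S.form v (S.ofBdom h) =
      1 / 2 * ∫ y, φ' ((u : Y →ₘ[μ] ℝ) y) * S.gamma (S.ofBdom u) (S.ofBdom h) y ∂μ := by
  obtain ⟨M, hM, hu⟩ : ∃ M : ℝ, 0 ≤ M ∧ ∀ᵐ y ∂μ, |(u : Y →ₘ[μ] ℝ) y| ≤ M := by
    obtain ⟨M, hM⟩ := u.2.2
    exact ⟨|M|, abs_nonneg M, hM.mono fun y hy => hy.trans (le_abs_self M)⟩
  obtain ⟨K, hK⟩ := isCompact_Icc.exists_bound_of_continuousOn (s := Set.Icc (-M) M)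
    hφ'.continuousOn
  have hK0 : 0 ≤ K := (norm_nonneg _).trans (hK 0 ⟨by linarith, hM⟩)
  choose p hp0 hp1 hp2 using fun n : ℕ =>
    exists_polynomial_near_deriv hφ hφ' hM (ε := 1 / ((n : ℝ) + 1)) (by positivity)
  have hε : ∀ n : ℕ, 1 / ((n : ℝ) + 1) ≤ 1 := fun n => by
    rw [div_le_one (by positivity)]; linarith [Nat.cast_nonneg (α := ℝ) n]
  have hdb : ∀ n, ∀ x ∈ Set.Icc (-M) M, |(p n).derivative.eval x| ≤ K + 1 := fun n x hx => by
    have h1 := hp1 n x hx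
    have h2 : |φ' x| ≤ K := hK x hx
    calc |(p n).derivative.eval x| = |φ' x + ((p n).derivative.eval x - φ' x)| := by ring_nf
      _ ≤ |φ' x| + |(p n).derivative.eval x - φ' x| := abs_add_le _ _
      _ ≤ K + 1 := add_le_add h2 (h1.trans (hε n))
  -- The approximating polynomials agree with φ at 0, where φ vanishes, so they are divisible by X.
  have hX : ∀ n, p n = Polynomial.X * (p n).divX := fun n => by
    have := Polynomial.X_mul_divX_add (p n)
    rw [Polynomial.coeff_zero_eq_eval_zero, hp0, h0, Polynomial.C_0, add_zero] at this
    exact this.symm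
  choose w hw hw' using fun n => S.exists_mul_eval u (p n).divX
  have hwp : ∀ n, (w n : Y →ₘ[μ] ℝ) =ᵐ[μ] fun y => (p n).eval ((u : Y →ₘ[μ] ℝ) y) := fun n => by
    filter_upwards [hw n] with y hy
    rw [hy]; nth_rewrite 2 [hX n]; simp
  -- The derivatives are uniformly bounded on the range of u, hence so are the energies. This is
  -- what upgrades L² convergence to weak convergence for the form.
  have hform : ∀ n, S.form (S.ofBdom (w n)) (S.ofBdom (w n)) ≤
      (K + 1) ^ 2 * S.form (S.ofBdom u) (S.ofBdom u) := fun n => by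
    obtain ⟨z, hz, hz'⟩ := S.exists_comp_of_bound (S.ofBdom u) hM (by positivity : 0 ≤ K + 1) hu
      (fun x => (p n).hasDerivAt x) (hdb n)
    have : z = S.ofBdom (w n) := by
      apply Subtype.ext
      apply Lp.ext
      filter_upwards [hz, hwp n] with y h1 h2
      rw [h1, DirichletForm.coeFn_ofBdom, DirichletForm.coeFn_ofBdom, h2, hp0, h0, sub_zero]
    rwa [this] at hz'
  have hL2 : Tendsto (fun n => (S.ofBdom (w n) : Lp ℝ 2 μ)) atTop (𝓝 (v : Lp ℝ 2 μ)) := by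
    refine tendsto_L2_of_dominated (S.ofBdom u : Lp ℝ 2 μ) (fun n => ?_) ?_
    · filter_upwards [hwp n, hv, hu] with y h1 h2 h3
      rw [DirichletForm.coeFn_ofBdom, DirichletForm.coeFn_ofBdom, h1, h2]
      refine (hp2 n _ (abs_le.1 h3)).trans ?_
      exact mul_le_of_le_one_left (abs_nonneg _) (hε n)
    · filter_upwards [ae_all_iff.2 hwp, hv, hu] with y h1 h2 h3
      simp only [DirichletForm.coeFn_ofBdom, h1, h2]
      rw [tendsto_iff_norm_sub_tendsto_zero]
      refine squeeze_zero (fun _ => norm_nonneg _) (fun n => hp2 n _ (abs_le.1 h3)) ?_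
      simpa using tendsto_one_div_add_atTop_nhds_zero_nat.mul_const |(u : Y →ₘ[μ] ℝ) y|
  have l1 := S.toClosedForm.tendsto_form hL2 hform (S.ofBdom h)
  have hγ := integrable_coeFn_L1 (S.gamma (S.ofBdom u) (S.ofBdom h))
  have hm : AEStronglyMeasurable (fun y => (u : Y →ₘ[μ] ℝ) y) μ :=
    (u : Y →ₘ[μ] ℝ).aestronglyMeasurable
  have hpm : ∀ n, AEStronglyMeasurable
      (fun y => (p n).derivative.eval ((u : Y →ₘ[μ] ℝ) y)) μ := fun n =>
    (p n).derivative.continuous.comp_aestronglyMeasurable hm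
  have hpb : ∀ n, ∀ᵐ y ∂μ, ‖(p n).derivative.eval ((u : Y →ₘ[μ] ℝ) y)‖ ≤ K + 1 := fun n => by
    filter_upwards [hu] with y hy using hdb n _ (abs_le.1 hy)
  have l2 : Tendsto (fun n => S.form (S.ofBdom (w n)) (S.ofBdom h)) atTop (𝓝 (1 / 2 *
      ∫ y, φ' ((u : Y →ₘ[μ] ℝ) y) * S.gamma (S.ofBdom u) (S.ofBdom h) y ∂μ)) := by
    have e : ∀ n, S.form (S.ofBdom (w n)) (S.ofBdom h) = 1 / 2 *
        ∫ y, (p n).derivative.eval ((u : Y →ₘ[μ] ℝ) y) *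
          S.gamma (S.ofBdom u) (S.ofBdom h) y ∂μ := fun n => by
      rw [S.form_eq_integral_gamma]
      congr 1
      refine integral_congr_ae ?_
      filter_upwards [hw' n h] with y hy
      rw [hy, ← hX n]
    simp only [e]
    refine Tendsto.const_mul _ (tendsto_integral_of_norm_sub
      (fun n => hγ.bdd_mul (hpm n) (hpb n)) ?_ (tendsto_integral_norm_mul_sub hpm hpb ?_
        (fun _ => hγ) hγ (by simp)))
    · refine hγ.bdd_mul (c := K) (hφ'.comp_aestronglyMeasurable hm) ?_
      filter_upwards [hu] with y hy using hK _ (abs_le.1 hy)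
    · filter_upwards [hu] with y hy
      rw [tendsto_iff_norm_sub_tendsto_zero]
      exact squeeze_zero (fun _ => norm_nonneg _) (fun n => hp1 n _ (abs_le.1 hy))
        tendsto_one_div_add_atTop_nhds_zero_nat
  exact tendsto_nhds_unique l1 l2

/-- The chain rule in integrated form. -/
theorem form_comp (u h : S.dom) {φ φ' : ℝ → ℝ} (hφ : ∀ x, HasDerivAt φ (φ' x) x)
    (hφ' : Continuous φ') {K : ℝ≥0} (hK : ∀ x, |φ' x| ≤ K) (h0 : φ 0 = 0) (v : S.dom)
    (hv : (v : Lp ℝ 2 μ) =ᵐ[μ] fun y => φ ((u : Lp ℝ 2 μ) y)) :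
    S.form v h = 1 / 2 * ∫ y, φ' ((u : Lp ℝ 2 μ) y) * S.gamma u h y ∂μ := by
  have hL : LipschitzWith K φ := lipschitzWith_of_nnnorm_deriv_le
    (fun x => (hφ x).differentiableAt) fun x => by
      rw [(hφ x).deriv]; exact hK x
  have hle : ∀ x, |φ x| ≤ K * |x| := fun x => by
    have := hL.dist_le_mul x 0
    simpa [Real.dist_eq, h0] using this
  -- Both arguments are truncated, since the bounded chain rule needs bounded functions on both
  -- sides. The form of φ(tₙ) and sₙ then converges in two ways: weakly on the left, and in L¹
  -- through γ on the right.
  obtain ⟨t, ht, htu, htl, hte, hts⟩ := S.exists_truncation u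
  obtain ⟨s, hs, -, -, hse, hss⟩ := S.exists_truncation h
  choose w hw hwe using fun n => S.exists_lipschitz_comp (t n) hL h0
  have hwC : ∀ n, S.form (w n) (w n) ≤ (K : ℝ) ^ 2 * S.form u u := fun n =>
    (hwe n).trans (mul_le_mul_of_nonneg_left (hte n) (by positivity))
  have hL2 : Tendsto (fun n => (w n : Lp ℝ 2 μ)) atTop (𝓝 (v : Lp ℝ 2 μ)) := by
    refine tendsto_L2_of_dominated ((2 * K : ℝ) • (u : Lp ℝ 2 μ)) (fun n => ?_) ?_
    · filter_upwards [hw n, hv, htu n, Lp.coeFn_smul (2 * K : ℝ) (u : Lp ℝ 2 μ)] with y h1 h2 h3 h4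
      rw [h1, h2, h4, Pi.smul_apply, smul_eq_mul, norm_mul]
      refine (norm_sub_le _ _).trans ?_
      have a1 := hle ((t n : Lp ℝ 2 μ) y)
      have a2 := hle ((u : Lp ℝ 2 μ) y)
      have a3 : (K : ℝ) * |(t n : Lp ℝ 2 μ) y| ≤ K * |(u : Lp ℝ 2 μ) y| := by gcongr
      rw [Real.norm_of_nonneg (by positivity : (0 : ℝ) ≤ 2 * K)]
      simp only [Real.norm_eq_abs]
      linarith
    · filter_upwards [ae_all_iff.2 hw, hv, htl] with y h1 h2 h3
      simp only [h1, h2]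
      exact (hL.continuous.tendsto _).comp h3
  have e : ∀ n, S.form (w n) (s n) =
      1 / 2 * ∫ y, φ' ((t n : Lp ℝ 2 μ) y) * S.gamma (t n) (s n) y ∂μ := fun n =>
    S.form_comp_of_bdom (S.toBdom (t n) ⟨n, ht n⟩) (S.toBdom (s n) ⟨n, hs n⟩) hφ hφ' h0 (w n) (hw n)
  have l1 : Tendsto (fun n => S.form (w n) (s n)) atTop (𝓝 (S.form v h)) := by
    have a1 := S.toClosedForm.tendsto_form hL2 hwC h
    -- Here `w n` converges only weakly, so the second argument is exchanged for `h` by a separate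
    -- estimate using the strong convergence of `s n`.
    have a2 : Tendsto (fun n => S.form (w n) (s n - h)) atTop (𝓝 0) := by
      have a3 : Tendsto (fun n => √((K : ℝ) ^ 2 * S.form u u) * √(S.form (s n - h) (s n - h)))
          atTop (𝓝 (√((K : ℝ) ^ 2 * S.form u u) * √0)) :=
        ((Real.continuous_sqrt.tendsto 0).comp hss).const_mul _
      rw [Real.sqrt_zero, mul_zero] at a3
      refine squeeze_zero_norm (fun n => ?_) a3
      refine (S.toClosedForm.abs_form_le (w n) (s n - h)).trans ?_
      exact mul_le_mul_of_nonneg_right (Real.sqrt_le_sqrt (hwC n)) (Real.sqrt_nonneg _)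
    have a4 := a1.add a2
    rw [add_zero] at a4
    refine a4.congr fun n => ?_
    change S.form (w n) h + S.form (w n) (s n - h) = _
    rw [← map_add]; congr 1; abel
  have hI : ∀ w : S.dom, integralForm S.gamma w w = 2 * S.form w w := fun w => by
    rw [S.energy, integralForm_apply]; ring
  have l2 : Tendsto (fun n => S.gamma (t n) (s n)) atTop (𝓝 (S.gamma u h)) := by
    refine tendsto_gamma S.gamma S.gamma_symm S.gamma_nonneg ?_ ?_
    · simpa only [hI, mul_zero] using hts.const_mul 2
    · simpa only [hI, mul_zero] using hss.const_mul 2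
  have hm : ∀ w : S.dom, AEStronglyMeasurable (fun y => φ' ((w : Lp ℝ 2 μ) y)) μ := fun w =>
    hφ'.comp_aestronglyMeasurable (Lp.aestronglyMeasurable _)
  have l3 : Tendsto (fun n => S.form (w n) (s n)) atTop
      (𝓝 (1 / 2 * ∫ y, φ' ((u : Lp ℝ 2 μ) y) * S.gamma u h y ∂μ)) := by
    simp only [e]
    refine Tendsto.const_mul _ (tendsto_integral_of_norm_sub
      (fun n => (integrable_coeFn_L1 _).bdd_mul (c := K) (hm _) (ae_of_all _ fun y => hK _))
      ((integrable_coeFn_L1 _).bdd_mul (c := K) (hm _) (ae_of_all _ fun y => hK _))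
      (tendsto_integral_norm_mul_sub (C := K) (fun n => hm _) (fun n => ae_of_all _ fun y => hK _)
        ?_ (fun _ => integrable_coeFn_L1 _) (integrable_coeFn_L1 _)
        (tendsto_integral_norm_sub_of_L1 l2)))
    filter_upwards [htl] with y hy
    exact (hφ'.tendsto _).comp hy
  exact tendsto_nhds_unique l1 l3

end LocalDirichletStructure

end PoissonDirichlet
end

noncomputable section

namespace PoissonDirichlet

/-! ### Algebras of bounded functions with a carré du champ and a generator -/

/-- An algebra `R` of bounded functions, dense in `L²(μ)`, with a positive derivation
`gam : R × R → L¹(μ)` and an operator `gen : R → L¹(μ)` satisfying the integration by parts formula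
`∫ F gen G = -½ ∫ gam F G`. -/
structure DiffusionAlgebra {Y : Type*} [MeasurableSpace Y] (μ : Measure Y)
    (R : Type*) [CommRing R] [Algebra ℝ R] where
  /-- The functions defined by the elements of `R`. -/
  ev : R →ₐ[ℝ] (Y →ₘ[μ] ℝ)
  bdd : ∀ F, ∃ C : ℝ, ∀ᵐ y ∂μ, |ev F y| ≤ C
  /-- The carré du champ. -/
  gam : R →ₗ[ℝ] R →ₗ[ℝ] Lp ℝ 1 μ
  gam_symm : ∀ F G, gam F G = gam G F
  gam_nonneg : ∀ F, 0 ≤ᵐ[μ] (gam F F : Y → ℝ)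
  gam_mul : ∀ F G H, gam (F * G) H =ᵐ[μ] fun y => ev F y * gam G H y + ev G y * gam F H y
  /-- The generator. -/
  gen : R → Y → ℝ
  gen_integrable : ∀ F, Integrable (gen F) μ
  ibp : ∀ F G, ∫ y, ev F y * gen G y ∂μ = -(1 / 2) * ∫ y, gam F G y ∂μ
  dense : ∀ u : Lp ℝ 2 μ, ∀ r > 0, ∃ F, ∃ h : ev F ∈ Lp ℝ 2 μ, ‖u - ⟨ev F, h⟩‖ < r

namespace DiffusionAlgebra

variable {Y : Type*} [MeasurableSpace Y] {μ : Measure Y}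
  {R : Type*} [CommRing R] [Algebra ℝ R] (D : DiffusionAlgebra μ R)

theorem exists_bound (F : R) : ∃ C : ℝ, 0 ≤ C ∧ ∀ᵐ y ∂μ, |D.ev F y| ≤ C := by
  obtain ⟨C, hC⟩ := D.bdd F
  exact ⟨|C|, abs_nonneg C, hC.mono fun y hy => hy.trans (le_abs_self C)⟩

theorem aestronglyMeasurable_ev (F : R) : AEStronglyMeasurable (D.ev F) μ :=
  (D.ev F).aestronglyMeasurable

theorem coeFn_ev_aeval (F : R) (p : Polynomial ℝ) :
    D.ev (Polynomial.aeval F p) =ᵐ[μ] fun y => p.eval (D.ev F y) := by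
  induction p using Polynomial.induction_on with
  | C a =>
    rw [Polynomial.aeval_C, AlgHomClass.commutes, Algebra.algebraMap_eq_smul_one]
    filter_upwards [AEEqFun.coeFn_smul a (1 : Y →ₘ[μ] ℝ),
      AEEqFun.coeFn_one (α := Y) (μ := μ) (β := ℝ)] with y h1 h2
    rw [h1, Pi.smul_apply, h2]; simp
  | add p q hp hq =>
    rw [map_add, map_add]
    filter_upwards [AEEqFun.coeFn_add (D.ev (Polynomial.aeval F p)) (D.ev (Polynomial.aeval F q)),
      hp, hq] with y h1 h2 h3
    rw [h1, Pi.add_apply, h2, h3, Polynomial.eval_add]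
  | monomial n a hn =>
    have e : Polynomial.aeval F (Polynomial.C a * Polynomial.X ^ (n + 1)) =
        F * Polynomial.aeval F (Polynomial.C a * Polynomial.X ^ n) := by
      simp only [map_mul, map_pow, Polynomial.aeval_X, Polynomial.aeval_C]; ring
    rw [e, map_mul]
    filter_upwards [AEEqFun.coeFn_mul (D.ev F)
      (D.ev (Polynomial.aeval F (Polynomial.C a * Polynomial.X ^ n))), hn] with y h1 h2
    rw [h1, Pi.mul_apply, h2]
    simp only [Polynomial.eval_mul, Polynomial.eval_C, Polynomial.eval_pow, Polynomial.eval_X]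
    ring

theorem coeFn_ev_one : D.ev 1 =ᵐ[μ] fun _ => 1 := by
  rw [map_one]; exact AEEqFun.coeFn_one

theorem gam_one (G : R) : D.gam 1 G = 0 := by
  apply Lp.ext
  have h := D.gam_mul 1 1 G
  rw [mul_one] at h
  filter_upwards [h, D.coeFn_ev_one, Lp.coeFn_zero ℝ 1 μ] with y h1 h2 h3
  rw [h2] at h1
  rw [h3, Pi.zero_apply]
  linarith

/-- The chain rule for polynomials. -/
theorem gam_aeval (F G : R) (p : Polynomial ℝ) :
    D.gam (Polynomial.aeval F p) G =ᵐ[μ] fun y => p.derivative.eval (D.ev F y) * D.gam F G y := by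
  induction p using Polynomial.induction_on with
  | C a =>
    rw [Polynomial.aeval_C, Algebra.algebraMap_eq_smul_one, map_smul, LinearMap.smul_apply,
      D.gam_one, smul_zero]
    filter_upwards [Lp.coeFn_zero ℝ 1 μ] with y h
    rw [h]; simp
  | add p q hp hq =>
    rw [map_add, map_add, LinearMap.add_apply]
    filter_upwards [Lp.coeFn_add (D.gam (Polynomial.aeval F p) G) (D.gam (Polynomial.aeval F q) G),
      hp, hq] with y h1 h2 h3
    rw [h1, Pi.add_apply, h2, h3, Polynomial.derivative_add, Polynomial.eval_add, add_mul]
  | monomial n a hn =>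
    have e : Polynomial.aeval F (Polynomial.C a * Polynomial.X ^ (n + 1)) =
        F * Polynomial.aeval F (Polynomial.C a * Polynomial.X ^ n) := by
      simp only [map_mul, map_pow, Polynomial.aeval_X, Polynomial.aeval_C]; ring
    rw [e]
    filter_upwards [D.gam_mul F (Polynomial.aeval F (Polynomial.C a * Polynomial.X ^ n)) G,
      D.coeFn_ev_aeval F (Polynomial.C a * Polynomial.X ^ n), hn] with y h1 h2 h3
    rw [h1, h2, h3]
    simp only [Polynomial.derivative_mul, Polynomial.derivative_C,
      Polynomial.derivative_X_pow, Polynomial.eval_mul, Polynomial.eval_C, Polynomial.eval_pow,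
      Polynomial.eval_X, Polynomial.eval_add, Polynomial.eval_zero]
    cases n with
    | zero => simp
    | succ m => simp; ring

/-- The bilinear form `∫ gam F G dμ`. -/
abbrev energy : R →ₗ[ℝ] R →ₗ[ℝ] ℝ := integralForm D.gam

theorem energy_nonneg (F : R) : 0 ≤ D.energy F F := integralForm_nonneg D.gam D.gam_nonneg F

theorem energy_symm (F G : R) : D.energy F G = D.energy G F := by
  rw [energy, integralForm_apply, integralForm_apply, D.gam_symm]

theorem energy_add_le (F G : R) :
    D.energy (F + G) (F + G) ≤ 2 * D.energy F F + 2 * D.energy G G := by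
  have := D.energy_nonneg (F - G)
  simp only [map_add, map_sub, LinearMap.add_apply, LinearMap.sub_apply] at *
  linarith

/-- Polynomials approximating a continuously differentiable function `φ`. -/
theorem exists_polynomial_seq (F : R) {φ φ' : ℝ → ℝ} (hφ : ∀ x, HasDerivAt φ (φ' x) x)
    (hφ' : Continuous φ') : ∃ (p : ℕ → Polynomial ℝ) (C : ℝ),
    (∀ n, ∀ᵐ y ∂μ, |(p n).eval (D.ev F y)| ≤ C) ∧
    (∀ n, ∀ᵐ y ∂μ, |(p n).derivative.eval (D.ev F y)| ≤ C) ∧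
    (∀ᵐ y ∂μ, |φ (D.ev F y)| ≤ C) ∧ (∀ᵐ y ∂μ, |φ' (D.ev F y)| ≤ C) ∧
    (∀ᵐ y ∂μ, Tendsto (fun n => (p n).eval (D.ev F y)) atTop (𝓝 (φ (D.ev F y)))) ∧
    (∀ᵐ y ∂μ, Tendsto (fun n => (p n).derivative.eval (D.ev F y)) atTop (𝓝 (φ' (D.ev F y)))) := by
  obtain ⟨M, hM, hu⟩ := D.exists_bound F
  obtain ⟨K, hK⟩ := isCompact_Icc.exists_bound_of_continuousOn (s := Set.Icc (-M) M)
    hφ'.continuousOn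
  obtain ⟨L, hL⟩ := isCompact_Icc.exists_bound_of_continuousOn (s := Set.Icc (-M) M)
    (continuous_iff_continuousAt.2 fun x => (hφ x).continuousAt).continuousOn
  have hK0 : 0 ≤ K := (norm_nonneg _).trans (hK 0 ⟨by linarith, hM⟩)
  have hL0 : 0 ≤ L := (norm_nonneg _).trans (hL 0 ⟨by linarith, hM⟩)
  choose p hp0 hp1 hp2 using fun n : ℕ =>
    exists_polynomial_near_deriv hφ hφ' hM (ε := 1 / ((n : ℝ) + 1)) (by positivity)
  have hε : ∀ n : ℕ, 1 / ((n : ℝ) + 1) ≤ 1 := fun n => by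
    rw [div_le_one (by positivity)]; linarith [Nat.cast_nonneg (α := ℝ) n]
  refine ⟨p, K + L + M + 1, fun n => ?_, fun n => ?_, ?_, ?_, ?_, ?_⟩
  · filter_upwards [hu] with y hy
    have h1 := hp2 n _ (abs_le.1 hy)
    have h2 : |φ (D.ev F y)| ≤ L := hL _ (abs_le.1 hy)
    have h3 : 1 / ((n : ℝ) + 1) * |D.ev F y| ≤ M :=
      (mul_le_of_le_one_left (abs_nonneg _) (hε n)).trans hy
    have h4 := abs_sub_abs_le_abs_sub ((p n).eval (D.ev F y)) (φ (D.ev F y))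
    linarith
  · filter_upwards [hu] with y hy
    have h1 := hp1 n _ (abs_le.1 hy)
    have h2 : |φ' (D.ev F y)| ≤ K := hK _ (abs_le.1 hy)
    have h4 := abs_sub_abs_le_abs_sub ((p n).derivative.eval (D.ev F y)) (φ' (D.ev F y))
    linarith [hε n]
  · filter_upwards [hu] with y hy
    have h2 : |φ (D.ev F y)| ≤ L := hL _ (abs_le.1 hy)
    linarith
  · filter_upwards [hu] with y hy
    have h2 : |φ' (D.ev F y)| ≤ K := hK _ (abs_le.1 hy)
    linarith
  · filter_upwards [hu] with y hy
    rw [tendsto_iff_norm_sub_tendsto_zero]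
    refine squeeze_zero (fun _ => norm_nonneg _) (fun n => hp2 n _ (abs_le.1 hy)) ?_
    simpa using tendsto_one_div_add_atTop_nhds_zero_nat.mul_const |D.ev F y|
  · filter_upwards [hu] with y hy
    rw [tendsto_iff_norm_sub_tendsto_zero]
    exact squeeze_zero (fun _ => norm_nonneg _) (fun n => hp1 n _ (abs_le.1 hy))
      tendsto_one_div_add_atTop_nhds_zero_nat

/-- Integration by parts for a function of an element of the algebra. -/
theorem ibp_comp (F G : R) {φ φ' : ℝ → ℝ} (hφ : ∀ x, HasDerivAt φ (φ' x) x)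
    (hφ' : Continuous φ') :
    ∫ y, φ (D.ev F y) * D.gen G y ∂μ = -(1 / 2) * ∫ y, φ' (D.ev F y) * D.gam F G y ∂μ := by
  obtain ⟨p, C, h1, h2, h3, h4, h5, h6⟩ := D.exists_polynomial_seq F hφ hφ'
  have hφc : Continuous φ := continuous_iff_continuousAt.2 fun x => (hφ x).continuousAt
  have m1 : ∀ n, AEStronglyMeasurable (fun y => (p n).eval (D.ev F y)) μ := fun n =>
    (p n).continuous.comp_aestronglyMeasurable (D.aestronglyMeasurable_ev F)
  have m2 : ∀ n, AEStronglyMeasurable (fun y => (p n).derivative.eval (D.ev F y)) μ := fun n =>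
    (p n).derivative.continuous.comp_aestronglyMeasurable (D.aestronglyMeasurable_ev F)
  have m3 := hφc.comp_aestronglyMeasurable (D.aestronglyMeasurable_ev F)
  have m4 := hφ'.comp_aestronglyMeasurable (D.aestronglyMeasurable_ev F)
  have i1 := D.gen_integrable G
  have i2 := integrable_coeFn_L1 (D.gam F G)
  have l1 := tendsto_integral_of_norm_sub (fun n => i1.bdd_mul (m1 n) (h1 n)) (i1.bdd_mul m3 h3)
    (tendsto_integral_norm_mul_sub m1 h1 h5 (fun _ => i1) i1 (by simp))
  have l2 := tendsto_integral_of_norm_sub (fun n => i2.bdd_mul (m2 n) (h2 n)) (i2.bdd_mul m4 h4)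
    (tendsto_integral_norm_mul_sub m2 h2 h6 (fun _ => i2) i2 (by simp))
  refine tendsto_nhds_unique (l1.congr fun n => ?_) (l2.const_mul (-(1 / 2)))
  have e := D.ibp (Polynomial.aeval F (p n)) G
  rw [integral_congr_ae (D.gam_aeval F G (p n))] at e
  rw [← e]
  refine integral_congr_ae ?_
  filter_upwards [D.coeFn_ev_aeval F (p n)] with y hy
  rw [hy]

section Closability

variable [IsFiniteMeasure μ]

theorem ev_mem_L2 (F : R) : D.ev F ∈ Lp ℝ 2 μ := by
  obtain ⟨C, -, hC⟩ := D.exists_bound F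
  exact Lp.mem_Lp_iff_memLp.2 (MemLp.of_bound (D.aestronglyMeasurable_ev F) C hC)

/-- The embedding in `L²(μ)`. -/
def toL2 : R →ₗ[ℝ] Lp ℝ 2 μ where
  toFun F := ⟨D.ev F, D.ev_mem_L2 F⟩
  map_add' F G := Subtype.ext (map_add D.ev F G)
  map_smul' c F := Subtype.ext (map_smul D.ev c F)

theorem coeFn_toL2 (F : R) : (D.toL2 F : Y → ℝ) = D.ev F := rfl

/-- If `Fₙ → 0` almost everywhere with bounded energy, then `Fₙ → 0` weakly. -/
theorem tendsto_energy_zero_of_ae {F : ℕ → R}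
    (hF : ∀ᵐ y ∂μ, Tendsto (fun n => D.ev (F n) y) atTop (𝓝 0)) {C : ℝ}
    (hC : ∀ n, D.energy (F n) (F n) ≤ C) (H : R) :
    Tendsto (fun n => D.energy (F n) H) atTop (𝓝 0) := by
  have hC0 : 0 ≤ C := (D.energy_nonneg _).trans (hC 0)
  have iH := integrable_coeFn_L1 (D.gam H H)
  have mc : ∀ n, AEStronglyMeasurable (fun y => Real.cos (D.ev (F n) y)) μ := fun n =>
    Real.continuous_cos.comp_aestronglyMeasurable (D.aestronglyMeasurable_ev _)
  have ms : ∀ n, AEStronglyMeasurable (fun y => Real.sin (D.ev (F n) y)) μ := fun n =>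
    Real.continuous_sin.comp_aestronglyMeasurable (D.aestronglyMeasurable_ev _)
  have i1 : ∀ n, Integrable (fun y => Real.cos (D.ev (F n) y) * D.gam (F n) H y) μ := fun n =>
    (integrable_coeFn_L1 _).bdd_mul (c := 1) (mc n) (ae_of_all _ fun y => Real.abs_cos_le_one _)
  -- Integration by parts for sin Fₙ produces the weight cos Fₙ. On the other side sin Fₙ is bounded
  -- by 1 and tends to 0, which suffices for a generator that is merely integrable.
  have l1 : Tendsto (fun n => ∫ y, Real.cos (D.ev (F n) y) * D.gam (F n) H y ∂μ) atTop (𝓝 0) := by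
    have h := tendsto_integral_of_norm_sub (l := atTop)
      (g := fun n y => Real.sin (D.ev (F n) y) * D.gen H y) (g₀ := fun y => 0 * D.gen H y)
      (fun n => (D.gen_integrable H).bdd_mul (c := 1) (ms n)
        (ae_of_all _ fun y => Real.abs_sin_le_one _)) (by simp)
      (tendsto_integral_norm_mul_sub (C := 1) (φ₀ := fun _ => (0 : ℝ)) ms
        (fun n => ae_of_all _ fun y => Real.abs_sin_le_one _)
        (by
          filter_upwards [hF] with y hy
          rw [← Real.sin_zero]
          exact (Real.continuous_sin.tendsto 0).comp hy)
        (fun _ => D.gen_integrable H) (D.gen_integrable H) (by simp))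
    have h' := h.const_mul (-2)
    simp only [zero_mul, integral_zero, mul_zero] at h'
    refine h'.congr fun n => ?_
    rw [D.ibp_comp (F n) H Real.hasDerivAt_sin Real.continuous_cos]; ring
  have i2 : ∀ n, Integrable (fun y => (1 - Real.cos (D.ev (F n) y)) ^ 2 * D.gam H H y) μ :=
    fun n => iH.bdd_mul (c := 4) ((aestronglyMeasurable_const.sub (mc n)).pow 2)
      (ae_of_all _ fun y => by
        have h1 := Real.neg_one_le_cos (D.ev (F n) y)
        have h2 := Real.cos_le_one (D.ev (F n) y)
        rw [Real.norm_of_nonneg (sq_nonneg _)]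
        nlinarith)
  have l2 : Tendsto (fun n => ∫ y, (1 - Real.cos (D.ev (F n) y)) ^ 2 * D.gam H H y ∂μ) atTop
      (𝓝 0) := by
    have h := tendsto_integral_of_norm_sub (l := atTop) i2 (g₀ := fun y => 0 * D.gam H H y)
      (by simp)
      (tendsto_integral_norm_mul_sub (C := 4) (φ₀ := fun _ => (0 : ℝ))
        (fun n => (aestronglyMeasurable_const.sub (mc n)).pow 2)
        (fun n => ae_of_all _ fun y => by
          have h1 := Real.neg_one_le_cos (D.ev (F n) y)
          have h2 := Real.cos_le_one (D.ev (F n) y)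
          rw [Real.norm_of_nonneg (sq_nonneg _)]
          nlinarith)
        (by
          filter_upwards [hF] with y hy
          have := (((Real.continuous_cos.tendsto 0).comp hy).const_sub 1).pow 2
          simpa using this)
        (fun _ => iH) iH (by simp))
    simpa using h
  -- The missing weight 1 - cos Fₙ is handled by a weighted Cauchy–Schwarz inequality. The parameter
  -- `t` makes the bounded energy of Fₙ negligible, and the last integral vanishes for fixed `t` by
  -- dominated convergence.
  have key : ∀ t : ℝ, 0 < t → ∀ n, |D.energy (F n) H| ≤
      |∫ y, Real.cos (D.ev (F n) y) * D.gam (F n) H y ∂μ| + t * C +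
        t⁻¹ * ∫ y, (1 - Real.cos (D.ev (F n) y)) ^ 2 * D.gam H H y ∂μ := by
    intro t ht n
    have i3 : Integrable (fun y => (1 - Real.cos (D.ev (F n) y)) * D.gam (F n) H y) μ := by
      simp only [sub_mul, one_mul]
      exact (integrable_coeFn_L1 _).sub (i1 n)
    have e : D.energy (F n) H = ∫ y, Real.cos (D.ev (F n) y) * D.gam (F n) H y ∂μ +
        ∫ y, (1 - Real.cos (D.ev (F n) y)) * D.gam (F n) H y ∂μ := by
      rw [← integral_add (i1 n) i3]
      refine integral_congr_ae (ae_of_all _ fun y => ?_)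
      ring
    have b : |∫ y, (1 - Real.cos (D.ev (F n) y)) * D.gam (F n) H y ∂μ| ≤
        t * D.energy (F n) (F n) +
          t⁻¹ * ∫ y, (1 - Real.cos (D.ev (F n) y)) ^ 2 * D.gam H H y ∂μ := by
      rw [energy, integralForm_apply, ← integral_const_mul, ← integral_const_mul, ← integral_add
        ((integrable_coeFn_L1 _).const_mul t) ((i2 n).const_mul _)]
      refine (abs_integral_le_integral_abs).trans (integral_mono_of_nonneg
        (ae_of_all _ fun y => abs_nonneg _)
        (((integrable_coeFn_L1 _).const_mul t).add ((i2 n).const_mul _)) ?_)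
      filter_upwards [gamma_sq_le D.gam D.gam_symm D.gam_nonneg (F n) H, D.gam_nonneg (F n),
        D.gam_nonneg H] with y h1 h2 h3
      set w := 1 - Real.cos (D.ev (F n) y)
      simp only [Pi.zero_apply] at h2 h3
      have h4 : 0 ≤ t * D.gam (F n) (F n) y + t⁻¹ * (w ^ 2 * D.gam H H y) := by positivity
      refine abs_le_of_sq_le_sq ?_ h4
      have h5 : (w * D.gam (F n) H y) ^ 2 ≤
          (t * D.gam (F n) (F n) y) * (t⁻¹ * (w ^ 2 * D.gam H H y)) := by
        have : (t * D.gam (F n) (F n) y) * (t⁻¹ * (w ^ 2 * D.gam H H y)) =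
          w ^ 2 * (D.gam (F n) (F n) y * D.gam H H y) := by field_simp
        rw [this, mul_pow]
        exact mul_le_mul_of_nonneg_left h1 (sq_nonneg _)
      have h6 : 0 ≤ t * D.gam (F n) (F n) y := by positivity
      have h7 : 0 ≤ t⁻¹ * (w ^ 2 * D.gam H H y) := by positivity
      nlinarith
    rw [e]
    refine (abs_add_le _ _).trans ?_
    have := mul_le_mul_of_nonneg_left (hC n) ht.le
    linarith
  rw [Metric.tendsto_atTop]
  intro ε hε
  set t := ε / (3 * (C + 1)) with ht
  have ht0 : 0 < t := by positivity
  have htC : t * C < ε / 3 := by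
    rw [ht, div_mul_eq_mul_div, div_lt_div_iff₀ (by positivity) (by norm_num)]
    nlinarith
  obtain ⟨n₁, hn₁⟩ := Metric.tendsto_atTop.1 l1 (ε / 3) (by positivity)
  obtain ⟨n₂, hn₂⟩ := Metric.tendsto_atTop.1 l2 (t * (ε / 3)) (by positivity)
  refine ⟨max n₁ n₂, fun n hn => ?_⟩
  have a1 := hn₁ n (le_of_max_le_left hn)
  have a2 := hn₂ n (le_of_max_le_right hn)
  rw [Real.dist_eq, sub_zero] at *
  have a3 := (abs_lt.1 a2).2
  have a4 : t⁻¹ * ∫ y, (1 - Real.cos (D.ev (F n) y)) ^ 2 * D.gam H H y ∂μ < ε / 3 := by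
    rw [inv_mul_lt_iff₀ ht0]; exact a3
  linarith [key t ht0 n]

/-- `F` converges to `u` in `L²(μ)` and is a Cauchy sequence for the energy. -/
structure Approx (F : ℕ → R) (u : Lp ℝ 2 μ) : Prop where
  tendsto : Tendsto (fun n => D.toL2 (F n)) atTop (𝓝 u)
  cauchy : ∀ ε > 0, ∃ N, ∀ m ≥ N, ∀ n ≥ N, D.energy (F m - F n) (F m - F n) < ε

variable {D}

theorem Approx.add {F G : ℕ → R} {u v : Lp ℝ 2 μ} (hF : D.Approx F u) (hG : D.Approx G v) :
    D.Approx (fun n => F n + G n) (u + v) where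
  tendsto := by simpa using hF.tendsto.add hG.tendsto
  cauchy ε hε := by
    obtain ⟨N, hN⟩ := hF.cauchy (ε / 4) (by positivity)
    obtain ⟨N', hN'⟩ := hG.cauchy (ε / 4) (by positivity)
    refine ⟨max N N', fun m hm n hn => ?_⟩
    have h1 := hN m (le_of_max_le_left hm) n (le_of_max_le_left hn)
    have h2 := hN' m (le_of_max_le_right hm) n (le_of_max_le_right hn)
    have h3 := D.energy_add_le (F m - F n) (G m - G n)
    rw [add_sub_add_comm]
    linarith

theorem Approx.smul {F : ℕ → R} {u : Lp ℝ 2 μ} (hF : D.Approx F u) (c : ℝ) :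
    D.Approx (fun n => c • F n) (c • u) where
  tendsto := by simpa using hF.tendsto.const_smul c
  cauchy ε hε := by
    obtain ⟨N, hN⟩ := hF.cauchy (ε / (c ^ 2 + 1)) (by positivity)
    refine ⟨N, fun m hm n hn => ?_⟩
    have h1 := hN m hm n hn
    rw [lt_div_iff₀ (by positivity)] at h1
    have h2 := D.energy_nonneg (F m - F n)
    rw [← smul_sub, map_smul, map_smul, LinearMap.smul_apply, smul_eq_mul, smul_eq_mul]
    nlinarith

theorem Approx.sub {F G : ℕ → R} {u v : Lp ℝ 2 μ} (hF : D.Approx F u) (hG : D.Approx G v) :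
    D.Approx (fun n => F n - G n) (u - v) := by
  have := hF.add (hG.smul (-1))
  simpa [sub_eq_add_neg] using this

theorem approx_const (F : R) : D.Approx (fun _ => F) (D.toL2 F) where
  tendsto := tendsto_const_nhds
  cauchy ε hε := ⟨0, fun m _ n _ => by simpa using hε⟩

theorem Approx.exists_bound {F : ℕ → R} {u : Lp ℝ 2 μ} (hF : D.Approx F u) :
    ∃ C N, ∀ n ≥ N, D.energy (F n) (F n) ≤ C := by
  obtain ⟨N, hN⟩ := hF.cauchy 1 one_pos
  refine ⟨2 * 1 + 2 * D.energy (F N) (F N), N, fun n hn => ?_⟩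
  have h1 := D.energy_add_le (F n - F N) (F N)
  rw [sub_add_cancel] at h1
  have h2 := hN n hn N le_rfl
  linarith

/-- The energy form is closable. -/
theorem Approx.tendsto_energy_zero {F : ℕ → R} (hF : D.Approx F 0) :
    Tendsto (fun n => D.energy (F n) (F n)) atTop (𝓝 0) := by
  obtain ⟨C, N₀, hC⟩ := hF.exists_bound
  have hC0 : 0 ≤ C := (D.energy_nonneg _).trans (hC N₀ le_rfl)
  have ht : Tendsto (fun n => D.toL2 (F (n + N₀))) atTop (𝓝 0) :=
    hF.tendsto.comp (tendsto_add_atTop_nat N₀)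
  obtain ⟨ns, hns, hae⟩ := exists_seq_tendsto_ae_of_L2 ht
  have hw := fun H => D.tendsto_energy_zero_of_ae (F := fun k => F (ns k + N₀)) (by
    filter_upwards [hae, Lp.coeFn_zero ℝ 2 μ] with y h1 h2
    rw [h2] at h1
    exact h1) (C := C) (fun n => hC _ (Nat.le_add_left _ _)) H
  rw [Metric.tendsto_atTop]
  intro ε hε
  -- For a late term G, split energy G G = energy G F_N + energy G (G - F_N): the first is small by
  -- weak convergence, the second by Cauchy–Schwarz with the bound `C`. Then F n is compared with G;
  -- the tolerances add up to ε.
  obtain ⟨N, hN⟩ := hF.cauchy (min (ε / 4) ((ε / 8) ^ 2 / (C + 1))) (by positivity)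
  obtain ⟨k₁, hk₁⟩ := Metric.tendsto_atTop.1 (hw (F N)) (ε / 8) (by positivity)
  refine ⟨N, fun n hn => ?_⟩
  rw [Real.dist_eq, sub_zero, abs_of_nonneg (D.energy_nonneg _)]
  set k := max k₁ N
  set G := F (ns k + N₀)
  have hkN : ns k + N₀ ≥ N :=
    ((le_max_right k₁ N).trans (hns.le_apply)).trans (Nat.le_add_right _ _)
  have a1 := hk₁ k (le_max_left _ _)
  rw [Real.dist_eq, sub_zero] at a1
  have a2 := lt_of_lt_of_le (hN _ hkN N le_rfl) (min_le_right _ _)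
  have a3 := lt_of_lt_of_le (hN n hn _ hkN) (min_le_left _ _)
  have a4 : D.energy G G = D.energy G (F N) + D.energy G (G - F N) := by
    rw [← map_add]; congr 1; abel
  have a5 : |D.energy G (G - F N)| < ε / 8 := by
    refine abs_lt_of_sq_lt_sq ?_ (by positivity)
    calc D.energy G (G - F N) ^ 2 ≤ D.energy G G * D.energy (G - F N) (G - F N) :=
          sq_le_mul_of_nonneg D.energy D.energy_symm D.energy_nonneg _ _
      _ ≤ (C + 1) * D.energy (G - F N) (G - F N) := by
          refine mul_le_mul_of_nonneg_right ?_ (D.energy_nonneg _)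
          linarith [hC _ (Nat.le_add_left N₀ (ns k))]
      _ < (C + 1) * ((ε / 8) ^ 2 / (C + 1)) := by
          refine mul_lt_mul_of_pos_left a2 (by positivity)
      _ = (ε / 8) ^ 2 := by field_simp
  have a6 := D.energy_add_le (F n - G) G
  rw [sub_add_cancel] at a6
  have a7 := (abs_lt.1 a1).2
  have a8 := (abs_lt.1 a5).2
  linarith

end Closability

end DiffusionAlgebra

end PoissonDirichlet
end

noncomputable section

namespace PoissonDirichlet

namespace DiffusionAlgebra

variable {Y : Type*} [MeasurableSpace Y] {μ : Measure Y}
  {R : Type*} [CommRing R] [Algebra ℝ R] (D : DiffusionAlgebra μ R)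

/-! ### The closure of the energy form -/

theorem tendsto_gam_zero {F G : ℕ → R}
    (hF : Tendsto (fun n => D.energy (F n) (F n)) atTop (𝓝 0)) {C : ℝ} {N : ℕ}
    (hG : ∀ n ≥ N, D.energy (G n) (G n) ≤ C) :
    Tendsto (fun n => D.gam (F n) (G n)) atTop (𝓝 0) := by
  rw [tendsto_zero_iff_norm_tendsto_zero]
  have h : Tendsto (fun n => √(D.energy (F n) (F n)) * √C) atTop (𝓝 (√0 * √C)) :=
    ((Real.continuous_sqrt.tendsto 0).comp hF).mul_const _
  rw [Real.sqrt_zero, zero_mul] at h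
  refine squeeze_zero' (Eventually.of_forall fun _ => norm_nonneg _) ?_ h
  filter_upwards [eventually_ge_atTop N] with n hn
  exact (norm_gamma_le D.gam D.gam_symm D.gam_nonneg _ _).trans
    (mul_le_mul_of_nonneg_left (Real.sqrt_le_sqrt (hG n hn)) (Real.sqrt_nonneg _))

variable [IsFiniteMeasure μ]

theorem Approx.cauchySeq_gam {F G : ℕ → R} {u v : Lp ℝ 2 μ} (hF : D.Approx F u)
    (hG : D.Approx G v) : CauchySeq fun n => D.gam (F n) (G n) := by
  obtain ⟨C, N₁, hC⟩ := hF.exists_bound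
  obtain ⟨C', N₂, hC'⟩ := hG.exists_bound
  rw [Metric.cauchySeq_iff]
  intro ε hε
  set δ := ε / (2 * (√C + √C' + 1)) with hδ
  have hδ0 : 0 < δ := by positivity
  obtain ⟨N₃, h₃⟩ := hF.cauchy (δ ^ 2) (by positivity)
  obtain ⟨N₄, h₄⟩ := hG.cauchy (δ ^ 2) (by positivity)
  refine ⟨max (max N₁ N₂) (max N₃ N₄), fun m hm n hn => ?_⟩
  simp only [ge_iff_le, max_le_iff] at hm hn
  have e : D.gam (F m) (G m) - D.gam (F n) (G n) =
      D.gam (F m - F n) (G m) + D.gam (F n) (G m - G n) := by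
    simp only [map_sub, LinearMap.sub_apply]; abel
  have b1 : √(D.energy (F m - F n) (F m - F n)) ≤ δ :=
    Real.sqrt_le_iff.2 ⟨hδ0.le, (h₃ m hm.2.1 n hn.2.1).le⟩
  have b2 : √(D.energy (G m - G n) (G m - G n)) ≤ δ :=
    Real.sqrt_le_iff.2 ⟨hδ0.le, (h₄ m hm.2.2 n hn.2.2).le⟩
  have b3 := Real.sqrt_le_sqrt (hC n hn.1.1)
  have b4 := Real.sqrt_le_sqrt (hC' m hm.1.2)
  rw [dist_eq_norm, e]
  calc ‖D.gam (F m - F n) (G m) + D.gam (F n) (G m - G n)‖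
      ≤ ‖D.gam (F m - F n) (G m)‖ + ‖D.gam (F n) (G m - G n)‖ := norm_add_le _ _
    _ ≤ δ * √C' + √C * δ := by
        refine add_le_add ?_ ?_
        · exact (norm_gamma_le D.gam D.gam_symm D.gam_nonneg _ _).trans
            (mul_le_mul b1 b4 (Real.sqrt_nonneg _) hδ0.le)
        · exact (norm_gamma_le D.gam D.gam_symm D.gam_nonneg _ _).trans
            (mul_le_mul b3 b2 (Real.sqrt_nonneg _) (Real.sqrt_nonneg _))
    _ = δ * (√C + √C') := by ring
    _ < δ * (2 * (√C + √C' + 1)) := by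
        refine mul_lt_mul_of_pos_left ?_ hδ0
        linarith [Real.sqrt_nonneg C, Real.sqrt_nonneg C']
    _ = ε := by rw [hδ]; field_simp

/-- The domain of the closure. -/
def dom : Submodule ℝ (Lp ℝ 2 μ) where
  carrier := {u | ∃ F, D.Approx F u}
  add_mem' := fun ⟨F, hF⟩ ⟨G, hG⟩ => ⟨_, hF.add hG⟩
  zero_mem' := ⟨fun _ => 0, by simpa using approx_const (D := D) 0⟩
  smul_mem' := fun c _ ⟨F, hF⟩ => ⟨_, hF.smul c⟩

/-- A sequence of `R` approximating an element of the domain. -/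
def seq (u : D.dom) : ℕ → R := u.2.choose

theorem approx_seq (u : D.dom) : D.Approx (D.seq u) u := u.2.choose_spec

/-- The extension of the carré du champ to the domain. -/
def gammaFun (u v : D.dom) : Lp ℝ 1 μ := limUnder atTop fun n => D.gam (D.seq u n) (D.seq v n)

variable {D}

/-- Closability makes the limit independent of the approximating sequence: the difference of two
approximations of the same element approximates 0, so its energy tends to 0. -/
theorem Approx.tendsto_gam {F G : ℕ → R} {u v : D.dom} (hF : D.Approx F u) (hG : D.Approx G v) :
    Tendsto (fun n => D.gam (F n) (G n)) atTop (𝓝 (D.gammaFun u v)) := by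
  have h1 : Tendsto (fun n => D.gam (D.seq u n) (D.seq v n)) atTop (𝓝 (D.gammaFun u v)) :=
    tendsto_nhds_limUnder (cauchySeq_tendsto_of_complete
      (Approx.cauchySeq_gam D (D.approx_seq u) (D.approx_seq v)))
  have hF' := hF.sub (D.approx_seq u)
  have hG' := hG.sub (D.approx_seq v)
  rw [sub_self] at hF' hG'
  obtain ⟨C, N, hC⟩ := hG.exists_bound
  obtain ⟨C', N', hC'⟩ := (D.approx_seq u).exists_bound
  have h2 := D.tendsto_gam_zero hF'.tendsto_energy_zero hC
  have h3 := D.tendsto_gam_zero hG'.tendsto_energy_zero hC'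
  have h4 := (h1.add h2).add h3
  rw [add_zero, add_zero] at h4
  refine h4.congr fun n => ?_
  rw [D.gam_symm (G n - D.seq v n)]
  simp only [map_sub, LinearMap.sub_apply]; abel

variable (D)

/-- The carré du champ of the closure. -/
def gamma : D.dom →ₗ[ℝ] D.dom →ₗ[ℝ] Lp ℝ 1 μ :=
  LinearMap.mk₂ ℝ D.gammaFun
    (fun u u' v => by
      have h1 := Approx.tendsto_gam (u := u + u') ((D.approx_seq u).add (D.approx_seq u'))
        (D.approx_seq v)
      have h2 := (Approx.tendsto_gam (D.approx_seq u) (D.approx_seq v)).add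
        (Approx.tendsto_gam (D.approx_seq u') (D.approx_seq v))
      exact tendsto_nhds_unique h1 (h2.congr fun n => by
        rw [map_add, LinearMap.add_apply]))
    (fun c u v => by
      have h1 := Approx.tendsto_gam (u := c • u) ((D.approx_seq u).smul c) (D.approx_seq v)
      have h2 := (Approx.tendsto_gam (D.approx_seq u) (D.approx_seq v)).const_smul c
      exact tendsto_nhds_unique h1 (h2.congr fun n => by
        rw [map_smul, LinearMap.smul_apply]))
    (fun u v v' => by
      have h1 := Approx.tendsto_gam (v := v + v') (D.approx_seq u)
        ((D.approx_seq v).add (D.approx_seq v'))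
      have h2 := (Approx.tendsto_gam (D.approx_seq u) (D.approx_seq v)).add
        (Approx.tendsto_gam (D.approx_seq u) (D.approx_seq v'))
      exact tendsto_nhds_unique h1 (h2.congr fun n => by rw [map_add]))
    (fun c u v => by
      have h1 := Approx.tendsto_gam (v := c • v) (D.approx_seq u) ((D.approx_seq v).smul c)
      have h2 := (Approx.tendsto_gam (D.approx_seq u) (D.approx_seq v)).const_smul c
      exact tendsto_nhds_unique h1 (h2.congr fun n => by rw [map_smul]))

variable {D} in
theorem Approx.tendsto_gamma {F G : ℕ → R} {u v : D.dom} (hF : D.Approx F u) (hG : D.Approx G v) :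
    Tendsto (fun n => D.gam (F n) (G n)) atTop (𝓝 (D.gamma u v)) := hF.tendsto_gam hG

theorem gamma_symm (u v : D.dom) : D.gamma u v = D.gamma v u :=
  tendsto_nhds_unique (Approx.tendsto_gamma (D.approx_seq u) (D.approx_seq v))
    ((Approx.tendsto_gamma (D.approx_seq v) (D.approx_seq u)).congr fun _ => D.gam_symm _ _)

theorem gamma_nonneg (u : D.dom) : 0 ≤ᵐ[μ] (D.gamma u u : Y → ℝ) := by
  have h := Approx.tendsto_gamma (D.approx_seq u) (D.approx_seq u)
  exact (Lp.coeFn_nonneg _).2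
    (ge_of_tendsto' h fun n => (Lp.coeFn_nonneg _).1 (D.gam_nonneg _))

/-- An element of `R`, seen in the domain of the closure. -/
def toDom : R →ₗ[ℝ] D.dom :=
  D.toL2.codRestrict D.dom fun F => ⟨_, approx_const F⟩

theorem coe_toDom (F : R) : (D.toDom F : Lp ℝ 2 μ) = D.toL2 F := rfl

theorem gamma_toDom (F G : R) : D.gamma (D.toDom F) (D.toDom G) = D.gam F G :=
  tendsto_nhds_unique (Approx.tendsto_gamma (u := D.toDom F) (v := D.toDom G)
    (approx_const F) (approx_const G)) tendsto_const_nhds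

/-- The energy of the closure. -/
abbrev cenergy : D.dom →ₗ[ℝ] D.dom →ₗ[ℝ] ℝ := integralForm D.gamma

variable {D} in
theorem Approx.tendsto_energy {F : ℕ → R} {u : D.dom} (hF : D.Approx F u) :
    Tendsto (fun n => D.energy (F n) (F n)) atTop (𝓝 (D.cenergy u u)) :=
  tendsto_integral_of_norm_sub (fun _ => integrable_coeFn_L1 _) (integrable_coeFn_L1 _)
    (tendsto_integral_norm_sub_of_L1 (hF.tendsto_gamma hF))

variable {D} in
theorem Approx.tendsto_cenergy_sub {F : ℕ → R} {u : D.dom} (hF : D.Approx F u) :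
    Tendsto (fun n => D.cenergy (D.toDom (F n) - u) (D.toDom (F n) - u)) atTop (𝓝 0) := by
  rw [Metric.tendsto_atTop]
  intro ε hε
  obtain ⟨N, hN⟩ := hF.cauchy (ε / 2) (by positivity)
  refine ⟨N, fun n hn => ?_⟩
  have h := Approx.tendsto_energy (u := D.toDom (F n) - u) ((approx_const (F n)).sub hF)
  have h2 : D.cenergy (D.toDom (F n) - u) (D.toDom (F n) - u) ≤ ε / 2 :=
    le_of_tendsto h ((eventually_ge_atTop N).mono fun m hm => (hN n hn m hm).le)
  rw [Real.dist_eq, sub_zero, abs_of_nonneg (integralForm_nonneg D.gamma D.gamma_nonneg _)]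
  linarith

/-- `R` is dense in the domain for the energy norm. -/
theorem exists_energy_lt (u : D.dom) {r : ℝ} (hr : 0 < r) :
    ∃ F : R, ‖((u - D.toDom F : D.dom) : Lp ℝ 2 μ)‖ ^ 2 +
      D.cenergy (u - D.toDom F) (u - D.toDom F) < r := by
  have h := D.approx_seq u
  have h1 : Tendsto (fun n => ‖((u - D.toDom (D.seq u n) : D.dom) : Lp ℝ 2 μ)‖ ^ 2) atTop
      (𝓝 0) := by
    have := (tendsto_iff_norm_sub_tendsto_zero.1 h.tendsto).pow 2
    rw [zero_pow two_ne_zero] at this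
    refine this.congr fun n => ?_
    rw [norm_sub_rev]; rfl
  have h2 := h.tendsto_cenergy_sub
  have h3 := h1.add h2
  rw [add_zero] at h3
  obtain ⟨n, hn⟩ := (h3.eventually_lt_const hr).exists
  refine ⟨D.seq u n, ?_⟩
  have e : D.cenergy (u - D.toDom (D.seq u n)) (u - D.toDom (D.seq u n)) =
      D.cenergy (D.toDom (D.seq u n) - u) (D.toDom (D.seq u n) - u) := by
    rw [← neg_sub (D.toDom (D.seq u n)) u]; simp only [map_neg, LinearMap.neg_apply, neg_neg]
  rw [e]; exact hn

theorem cenergy_nonneg (u : D.dom) : 0 ≤ D.cenergy u u :=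
  integralForm_nonneg D.gamma D.gamma_nonneg u

theorem cenergy_symm (u v : D.dom) : D.cenergy u v = D.cenergy v u := by
  rw [cenergy, integralForm_apply, integralForm_apply, D.gamma_symm]

theorem cenergy_add_le (u v : D.dom) :
    D.cenergy (u + v) (u + v) ≤ 2 * D.cenergy u u + 2 * D.cenergy v v := by
  have := D.cenergy_nonneg (u - v)
  simp only [map_add, map_sub, LinearMap.add_apply, LinearMap.sub_apply] at *
  linarith

theorem cenergy_neg (u : D.dom) : D.cenergy (-u) (-u) = D.cenergy u u := by
  simp only [map_neg, LinearMap.neg_apply, neg_neg]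

/-- The closure is a closed form. -/
def closedForm : ClosedForm (Lp ℝ 2 μ) where
  dom := D.dom
  form := (1 / 2 : ℝ) • D.cenergy
  symm u v := by simp only [LinearMap.smul_apply, D.cenergy_symm u v]
  nonneg u := by
    have := D.cenergy_nonneg u
    simp only [LinearMap.smul_apply, smul_eq_mul]; positivity
  closed u hu := by
    simp only [LinearMap.smul_apply, smul_eq_mul] at *
    -- Replacing each `u n` by an element of the algebra at energy distance below 1/(n + 1) gives a
    -- sequence in `R` that is itself an approximation of the L² limit.
    choose F hF using fun n : ℕ => D.exists_energy_lt (u n) (r := 1 / ((n : ℝ) + 1)) (by positivity)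
    have hF1 : ∀ n, ‖((u n - D.toDom (F n) : D.dom) : Lp ℝ 2 μ)‖ ^ 2 < 1 / ((n : ℝ) + 1) := fun n =>
      lt_of_le_of_lt (le_add_of_nonneg_right (D.cenergy_nonneg _)) (hF n)
    have hF2 : ∀ n, D.cenergy (u n - D.toDom (F n)) (u n - D.toDom (F n)) < 1 / ((n : ℝ) + 1) :=
      fun n => lt_of_le_of_lt (le_add_of_nonneg_left (sq_nonneg _)) (hF n)
    have l0 := tendsto_one_div_add_atTop_nhds_zero_nat (𝕜 := ℝ)
    have hc1 : CauchySeq fun n => (u n : Lp ℝ 2 μ) := by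
      rw [Metric.cauchySeq_iff]
      intro ε hε
      obtain ⟨N, hN⟩ := hu (ε ^ 2) (by positivity)
      refine ⟨N, fun m hm n hn => ?_⟩
      have h1 := hN m hm n hn
      have h2 := D.cenergy_nonneg (u m - u n)
      have h3 : ‖(u m : Lp ℝ 2 μ) - u n‖ ^ 2 < ε ^ 2 :=
        lt_of_le_of_lt (le_add_of_nonneg_right (by positivity)) h1
      rw [dist_eq_norm]
      exact lt_of_pow_lt_pow_left₀ 2 hε.le h3
    obtain ⟨w, hw⟩ := cauchySeq_tendsto_of_complete hc1
    have hd : Tendsto (fun n => (u n : Lp ℝ 2 μ) - D.toL2 (F n)) atTop (𝓝 0) := by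
      rw [tendsto_zero_iff_norm_tendsto_zero]
      have : Tendsto (fun n : ℕ => √(1 / ((n : ℝ) + 1))) atTop (𝓝 0) := by
        rw [← Real.sqrt_zero]; exact (Real.continuous_sqrt.tendsto 0).comp l0
      exact squeeze_zero (fun _ => norm_nonneg _)
        (fun n => Real.le_sqrt_of_sq_le (hF1 n).le) this
    have hA : D.Approx F w := by
      refine ⟨by simpa using hw.sub hd, fun ε hε => ?_⟩
      obtain ⟨N, hN⟩ := hu (ε / 16) (by positivity)
      obtain ⟨N', hN'⟩ := (l0.eventually_lt_const (show (0 : ℝ) < ε / 16 by positivity)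
        ).exists_forall_of_atTop
      refine ⟨max N N', fun m hm n hn => ?_⟩
      have a1 := hN m (le_of_max_le_left hm) n (le_of_max_le_left hn)
      have a2 := (hF2 m).trans (hN' m (le_of_max_le_right hm))
      have a3 := (hF2 n).trans (hN' n (le_of_max_le_right hn))
      have a4 : D.cenergy (u m - u n) (u m - u n) < ε / 8 := by
        have : 0 ≤ ‖(u m - u n : D.dom)‖ ^ 2 := sq_nonneg _
        linarith
      have e : D.toDom (F m - F n) =
          -(u m - D.toDom (F m)) + ((u m - u n) + (u n - D.toDom (F n))) := by
        rw [map_sub]; abel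
      have e2 : D.energy (F m - F n) (F m - F n) =
          D.cenergy (D.toDom (F m - F n)) (D.toDom (F m - F n)) := by
        rw [integralForm_apply, integralForm_apply, gamma_toDom]
      have a5 := D.cenergy_add_le (-(u m - D.toDom (F m))) ((u m - u n) + (u n - D.toDom (F n)))
      have a6 := D.cenergy_add_le (u m - u n) (u n - D.toDom (F n))
      rw [cenergy_neg] at a5
      rw [e2, e]
      linarith
    refine ⟨⟨w, F, hA⟩, ?_⟩
    set v : D.dom := ⟨w, F, hA⟩
    have t1 : Tendsto (fun n => ‖(u n : Lp ℝ 2 μ) - w‖ ^ 2) atTop (𝓝 0) := by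
      have := (tendsto_iff_norm_sub_tendsto_zero.1 hw).pow 2
      rwa [zero_pow two_ne_zero] at this
    have t2 := Approx.tendsto_cenergy_sub (u := v) hA
    have t3 := t1.add (l0.add t2)
    simp only [add_zero] at t3
    refine squeeze_zero (fun n => ?_) (fun n => ?_) t3
    · have := D.cenergy_nonneg (u n - v)
      positivity
    · refine add_le_add le_rfl ?_
      have e : u n - v = (u n - D.toDom (F n)) + (D.toDom (F n) - v) := by abel
      have := D.cenergy_add_le (u n - D.toDom (F n)) (D.toDom (F n) - v)
      rw [← e] at this
      linarith [hF2 n]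

end DiffusionAlgebra

end PoissonDirichlet
end

noncomputable section

namespace PoissonDirichlet

theorem ae_norm_le_of_tendsto {Y : Type*} [MeasurableSpace Y] {μ : Measure Y}
    {ι : Type*} {l : Filter ι} [l.NeBot] [Countable ι] {c : ι → Y → ℝ} {c₀ : Y → ℝ} {C : ℝ}
    (hC : ∀ n, ∀ᵐ y ∂μ, ‖c n y‖ ≤ C) (hlim : ∀ᵐ y ∂μ, Tendsto (fun n => c n y) l (𝓝 (c₀ y))) :
    ∀ᵐ y ∂μ, ‖c₀ y‖ ≤ C := by
  filter_upwards [ae_all_iff.2 hC, hlim] with y h1 h2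
  exact le_of_tendsto' h2.norm h1

/-- If b(v_m, v_n) has a limit a along pairs, then b(v_m, v_m) - 2 b(v_m, v_n) + b(v_n, v_n) tends
to a - 2a + a = 0. Cauchy estimates are obtained in this form. -/
theorem tendsto_form_sub_sub {V : Type*} [AddCommGroup V] [Module ℝ V] (b : V →ₗ[ℝ] V →ₗ[ℝ] ℝ)
    (hs : ∀ u v, b u v = b v u) {v : ℕ → V} {a : ℝ}
    (h : Tendsto (fun p : ℕ × ℕ => b (v p.1) (v p.2)) atTop (𝓝 a)) :
    Tendsto (fun p : ℕ × ℕ => b (v p.1 - v p.2) (v p.1 - v p.2)) atTop (𝓝 0) := by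
  have h1 : Tendsto (Prod.fst : ℕ × ℕ → ℕ) atTop atTop := by
    rw [← prod_atTop_atTop_eq]; exact tendsto_fst
  have h2 : Tendsto (Prod.snd : ℕ × ℕ → ℕ) atTop atTop := by
    rw [← prod_atTop_atTop_eq]; exact tendsto_snd
  have hd : Tendsto (fun n => b (v n) (v n)) atTop (𝓝 a) := h.comp tendsto_atTop_diagonal
  have := ((hd.comp h1).sub (h.const_mul 2)).add (hd.comp h2)
  rw [show a - 2 * a + a = 0 by ring] at this
  refine this.congr fun p => ?_
  simp only [map_sub, LinearMap.sub_apply, Function.comp_apply, hs (v p.2) (v p.1)]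
  ring

namespace DiffusionAlgebra

variable {Y : Type*} [MeasurableSpace Y] {μ : Measure Y} [IsFiniteMeasure μ]
  {R : Type*} [CommRing R] [Algebra ℝ R] (D : DiffusionAlgebra μ R)

/-! ### The chain rule on the closure -/

theorem tendsto_integral_mul_gamma {ι : Type*} {l : Filter ι} [l.NeBot] [l.IsCountablyGenerated]
    {c : ι → Y → ℝ} {c₀ : Y → ℝ} {C : ℝ} (hc : ∀ n, AEStronglyMeasurable (c n) μ)
    (hC : ∀ n, ∀ᵐ y ∂μ, ‖c n y‖ ≤ C) (hlim : ∀ᵐ y ∂μ, Tendsto (fun n => c n y) l (𝓝 (c₀ y)))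
    {u w : ι → D.dom} {u₀ w₀ : D.dom}
    (hu : Tendsto (fun n => D.cenergy (u n - u₀) (u n - u₀)) l (𝓝 0))
    (hw : Tendsto (fun n => D.cenergy (w n - w₀) (w n - w₀)) l (𝓝 0)) :
    Tendsto (fun n => ∫ y, ‖c n y * D.gamma (u n) (w n) y - c₀ y * D.gamma u₀ w₀ y‖ ∂μ) l
      (𝓝 0) :=
  tendsto_integral_norm_mul_sub hc hC hlim (fun _ => integrable_coeFn_L1 _)
    (integrable_coeFn_L1 _) (tendsto_integral_norm_sub_of_L1
      (tendsto_gamma D.gamma D.gamma_symm D.gamma_nonneg hu hw))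

/-- The closure is complete. -/
theorem exists_tendsto_cenergy_sub {v : ℕ → D.dom} {v₀ : Lp ℝ 2 μ}
    (hv₀ : Tendsto (fun n => (v n : Lp ℝ 2 μ)) atTop (𝓝 v₀))
    (hcau : Tendsto (fun p : ℕ × ℕ => D.cenergy (v p.1 - v p.2) (v p.1 - v p.2)) atTop (𝓝 0)) :
    ∃ h : v₀ ∈ D.dom,
      Tendsto (fun n => D.cenergy (v n - ⟨v₀, h⟩) (v n - ⟨v₀, h⟩)) atTop (𝓝 0) := by
  obtain ⟨v', hv''⟩ : ∃ v' : D.dom, Tendsto (fun n => ‖(v n : Lp ℝ 2 μ) - (v' : Lp ℝ 2 μ)‖ ^ 2 +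
      1 / 2 * D.cenergy (v n - v') (v n - v')) atTop (𝓝 0) :=
    D.closedForm.closed v (fun r hr => by
    obtain ⟨N, hN⟩ := Metric.cauchySeq_iff.1 hv₀.cauchySeq (√(r / 2)) (by positivity)
    obtain ⟨N', hN'⟩ := eventually_atTop_prod_self.1 (hcau.eventually_lt_const
      (show (0 : ℝ) < r / 2 by positivity))
    refine ⟨max N N', fun m hm n hn => ?_⟩
    have a1 := hN m (le_of_max_le_left hm) n (le_of_max_le_left hn)
    have a2 := hN' m n (le_of_max_le_right hm) (le_of_max_le_right hn)
    have a3 : ‖(v m : Lp ℝ 2 μ) - v n‖ ^ 2 < r / 2 := by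
      rw [dist_eq_norm] at a1
      exact (Real.lt_sqrt (norm_nonneg _)).1 a1
    have a4 := D.cenergy_nonneg (v m - v n)
    change ‖(v m : Lp ℝ 2 μ) - v n‖ ^ 2 + 1 / 2 * D.cenergy (v m - v n) (v m - v n) < r
    dsimp only at a2
    linarith)
  have t1 : Tendsto (fun n => ‖(v n : Lp ℝ 2 μ) - (v' : Lp ℝ 2 μ)‖ ^ 2) atTop (𝓝 0) :=
    squeeze_zero (fun _ => sq_nonneg _) (fun n => by
      have := D.cenergy_nonneg (v n - v')
      linarith) hv''
  have t2 : Tendsto (fun n => D.cenergy (v n - v') (v n - v')) atTop (𝓝 0) := by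
    have h2 := hv''.const_mul 2
    rw [mul_zero] at h2
    refine squeeze_zero (fun _ => D.cenergy_nonneg _) (fun n => ?_) h2
    nlinarith [sq_nonneg ‖(v n : Lp ℝ 2 μ) - (v' : Lp ℝ 2 μ)‖]
  have e : v₀ = v' := by
    refine tendsto_nhds_unique hv₀ (tendsto_iff_norm_sub_tendsto_zero.2 ?_)
    have := (Real.continuous_sqrt.tendsto 0).comp t1
    rw [Real.sqrt_zero] at this
    exact this.congr fun n => Real.sqrt_sq (norm_nonneg _)
  subst e
  exact ⟨v'.2, t2⟩

/-- Using the hypothesis in both arguments gives gamma (v m) (v n) = c_m c_n gamma (u m) (u n). The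
weights are bounded and converge almost everywhere and the carré du champ converges in L¹, so the
mixed energies have a limit. -/
theorem tendsto_cenergy_sub_sub {c : ℕ → Y → ℝ} {c₀ : Y → ℝ} {C : ℝ}
    (hc : ∀ n, AEStronglyMeasurable (c n) μ) (hC : ∀ n, ∀ᵐ y ∂μ, ‖c n y‖ ≤ C)
    (hlim : ∀ᵐ y ∂μ, Tendsto (fun n => c n y) atTop (𝓝 (c₀ y)))
    {u v : ℕ → D.dom} {u₀ : D.dom}
    (hu : Tendsto (fun n => D.cenergy (u n - u₀) (u n - u₀)) atTop (𝓝 0))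
    (hv : ∀ n w, D.gamma (v n) w =ᵐ[μ] fun y => c n y * D.gamma (u n) w y) :
    Tendsto (fun p : ℕ × ℕ => D.cenergy (v p.1 - v p.2) (v p.1 - v p.2)) atTop (𝓝 0) := by
  have hc₀ : AEStronglyMeasurable c₀ μ := aestronglyMeasurable_of_tendsto_ae _ hc hlim
  have hC₀ := ae_norm_le_of_tendsto hC hlim
  have h1 : Tendsto (Prod.fst : ℕ × ℕ → ℕ) atTop atTop := by
    rw [← prod_atTop_atTop_eq]; exact tendsto_fst
  have h2 : Tendsto (Prod.snd : ℕ × ℕ → ℕ) atTop atTop := by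
    rw [← prod_atTop_atTop_eq]; exact tendsto_snd
  have hvv : ∀ m n, D.gamma (v m) (v n) =ᵐ[μ] fun y => c m y * c n y * D.gamma (u m) (u n) y := by
    intro m n
    have := hv n (u m)
    rw [D.gamma_symm, D.gamma_symm (u n)] at this
    filter_upwards [hv m (v n), this] with y a1 a2
    rw [a1, a2]; ring
  have hCC : ∀ m n, ∀ᵐ y ∂μ, ‖c m y * c n y‖ ≤ C * C := fun m n => by
    filter_upwards [hC m, hC n] with y a1 a2
    rw [norm_mul]
    exact mul_le_mul a1 a2 (norm_nonneg _) ((norm_nonneg _).trans a1)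
  have hCC₀ : ∀ᵐ y ∂μ, ‖c₀ y * c₀ y‖ ≤ C * C := by
    filter_upwards [hC₀] with y a1
    rw [norm_mul]
    exact mul_le_mul a1 a1 (norm_nonneg _) ((norm_nonneg _).trans a1)
  have key : Tendsto (fun p : ℕ × ℕ => D.cenergy (v p.1) (v p.2)) atTop
      (𝓝 (∫ y, c₀ y * c₀ y * D.gamma u₀ u₀ y ∂μ)) := by
    have k1 := D.tendsto_integral_mul_gamma (l := (atTop : Filter (ℕ × ℕ)))
      (c := fun (p : ℕ × ℕ) y => c p.1 y * c p.2 y) (c₀ := fun y => c₀ y * c₀ y)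
      (u := fun p => u p.1) (w := fun p => u p.2) (u₀ := u₀) (w₀ := u₀)
      (fun p => (hc p.1).mul (hc p.2)) (fun p => hCC p.1 p.2)
      (by
        filter_upwards [hlim] with y hy
        exact (hy.comp h1).mul (hy.comp h2))
      (hu.comp h1) (hu.comp h2)
    have k2 : ∀ p : ℕ × ℕ, Integrable
        (fun y => c p.1 y * c p.2 y * D.gamma (u p.1) (u p.2) y) μ := fun p =>
      Integrable.bdd_mul (f := fun y => c p.1 y * c p.2 y) (integrable_coeFn_L1 _)
        ((hc p.1).mul (hc p.2)) (hCC p.1 p.2)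
    have k3 : Integrable (fun y => c₀ y * c₀ y * D.gamma u₀ u₀ y) μ :=
      Integrable.bdd_mul (f := fun y => c₀ y * c₀ y) (integrable_coeFn_L1 _)
        (hc₀.mul hc₀) hCC₀
    refine (tendsto_integral_of_norm_sub k2 k3 k1).congr fun p => ?_
    exact (integral_congr_ae (hvv p.1 p.2)).symm
  exact tendsto_form_sub_sub D.cenergy D.cenergy_symm key

/-- The relation `gamma v w = c gamma u w` passes to the limit. -/
theorem exists_gamma_eq_of_tendsto {c : ℕ → Y → ℝ} {c₀ : Y → ℝ} {C : ℝ}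
    (hc : ∀ n, AEStronglyMeasurable (c n) μ) (hC : ∀ n, ∀ᵐ y ∂μ, ‖c n y‖ ≤ C)
    (hlim : ∀ᵐ y ∂μ, Tendsto (fun n => c n y) atTop (𝓝 (c₀ y)))
    {u v : ℕ → D.dom} {u₀ : D.dom} {v₀ : Lp ℝ 2 μ}
    (hu : Tendsto (fun n => D.cenergy (u n - u₀) (u n - u₀)) atTop (𝓝 0))
    (hv : ∀ n w, D.gamma (v n) w =ᵐ[μ] fun y => c n y * D.gamma (u n) w y)
    (hv₀ : Tendsto (fun n => (v n : Lp ℝ 2 μ)) atTop (𝓝 v₀)) :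
    ∃ h : v₀ ∈ D.dom, ∀ w, D.gamma ⟨v₀, h⟩ w =ᵐ[μ] fun y => c₀ y * D.gamma u₀ w y := by
  obtain ⟨h, t⟩ := D.exists_tendsto_cenergy_sub hv₀ (D.tendsto_cenergy_sub_sub hc hC hlim hu hv)
  refine ⟨h, fun w => ?_⟩
  have z : Tendsto (fun _ : ℕ => D.cenergy (w - w) (w - w)) atTop (𝓝 0) := by simp
  refine ae_eq_of_tendsto_integral_norm_sub (l := atTop) (g := fun n => D.gamma (v n) w)
    (fun n => integrable_coeFn_L1 _) (integrable_coeFn_L1 _)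
    ((integrable_coeFn_L1 _).bdd_mul (aestronglyMeasurable_of_tendsto_ae _ hc hlim)
      (ae_norm_le_of_tendsto hC hlim))
    (tendsto_integral_norm_sub_of_L1
      (tendsto_gamma D.gamma D.gamma_symm D.gamma_nonneg t z)) ?_
  refine (D.tendsto_integral_mul_gamma hc hC hlim hu z).congr fun n => ?_
  refine integral_congr_ae ?_
  filter_upwards [hv n w] with y hy
  rw [hy]

/-- A relation `gamma v w = c gamma u w` holds for all `w` if it holds for `w ∈ R`. -/
theorem gamma_eq_of_forall_toDom {c : Y → ℝ} {C : ℝ} (hc : AEStronglyMeasurable c μ)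
    (hC : ∀ᵐ y ∂μ, ‖c y‖ ≤ C) {u v : D.dom}
    (h : ∀ G, D.gamma v (D.toDom G) =ᵐ[μ] fun y => c y * D.gamma u (D.toDom G) y) (w : D.dom) :
    D.gamma v w =ᵐ[μ] fun y => c y * D.gamma u w y := by
  have t := (D.approx_seq w).tendsto_cenergy_sub
  have z : ∀ u : D.dom, Tendsto (fun _ : ℕ => D.cenergy (u - u) (u - u)) atTop (𝓝 0) := by simp
  refine ae_eq_of_tendsto_integral_norm_sub (l := atTop)
    (g := fun n => D.gamma v (D.toDom (D.seq w n)))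
    (fun n => integrable_coeFn_L1 _) (integrable_coeFn_L1 _)
    ((integrable_coeFn_L1 _).bdd_mul hc hC)
    (tendsto_integral_norm_sub_of_L1
      (tendsto_gamma D.gamma D.gamma_symm D.gamma_nonneg (z v) t)) ?_
  refine (D.tendsto_integral_mul_gamma (fun _ => hc) (fun _ => hC)
    (ae_of_all _ fun y => tendsto_const_nhds) (z u) t).congr fun n => ?_
  refine integral_congr_ae ?_
  filter_upwards [h (D.seq w n)] with y hy
  rw [hy]

/-- The chain rule for elements of `R`. -/
theorem exists_comp_toDom (F : R) {φ φ' : ℝ → ℝ} (hφ : ∀ x, HasDerivAt φ (φ' x) x)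
    (hφ' : Continuous φ') : ∃ v : D.dom,
    ((v : Lp ℝ 2 μ) =ᵐ[μ] fun y => φ (D.ev F y)) ∧
      ∀ w, D.gamma v w =ᵐ[μ] fun y => φ' (D.ev F y) * D.gamma (D.toDom F) w y := by
  obtain ⟨p, C, h1, h2, h3, h4, h5, h6⟩ := D.exists_polynomial_seq F hφ hφ'
  have hφc : Continuous φ := continuous_iff_continuousAt.2 fun x => (hφ x).continuousAt
  have hm : MemLp (fun y => φ (D.ev F y)) 2 μ :=
    MemLp.of_bound (hφc.comp_aestronglyMeasurable (D.aestronglyMeasurable_ev F)) C h3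
  have m2 : ∀ n, AEStronglyMeasurable (fun y => (p n).derivative.eval (D.ev F y)) μ := fun n =>
    (p n).derivative.continuous.comp_aestronglyMeasurable (D.aestronglyMeasurable_ev F)
  have hL : Tendsto (fun n => (D.toDom (Polynomial.aeval F (p n)) : Lp ℝ 2 μ)) atTop
      (𝓝 (hm.toLp _)) := by
    refine tendsto_L2_of_dominated ((memLp_const (2 * C)).toLp _) (fun n => ?_) ?_
    · filter_upwards [D.coeFn_ev_aeval F (p n), hm.coeFn_toLp, h1 n, h3,
        (memLp_const (μ := μ) (p := 2) (2 * C)).coeFn_toLp] with y a1 a2 a3 a4 a5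
      rw [a5, coe_toDom, coeFn_toL2, a1, a2]
      refine (norm_sub_le _ _).trans ((add_le_add a3 a4).trans ?_)
      rw [← two_mul]; exact le_abs_self _
    · filter_upwards [ae_all_iff.2 fun n => D.coeFn_ev_aeval F (p n), hm.coeFn_toLp, h5]
        with y a1 a2 a3
      simp only [coe_toDom, coeFn_toL2, a1, a2]
      exact a3
  obtain ⟨h, H⟩ := D.exists_gamma_eq_of_tendsto (u := fun _ => D.toDom F) (u₀ := D.toDom F)
    m2 h2 h6 (by simp) (fun n w => D.gamma_eq_of_forall_toDom (m2 n) (h2 n) (fun G => by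
      rw [gamma_toDom, gamma_toDom]; exact D.gam_aeval F G (p n)) w) hL
  exact ⟨⟨_, h⟩, hm.coeFn_toLp, H⟩

/-- The chain rule. -/
theorem exists_comp (u : D.dom) {φ φ' : ℝ → ℝ} (hφ : ∀ x, HasDerivAt φ (φ' x) x)
    (hφ' : Continuous φ') {K : ℝ≥0} (hK : ∀ x, |φ' x| ≤ K) : ∃ v : D.dom,
    ((v : Lp ℝ 2 μ) =ᵐ[μ] fun y => φ ((u : Lp ℝ 2 μ) y)) ∧
      ∀ w, D.gamma v w =ᵐ[μ] fun y => φ' ((u : Lp ℝ 2 μ) y) * D.gamma u w y := by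
  have hL : LipschitzWith K φ := lipschitzWith_of_nnnorm_deriv_le
    (fun x => (hφ x).differentiableAt) fun x => by
      rw [(hφ x).deriv]; exact hK x
  have hm : MemLp (fun y => φ ((u : Lp ℝ 2 μ) y)) 2 μ := by
    refine MemLp.of_le ((((Lp.memLp (u : Lp ℝ 2 μ)).norm.const_mul (K : ℝ))).add
      (memLp_const |φ 0|)) (hL.continuous.comp_aestronglyMeasurable (Lp.aestronglyMeasurable _))
      (ae_of_all _ fun y => ?_)
    have := hL.dist_le_mul ((u : Lp ℝ 2 μ) y) 0
    rw [Real.dist_eq, dist_zero_right] at this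
    refine le_trans ?_ (le_abs_self _)
    rw [Pi.add_apply, Real.norm_eq_abs]
    linarith [abs_sub_abs_le_abs_sub (φ ((u : Lp ℝ 2 μ) y)) (φ 0)]
  obtain ⟨ns, hns, hae⟩ := exists_seq_tendsto_ae_of_L2 (D.approx_seq u).tendsto
  choose v hv hv' using fun n => D.exists_comp_toDom (D.seq u (ns n)) hφ hφ'
  have hL2 : Tendsto (fun n => (v n : Lp ℝ 2 μ)) atTop (𝓝 (hm.toLp _)) := by
    have t := ((tendsto_iff_norm_sub_tendsto_zero.1 (D.approx_seq u).tendsto).comp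
      hns.tendsto_atTop).const_mul (K : ℝ)
    rw [mul_zero] at t
    refine tendsto_iff_norm_sub_tendsto_zero.2
      (squeeze_zero (fun _ => norm_nonneg _) (fun n => ?_) t)
    refine Lp.norm_le_mul_norm_of_ae_le_mul ?_
    filter_upwards [Lp.coeFn_sub (v n : Lp ℝ 2 μ) (hm.toLp _), hm.coeFn_toLp, hv n,
      Lp.coeFn_sub (D.toL2 (D.seq u (ns n))) (u : Lp ℝ 2 μ)] with y a1 a2 a3 a4
    rw [a1, Pi.sub_apply, a2, a3, a4, Pi.sub_apply, coeFn_toL2]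
    have := hL.dist_le_mul (D.ev (D.seq u (ns n)) y) ((u : Lp ℝ 2 μ) y)
    rwa [dist_eq_norm, dist_eq_norm] at this
  obtain ⟨h, H⟩ := D.exists_gamma_eq_of_tendsto (c := fun n y => φ' (D.ev (D.seq u (ns n)) y))
    (c₀ := fun y => φ' ((u : Lp ℝ 2 μ) y)) (C := K)
    (fun n => hφ'.comp_aestronglyMeasurable (D.aestronglyMeasurable_ev _))
    (fun n => ae_of_all _ fun y => hK _)
    (by
      filter_upwards [hae] with y hy
      exact (hφ'.tendsto _).comp hy)
    ((D.approx_seq u).tendsto_cenergy_sub.comp hns.tendsto_atTop) hv' hL2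
  exact ⟨⟨_, h⟩, hm.coeFn_toLp, H⟩

theorem gamma_comp (u v : D.dom) {φ φ' : ℝ → ℝ} (hφ : ∀ x, HasDerivAt φ (φ' x) x)
    (hφ' : Continuous φ') {K : ℝ≥0} (hK : ∀ x, |φ' x| ≤ K)
    (hv : (v : Lp ℝ 2 μ) =ᵐ[μ] fun y => φ ((u : Lp ℝ 2 μ) y)) (w : D.dom) :
    D.gamma v w =ᵐ[μ] fun y => φ' ((u : Lp ℝ 2 μ) y) * D.gamma u w y := by
  obtain ⟨v', h1, h2⟩ := D.exists_comp u hφ hφ' hK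
  have : v = v' := Subtype.ext (Lp.ext (hv.trans h1.symm))
  rw [this]; exact h2 w

end DiffusionAlgebra

end PoissonDirichlet
end

/-! ### Contractions, products and locality for the closure -/

noncomputable section

namespace PoissonDirichlet

/-- A `1`-Lipschitz function is a uniform limit of continuously differentiable ones. -/
theorem exists_contDiff_near_lipschitz {T : ℝ → ℝ} (hT : LipschitzWith 1 T) {ε : ℝ} (hε : 0 < ε) :
    ∃ φ φ' : ℝ → ℝ, (∀ x, HasDerivAt φ (φ' x) x) ∧ Continuous φ' ∧ (∀ x, |φ' x| ≤ 1) ∧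
      ∀ x, |φ x - T x| ≤ ε := by
  have hi : ∀ a b, IntervalIntegrable T volume a b := fun a b =>
    hT.continuous.intervalIntegrable a b
  have hd : ∀ x, HasDerivAt (fun x => ∫ t in (0 : ℝ)..x, T t) (T x) x := fun x =>
    intervalIntegral.integral_hasDerivAt_right (hi _ _)
      (hT.continuous.stronglyMeasurableAtFilter _ _) hT.continuous.continuousAt
  -- The moving average of `T` over [x, x + ε]. Its derivative is a difference quotient of `T`,
  -- hence bounded by 1.
  refine ⟨fun x => ε⁻¹ * ((∫ t in (0 : ℝ)..(x + ε), T t) - ∫ t in (0 : ℝ)..x, T t),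
    fun x => ε⁻¹ * (T (x + ε) - T x), fun x => ?_, ?_, fun x => ?_, fun x => ?_⟩
  · exact (((hd (x + ε)).comp_add_const x ε).sub (hd x)).const_mul _
  · have := hT.continuous; fun_prop
  · have := hT.dist_le_mul (x + ε) x
    rw [Real.dist_eq, Real.dist_eq, add_sub_cancel_left, abs_of_pos hε, NNReal.coe_one,
      one_mul] at this
    rw [abs_mul, abs_of_pos (inv_pos.2 hε), inv_mul_le_iff₀ hε, mul_one]
    exact this
  · have e : ε⁻¹ * ((∫ t in (0 : ℝ)..(x + ε), T t) - ∫ t in (0 : ℝ)..x, T t) - T x =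
        ε⁻¹ * ∫ t in x..(x + ε), (T t - T x) := by
      rw [intervalIntegral.integral_interval_sub_left (hi _ _) (hi _ _),
        intervalIntegral.integral_sub (hi _ _) (by simp)]
      simp only [intervalIntegral.integral_const, add_sub_cancel_left, smul_eq_mul]
      field_simp
    rw [e, abs_mul, abs_of_pos (inv_pos.2 hε), inv_mul_le_iff₀ hε]
    have := intervalIntegral.norm_integral_le_of_norm_le_const (a := x) (b := x + ε)
      (f := fun t => T t - T x) (C := ε) (fun t ht => by
        rw [Set.uIoc_of_le (by linarith)] at ht
        have := hT.dist_le_mul t x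
        rw [NNReal.coe_one, one_mul, Real.dist_eq, Real.dist_eq,
          abs_of_nonneg (by linarith [ht.1] : 0 ≤ t - x)] at this
        rw [Real.norm_eq_abs]
        linarith [ht.2])
    rwa [add_sub_cancel_left, abs_of_pos hε] at this

/-- A continuously differentiable function with bounded derivative, equal to `x²` on `[-M, M]`. -/
theorem exists_sq_near {M : ℝ} (hM : 0 ≤ M) : ∃ φ φ' : ℝ → ℝ,
    (∀ x, HasDerivAt φ (φ' x) x) ∧ Continuous φ' ∧ (∀ x, |φ' x| ≤ 2 * M) ∧
      ∀ x, |x| ≤ M → φ x = x ^ 2 ∧ φ' x = 2 * x := by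
  have hc : Continuous fun t : ℝ => 2 * max (-M) (min t M) := by fun_prop
  have hm : ∀ t, |t| ≤ M → 2 * max (-M) (min t M) = 2 * t := fun t ht => by
    rw [min_eq_left (abs_le.1 ht).2, max_eq_right (abs_le.1 ht).1]
  -- The primitive of 2t with t truncated to [-M, M], so that the derivative remains bounded
  -- outside.
  refine ⟨fun x => ∫ t in (0 : ℝ)..x, 2 * max (-M) (min t M), fun t => 2 * max (-M) (min t M),
    fun x => intervalIntegral.integral_hasDerivAt_right (hc.intervalIntegrable _ _)
      (hc.stronglyMeasurableAtFilter _ _) hc.continuousAt, hc, fun x => ?_,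
      fun x hx => ⟨?_, hm x hx⟩⟩
  · rw [abs_mul, abs_two]
    refine mul_le_mul_of_nonneg_left (abs_le.2 ⟨le_max_left _ _, max_le (by linarith)
      (min_le_right _ _)⟩) two_pos.le
  · have : ∫ t in (0 : ℝ)..x, 2 * max (-M) (min t M) = ∫ t in (0 : ℝ)..x, 2 * t := by
      refine intervalIntegral.integral_congr fun t ht => hm t ?_
      have := Set.abs_sub_left_of_mem_uIcc ht
      rw [sub_zero, sub_zero] at this
      exact this.trans hx
    dsimp only
    rw [this, intervalIntegral.integral_const_mul, integral_id]
    ring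

namespace DiffusionAlgebra

variable {Y : Type*} [MeasurableSpace Y] {μ : Measure Y} [IsFiniteMeasure μ]
  {R : Type*} [CommRing R] [Algebra ℝ R] (D : DiffusionAlgebra μ R)

/-- Normal contractions operate. -/
theorem exists_contraction {T : ℝ → ℝ} (hT : LipschitzWith 1 T) (h0 : T 0 = 0) (u : D.dom) :
    ∃ v : D.dom, ((v : Lp ℝ 2 μ) =ᵐ[μ] fun y => T ((u : Lp ℝ 2 μ) y)) ∧
      1 / 2 * D.cenergy v v ≤ 1 / 2 * D.cenergy u u := by
  have hm : MemLp (fun y => T ((u : Lp ℝ 2 μ) y)) 2 μ := hT.comp_memLp h0 (Lp.memLp _)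
  choose φ φ' h1 h2 h3 h4 using fun n : ℕ =>
    exists_contDiff_near_lipschitz hT (ε := 1 / ((n : ℝ) + 1)) (by positivity)
  choose v hv hv' using fun n => D.exists_comp u (h1 n) (h2 n) (K := 1) (by simpa using h3 n)
  have hlim : Tendsto (fun n => (v n : Lp ℝ 2 μ)) atTop (𝓝 (hm.toLp _)) := by
    refine tendsto_L2_of_dominated ((memLp_const (1 : ℝ)).toLp _) (fun n => ?_) ?_
    · filter_upwards [hv n, hm.coeFn_toLp,
        (memLp_const (μ := μ) (p := 2) (1 : ℝ)).coeFn_toLp] with y a1 a2 a3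
      rw [a1, a2, a3, norm_one]
      refine (h4 n _).trans ?_
      rw [div_le_one (by positivity)]; linarith [Nat.cast_nonneg (α := ℝ) n]
    · filter_upwards [ae_all_iff.2 hv, hm.coeFn_toLp] with y a1 a2
      simp only [a1, a2]
      exact tendsto_iff_norm_sub_tendsto_zero.2 (squeeze_zero (fun _ => norm_nonneg _)
        (fun n => h4 n _) tendsto_one_div_add_atTop_nhds_zero_nat)
  -- The chain rule in both arguments gives gamma (v n) (v n) = φ'(u)² gamma u u with |φ'| ≤ 1.
  -- Lower semicontinuity then carries the bound to the Lipschitz limit.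
  have hle : ∀ n, 1 / 2 * D.cenergy (v n) (v n) ≤ 1 / 2 * D.cenergy u u := fun n => by
    refine mul_le_mul_of_nonneg_left ?_ (by norm_num)
    refine integral_mono_ae (integrable_coeFn_L1 _) (integrable_coeFn_L1 _) ?_
    have := hv' n u
    rw [D.gamma_symm] at this
    filter_upwards [hv' n (v n), this, D.gamma_nonneg u] with y a1 a2 a3
    rw [a1, a2, ← mul_assoc, ← sq]
    refine mul_le_of_le_one_left a3 ?_
    rw [← sq_abs]
    exact pow_le_one₀ (abs_nonneg _) (h3 n _)
  obtain ⟨h, H⟩ := D.closedForm.mem_dom_of_tendsto (u := v) hlim hle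
  exact ⟨⟨_, h⟩, hm.coeFn_toLp, H⟩

/-- The product rule. -/
theorem gamma_mul (f g p : D.dom) (hf : MemLp (f : Lp ℝ 2 μ) ∞ μ)
    (hg : MemLp (g : Lp ℝ 2 μ) ∞ μ)
    (hp : (p : Lp ℝ 2 μ) =ᵐ[μ] fun y => (f : Lp ℝ 2 μ) y * (g : Lp ℝ 2 μ) y) (w : D.dom) :
    D.gamma p w =ᵐ[μ] fun y =>
      (f : Lp ℝ 2 μ) y * D.gamma g w y + (g : Lp ℝ 2 μ) y * D.gamma f w y := by
  -- The product rule reduces to squares by polarization. For a bounded f, the square is a function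
  -- with bounded derivative on the range of f, to which the chain rule applies.
  have hsq : ∀ f : D.dom, MemLp (f : Lp ℝ 2 μ) ∞ μ → ∃ s : D.dom,
      ((s : Lp ℝ 2 μ) =ᵐ[μ] fun y => (f : Lp ℝ 2 μ) y ^ 2) ∧
      D.gamma s w =ᵐ[μ] fun y => 2 * (f : Lp ℝ 2 μ) y * D.gamma f w y := fun f hf => by
    obtain ⟨φ, φ', a1, a2, a3, a4⟩ := exists_sq_near
      (M := (eLpNormEssSup (f : Lp ℝ 2 μ) μ).toReal) ENNReal.toReal_nonneg
    have hM : ∀ᵐ y ∂μ, |(f : Lp ℝ 2 μ) y| ≤ (eLpNormEssSup (f : Lp ℝ 2 μ) μ).toReal := by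
      filter_upwards [ae_le_eLpNormEssSup (f := (f : Lp ℝ 2 μ)) (μ := μ)] with y hy
      have htop := hf.2
      rw [eLpNorm_exponent_top] at htop
      have := ENNReal.toReal_mono htop.ne hy
      rwa [toReal_enorm] at this
    obtain ⟨s, h1, h2⟩ := D.exists_comp f a1 a2
      (K := 2 * (eLpNormEssSup (f : Lp ℝ 2 μ) μ).toNNReal) a3
    refine ⟨s, ?_, ?_⟩
    · filter_upwards [h1, hM] with y b1 b2
      rw [b1, (a4 _ b2).1]
    · filter_upwards [h2 w, hM] with y b1 b2
      rw [b1, (a4 _ b2).2]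
  obtain ⟨s₁, h1, h1'⟩ := hsq f hf
  obtain ⟨s₂, h2, h2'⟩ := hsq g hg
  obtain ⟨s₃, h3, h3'⟩ := hsq (f + g) ((hf.add hg).ae_eq (Lp.coeFn_add _ _).symm)
  have e : p = (1 / 2 : ℝ) • (s₃ - s₁ - s₂) := by
    apply Subtype.ext
    apply Lp.ext
    filter_upwards [hp, h1, h2, h3, Lp.coeFn_add (f : Lp ℝ 2 μ) g,
      Lp.coeFn_smul (1 / 2 : ℝ) ((s₃ : Lp ℝ 2 μ) - (s₁ : Lp ℝ 2 μ) - (s₂ : Lp ℝ 2 μ)),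
      Lp.coeFn_sub (s₃ : Lp ℝ 2 μ) s₁,
      Lp.coeFn_sub ((s₃ : Lp ℝ 2 μ) - (s₁ : Lp ℝ 2 μ)) s₂] with y a1 a2 a3 a4 a5 a6 a7 a8
    change _ = ((1 / 2 : ℝ) • ((s₃ : Lp ℝ 2 μ) - (s₁ : Lp ℝ 2 μ) - (s₂ : Lp ℝ 2 μ)) : Lp ℝ 2 μ) y
    change (s₃ : Lp ℝ 2 μ) y = ((f : Lp ℝ 2 μ) + g : Lp ℝ 2 μ) y ^ 2 at a4
    rw [a6, Pi.smul_apply, a8, Pi.sub_apply, a7, Pi.sub_apply, a1, a2, a3, a4, a5, Pi.add_apply,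
      smul_eq_mul]
    ring
  have e2 : D.gamma p w = (1 / 2 : ℝ) • (D.gamma s₃ w - D.gamma s₁ w - D.gamma s₂ w) := by
    rw [e]; simp only [map_smul, map_sub, LinearMap.smul_apply, LinearMap.sub_apply]
  rw [map_add, LinearMap.add_apply] at h3'
  rw [e2]
  filter_upwards [h1', h2', h3', Lp.coeFn_add (f : Lp ℝ 2 μ) g,
    Lp.coeFn_add (D.gamma f w) (D.gamma g w),
    Lp.coeFn_smul (1 / 2 : ℝ) (D.gamma s₃ w - D.gamma s₁ w - D.gamma s₂ w),
    Lp.coeFn_sub (D.gamma s₃ w) (D.gamma s₁ w),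
    Lp.coeFn_sub (D.gamma s₃ w - D.gamma s₁ w) (D.gamma s₂ w)] with y a1 a2 a3 a4 a5 a6 a7 a8
  change _ = 2 * ((f : Lp ℝ 2 μ) + g : Lp ℝ 2 μ) y * _ at a3
  rw [a6, Pi.smul_apply, a8, Pi.sub_apply, a7, Pi.sub_apply, a1, a2, a3, a4, a5, Pi.add_apply,
    Pi.add_apply, smul_eq_mul]
  ring

theorem exists_hasDerivAt_bound {F : ℝ → ℝ} (hF : ContDiff ℝ (⊤ : ℕ∞) F)
    (hc : HasCompactSupport F) : (∀ x, HasDerivAt F (deriv F x) x) ∧ Continuous (deriv F) ∧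
      ∃ K : ℝ≥0, ∀ x, |deriv F x| ≤ K := by
  have h1 : Continuous (deriv F) := hF.continuous_deriv (by simp)
  refine ⟨fun x => (hF.differentiable (by simp) x).hasDerivAt, h1, ?_⟩
  obtain ⟨C, hC⟩ := h1.bounded_above_of_compact_support hc.deriv
  exact ⟨⟨|C|, abs_nonneg C⟩, fun x => (hC x).trans (le_abs_self C)⟩

/-- The closure, as a local Dirichlet structure. -/
def localDirichletStructure : LocalDirichletStructure μ where
  dom := D.dom
  form := (1 / 2 : ℝ) • D.cenergy
  symm := D.closedForm.symm
  nonneg := D.closedForm.nonneg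
  dense u := by
    rw [Metric.mem_closure_iff]
    intro r hr
    obtain ⟨F, h, hF⟩ := D.dense u r hr
    exact ⟨D.toDom F, (D.toDom F).2, by rw [dist_eq_norm]; exact hF⟩
  closed := D.closedForm.closed
  contraction T hT h0 u := D.exists_contraction hT h0 u
  isLocal F G hF hG hF' hG' hd u v w hv hw := by
    obtain ⟨f1, f2, K, f3⟩ := exists_hasDerivAt_bound hF hF'
    obtain ⟨g1, g2, L, g3⟩ := exists_hasDerivAt_bound hG hG'
    -- The two chain rules give gamma v w = F'(u) G'(u) gamma u u, and F' G' = 0 because the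
    -- supports are disjoint.
    have a := D.gamma_comp u v (fun x => (f1 x).sub_const (F 0)) f2 f3 hv w
    have b := D.gamma_comp u w (fun x => (g1 x).sub_const (G 0)) g2 g3 hw u
    rw [D.gamma_symm] at b
    change 1 / 2 * ∫ y, D.gamma v w y ∂μ = 0
    rw [mul_eq_zero]
    right
    refine integral_eq_zero_of_ae ?_
    filter_upwards [a, b] with y ha hb
    rw [ha, hb, Pi.zero_apply]
    set x := (u : Lp ℝ 2 μ) y
    by_cases hx : x ∈ tsupport F
    · have : deriv G x = 0 := by
        by_contra hne
        exact Set.disjoint_left.1 hd hx (support_deriv_subset hne)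
      rw [this]; ring
    · have : deriv F x = 0 := by
        by_contra hne
        exact hx (support_deriv_subset hne)
      rw [this]; ring
  gamma := D.gamma
  gamma_symm := D.gamma_symm
  gamma_nonneg := D.gamma_nonneg
  energy u := rfl
  gamma_spec f g h fh gh fg hf hg hh hfh hgh hfg := by
    -- Three Leibniz rules: the terms carrying f or g cancel and 2 h gamma f g is left, which the
    -- factor ½ in the form normalizes.
    have a1 := D.gamma_mul f h fh hf hh hfh g
    have a2 := D.gamma_mul g h gh hg hh hgh f
    have a3 := D.gamma_mul f g fg hf hg hfg h
    rw [D.gamma_symm h g] at a1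
    rw [D.gamma_symm h f, D.gamma_symm g f] at a2
    change 1 / 2 * ∫ y, D.gamma fh g y ∂μ + 1 / 2 * ∫ y, D.gamma gh f y ∂μ
      - 1 / 2 * ∫ y, D.gamma h fg y ∂μ = _
    rw [D.gamma_symm h fg, ← mul_add, ← mul_sub,
      ← integral_add (integrable_coeFn_L1 _) (integrable_coeFn_L1 _),
      ← integral_sub ((integrable_coeFn_L1 _).add (integrable_coeFn_L1 _))
        (integrable_coeFn_L1 _), ← integral_const_mul]
    refine integral_congr_ae ?_
    filter_upwards [a1, a2, a3] with y b1 b2 b3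
    change 1 / 2 * (D.gamma fh g y + D.gamma gh f y - D.gamma fg h y) = _
    rw [b1, b2, b3]
    ring

end DiffusionAlgebra

end PoissonDirichlet
end

noncomputable section

namespace PoissonDirichlet

/-! ### Poisson random measures: first moments and characteristic functional -/

theorem lintegral_poissonMeasure (r : ℝ≥0) : ∫⁻ n, (n : ℝ≥0∞) ∂poissonMeasure r = r := by
  have h1 : ∑' n : ℕ, ENNReal.ofReal (Real.exp (-r) * (r : ℝ) ^ n / (n.factorial : ℝ)) = 1 := by
    rw [← ENNReal.ofReal_tsum_of_nonneg (fun n => by positivity)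
      (hasSum_one_poissonMeasure r).summable, (hasSum_one_poissonMeasure r).tsum_eq,
      ENNReal.ofReal_one]
  rw [poissonMeasure, lintegral_sum_measure]
  simp only [lintegral_smul_measure, lintegral_dirac, smul_eq_mul]
  rw [tsum_eq_zero_add' ENNReal.summable]
  simp only [Nat.cast_zero, mul_zero, zero_add]
  calc ∑' n : ℕ, ENNReal.ofReal (Real.exp (-r) * (r : ℝ) ^ (n + 1) / ((n + 1).factorial : ℝ)) *
        ((n + 1 : ℕ) : ℝ≥0∞)
      = ∑' n : ℕ, (r : ℝ≥0∞) *
          ENNReal.ofReal (Real.exp (-r) * (r : ℝ) ^ n / (n.factorial : ℝ)) := by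
        refine tsum_congr fun n => ?_
        rw [← ENNReal.ofReal_natCast, ← ENNReal.ofReal_mul (by positivity),
          ← ENNReal.ofReal_coe_nnreal (p := r), ← ENNReal.ofReal_mul r.coe_nonneg]
        congr 1
        rw [Nat.factorial_succ]
        push_cast
        field_simp
        ring
    _ = r := by rw [ENNReal.tsum_mul_left, h1, mul_one]

variable {X : Type*} [MeasurableSpace X] {ν : Measure X} {P : Measure (Configuration X)}

theorem measurable_configuration :
    Measurable (Subtype.val : Configuration X → Measure X) := measurable_subtype_coe

theorem measurable_count {B : Set X} (hB : MeasurableSet B) :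
    Measurable fun ω : Configuration X => ω.1 B :=
  (Measure.measurable_coe hB).comp measurable_configuration

theorem N_smul (c : ℝ) (h : X → ℝ) (ω : Configuration X) : N (c • h) ω = c * N h ω :=
  integral_const_mul c h

namespace IsPoissonLaw

variable (hP : IsPoissonLaw ν P)

include hP

theorem lintegral_count {B : Set X} (hB : MeasurableSet B) (h : ν B ≠ ∞) :
    ∫⁻ ω, ω.1 B ∂P = ν B := by
  have := lintegral_map (μ := P) (measurable_id (α := ℝ≥0∞)) (measurable_count hB)
  simp only [id] at this
  rw [← this, hP.law B hB h, lintegral_map (f := fun a => a) measurable_id (by fun_prop),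
    lintegral_poissonMeasure, ENNReal.coe_toNNReal h]

variable [SigmaFinite ν]

/-- The intensity of the random measure is `ν`. -/
theorem bind_eq : P.bind Subtype.val = ν := by
  -- The law of the counts is prescribed only on sets of finite measure, so the two measures are
  -- compared on an exhaustion by such sets.
  rw [Measure.ext_iff_of_iUnion_eq_univ (iUnion_spanningSets ν)]
  intro i
  ext B hB
  have hB' := hB.inter (measurableSet_spanningSets ν i)
  rw [Measure.restrict_apply hB, Measure.restrict_apply hB,
    Measure.bind_apply hB' measurable_configuration.aemeasurable]
  exact hP.lintegral_count hB'
    (ne_top_of_le_ne_top (measure_spanningSets_lt_top ν i).ne (measure_mono Set.inter_subset_right))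

theorem lintegral_lintegral {f : X → ℝ≥0∞} (hf : AEMeasurable f ν) :
    ∫⁻ ω, ∫⁻ x, f x ∂ω.1 ∂P = ∫⁻ x, f x ∂ν := by
  have := Measure.lintegral_bind (m := P) (f := f) measurable_configuration.aemeasurable
    (by rwa [hP.bind_eq])
  rw [hP.bind_eq] at this
  exact this.symm

/-- Since ν is the mean of the random measure, a ν-null set is null for almost every configuration.
Hence N(h) depends, almost surely, only on the ν-class of h, and may be applied to elements of `Lp`.
-/
theorem ae_ae {p : X → Prop} (h : ∀ᵐ x ∂ν, p x) : ∀ᵐ ω ∂P, ∀ᵐ x ∂ω.1, p x := by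
  rw [← hP.bind_eq] at h
  exact Measure.ae_ae_of_ae_bind measurable_configuration.aemeasurable h

theorem N_congr {h k : X → ℝ} (e : h =ᵐ[ν] k) : N h =ᵐ[P] N k := by
  filter_upwards [hP.ae_ae e] with ω hω
  exact integral_congr_ae hω

theorem ae_integrable {h : X → ℝ} (hh : Integrable h ν) : ∀ᵐ ω ∂P, Integrable h ω.1 := by
  have h1 : ∫⁻ ω, ∫⁻ x, ‖h x‖ₑ ∂ω.1 ∂P ≠ ∞ := by
    rw [hP.lintegral_lintegral hh.1.enorm]; exact hh.2.ne
  have m : Measurable fun ω : Configuration X => ∫⁻ x, ‖hh.1.mk h x‖ₑ ∂ω.1 :=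
    (Measure.measurable_lintegral hh.1.stronglyMeasurable_mk.enorm).comp measurable_configuration
  have e := hP.ae_ae hh.1.ae_eq_mk
  have h2 : (fun ω : Configuration X => ∫⁻ x, ‖h x‖ₑ ∂ω.1) =ᵐ[P]
      fun ω => ∫⁻ x, ‖hh.1.mk h x‖ₑ ∂ω.1 := by
    filter_upwards [e] with ω hω
    refine lintegral_congr_ae ?_
    filter_upwards [hω] with x hx
    rw [hx]
  filter_upwards [ae_lt_top' (m.aemeasurable.congr h2.symm) h1, e] with ω h3 h4
  exact ⟨⟨_, hh.1.stronglyMeasurable_mk, h4⟩, h3⟩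

theorem aestronglyMeasurable_N {h : X → ℝ} (hh : Integrable h ν) :
    AEStronglyMeasurable (N h) P := by
  have hh' : Integrable (hh.1.mk h) ν := hh.congr hh.1.ae_eq_mk
  have m := hh.1.stronglyMeasurable_mk.measurable
  have m1 : Measurable fun ω : Configuration X => ∫⁻ x, ENNReal.ofReal (hh.1.mk h x) ∂ω.1 :=
    (Measure.measurable_lintegral m.ennreal_ofReal).comp measurable_configuration
  have m2 : Measurable fun ω : Configuration X => ∫⁻ x, ENNReal.ofReal (-hh.1.mk h x) ∂ω.1 :=
    (Measure.measurable_lintegral m.neg.ennreal_ofReal).comp measurable_configuration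
  refine ((m1.ennreal_toReal.sub m2.ennreal_toReal).aestronglyMeasurable (μ := P)).congr ?_
  filter_upwards [hP.ae_integrable hh', hP.N_congr hh.1.ae_eq_mk] with ω h1 h2
  rw [h2, N, integral_eq_lintegral_pos_part_sub_lintegral_neg_part h1]
  rfl

theorem lintegral_enorm_N_le {h : X → ℝ} (hh : Integrable h ν) :
    ∫⁻ ω, ‖N h ω‖ₑ ∂P ≤ ∫⁻ x, ‖h x‖ₑ ∂ν := by
  rw [← hP.lintegral_lintegral hh.1.enorm]
  exact lintegral_mono fun ω => enorm_integral_le_lintegral_enorm _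

theorem integrable_N {h : X → ℝ} (hh : Integrable h ν) : Integrable (N h) P :=
  ⟨hP.aestronglyMeasurable_N hh, (hP.lintegral_enorm_N_le hh).trans_lt hh.2⟩

theorem integral_norm_N_le {h : X → ℝ} (hh : Integrable h ν) :
    ∫ ω, ‖N h ω‖ ∂P ≤ ∫ x, ‖h x‖ ∂ν := by
  rw [integral_norm_eq_lintegral_enorm (hP.aestronglyMeasurable_N hh),
    integral_norm_eq_lintegral_enorm hh.1]
  exact ENNReal.toReal_mono hh.2.ne (hP.lintegral_enorm_N_le hh)

theorem N_add {h k : X → ℝ} (hh : Integrable h ν) (hk : Integrable k ν) :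
    N (h + k) =ᵐ[P] N h + N k := by
  filter_upwards [hP.ae_integrable hh, hP.ae_integrable hk] with ω h1 h2
  exact integral_add h1 h2

theorem N_sub {h k : X → ℝ} (hh : Integrable h ν) (hk : Integrable k ν) :
    N (h - k) =ᵐ[P] N h - N k := by
  filter_upwards [hP.ae_integrable hh, hP.ae_integrable hk] with ω h1 h2
  exact integral_sub h1 h2

end IsPoissonLaw

theorem norm_exp_I_mul_sub_le (x y : ℝ) :
    ‖Complex.exp (Complex.I * x) - Complex.exp (Complex.I * y)‖ ≤ |x - y| := by
  have e : Complex.exp (Complex.I * x) - Complex.exp (Complex.I * y) =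
      Complex.exp (Complex.I * y) * (Complex.exp (Complex.I * ((x - y : ℝ) : ℂ)) - 1) := by
    rw [mul_sub, ← Complex.exp_add, mul_one]
    congr 2
    push_cast; ring
  rw [e, norm_mul, mul_comm Complex.I, Complex.norm_exp_ofReal_mul_I, one_mul]
  exact Real.norm_exp_I_mul_ofReal_sub_one_le

theorem norm_exp_I_mul (x : ℝ) : ‖Complex.exp (Complex.I * x)‖ = 1 := by
  rw [mul_comm, Complex.norm_exp_ofReal_mul_I]

theorem continuous_exp_I_mul : Continuous fun x : ℝ => Complex.exp (Complex.I * x) := by fun_prop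

namespace IsPoissonLaw

variable (hP : IsPoissonLaw ν P)

include hP

theorem integral_exp_count (c : ℝ) {B : Set X} (hB : MeasurableSet B) (h : ν B ≠ ∞) :
    charFun (P.map fun ω => c * (ω.1 B).toReal) 1 =
      Complex.exp (ν.real B * (Complex.exp (Complex.I * c) - 1)) := by
  have m := measurable_count hB
  have e : P.map (fun ω => (ω.1 B).toReal) =
      (poissonMeasure (ν B).toNNReal).map (Nat.cast : ℕ → ℝ) := by
    have e1 : (fun ω : Configuration X => (ω.1 B).toReal) =
      ENNReal.toReal ∘ fun ω : Configuration X => ω.1 B := rfl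
    rw [e1, ← Measure.map_map (by fun_prop) m, hP.law B hB h, Measure.map_map (by fun_prop)
      (by fun_prop)]
    congr 1
  have e2 : P.map (fun ω => c * (ω.1 B).toReal) =
      (P.map fun ω => (ω.1 B).toReal).map (c * ·) := by
    rw [Measure.map_map (by fun_prop) m.ennreal_toReal]; rfl
  rw [e2, charFun_map_mul, e, charFun_map_cast_poissonMeasure, mul_one, mul_comm Complex.I]
  rfl

variable [SigmaFinite ν]

/-- The characteristic functional, for simple functions. -/
theorem integral_exp_N_simpleFunc (f : SimpleFunc X ℝ) (hf : Integrable f ν) :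
    ∫ ω, Complex.exp (Complex.I * (N f ω : ℂ)) ∂P =
      Complex.exp (∫ x, (Complex.exp (Complex.I * (f x : ℂ)) - 1) ∂ν) := by
  -- Only the nonzero values are enumerated: their level sets have finite measure and are disjoint,
  -- so the counts are independent Poisson variables. The value 0 contributes to neither side.
  set s := f.range.filter (· ≠ 0) with hs
  let e := s.equivFin.symm
  let B : Fin s.card → Set X := fun i => f ⁻¹' {(e i : ℝ)}
  have hB : ∀ i, MeasurableSet (B i) := fun i => f.measurableSet_preimage _
  have hfin : ∀ i, ν (B i) ≠ ∞ := fun i =>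
    ((SimpleFunc.integrable_iff.1 hf) _ (Finset.mem_filter.1 (e i).2).2).ne
  have hdis : Pairwise fun i j => Disjoint (B i) (B j) := fun i j hij => by
    refine Set.disjoint_left.2 fun x hx hx' => hij ?_
    have h1 : f x = e i := hx
    have h2 : f x = e j := hx'
    exact e.injective (Subtype.ext (h1.symm.trans h2))
  have ind := (hP.indep _ B hB hdis).comp (fun i (t : ℝ≥0∞) => (e i : ℝ) * t.toReal)
    (fun i => by fun_prop)
  have key := congrFun (ind.charFun_map_fun_sum_eq_prod (fun i =>
    ((measurable_count (hB i)).ennreal_toReal.const_mul _).aemeasurable)) 1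
  have sumB : ∀ {M : Type} [AddCommMonoid M] (g : ℝ → M), g 0 = 0 →
      ∑ c ∈ f.range, g c = ∑ i, g (e i) := fun {M} _ g hg => by
    rw [e.sum_comp (fun c : s => g c), Finset.sum_coe_sort s g, hs, Finset.sum_filter]
    refine Finset.sum_congr rfl fun c _ => ?_
    split_ifs with h
    · rfl
    · rw [not_not.1 h, hg]
  have eN : ∀ᵐ ω ∂P, ∑ i, (e i : ℝ) * (ω.1 (B i)).toReal = N f ω := by
    filter_upwards [hP.ae_integrable hf] with ω hω
    rw [N, ← SimpleFunc.integral_eq_integral f hω, SimpleFunc.integral_eq,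
      sumB (fun c => ω.1.real (f ⁻¹' {c}) • c) (by simp)]
    refine Finset.sum_congr rfl fun i _ => ?_
    rw [smul_eq_mul, mul_comm]; rfl
  have eR : ∫ x, (Complex.exp (Complex.I * (f x : ℂ)) - 1) ∂ν =
      ∑ i, (ν.real (B i) : ℂ) * (Complex.exp (Complex.I * ((e i : ℝ) : ℂ)) - 1) := by
    have h := SimpleFunc.map_integral f (fun t : ℝ => Complex.exp (Complex.I * (t : ℂ)) - 1) hf
      (by simp)
    rw [sumB _ (by simp)] at h
    have hi : Integrable (f.map fun t : ℝ => Complex.exp (Complex.I * (t : ℂ)) - 1) ν := by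
      refine hf.mono (SimpleFunc.aestronglyMeasurable _) (ae_of_all _ fun x => ?_)
      exact Real.norm_exp_I_mul_ofReal_sub_one_le
    rw [SimpleFunc.integral_eq_integral _ hi] at h
    simpa using h
  have hm : Measurable fun ω : Configuration X => ∑ i, (e i : ℝ) * (ω.1 (B i)).toReal :=
    Finset.measurable_fun_sum _ fun i _ => (measurable_count (hB i)).ennreal_toReal.const_mul _
  rw [Finset.prod_apply] at key
  rw [charFun_apply, integral_map hm.aemeasurable (by fun_prop)] at key
  rw [eR, Complex.exp_sum, ← Finset.prod_congr rfl fun i _ => hP.integral_exp_count (e i) (hB i)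
    (hfin i)]
  refine Eq.trans ?_ key
  refine integral_congr_ae ?_
  filter_upwards [eN] with ω hω
  rw [← hω]
  simp [mul_comm]

/-- The characteristic functional of a Poisson random measure. -/
theorem integral_exp_N [IsProbabilityMeasure P] {f : X → ℝ} (hf : Integrable f ν) :
    ∫ ω, Complex.exp (Complex.I * (N f ω : ℂ)) ∂P =
      Complex.exp (∫ x, (Complex.exp (Complex.I * (f x : ℂ)) - 1) ∂ν) := by
  choose g hg hg' using fun n : ℕ =>
    (memLp_one_iff_integrable.2 hf).exists_simpleFunc_eLpNorm_sub_lt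
    (by simp) (ε := ENNReal.ofReal (1 / ((n : ℝ) + 1))) (by simp; positivity)
  have hgi : ∀ n, Integrable (g n) ν := fun n => memLp_one_iff_integrable.1 (hg' n)
  have hi : ∀ k : X → ℝ, Integrable k ν →
      Integrable (fun x => Complex.exp (Complex.I * (k x : ℂ)) - 1) ν := fun k hk =>
    hk.mono ((continuous_exp_I_mul.comp_aestronglyMeasurable hk.1).sub aestronglyMeasurable_const)
      (ae_of_all _ fun x => Real.norm_exp_I_mul_ofReal_sub_one_le)
  have hj : ∀ k : X → ℝ, Integrable k ν →
      Integrable (fun ω => Complex.exp (Complex.I * (N k ω : ℂ))) P := fun k hk =>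
    Integrable.of_bound
      (continuous_exp_I_mul.comp_aestronglyMeasurable (hP.aestronglyMeasurable_N hk)) 1
      (ae_of_all _ fun ω => (norm_exp_I_mul _).le)
  -- Both integrals in the identity, over P and over ν, are Lipschitz in the L¹(ν) norm because
  -- |e^{ix} - e^{iy}| ≤ |x - y| and E|N(h)| ≤ ∫ |h| dν.
  have h0 : Tendsto (fun n => ∫ x, ‖g n x - f x‖ ∂ν) atTop (𝓝 0) := by
    refine squeeze_zero (fun n => by positivity) (fun n => ?_)
      (tendsto_one_div_add_atTop_nhds_zero_nat (𝕜 := ℝ))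
    have h1 := (hg n).le
    rw [eLpNorm_one_eq_lintegral_enorm] at h1
    rw [integral_norm_eq_lintegral_enorm (f := fun x => g n x - f x) ((hgi n).sub hf).1]
    refine ENNReal.toReal_le_of_le_ofReal (by positivity) (le_trans (le_of_eq ?_) h1)
    refine lintegral_congr fun x => ?_
    rw [← enorm_neg, neg_sub]; rfl
  have h2 : Tendsto (fun n => ∫ ω, Complex.exp (Complex.I * (N (g n) ω : ℂ)) ∂P) atTop
      (𝓝 (∫ ω, Complex.exp (Complex.I * (N f ω : ℂ)) ∂P)) := by
    refine tendsto_integral_of_norm_sub (fun n => hj _ (hgi n)) (hj f hf)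
      (squeeze_zero (fun n => by positivity) (fun n => ?_) h0)
    refine le_trans ?_ (hP.integral_norm_N_le ((hgi n).sub hf))
    refine integral_mono_ae ((hj _ (hgi n)).sub (hj f hf)).norm
      (hP.integrable_N ((hgi n).sub hf)).norm ?_
    filter_upwards [hP.N_sub (hgi n) hf] with ω hω
    change _ ≤ ‖N (⇑(g n) - f) ω‖
    rw [hω]
    exact norm_exp_I_mul_sub_le _ _
  have h3 : Tendsto (fun n => ∫ x, (Complex.exp (Complex.I * (g n x : ℂ)) - 1) ∂ν) atTop
      (𝓝 (∫ x, (Complex.exp (Complex.I * (f x : ℂ)) - 1) ∂ν)) := by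
    refine tendsto_integral_of_norm_sub (fun n => hi _ (hgi n)) (hi f hf)
      (squeeze_zero (fun n => by positivity) (fun n => ?_) h0)
    refine integral_mono ((hi _ (hgi n)).sub (hi f hf)).norm ((hgi n).sub hf).norm fun x => ?_
    rw [sub_sub_sub_cancel_right]
    exact norm_exp_I_mul_sub_le _ _
  refine tendsto_nhds_unique h2 (((Complex.continuous_exp.tendsto _).comp h3).congr fun n => ?_)
  exact (hP.integral_exp_N_simpleFunc (g n) (hgi n)).symm

end IsPoissonLaw

end PoissonDirichlet
end

/-! ### Differentiated characteristic functional and L² bound -/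

noncomputable section

namespace PoissonDirichlet

theorem norm_exp_I_mul_sub_one_sub_le (x : ℝ) :
    ‖Complex.exp (Complex.I * x) - 1 - Complex.I * x‖ ≤ 2 * x ^ 2 := by
  by_cases hx : |x| ≤ 1
  · have h := Complex.norm_exp_sub_one_sub_id_le (x := Complex.I * x) (by simpa using hx)
    refine h.trans ?_
    rw [norm_mul, Complex.norm_I, one_mul, Complex.norm_real, Real.norm_eq_abs, sq_abs]
    nlinarith [sq_nonneg x]
  · have h1 : ‖Complex.exp (Complex.I * x) - 1‖ ≤ |x| := Real.norm_exp_I_mul_ofReal_sub_one_le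
    have h2 : ‖Complex.I * (x : ℂ)‖ = |x| := by simp
    have h3 := norm_sub_le (Complex.exp (Complex.I * x) - 1) (Complex.I * x)
    rw [h2] at h3
    rw [← sq_abs]
    nlinarith [not_le.1 hx]

/-- `(sin (x s) / s)² → x²` as `s → 0`, along `s = 1 / (2 (n + 1))`. -/
theorem tendsto_one_sub_cos (x : ℝ) :
    Tendsto (fun n : ℕ => 2 * ((n : ℝ) + 1) ^ 2 * (1 - Real.cos (1 / ((n : ℝ) + 1) * x))) atTop
      (𝓝 (x ^ 2)) := by
  have hd : HasDerivAt (fun s : ℝ => Real.sin (s * x)) x 0 := by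
    have := (Real.hasDerivAt_sin (0 * x)).comp (0 : ℝ) ((hasDerivAt_id (0 : ℝ)).mul_const x)
    simpa [Function.comp_def] using this
  have h := hd.tendsto_slope_zero
  have hs : Tendsto (fun n : ℕ => 1 / ((n : ℝ) + 1) / 2) atTop (𝓝[≠] 0) := by
    refine tendsto_nhdsWithin_iff.2 ⟨?_, Eventually.of_forall fun n => ?_⟩
    · simpa using (tendsto_one_div_add_atTop_nhds_zero_nat (𝕜 := ℝ)).div_const 2
    · simp only [Set.mem_compl_iff, Set.mem_singleton_iff]; positivity
  refine ((h.comp hs).pow 2).congr fun n => ?_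
  have hn : ((n : ℝ) + 1) ≠ 0 := by positivity
  have e : 1 / ((n : ℝ) + 1) * x = 2 * (1 / ((n : ℝ) + 1) / 2 * x) := by ring
  simp only [Function.comp_apply, zero_add, zero_mul, Real.sin_zero, sub_zero, smul_eq_mul]
  rw [e, Real.cos_two_mul, Real.cos_sq']
  field_simp
  ring

variable {X : Type*} [MeasurableSpace X] {ν : Measure X} {P : Measure (Configuration X)}

/-- `L¹(ν) ∩ L²(ν)`. -/
def integrableL2 {X : Type*} [MeasurableSpace X] (ν : Measure X) : Submodule ℝ (Lp ℝ 2 ν) where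
  carrier := {f : Lp ℝ 2 ν | Integrable f ν}
  add_mem' hf hg := (hf.add hg).congr (Lp.coeFn_add _ _).symm
  zero_mem' := (integrable_zero X ℝ ν).congr (Lp.coeFn_zero ℝ 2 ν).symm
  smul_mem' c f hf := (hf.smul c).congr (Lp.coeFn_smul c f).symm

theorem denseRange_integrableL2 (ν : Measure X) :
    DenseRange ((integrableL2 ν).subtype : integrableL2 ν → Lp ℝ 2 ν) := by
  have h : (integrableL2 ν : Set (Lp ℝ 2 ν)) = {f : Lp ℝ 2 ν | Integrable f ν} := rfl
  have := dense_integrable ν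
  rw [← h] at this
  simpa [DenseRange] using this

theorem norm_expN (f : Lp ℝ 2 ν) (ω : Configuration X) : ‖expN P f ω‖ = 1 := norm_exp_I_mul _

namespace IsPoissonLaw

variable (hP : IsPoissonLaw ν P) [SigmaFinite ν] [IsProbabilityMeasure P]

include hP

/-- The derivative of the characteristic functional. -/
theorem integral_exp_N_mul_N {h k : X → ℝ} (hh : Integrable h ν) (hk : Integrable k ν) :
    ∫ ω, Complex.exp (Complex.I * (N h ω : ℂ)) * (N k ω : ℂ) ∂P =
      (∫ ω, Complex.exp (Complex.I * (N h ω : ℂ)) ∂P) *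
        ∫ x, Complex.exp (Complex.I * (h x : ℂ)) * (k x : ℂ) ∂ν := by
  have hder : ∀ a b t : ℝ, HasDerivAt (fun t : ℝ => Complex.exp (Complex.I * ((a + t * b : ℝ) : ℂ)))
      (Complex.I * (Complex.exp (Complex.I * ((a + t * b : ℝ) : ℂ)) * b)) t := fun a b t => by
    have h1 : HasDerivAt (fun t : ℝ => ((a + t * b : ℝ) : ℂ)) ((b : ℝ) : ℂ) t := by
      have := (((hasDerivAt_id t).mul_const b).const_add a).ofReal_comp
      simpa using this
    have := (h1.const_mul Complex.I).cexp
    convert this using 1; ring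
  have m1 := fun t : ℝ => hP.aestronglyMeasurable_N (hh.add (hk.smul t))
  have nh := hP.aestronglyMeasurable_N hh
  have nk := hP.aestronglyMeasurable_N hk
  have mN : ∀ t : ℝ, AEStronglyMeasurable
      (fun ω => Complex.exp (Complex.I * ((N h ω + t * N k ω : ℝ) : ℂ))) P := fun t =>
    continuous_exp_I_mul.comp_aestronglyMeasurable (nh.add (nk.const_mul t))
  have mx : ∀ t : ℝ, AEStronglyMeasurable
      (fun x => Complex.exp (Complex.I * ((h x + t * k x : ℝ) : ℂ))) ν := fun t =>
    continuous_exp_I_mul.comp_aestronglyMeasurable (hh.1.add (hk.1.const_mul t))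
  -- The characteristic functional at h + t k is differentiated in t on both sides at t = 0; `d1`
  -- and `d2` treat the integrals over P and over ν, with dominating functions |N(k)| and |k|.
  have d1 := (hasDerivAt_integral_of_dominated_loc_of_deriv_le (𝕜 := ℝ) (μ := P) (x₀ := 0)
    (F := fun t ω => Complex.exp (Complex.I * ((N h ω + t * N k ω : ℝ) : ℂ)))
    (F' := fun t ω => Complex.I *
      (Complex.exp (Complex.I * ((N h ω + t * N k ω : ℝ) : ℂ)) * (N k ω : ℂ)))
    (s := Set.univ) (bound := fun ω => ‖N k ω‖) univ_mem
    (Eventually.of_forall mN)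
    (Integrable.of_bound (mN 0) 1 (ae_of_all _ fun ω => (norm_exp_I_mul _).le))
    (((mN 0).mul (Complex.continuous_ofReal.comp_aestronglyMeasurable nk)).const_mul _)
    (ae_of_all _ fun ω t _ => by
      rw [norm_mul, norm_mul, norm_exp_I_mul, Complex.norm_I, one_mul, one_mul, Complex.norm_real])
    (hP.integrable_N hk).norm (ae_of_all _ fun ω t _ => hder _ _ t)).2
  have d2 := (hasDerivAt_integral_of_dominated_loc_of_deriv_le (𝕜 := ℝ) (μ := ν) (x₀ := 0)
    (F := fun t x => Complex.exp (Complex.I * ((h x + t * k x : ℝ) : ℂ)) - 1)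
    (F' := fun t x => Complex.I *
      (Complex.exp (Complex.I * ((h x + t * k x : ℝ) : ℂ)) * (k x : ℂ)))
    (s := Set.univ) (bound := fun x => ‖k x‖) univ_mem
    (Eventually.of_forall fun t => (mx t).sub aestronglyMeasurable_const)
    (by
      refine hh.mono ((mx 0).sub aestronglyMeasurable_const) (ae_of_all _ fun x => ?_)
      simpa using Real.norm_exp_I_mul_ofReal_sub_one_le (x := h x))
    (((mx 0).mul (Complex.continuous_ofReal.comp_aestronglyMeasurable hk.1)).const_mul _)
    (ae_of_all _ fun ω t _ => by
      rw [norm_mul, norm_mul, norm_exp_I_mul, Complex.norm_I, one_mul, one_mul, Complex.norm_real])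
    hk.norm (ae_of_all _ fun x t _ => (hder _ _ t).sub_const 1)).2
  have e : ∀ t : ℝ, ∫ ω, Complex.exp (Complex.I * ((N h ω + t * N k ω : ℝ) : ℂ)) ∂P =
      Complex.exp (∫ x, (Complex.exp (Complex.I * ((h x + t * k x : ℝ) : ℂ)) - 1) ∂ν) := fun t => by
    have := hP.integral_exp_N (hh.add (hk.smul t))
    refine Eq.trans (integral_congr_ae ?_) this
    filter_upwards [hP.N_add hh (hk.smul t)] with ω hω
    rw [hω, Pi.add_apply, N_smul]
  have u := (d1.congr_of_eventuallyEq (Eventually.of_forall fun t => (e t).symm)).unique d2.cexp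
  rw [← e 0] at u
  simp only [zero_mul, add_zero, integral_const_mul] at u
  have hI : Complex.I ≠ 0 := Complex.I_ne_zero
  refine mul_left_cancel₀ hI (u.trans (by ring))

/-- The compensated integral is bounded from `L²(ν)` to `L²(P)`. -/
theorem lintegral_sq_le {f : X → ℝ} (hf : Integrable f ν) (hf2 : MemLp f 2 ν) :
    ∫⁻ ω, ENNReal.ofReal ((N f ω - ∫ x, f x ∂ν) ^ 2) ∂P ≤
      ENNReal.ofReal (8 * ∫ x, f x ^ 2 ∂ν) := by
  set c := ∫ x, f x ∂ν with hc
  have hi : Integrable (fun x => f x ^ 2) ν := hf2.integrable_sq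
  have nf := hP.aestronglyMeasurable_N hf
  have mY : AEStronglyMeasurable (fun ω => N f ω - c) P := nf.sub aestronglyMeasurable_const
  -- Second moments are read off the characteristic function: 2 s⁻² (1 - cos(sY)) → Y² as s = 1/(n +
  -- 1) → 0. Fatou's lemma needs no moment known in advance.
  let g : ℕ → Configuration X → ℝ≥0∞ := fun n ω => ENNReal.ofReal
    (2 * ((n : ℝ) + 1) ^ 2 * (1 - Real.cos (1 / ((n : ℝ) + 1) * (N f ω - c))))
  have mc : ∀ t : ℝ, AEStronglyMeasurable (fun ω => Real.cos (t * (N f ω - c))) P := fun t =>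
    Real.continuous_cos.comp_aestronglyMeasurable (mY.const_mul t)
  have ic : ∀ t : ℝ, Integrable (fun ω => Real.cos (t * (N f ω - c))) P := fun t =>
    Integrable.of_bound (mc t) 1 (ae_of_all _ fun ω => Real.abs_cos_le_one _)
  have mg : ∀ n, AEMeasurable (g n) P := fun n =>
    (((aestronglyMeasurable_const.sub (mc _)).const_mul _).aemeasurable).ennreal_ofReal
  have hlim : ∀ ω, liminf (fun n => g n ω) atTop = ENNReal.ofReal ((N f ω - c) ^ 2) := fun ω =>
    ((ENNReal.continuous_ofReal.tendsto _).comp (tendsto_one_sub_cos _)).liminf_eq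
  -- Compensation removes the linear term of the exponent, leaving z with |z| ≤ 2t² ∫ f². For |z| ≤
  -- 1, |e^z - 1| ≤ 2|z|; multiplied by 2 t⁻², this gives the constant 8. The sharp constant does
  -- not matter, only boundedness.
  have hcos : ∀ t : ℝ, 0 < t → 2 * t ^ 2 * ∫ x, f x ^ 2 ∂ν ≤ 1 →
      ∫ ω, (1 - Real.cos (t * (N f ω - c))) ∂P ≤ 4 * t ^ 2 * ∫ x, f x ^ 2 ∂ν := fun t ht hsm => by
    have it : Integrable (fun x => t * f x) ν := hf.const_mul t
    have i1 : Integrable (fun x => Complex.exp (Complex.I * ((t * f x : ℝ) : ℂ)) - 1) ν :=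
      it.mono ((continuous_exp_I_mul.comp_aestronglyMeasurable it.1).sub aestronglyMeasurable_const)
        (ae_of_all _ fun x => Real.norm_exp_I_mul_ofReal_sub_one_le)
    have i2 : Integrable (fun x => Complex.I * ((t * f x : ℝ) : ℂ)) ν := it.ofReal.const_mul _
    set z := ∫ x, (Complex.exp (Complex.I * ((t * f x : ℝ) : ℂ)) - 1 -
      Complex.I * ((t * f x : ℝ) : ℂ)) ∂ν with hz
    have zle : ‖z‖ ≤ 2 * t ^ 2 * ∫ x, f x ^ 2 ∂ν := by
      refine (norm_integral_le_integral_norm _).trans ?_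
      rw [← integral_const_mul]
      refine integral_mono (i1.sub i2).norm (hi.const_mul _) fun x => ?_
      refine (norm_exp_I_mul_sub_one_sub_le (t * f x)).trans (le_of_eq ?_)
      ring
    have ez : z = (∫ x, (Complex.exp (Complex.I * ((t * f x : ℝ) : ℂ)) - 1) ∂ν) -
        Complex.I * ((t * c : ℝ) : ℂ) := by
      have e1 : ∫ x, ((t * f x : ℝ) : ℂ) ∂ν = ((∫ x, t * f x ∂ν : ℝ) : ℂ) := integral_ofReal
      rw [hz, integral_sub i1 i2, integral_const_mul, e1, integral_const_mul]
    have key : ∫ ω, Complex.exp (Complex.I * ((t * (N f ω - c) : ℝ) : ℂ)) ∂P = Complex.exp z := by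
      have e := hP.integral_exp_N (hf.smul t)
      rw [ez, Complex.exp_sub]
      change _ = Complex.exp (∫ x, (Complex.exp (Complex.I * (((t • f) x : ℝ) : ℂ)) - 1) ∂ν) / _
      rw [← e, ← integral_div]
      refine integral_congr_ae (ae_of_all _ fun ω => ?_)
      dsimp only
      rw [← Complex.exp_sub, N_smul]
      congr 1
      push_cast; ring
    have hre : ∫ ω, Real.cos (t * (N f ω - c)) ∂P = (Complex.exp z).re := by
      rw [← key]
      have ii : Integrable (fun ω => Complex.exp (Complex.I * ((t * (N f ω - c) : ℝ) : ℂ))) P :=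
        Integrable.of_bound (continuous_exp_I_mul.comp_aestronglyMeasurable (mY.const_mul t)) 1
          (ae_of_all _ fun ω => (norm_exp_I_mul _).le)
      refine Eq.trans (integral_congr_ae (ae_of_all _ fun ω => ?_)) (integral_re ii)
      dsimp only
      rw [mul_comm Complex.I]
      exact (Complex.exp_ofReal_mul_I_re _).symm
    rw [integral_sub (integrable_const _) (ic t), hre]
    simp only [integral_const, probReal_univ, smul_eq_mul, mul_one]
    have h1 := Complex.norm_exp_sub_one_le (zle.trans hsm)
    have h2 := Complex.abs_re_le_norm (Complex.exp z - 1)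
    rw [Complex.sub_re, Complex.one_re] at h2
    linarith [(abs_le.1 h2).1]
  have hbound : ∀ᶠ n : ℕ in atTop, ∫⁻ ω, g n ω ∂P ≤ ENNReal.ofReal (8 * ∫ x, f x ^ 2 ∂ν) := by
    have t0 : Tendsto (fun n : ℕ => 2 * (1 / ((n : ℝ) + 1)) ^ 2 * ∫ x, f x ^ 2 ∂ν) atTop (𝓝 0) := by
      have := (((tendsto_one_div_add_atTop_nhds_zero_nat (𝕜 := ℝ)).pow 2).const_mul 2).mul_const
        (∫ x, f x ^ 2 ∂ν)
      simpa using this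
    filter_upwards [t0.eventually_le_const one_pos] with n hn
    have h1 := hcos _ (by positivity) hn
    have h2 : Integrable (fun ω => 2 * ((n : ℝ) + 1) ^ 2 *
        (1 - Real.cos (1 / ((n : ℝ) + 1) * (N f ω - c)))) P :=
      ((integrable_const _).sub (ic _)).const_mul _
    rw [← ofReal_integral_eq_lintegral_ofReal h2 (ae_of_all _ fun ω => mul_nonneg (by positivity)
      (sub_nonneg.2 (Real.cos_le_one _)))]
    refine ENNReal.ofReal_le_ofReal ?_
    rw [integral_const_mul]
    refine (mul_le_mul_of_nonneg_left h1 (by positivity)).trans (le_of_eq ?_)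
    field_simp
    ring
  calc ∫⁻ ω, ENNReal.ofReal ((N f ω - c) ^ 2) ∂P = ∫⁻ ω, liminf (fun n => g n ω) atTop ∂P := by
        simp only [hlim]
    _ ≤ liminf (fun n => ∫⁻ ω, g n ω ∂P) atTop := lintegral_liminf_le' mg
    _ ≤ ENNReal.ofReal (8 * ∫ x, f x ^ 2 ∂ν) :=
        liminf_le_of_frequently_le' hbound.frequently

theorem memLp_compensated {f : X → ℝ} (hf : Integrable f ν) (hf2 : MemLp f 2 ν) :
    MemLp (fun ω => N f ω - ∫ x, f x ∂ν) 2 P := by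
  have mY : AEStronglyMeasurable (fun ω => N f ω - ∫ x, f x ∂ν) P :=
    (hP.aestronglyMeasurable_N hf).sub aestronglyMeasurable_const
  rw [memLp_two_iff_integrable_sq mY]
  refine ⟨mY.pow 2, ?_⟩
  rw [hasFiniteIntegral_iff_ofReal (ae_of_all _ fun ω => sq_nonneg _)]
  exact (hP.lintegral_sq_le hf hf2).trans_lt ENNReal.ofReal_lt_top

/-- `N(f) ∈ L²(P)` for `f ∈ L¹(ν) ∩ L²(ν)`. -/
theorem memLp_N {f : X → ℝ} (hf : Integrable f ν) (hf2 : MemLp f 2 ν) : MemLp (N f) 2 P := by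
  have := (hP.memLp_compensated hf hf2).add (memLp_const (∫ x, f x ∂ν))
  refine this.ae_eq (ae_of_all _ fun ω => ?_)
  simp

/-! ### The compensated integral -/

/-- The compensated integral on `L¹(ν) ∩ L²(ν)`. -/
def compensated : integrableL2 ν →ₗ[ℝ] Lp ℝ 2 P where
  toFun f := (hP.memLp_compensated f.2 (Lp.memLp _)).toLp _
  map_add' f g := by
    rw [← MemLp.toLp_add]
    refine MemLp.toLp_congr _ _ ?_
    filter_upwards [hP.N_add f.2 g.2, hP.N_congr (Lp.coeFn_add (f : Lp ℝ 2 ν) g)] with ω h1 h2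
    rw [Submodule.coe_add, h2, h1, integral_congr_ae (Lp.coeFn_add (f : Lp ℝ 2 ν) g)]
    simp only [Pi.add_apply]
    rw [integral_add f.2 g.2]
    ring
  map_smul' c f := by
    rw [RingHom.id_apply, ← MemLp.toLp_const_smul]
    refine MemLp.toLp_congr _ _ ?_
    filter_upwards [hP.N_congr (Lp.coeFn_smul c (f : Lp ℝ 2 ν))] with ω h1
    rw [Submodule.coe_smul, h1, N_smul, integral_congr_ae (Lp.coeFn_smul c (f : Lp ℝ 2 ν))]
    simp only [Pi.smul_apply, smul_eq_mul, integral_const_mul]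
    ring

theorem coeFn_compensated (f : integrableL2 ν) :
    hP.compensated f =ᵐ[P] fun ω => N (f : Lp ℝ 2 ν) ω - ∫ x, (f : Lp ℝ 2 ν) x ∂ν :=
  (hP.memLp_compensated f.2 (Lp.memLp _)).coeFn_toLp

theorem norm_compensated_le (f : integrableL2 ν) : ‖hP.compensated f‖ ≤ √8 * ‖(f : Lp ℝ 2 ν)‖ := by
  refine le_of_sq_le_sq ?_ (by positivity)
  rw [mul_pow, Real.sq_sqrt (by norm_num), L2_norm_sq, L2_norm_sq]
  simp only [Real.norm_eq_abs, sq_abs]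
  have h := hP.lintegral_sq_le f.2 (Lp.memLp _)
  have hm : Integrable (fun ω => (N (f : Lp ℝ 2 ν) ω - ∫ x, (f : Lp ℝ 2 ν) x ∂ν) ^ 2) P :=
    (hP.memLp_compensated f.2 (Lp.memLp _)).integrable_sq
  rw [← ofReal_integral_eq_lintegral_ofReal hm (ae_of_all _ fun ω => sq_nonneg _)] at h
  have h2 := (ENNReal.ofReal_le_ofReal_iff (by positivity)).1 h
  refine le_trans (le_of_eq (integral_congr_ae ?_)) h2
  filter_upwards [hP.coeFn_compensated f] with ω hω
  rw [hω]

/-- The compensated integral, as a continuous linear map. -/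
def compensatedL : Lp ℝ 2 ν →L[ℝ] Lp ℝ 2 P := hP.compensated.extendOfNorm (integrableL2 ν).subtype

theorem compensatedL_coe (f : integrableL2 ν) : hP.compensatedL f = hP.compensated f :=
  LinearMap.extendOfNorm_eq (denseRange_integrableL2 ν) ⟨√8, hP.norm_compensated_le⟩ f

/-- Uniqueness of continuous extensions identifies `Ntilde`, defined as an extension of a mere
function, with a continuous linear map; linearity and continuity of Ñ come from here. -/
theorem Ntilde_eq : (Ntilde P : Lp ℝ 2 ν → Lp ℝ 2 P) = hP.compensatedL := by
  refine Dense.extend_unique (dense_integrable ν) (fun f => ?_) hP.compensatedL.continuous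
  rw [toL2, dif_pos (hP.memLp_compensated f.2 (Lp.memLp _))]
  exact hP.compensatedL_coe ⟨f, f.2⟩

theorem Ntilde_ae {f : Lp ℝ 2 ν} (hf : Integrable f ν) :
    Ntilde P f =ᵐ[P] fun ω => N f ω - ∫ x, f x ∂ν := by
  rw [hP.Ntilde_eq, hP.compensatedL_coe ⟨f, hf⟩]
  exact hP.coeFn_compensated ⟨f, hf⟩

theorem Ntilde_add (f g : Lp ℝ 2 ν) : Ntilde P (f + g) = Ntilde P f + Ntilde P g := by
  rw [hP.Ntilde_eq, map_add]

theorem Ntilde_smul (c : ℝ) (f : Lp ℝ 2 ν) : Ntilde P (c • f) = c • Ntilde P f := by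
  rw [hP.Ntilde_eq, map_smul]

theorem continuous_Ntilde : Continuous (Ntilde P : Lp ℝ 2 ν → Lp ℝ 2 P) := by
  rw [hP.Ntilde_eq]; exact hP.compensatedL.continuous

theorem exp_Ntilde_ae {f : Lp ℝ 2 ν} (hf : Integrable f ν) :
    expN P f =ᵐ[P] fun ω => Complex.exp (-(Complex.I * ((∫ x, f x ∂ν : ℝ) : ℂ))) *
      Complex.exp (Complex.I * (N f ω : ℂ)) := by
  filter_upwards [hP.Ntilde_ae hf] with ω hω
  rw [expN, hω, ← Complex.exp_add]
  congr 1
  push_cast; ring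

/-- `E[e^{iÑ(h)} N(k)] = E[e^{iÑ(h)}] ∫ e^{ih} k dν`. -/
theorem integral_expN_mul_N {h : Lp ℝ 2 ν} {k : X → ℝ} (hh : Integrable h ν)
    (hk : Integrable k ν) :
    ∫ ω, expN P h ω * (N k ω : ℂ) ∂P =
      (∫ ω, expN P h ω ∂P) * ∫ x, Complex.exp (Complex.I * (h x : ℂ)) * (k x : ℂ) ∂ν := by
  have e := hP.exp_Ntilde_ae hh
  rw [integral_congr_ae e, integral_const_mul, mul_assoc, ← hP.integral_exp_N_mul_N hh hk,
    ← integral_const_mul]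
  refine integral_congr_ae ?_
  filter_upwards [e] with ω hω
  rw [hω]; ring

/-- `E[e^{iÑ(h)} Ñ(w)] = E[e^{iÑ(h)}] ∫ (e^{ih} - 1) w dν`. -/
theorem integral_expN_mul_Ntilde {h : Lp ℝ 2 ν} (hh : Integrable h ν) (w : Lp ℝ 2 ν) :
    ∫ ω, expN P h ω * (Ntilde P w ω : ℂ) ∂P =
      (∫ ω, expN P h ω ∂P) * ∫ x, (Complex.exp (Complex.I * (h x : ℂ)) - 1) * (w x : ℂ) ∂ν := by
  -- As |e^{ih} - 1| ≤ |h|, this factor is square integrable. Both sides are then L²-continuous in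
  -- `w`, and it suffices to treat integrable `w`, where Ñ(w) = N(w) - ∫ w dν.
  have hm : MemLp (fun x => conj (Complex.exp (Complex.I * (h x : ℂ)) - 1)) 2 ν := by
    refine (Lp.memLp h).of_le (Complex.continuous_conj.comp_aestronglyMeasurable
      ((continuous_exp_I_mul.comp_aestronglyMeasurable (Lp.aestronglyMeasurable h)).sub
        aestronglyMeasurable_const)) (ae_of_all _ fun x => ?_)
    rw [RCLike.norm_conj]
    exact Real.norm_exp_I_mul_ofReal_sub_one_le
  have hm' : MemLp (fun ω => conj (expN P h ω)) 2 P := by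
    refine (memLp_expN P h).of_le (Complex.continuous_conj.comp_aestronglyMeasurable
      (memLp_expN P h).1) (ae_of_all _ fun ω => ?_)
    rw [RCLike.norm_conj]
  have c1 : Continuous fun w : Lp ℝ 2 ν => ∫ ω, expN P h ω * (Ntilde P w ω : ℂ) ∂P := by
    have c : Continuous fun w : Lp ℝ 2 ν =>
        inner ℂ (hm'.toLp _) (Complex.ofRealCLM.compLp (Ntilde P w)) :=
      continuous_const.inner
        ((Complex.ofRealCLM.compLpL 2 P).continuous.comp hP.continuous_Ntilde)
    refine c.congr fun w => ?_
    rw [L2.inner_def]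
    refine integral_congr_ae ?_
    filter_upwards [hm'.coeFn_toLp, Complex.ofRealCLM.coeFn_compLp (Ntilde P w)] with ω a1 a2
    rw [a1, a2]
    simp [mul_comm]
  have c2 : Continuous fun w : Lp ℝ 2 ν =>
      ∫ x, (Complex.exp (Complex.I * (h x : ℂ)) - 1) * (w x : ℂ) ∂ν := by
    have c : Continuous fun w : Lp ℝ 2 ν =>
        inner ℂ (hm.toLp _) (Complex.ofRealCLM.compLp w) :=
      continuous_const.inner (Complex.ofRealCLM.compLpL 2 ν).continuous
    refine c.congr fun w => ?_
    rw [L2.inner_def]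
    refine integral_congr_ae ?_
    filter_upwards [hm.coeFn_toLp, Complex.ofRealCLM.coeFn_compLp w] with ω a1 a2
    rw [a1, a2]
    simp [mul_comm]
  have hd := (dense_integrable ν)
  refine congrFun (Continuous.ext_on hd c1 (c2.const_mul _) fun w hw => ?_) w
  have hw' : Integrable w ν := hw
  have e1 : ∫ ω, expN P h ω * (Ntilde P w ω : ℂ) ∂P =
      ∫ ω, expN P h ω * (N w ω : ℂ) ∂P -
        (∫ ω, expN P h ω ∂P) * ((∫ x, w x ∂ν : ℝ) : ℂ) := by
    rw [← integral_mul_const, ← integral_sub]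
    · refine integral_congr_ae ?_
      filter_upwards [hP.Ntilde_ae hw'] with ω hω
      rw [hω]
      push_cast; ring
    · exact (hP.integrable_N hw').ofReal.bdd_mul (c := 1) (memLp_expN P h).1
        (ae_of_all _ fun ω => (norm_exp_I_mul _).le)
    · exact ((memLp_expN P h).integrable (by norm_num)).mul_const _
  have e2 : ∫ x, (Complex.exp (Complex.I * (h x : ℂ)) - 1) * (w x : ℂ) ∂ν =
      ∫ x, Complex.exp (Complex.I * (h x : ℂ)) * (w x : ℂ) ∂ν - ((∫ x, w x ∂ν : ℝ) : ℂ) := by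
    have e3 : ((∫ x, w x ∂ν : ℝ) : ℂ) = ∫ x, (w x : ℂ) ∂ν := integral_ofReal.symm
    rw [e3, ← integral_sub]
    · simp only [sub_mul, one_mul]
    · exact hw'.ofReal.bdd_mul (c := 1)
        (continuous_exp_I_mul.comp_aestronglyMeasurable (Lp.aestronglyMeasurable h))
        (ae_of_all _ fun ω => (norm_exp_I_mul _).le)
    · exact hw'.ofReal
  rw [e1, e2, hP.integral_expN_mul_N hh hw']
  ring

end IsPoissonLaw

end PoissonDirichlet
end

noncomputable section

namespace PoissonDirichlet

/-! ### The random variables `e^{iÑ(f)}` separate `L¹(P)` -/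

variable {X : Type*} [MeasurableSpace X] {ν : Measure X} {P : Measure (Configuration X)}

/-- Measurable sets of finite measure. -/
abbrev FiniteSet (ν : Measure X) : Type _ := {B : Set X // MeasurableSet B ∧ ν B ≠ ∞}

/-- The cylinder sets. -/
def cylinders (ν : Measure X) : Set (Set (Configuration X)) :=
  piiUnionInter (fun B : FiniteSet ν =>
    {s | MeasurableSet[MeasurableSpace.comap (fun ω : Configuration X => ω.1 B.1) inferInstance] s})
    Set.univ

theorem isPiSystem_cylinders (ν : Measure X) : IsPiSystem (cylinders ν) :=
  isPiSystem_piiUnionInter _ (fun B : FiniteSet ν => @MeasurableSpace.isPiSystem_measurableSet _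
    (MeasurableSpace.comap (fun ω : Configuration X => ω.1 B.1) inferInstance)) _

/-- By σ-finiteness the count of any measurable set is the supremum of the counts of its
finite-measure pieces, so sets of finite measure generate the whole σ-field. -/
theorem generateFrom_cylinders (ν : Measure X) [SigmaFinite ν] :
    (inferInstance : MeasurableSpace (Configuration X)) =
      MeasurableSpace.generateFrom (cylinders ν) := by
  rw [cylinders, generateFrom_piiUnionInter_measurableSet (fun B : FiniteSet ν =>
    MeasurableSpace.comap (fun ω : Configuration X => ω.1 B.1) inferInstance) Set.univ]
  refine le_antisymm ?_ ?_
  · set m : MeasurableSpace (Configuration X) := ⨆ B ∈ (Set.univ : Set (FiniteSet ν)),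
      MeasurableSpace.comap (fun ω : Configuration X => ω.1 B.1) inferInstance with hm
    have h1 : ∀ B : FiniteSet ν, Measurable[m] fun ω : Configuration X => ω.1 B.1 := fun B => by
      rw [measurable_iff_comap_le]
      exact le_iSup₂_of_le B (Set.mem_univ B) le_rfl
    have h2 : @Measurable _ _ m _ (Subtype.val : Configuration X → Measure X) := by
      refine @Measure.measurable_of_measurable_coe _ _ _ m _ fun B hB => ?_
      have e : (fun ω : Configuration X => ω.1 B) =
          fun ω => ⨆ n, ω.1 (B ∩ spanningSets ν n) := by
        ext ω
        rw [← Monotone.measure_iUnion, ← Set.inter_iUnion, iUnion_spanningSets, Set.inter_univ]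
        exact fun i j hij => Set.inter_subset_inter_right _ (monotone_spanningSets ν hij)
      rw [e]
      exact Measurable.iSup fun n => h1 ⟨_, hB.inter (measurableSet_spanningSets ν n),
        ne_top_of_le_ne_top (measure_spanningSets_lt_top ν n).ne
          (measure_mono Set.inter_subset_right)⟩
    exact measurable_iff_comap_le.1 h2
  · exact iSup₂_le fun B _ => measurable_iff_comap_le.1 (measurable_count B.2.1)

namespace IsPoissonLaw

variable (hP : IsPoissonLaw ν P) [SigmaFinite ν] [IsProbabilityMeasure P]

include hP

/-- The count of `B` is almost surely finite, so it can be recovered from the real variable Ñ(1_B)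
by adding ν(B) back. This turns cylinder events into events of finitely many variables Ñ. -/
theorem Ntilde_indicator (B : FiniteSet ν) :
    ∀ᵐ ω ∂P, ω.1 B.1 = ENNReal.ofReal
      (Ntilde P (indicatorConstLp 2 B.2.1 B.2.2 (1 : ℝ)) ω + ν.real B.1) := by
  have hi : Integrable (B.1.indicator fun _ => (1 : ℝ)) ν :=
    (integrable_indicator_iff B.2.1).2 (integrableOn_const B.2.2)
  have e : (indicatorConstLp 2 B.2.1 B.2.2 (1 : ℝ) : Lp ℝ 2 ν) =ᵐ[ν]
      B.1.indicator fun _ => (1 : ℝ) :=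
    indicatorConstLp_coeFn
  have hfin : ∀ᵐ ω ∂P, ω.1 B.1 < ∞ := ae_lt_top (measurable_count B.2.1)
    (by rw [hP.lintegral_count B.2.1 B.2.2]; exact B.2.2)
  filter_upwards [hP.Ntilde_ae (hi.congr e.symm), hP.N_congr e, hfin] with ω h1 h2 h3
  rw [h1, h2, integral_congr_ae e, N, integral_indicator_const _ B.2.1,
    integral_indicator_const _ B.2.1]
  simp only [smul_eq_mul, mul_one, sub_add_cancel]
  exact (ENNReal.ofReal_toReal h3.ne).symm

/-- The positive and negative parts of k are densities of two finite measures. The hypothesis says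
that the vectors (Ñ(1_B)) have the same characteristic function under both; so the measures agree on
cylinders, a π-system generating the σ-field, hence everywhere. -/
theorem ae_eq_zero_of_real {k : Configuration X → ℝ} (hk : Integrable k P)
    (h : ∀ f : Lp ℝ 2 ν, ∫ ω, (k ω : ℂ) * expN P f ω ∂P = 0) : k =ᵐ[P] 0 := by
  let p : Configuration X → ℝ≥0 := fun ω => (k ω).toNNReal
  let n : Configuration X → ℝ≥0 := fun ω => (-k ω).toNNReal
  have mp : AEMeasurable p P := hk.1.aemeasurable.real_toNNReal
  have mn : AEMeasurable n P := hk.1.aemeasurable.neg.real_toNNReal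
  have ip : Integrable (fun ω => (p ω : ℝ)) P := by
    simpa [p, Real.coe_toNNReal'] using hk.pos_part
  have in' : Integrable (fun ω => (n ω : ℝ)) P := by
    simpa [n, Real.coe_toNNReal'] using hk.neg_part
  have fp : ∫⁻ ω, (p ω : ℝ≥0∞) ∂P ≠ ∞ := by
    have := ip.2
    simpa [hasFiniteIntegral_iff_enorm, Real.enorm_eq_ofReal] using this.ne
  have fn : ∫⁻ ω, (n ω : ℝ≥0∞) ∂P ≠ ∞ := by
    have := in'.2
    simpa [hasFiniteIntegral_iff_enorm, Real.enorm_eq_ofReal] using this.ne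
  have pn : ∀ ω, (p ω : ℝ) - n ω = k ω := fun ω => by
    simp only [p, n, Real.coe_toNNReal']
    rcases le_total (k ω) 0 with h | h
    · rw [max_eq_right h, max_eq_left (by linarith)]; ring
    · rw [max_eq_left h, max_eq_right (by linarith)]; ring
  let μp := P.withDensity fun ω => (p ω : ℝ≥0∞)
  let μn := P.withDensity fun ω => (n ω : ℝ≥0∞)
  have : IsFiniteMeasure μp := isFiniteMeasure_withDensity fp
  have : IsFiniteMeasure μn := isFiniteMeasure_withDensity fn
  have key : ∀ s ∈ cylinders ν, μp s = μn s := by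
    rintro s ⟨t, -, C, hC, rfl⟩
    choose! D hD hD' using fun B (hB : B ∈ t) => hC B hB
    -- A linear combination of the coordinates of `V` is Ñ of the same combination of indicators, so
    -- the characteristic function of `V` is an expectation of one e^{iÑ(f)}.
    let V : Configuration X → EuclideanSpace ℝ t := fun ω => WithLp.toLp 2 fun B =>
      Ntilde P (indicatorConstLp 2 B.1.2.1 B.1.2.2 (1 : ℝ)) ω
    have mV : Measurable V := by
      refine (WithLp.measurable_toLp 2 _).comp (measurable_pi_lambda _ fun B => ?_)
      exact (Lp.stronglyMeasurable _).measurable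
    have hmap : μp.map V = μn.map V := by
      refine Measure.ext_of_charFun (funext fun a => ?_)
      have ce : ∀ q : Configuration X → ℝ≥0, AEMeasurable q P →
          charFun ((P.withDensity fun ω => (q ω : ℝ≥0∞)).map V) a =
          ∫ ω, (q ω : ℂ) * expN P (∑ B : t, a B •
            indicatorConstLp 2 B.1.2.1 B.1.2.2 (1 : ℝ) : Lp ℝ 2 ν) ω ∂P := fun q hq => by
        rw [charFun_apply, integral_map mV.aemeasurable (by fun_prop),
          integral_withDensity_eq_integral_smul₀ hq]
        refine integral_congr_ae ?_
        have e : Ntilde P (∑ B : t, a B • indicatorConstLp 2 B.1.2.1 B.1.2.2 (1 : ℝ) : Lp ℝ 2 ν) =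
            ∑ B : t, a B • Ntilde P (indicatorConstLp 2 B.1.2.1 B.1.2.2 (1 : ℝ) : Lp ℝ 2 ν) := by
          rw [hP.Ntilde_eq, map_sum]; simp only [map_smul]
        filter_upwards [Lp.coeFn_fun_finsetSum Finset.univ fun B : t => a B •
          Ntilde P (indicatorConstLp 2 B.1.2.1 B.1.2.2 (1 : ℝ) : Lp ℝ 2 ν),
          ae_all_iff.2 fun B : t => Lp.coeFn_smul (a B)
            (Ntilde P (indicatorConstLp 2 B.1.2.1 B.1.2.2 (1 : ℝ) : Lp ℝ 2 ν))] with ω h1 h2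
        rw [expN, e, h1]
        simp only [h2, Pi.smul_apply, smul_eq_mul]
        rw [NNReal.smul_def, Complex.real_smul]
        congr 2
        rw [mul_comm]
        congr 2
      rw [ce p mp, ce n mn, ← sub_eq_zero, ← integral_sub]
      · rw [← h (∑ B : t, a B • indicatorConstLp 2 B.1.2.1 B.1.2.2 (1 : ℝ))]
        refine integral_congr_ae (ae_of_all _ fun ω => ?_)
        dsimp only
        rw [← sub_mul, ← pn ω]
        push_cast
        rfl
      · exact ip.ofReal.mul_bdd (c := 1) (memLp_expN P _).1
          (ae_of_all _ fun ω => (norm_expN _ ω).le)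
      · exact in'.ofReal.mul_bdd (c := 1) (memLp_expN P _).1
          (ae_of_all _ fun ω => (norm_expN _ ω).le)
    let A : Set (EuclideanSpace ℝ t) := {v | ∀ B : t, ENNReal.ofReal (v B + ν.real B.1.1) ∈ D B.1}
    have mA : MeasurableSet A := by
      have : A = ⋂ B : t, (fun v : EuclideanSpace ℝ t =>
          ENNReal.ofReal (v B + ν.real B.1.1)) ⁻¹' D B.1 := by
        ext v; simp [A]
      rw [this]
      refine MeasurableSet.iInter fun B => ?_
      exact (by fun_prop : Measurable fun v : EuclideanSpace ℝ t =>
        ENNReal.ofReal (v B + ν.real B.1.1)) (hD B.1 B.2)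
    have hae : ∀ᵐ ω ∂P, ω ∈ (⋂ B ∈ t, C B) ↔ ω ∈ V ⁻¹' A := by
      filter_upwards [ae_all_iff.2 fun B : t => hP.Ntilde_indicator B.1] with ω hω
      simp only [Set.mem_iInter, Set.mem_preimage, A, Set.mem_ofPred_eq]
      refine ⟨fun h B => ?_, fun h B hB => ?_⟩
      · have := h B.1 B.2
        rwa [← hD' B.1 B.2, Set.mem_preimage, hω B] at this
      · rw [← hD' B hB, Set.mem_preimage, hω ⟨B, hB⟩]
        exact h ⟨B, hB⟩
    have hs : ∀ q : Configuration X → ℝ≥0,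
        (P.withDensity fun ω => (q ω : ℝ≥0∞)) (⋂ B ∈ t, C B) =
        (P.withDensity fun ω => (q ω : ℝ≥0∞)) (V ⁻¹' A) := fun q =>
      measure_congr ((withDensity_absolutelyContinuous P _).ae_le (hae.mono fun ω hω =>
        propext hω))
    change (P.withDensity fun ω => (p ω : ℝ≥0∞)) _ = (P.withDensity fun ω => (n ω : ℝ≥0∞)) _
    rw [hs p, hs n, ← Measure.map_apply mV mA, ← Measure.map_apply mV mA]
    exact congrArg (· A) hmap
  have huniv : Set.univ ∈ cylinders ν := ⟨∅, by simp, fun _ => Set.univ, by simp, by simp⟩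
  have heq : μp = μn := ext_of_generate_finite (cylinders ν) (generateFrom_cylinders ν)
    (isPiSystem_cylinders ν) key (key _ huniv)
  have hpn := (withDensity_eq_iff mp.coe_nnreal_ennreal mn.coe_nnreal_ennreal fp).1 heq
  filter_upwards [hpn] with ω hω
  have : p ω = n ω := by exact_mod_cast hω
  rw [Pi.zero_apply, ← pn ω, this, sub_self]

/-- L² convergence of fₙ gives almost sure convergence of Ñ(fₙ) along a subsequence, and the
exponentials have modulus 1, so dominated convergence applies. -/
theorem isClosed_integral_expN_eq_zero {k : Configuration X → ℂ} (hk : Integrable k P) :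
    IsClosed {f : Lp ℝ 2 ν | ∫ ω, k ω * expN P f ω ∂P = 0} := by
  refine IsSeqClosed.isClosed fun f f₀ hf hlim => ?_
  have h1 : Tendsto (fun n => Ntilde P (f n)) atTop (𝓝 (Ntilde P f₀)) :=
    (hP.continuous_Ntilde.tendsto f₀).comp hlim
  obtain ⟨ns, -, hns⟩ := exists_seq_tendsto_ae_of_L2 h1
  have h2 : Tendsto (fun j => ∫ ω, k ω * expN P (f (ns j)) ω ∂P) atTop
      (𝓝 (∫ ω, k ω * expN P f₀ ω ∂P)) := by
    refine tendsto_integral_of_dominated_convergence (fun ω => ‖k ω‖)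
      (fun j => hk.1.mul (memLp_expN P _).1) hk.norm (fun j => ae_of_all _ fun ω => ?_) ?_
    · rw [norm_mul, norm_expN, mul_one]
    · filter_upwards [hns] with ω hω
      exact ((continuous_exp_I_mul.tendsto _).comp hω).const_mul _
  have h3 : (fun j => ∫ ω, k ω * expN P (f (ns j)) ω ∂P) = fun _ => 0 := funext fun j => hf (ns j)
  rw [h3] at h2
  exact tendsto_nhds_unique h2 tendsto_const_nhds

theorem conj_expN (f : Lp ℝ 2 ν) : ∀ᵐ ω ∂P, conj (expN P f ω) = expN P (-f) ω := by
  have e : Ntilde P (-f) = -Ntilde P f := by rw [hP.Ntilde_eq, map_neg]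
  filter_upwards [Lp.coeFn_neg (Ntilde P f)] with ω hω
  rw [expN, expN, e, hω, ← Complex.exp_conj]
  simp

/-- The random variables `e^{iÑ(f)}`, `f` in a dense subset of `L²(ν)`, separate `L¹(P)`. -/
theorem ae_eq_zero {W : Set (Lp ℝ 2 ν)} (hW : Dense W) {k : Configuration X → ℂ}
    (hk : Integrable k P) (h : ∀ f ∈ W, ∫ ω, k ω * expN P f ω ∂P = 0) : k =ᵐ[P] 0 := by
  have h1 : ∀ f : Lp ℝ 2 ν, ∫ ω, k ω * expN P f ω ∂P = 0 := fun f =>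
    (hP.isClosed_integral_expN_eq_zero hk).closure_subset_iff.2 h (hW f)
  have ik : ∀ f : Lp ℝ 2 ν, Integrable (fun ω => k ω * expN P f ω) P := fun f =>
    hk.mul_bdd (c := 1) (memLp_expN P _).1 (ae_of_all _ fun ω => (norm_expN _ ω).le)
  have hkc : Integrable (fun ω => conj (k ω)) P := by
    simpa using Complex.conjCLE.toContinuousLinearMap.integrable_comp hk
  have ikc : ∀ f : Lp ℝ 2 ν, Integrable (fun ω => conj (k ω) * expN P f ω) P := fun f =>
    hkc.mul_bdd (c := 1) (memLp_expN P _).1 (ae_of_all _ fun ω => (norm_expN _ ω).le)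
  -- The exponentials are stable under conjugation, which is f ↦ -f, so real and imaginary parts of
  -- k satisfy the hypothesis separately.
  have h2 : ∀ f : Lp ℝ 2 ν, ∫ ω, conj (k ω) * expN P f ω ∂P = 0 := fun f => by
    rw [← map_zero (starRingEnd ℂ), ← h1 (-f), ← integral_conj]
    refine integral_congr_ae ?_
    filter_upwards [hP.conj_expN (-f)] with ω hω
    rw [map_mul, hω, neg_neg]
  have hre := hP.ae_eq_zero_of_real (k := fun ω => (k ω).re) hk.re fun f => by
    have : ∫ ω, ((k ω).re : ℂ) * expN P f ω ∂P =
        1 / 2 * (∫ ω, k ω * expN P f ω ∂P + ∫ ω, conj (k ω) * expN P f ω ∂P) := by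
      rw [← integral_add (ik f) (ikc f), ← integral_const_mul]
      refine integral_congr_ae (ae_of_all _ fun ω => ?_)
      dsimp only
      rw [← add_mul, Complex.add_conj]
      push_cast; ring
    rw [this, h1, h2]; simp
  have him := hP.ae_eq_zero_of_real (k := fun ω => (k ω).im) hk.im fun f => by
    have : ∫ ω, ((k ω).im : ℂ) * expN P f ω ∂P =
        1 / (2 * Complex.I) * (∫ ω, k ω * expN P f ω ∂P - ∫ ω, conj (k ω) * expN P f ω ∂P) := by
      rw [← integral_sub (ik f) (ikc f), ← integral_const_mul]
      refine integral_congr_ae (ae_of_all _ fun ω => ?_)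
      dsimp only
      rw [← sub_mul, Complex.sub_conj]
      have := Complex.I_ne_zero
      push_cast
      field_simp
    rw [this, h1, h2]; simp
  filter_upwards [hre, him] with ω a b
  exact Complex.ext a b

end IsPoissonLaw

end PoissonDirichlet
end

/-! ### Integration by parts against exponentials -/

noncomputable section

namespace PoissonDirichlet

variable {X : Type*} [MeasurableSpace X] {ν : Measure X} [SigmaFinite ν]

namespace LocalDirichletStructure

variable (S : LocalDirichletStructure ν)

/-- Since φ is a contraction vanishing at 0, φ(h) lies in the form domain and may be tested in the
weak equation of the generator; the chain rule evaluates the result. -/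
theorem inner_gen_comp (g h : S.testDomain) {φ φ' : ℝ → ℝ} (hφ : ∀ x, HasDerivAt φ (φ' x) x)
    (hφ' : Continuous φ') (hK : ∀ x, |φ' x| ≤ 1) (h0 : φ 0 = 0) :
    Integrable (fun x => S.gen g x * φ ((h : Lp ℝ 2 ν) x)) ν ∧
    ∫ x, S.gen g x * φ ((h : Lp ℝ 2 ν) x) ∂ν =
      -(1 / 2) * ∫ x, φ' ((h : Lp ℝ 2 ν) x) * S.gamma (S.toDom g) (S.toDom h) x ∂ν := by
  have hK' : ∀ x, |φ' x| ≤ (1 : ℝ≥0) := by simpa using hK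
  have hL : LipschitzWith 1 φ := lipschitzWith_of_nnnorm_deriv_le
    (fun x => (hφ x).differentiableAt) fun x => by
      rw [(hφ x).deriv]; exact hK' x
  obtain ⟨v, hv, -⟩ := S.contraction φ hL h0 (S.toDom h)
  have h1 := S.form_comp (S.toDom h) (S.toDom g) hφ hφ' hK' h0 v hv
  have h2 := S.form_toDom g v
  rw [S.symm] at h2
  rw [h1, L2.inner_def] at h2
  have e : (fun x => S.gen g x * φ ((h : Lp ℝ 2 ν) x)) =ᵐ[ν]
      fun x => inner ℝ (S.gen g x) ((v : Lp ℝ 2 ν) x) := by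
    filter_upwards [hv] with x hx
    rw [hx]
    simp only [RCLike.inner_apply, conj_trivial]
    rw [mul_comm]; rfl
  refine ⟨(L2.integrable_inner (𝕜 := ℝ) (S.gen g) (v : Lp ℝ 2 ν)).congr e.symm, ?_⟩
  rw [integral_congr_ae e, S.gamma_symm (S.toDom g)]
  change _ = -(1 / 2) * ∫ x, φ' ((S.toDom h : Lp ℝ 2 ν) x) * _ ∂ν
  linarith

/-- `i ∫ (e^{ih} - 1) a[g] dν = ½ ∫ e^{ih} γ[g, h] dν`. -/
theorem integral_exp_gen (g h : S.testDomain) :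
    Complex.I * ∫ x, (Complex.exp (Complex.I * ((h : Lp ℝ 2 ν) x : ℂ)) - 1) * (S.gen g x : ℂ) ∂ν =
      1 / 2 * ∫ x, Complex.exp (Complex.I * ((h : Lp ℝ 2 ν) x : ℂ)) *
        (S.gamma (S.toDom g) (S.toDom h) x : ℂ) ∂ν := by
  -- The chain rule is real, so e^{ix} - 1 is split into cos x - 1 and sin x, both contractions
  -- vanishing at 0. This is where subtracting 1 from the exponential matters.
  obtain ⟨i1, e1⟩ := S.inner_gen_comp g h (φ := fun x => Real.cos x - 1)
    (φ' := fun x => -Real.sin x) (fun x => (Real.hasDerivAt_cos x).sub_const 1)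
    Real.continuous_sin.neg (fun x => by rw [abs_neg]; exact Real.abs_sin_le_one x) (by simp)
  obtain ⟨i2, e2⟩ := S.inner_gen_comp g h Real.hasDerivAt_sin Real.continuous_cos
    Real.abs_cos_le_one Real.sin_zero
  have hγ := integrable_coeFn_L1 (S.gamma (S.toDom g) (S.toDom h))
  have hm : AEStronglyMeasurable (fun x => (h : Lp ℝ 2 ν) x) ν := Lp.aestronglyMeasurable _
  have i3 : Integrable (fun x => Real.cos ((h : Lp ℝ 2 ν) x) *
      S.gamma (S.toDom g) (S.toDom h) x) ν :=
    hγ.bdd_mul (c := 1) (Real.continuous_cos.comp_aestronglyMeasurable hm)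
      (ae_of_all _ fun x => Real.abs_cos_le_one _)
  have i4 : Integrable (fun x => Real.sin ((h : Lp ℝ 2 ν) x) *
      S.gamma (S.toDom g) (S.toDom h) x) ν :=
    hγ.bdd_mul (c := 1) (Real.continuous_sin.comp_aestronglyMeasurable hm)
      (ae_of_all _ fun x => Real.abs_sin_le_one _)
  have hexp : ∀ t : ℝ, Complex.exp (Complex.I * (t : ℂ)) = Real.cos t + Complex.I * Real.sin t :=
    fun t => by rw [mul_comm, Complex.exp_mul_I]; push_cast; ring
  have a1 : ∫ x, (Complex.exp (Complex.I * ((h : Lp ℝ 2 ν) x : ℂ)) - 1) * (S.gen g x : ℂ) ∂ν =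
      ((∫ x, S.gen g x * (Real.cos ((h : Lp ℝ 2 ν) x) - 1) ∂ν : ℝ) : ℂ) +
        Complex.I * ((∫ x, S.gen g x * Real.sin ((h : Lp ℝ 2 ν) x) ∂ν : ℝ) : ℂ) := by
    rw [← integral_complex_ofReal, ← integral_complex_ofReal, ← integral_const_mul,
      ← integral_add i1.ofReal (i2.ofReal.const_mul _)]
    refine integral_congr_ae (ae_of_all _ fun x => ?_)
    dsimp only
    rw [hexp]
    push_cast; ring
  have a2 : ∫ x, Complex.exp (Complex.I * ((h : Lp ℝ 2 ν) x : ℂ)) *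
        (S.gamma (S.toDom g) (S.toDom h) x : ℂ) ∂ν =
      ((∫ x, Real.cos ((h : Lp ℝ 2 ν) x) * S.gamma (S.toDom g) (S.toDom h) x ∂ν : ℝ) : ℂ) +
        Complex.I * ((∫ x, Real.sin ((h : Lp ℝ 2 ν) x) *
          S.gamma (S.toDom g) (S.toDom h) x ∂ν : ℝ) : ℂ) := by
    rw [← integral_complex_ofReal, ← integral_complex_ofReal, ← integral_const_mul,
      ← integral_add i3.ofReal (i4.ofReal.const_mul _)]
    refine integral_congr_ae (ae_of_all _ fun x => ?_)
    dsimp only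
    rw [hexp]
    push_cast; ring
  rw [a1, a2, e1, e2]
  simp only [neg_mul, integral_neg, Complex.ofReal_mul, Complex.ofReal_neg]
  push_cast
  linear_combination (-(1 / 2) : ℂ) *
    ((∫ x, Real.cos ((h : Lp ℝ 2 ν) x) * S.gamma (S.toDom g) (S.toDom h) x ∂ν : ℝ) : ℂ) *
      Complex.I_mul_I

end LocalDirichletStructure

variable {P : Measure (Configuration X)} [IsProbabilityMeasure P]

namespace IsPoissonLaw

variable (hP : IsPoissonLaw ν P) (S : LocalDirichletStructure ν)

include hP

/-- `E[e^{iÑ(h)} iÑ(a[g])] = ½ E[e^{iÑ(h)} N(γ[g, h])]`. -/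
theorem integral_expN_gen (g h : S.testDomain) :
    Complex.I * ∫ ω, expN P (h : Lp ℝ 2 ν) ω * (Ntilde P (S.gen g) ω : ℂ) ∂P =
      1 / 2 * ∫ ω, expN P (h : Lp ℝ 2 ν) ω *
        (N (S.gamma (S.toDom g) (S.toDom h)) ω : ℂ) ∂P := by
  rw [hP.integral_expN_mul_Ntilde h.2.2, hP.integral_expN_mul_N h.2.2 (integrable_coeFn_L1 _)]
  linear_combination (∫ ω, expN P (h : Lp ℝ 2 ν) ω ∂P) * S.integral_exp_gen g h

end IsPoissonLaw

end PoissonDirichlet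
end

noncomputable section

namespace PoissonDirichlet

variable {X : Type*} [MeasurableSpace X] {ν : Measure X}

/-! ### The algebra of formal exponential sums -/

/-- Formal sums `∑ λ_p e^{iÑ(f_p)}`, `f_p ∈ 𝒟(a) ∩ L¹(ν)`. -/
abbrev ExpPoly (S : LocalDirichletStructure ν) : Type _ := AddMonoidAlgebra ℂ S.testDomain

namespace ExpPoly

open AddMonoidAlgebra

variable {S : LocalDirichletStructure ν}

/-- The linear map on formal sums with prescribed values on the exponentials. -/
def lin {V : Type*} [AddCommGroup V] [Module ℂ V] (v : S.testDomain → V) : ExpPoly S →ₗ[ℂ] V :=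
  Finsupp.linearCombination ℂ v ∘ₗ (coeffLinearEquiv ℂ).toLinearMap

@[simp]
theorem lin_single {V : Type*} [AddCommGroup V] [Module ℂ V] (v : S.testDomain → V)
    (f : S.testDomain) (c : ℂ) : lin v (single f c) = c • v f := by
  simp [lin]

/-- The exchange of `λ e^{iÑ(f)}` and `conj λ e^{-iÑ(f)}`. -/
def conjHom : ExpPoly S →ₐ[ℝ] ExpPoly S :=
  (mapDomainAlgHom ℝ ℂ (-AddMonoidHom.id S.testDomain)).comp
    (mapAlgHom S.testDomain Complex.conjAe.toAlgHom)

@[simp]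
theorem conjHom_single (f : S.testDomain) (c : ℂ) :
    conjHom (single f c) = single (-f) (conj c) := by
  simp [conjHom]

@[simp]
theorem conjHom_conjHom (F : ExpPoly S) : conjHom (conjHom F) = F := by
  induction F using AddMonoidAlgebra.induction_linear with
  | zero => simp
  | add F G hF hG => rw [map_add, map_add, hF, hG]
  | single f c => simp

theorem conjHom_smul (c : ℂ) (F : ExpPoly S) : conjHom (c • F) = conj c • conjHom F := by
  induction F using AddMonoidAlgebra.induction_linear with
  | zero => simp
  | add F G hF hG => rw [smul_add, map_add, hF, hG, map_add, smul_add]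
  | single f d => simp

variable (P : Measure (Configuration X))

/-- The random variable `∑ λ_p e^{iÑ(f_p)}`. -/
def eval : ExpPoly S →ₗ[ℂ] Configuration X → ℂ := lin fun f => expN P (f : Lp ℝ 2 ν)

/-- The random variable `∑ λ_p e^{iÑ(f_p)} (iÑ(a[f_p]) - ½ N(γ[f_p]))`. -/
def genSum : ExpPoly S →ₗ[ℂ] Configuration X → ℂ :=
  lin fun f ω => expN P (f : Lp ℝ 2 ν) ω * (Complex.I * (Ntilde P (S.gen f) ω : ℂ) -
      1 / 2 * (N (S.gamma (S.toDom f) (S.toDom f)) ω : ℂ))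

/-- The random variable `-∑ λ_p μ_q e^{iÑ(f_p + g_q)} N(γ[f_p, g_q])`. -/
def gammaSum : ExpPoly S →ₗ[ℂ] ExpPoly S →ₗ[ℂ] Configuration X → ℂ :=
  lin fun f => lin fun g ω => -(expN P (f : Lp ℝ 2 ν) ω * expN P (g : Lp ℝ 2 ν) ω *
    (N (S.gamma (S.toDom f) (S.toDom g)) ω : ℂ))

theorem eval_single (f : S.testDomain) (c : ℂ) (ω : Configuration X) :
    eval P (single f c) ω = c * expN P (f : Lp ℝ 2 ν) ω := by simp [eval]

theorem genSum_single (f : S.testDomain) (c : ℂ) (ω : Configuration X) :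
    genSum P (single f c) ω = c * (expN P (f : Lp ℝ 2 ν) ω *
      (Complex.I * (Ntilde P (S.gen f) ω : ℂ) -
        1 / 2 * (N (S.gamma (S.toDom f) (S.toDom f)) ω : ℂ))) := by simp [genSum]

theorem gammaSum_single (f g : S.testDomain) (c d : ℂ) (ω : Configuration X) :
    gammaSum P (single f c) (single g d) ω = -(c * d * (expN P (f : Lp ℝ 2 ν) ω *
      expN P (g : Lp ℝ 2 ν) ω * (N (S.gamma (S.toDom f) (S.toDom g)) ω : ℂ))) := by
  simp [gammaSum]; ring

theorem gammaSum_symm (F G : ExpPoly S) : gammaSum P F G = gammaSum P G F := by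
  induction F using AddMonoidAlgebra.induction_linear with
  | zero => simp
  | add F F' hF hF' => rw [map_add, LinearMap.add_apply, hF, hF', map_add]
  | single f c =>
    induction G using AddMonoidAlgebra.induction_linear with
    | zero => simp
    | add G G' hG hG' => rw [map_add, map_add, LinearMap.add_apply, hG, hG']
    | single g d =>
      ext ω
      rw [gammaSum_single, gammaSum_single, S.gamma_symm]
      ring

theorem aestronglyMeasurable_eval [IsFiniteMeasure P] (F : ExpPoly S) :
    AEStronglyMeasurable (eval P F) P := by
  induction F using AddMonoidAlgebra.induction_linear with
  | zero => rw [map_zero]; exact aestronglyMeasurable_const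
  | add F G hF hG => rw [map_add]; exact hF.add hG
  | single f c =>
    simp only [eval, lin_single]
    exact (memLp_expN P _).1.const_smul c

theorem exists_norm_eval_le (F : ExpPoly S) : ∃ C, ∀ ω, ‖eval P F ω‖ ≤ C := by
  induction F using AddMonoidAlgebra.induction_linear with
  | zero => exact ⟨0, by simp⟩
  | add F G hF hG =>
    obtain ⟨C, hC⟩ := hF
    obtain ⟨D, hD⟩ := hG
    refine ⟨C + D, fun ω => ?_⟩
    rw [map_add]
    exact (norm_add_le _ _).trans (add_le_add (hC ω) (hD ω))
  | single f c =>
    exact ⟨‖c‖, fun ω => by rw [eval_single, norm_mul, norm_expN, mul_one]⟩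

theorem memLp_eval [IsFiniteMeasure P] (F : ExpPoly S) : MemLp (eval P F) 2 P := by
  obtain ⟨C, hC⟩ := exists_norm_eval_le P F
  exact MemLp.of_bound (aestronglyMeasurable_eval P F) C (ae_of_all _ hC)

theorem integrable_eval_mul [IsFiniteMeasure P] (F : ExpPoly S) {k : Configuration X → ℂ}
    (hk : Integrable k P) : Integrable (fun ω => eval P F ω * k ω) P := by
  obtain ⟨C, hC⟩ := exists_norm_eval_le P F
  exact hk.bdd_mul (aestronglyMeasurable_eval P F) (ae_of_all _ hC)

end ExpPoly

theorem integrable_expN_mul {P : Measure (Configuration X)} [IsFiniteMeasure P]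
    {k : Configuration X → ℂ} (hk : Integrable k P) (f : Lp ℝ 2 ν) :
    Integrable (fun ω => expN P f ω * k ω) P :=
  hk.bdd_mul (c := 1) (memLp_expN P _).1 (ae_of_all _ fun ω => (norm_expN _ ω).le)

namespace IsPoissonLaw

open AddMonoidAlgebra ExpPoly

variable {P : Measure (Configuration X)} [SigmaFinite ν] (hP : IsPoissonLaw ν P)
  {S : LocalDirichletStructure ν}

include hP

theorem N_gamma_add_left (u v w : S.dom) :
    N (S.gamma (u + v) w) =ᵐ[P] fun ω => N (S.gamma u w) ω + N (S.gamma v w) ω := by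
  have e : (S.gamma (u + v) w : X → ℝ) =ᵐ[ν] ⇑(S.gamma u w) + ⇑(S.gamma v w) := by
    rw [map_add, LinearMap.add_apply]; exact Lp.coeFn_add _ _
  exact (hP.N_congr e).trans (hP.N_add (integrable_coeFn_L1 _) (integrable_coeFn_L1 _))

theorem N_gamma_smul_left (c : ℝ) (u w : S.dom) :
    N (S.gamma (c • u) w) =ᵐ[P] fun ω => c * N (S.gamma u w) ω := by
  have e : (S.gamma (c • u) w : X → ℝ) =ᵐ[ν] c • ⇑(S.gamma u w) := by
    rw [map_smul, LinearMap.smul_apply]; exact Lp.coeFn_smul _ _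
  exact (hP.N_congr e).trans (ae_of_all _ fun ω => N_smul c _ ω)

theorem N_gamma_nonneg (u : S.dom) : ∀ᵐ ω ∂P, 0 ≤ N (S.gamma u u) ω := by
  filter_upwards [hP.ae_ae (S.gamma_nonneg u)] with ω h
  exact integral_nonneg_of_ae h

theorem N_gamma_sum_left {ι : Type*} (s : Finset ι) (c : ι → ℝ) (u : ι → S.dom) (w : S.dom) :
    N (S.gamma (∑ i ∈ s, c i • u i) w) =ᵐ[P] fun ω => ∑ i ∈ s, c i * N (S.gamma (u i) w) ω := by
  classical
  induction s using Finset.induction_on with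
  | empty =>
    filter_upwards [hP.N_gamma_smul_left 0 (0 : S.dom) w] with ω h
    simpa using h
  | insert i s hi ih =>
    rw [Finset.sum_insert hi]
    filter_upwards [hP.N_gamma_add_left (c i • u i) (∑ i ∈ s, c i • u i) w,
      hP.N_gamma_smul_left (c i) (u i) w, ih] with ω h1 h2 h3
    rw [h1, h2, h3, Finset.sum_insert hi]

variable [IsProbabilityMeasure P]

theorem expN_add (f g : Lp ℝ 2 ν) :
    expN P (f + g) =ᵐ[P] fun ω => expN P f ω * expN P g ω := by
  filter_upwards [Lp.coeFn_add (Ntilde P f) (Ntilde P g)] with ω h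
  rw [expN, expN, expN, hP.Ntilde_add, h, ← Complex.exp_add, Pi.add_apply]
  push_cast
  ring_nf

theorem eval_mul (F G : ExpPoly S) :
    eval P (F * G) =ᵐ[P] fun ω => eval P F ω * eval P G ω := by
  induction F using AddMonoidAlgebra.induction_linear with
  | zero => simp; rfl
  | add F F' hF hF' =>
    rw [add_mul, map_add, map_add]
    filter_upwards [hF, hF'] with ω h h'
    rw [Pi.add_apply, h, h', Pi.add_apply, add_mul]
  | single f c =>
    induction G using AddMonoidAlgebra.induction_linear with
    | zero => simp; rfl
    | add G G' hG hG' =>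
      rw [mul_add, map_add, map_add]
      filter_upwards [hG, hG'] with ω h h'
      rw [Pi.add_apply, h, h', Pi.add_apply, mul_add]
    | single g d =>
      filter_upwards [hP.expN_add f g] with ω h
      rw [single_mul_single, eval_single, eval_single, eval_single, Submodule.coe_add, h]
      ring

theorem eval_conjHom (F : ExpPoly S) :
    eval P (conjHom F) =ᵐ[P] fun ω => conj (eval P F ω) := by
  induction F using AddMonoidAlgebra.induction_linear with
  | zero => simp; rfl
  | add F F' hF hF' =>
    rw [map_add, map_add, map_add]
    filter_upwards [hF, hF'] with ω h h'
    rw [Pi.add_apply, h, h', Pi.add_apply, map_add]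
  | single f c =>
    filter_upwards [hP.conj_expN (f : Lp ℝ 2 ν)] with ω h
    rw [conjHom_single, eval_single, eval_single, map_mul, h, Submodule.coe_neg]

theorem integrable_genSum (F : ExpPoly S) : Integrable (genSum P F) P := by
  induction F using AddMonoidAlgebra.induction_linear with
  | zero => rw [map_zero]; exact integrable_zero _ _ _
  | add F G hF hG => rw [map_add]; exact hF.add hG
  | single f c =>
    simp only [genSum, lin_single]
    refine Integrable.smul c (integrable_expN_mul (Integrable.sub ?_ ?_) _)
    · exact (((Lp.memLp (Ntilde P (S.gen f))).integrable (by norm_num)).ofReal).const_mul _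
    · exact ((hP.integrable_N (integrable_coeFn_L1 _)).ofReal).const_mul _

theorem integrable_gammaSum (F G : ExpPoly S) : Integrable (gammaSum P F G) P := by
  induction F using AddMonoidAlgebra.induction_linear with
  | zero => rw [map_zero]; exact integrable_zero _ _ _
  | add F F' hF hF' => rw [map_add]; exact hF.add hF'
  | single f c =>
    induction G using AddMonoidAlgebra.induction_linear with
    | zero => rw [map_zero]; exact integrable_zero _ _ _
    | add G G' hG hG' => rw [map_add]; exact hG.add hG'
    | single g d =>
      simp only [gammaSum, lin_single, LinearMap.smul_apply, mul_assoc]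
      exact (((integrable_expN_mul (integrable_expN_mul
        (hP.integrable_N (integrable_coeFn_L1 _)).ofReal _) _).neg).smul d).smul c

/-- The integration by parts formula for formal exponential sums. -/
theorem integral_eval_mul_genSum (F G : ExpPoly S) :
    ∫ ω, eval P F ω * genSum P G ω ∂P = -(1 / 2) * ∫ ω, gammaSum P F G ω ∂P := by
  have ii := fun F G : ExpPoly S => integrable_eval_mul P F (hP.integrable_genSum G)
  have ig := fun F G : ExpPoly S => hP.integrable_gammaSum F G
  induction F using AddMonoidAlgebra.induction_linear with
  | zero => simp
  | add F F' hF hF' =>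
    simp only [map_add, LinearMap.add_apply, Pi.add_apply, add_mul]
    rw [integral_add (ii _ _) (ii _ _), integral_add (ig _ _) (ig _ _), hF, hF', mul_add]
  | single f c =>
    induction G using AddMonoidAlgebra.induction_linear with
    | zero => simp
    | add G G' hG hG' =>
      simp only [map_add, Pi.add_apply, mul_add]
      rw [integral_add (ii _ _) (ii _ _), integral_add (ig _ _) (ig _ _), hG, hG', mul_add]
    | single g d =>
      -- With e^{iÑ(f)} e^{iÑ(g)} = e^{iÑ(f+g)}, the drift term iÑ(a[g]) contributes ½ N(γ[g, f +
      -- g]) = ½ N(γ[f,g]) + ½ N(γ[g]), and the last summand is cancelled by the correction -½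
      -- N(γ[g]).
      have h0 := hP.integral_expN_gen S g (f + g)
      have hN : ∀ u v : S.dom, Integrable (fun ω => expN P ((f + g : S.testDomain) : Lp ℝ 2 ν) ω *
          (N (S.gamma u v) ω : ℂ)) P := fun u v =>
        integrable_expN_mul (hP.integrable_N (integrable_coeFn_L1 _)).ofReal _
      have hE : Integrable (fun ω => expN P ((f + g : S.testDomain) : Lp ℝ 2 ν) ω *
          (Ntilde P (S.gen g) ω : ℂ)) P :=
        integrable_expN_mul ((Lp.memLp (Ntilde P (S.gen g))).integrable (by norm_num)).ofReal _
      have h1 : ∫ ω, expN P ((f + g : S.testDomain) : Lp ℝ 2 ν) ω *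
          (N (S.gamma (S.toDom g) (S.toDom (f + g))) ω : ℂ) ∂P =
          (∫ ω, expN P ((f + g : S.testDomain) : Lp ℝ 2 ν) ω *
            (N (S.gamma (S.toDom f) (S.toDom g)) ω : ℂ) ∂P) +
          ∫ ω, expN P ((f + g : S.testDomain) : Lp ℝ 2 ν) ω *
            (N (S.gamma (S.toDom g) (S.toDom g)) ω : ℂ) ∂P := by
        rw [← integral_add (hN _ _) (hN _ _), S.gamma_symm]
        refine integral_congr_ae ?_
        filter_upwards [hP.N_gamma_add_left (S.toDom f) (S.toDom g) (S.toDom g)] with ω h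
        have e : S.toDom (f + g) = S.toDom f + S.toDom g := rfl
        rw [e, h]; push_cast; ring
      have h2 : ∫ ω, eval P (single f c) ω * genSum P (single g d) ω ∂P =
          c * d * (Complex.I * (∫ ω, expN P ((f + g : S.testDomain) : Lp ℝ 2 ν) ω *
            (Ntilde P (S.gen g) ω : ℂ) ∂P) -
          1 / 2 * ∫ ω, expN P ((f + g : S.testDomain) : Lp ℝ 2 ν) ω *
            (N (S.gamma (S.toDom g) (S.toDom g)) ω : ℂ) ∂P) := by
        rw [← integral_const_mul, ← integral_const_mul,
          ← integral_sub (hE.const_mul _) ((hN _ _).const_mul _), ← integral_const_mul]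
        refine integral_congr_ae ?_
        filter_upwards [hP.expN_add (f : Lp ℝ 2 ν) g] with ω h
        rw [eval_single, genSum_single, Submodule.coe_add, h]; ring
      have h3 : ∫ ω, gammaSum P (single f c) (single g d) ω ∂P =
          -(c * d) * ∫ ω, expN P ((f + g : S.testDomain) : Lp ℝ 2 ν) ω *
            (N (S.gamma (S.toDom f) (S.toDom g)) ω : ℂ) ∂P := by
        rw [← integral_const_mul]
        refine integral_congr_ae ?_
        filter_upwards [hP.expN_add (f : Lp ℝ 2 ν) g] with ω h
        rw [gammaSum_single, Submodule.coe_add, h]; ring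
      rw [h2, h3, h0, h1]
      ring

/-- On exponentials the Leibniz rule is additivity of γ in the exponent: γ[f + g, k] = γ[f,k] +
γ[g,k]. The general case is multilinear. -/
theorem gammaSum_mul (F G H : ExpPoly S) : gammaSum P (F * G) H =ᵐ[P] fun ω =>
    eval P F ω * gammaSum P G H ω + eval P G ω * gammaSum P F H ω := by
  induction F using AddMonoidAlgebra.induction_linear with
  | zero => simp; rfl
  | add F F' hF hF' =>
    simp only [add_mul, map_add, LinearMap.add_apply]
    filter_upwards [hF, hF'] with ω h h'
    simp only [Pi.add_apply, h, h']; ring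
  | single f c =>
    induction G using AddMonoidAlgebra.induction_linear with
    | zero => simp; rfl
    | add G G' hG hG' =>
      simp only [mul_add, map_add, LinearMap.add_apply]
      filter_upwards [hG, hG'] with ω h h'
      simp only [Pi.add_apply, h, h']; ring
    | single g d =>
      induction H using AddMonoidAlgebra.induction_linear with
      | zero => simp; rfl
      | add H H' hH hH' =>
        simp only [map_add]
        filter_upwards [hH, hH'] with ω h h'
        simp only [Pi.add_apply, h, h']; ring
      | single k e =>
        filter_upwards [hP.expN_add (f : Lp ℝ 2 ν) g,
          hP.N_gamma_add_left (S.toDom f) (S.toDom g) (S.toDom k)] with ω h h'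
        have e : S.toDom (f + g) = S.toDom f + S.toDom g := rfl
        rw [single_mul_single, gammaSum_single, gammaSum_single, gammaSum_single, eval_single,
          eval_single, Submodule.coe_add, h, e, h']
        push_cast
        ring

theorem gammaSum_conjHom (F G : ExpPoly S) :
    gammaSum P (conjHom F) (conjHom G) =ᵐ[P] fun ω => conj (gammaSum P F G ω) := by
  induction F using AddMonoidAlgebra.induction_linear with
  | zero => simp; rfl
  | add F F' hF hF' =>
    simp only [map_add, LinearMap.add_apply]
    filter_upwards [hF, hF'] with ω h h'
    rw [Pi.add_apply, h, h', Pi.add_apply, map_add]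
  | single f c =>
    induction G using AddMonoidAlgebra.induction_linear with
    | zero => simp; rfl
    | add G G' hG hG' =>
      simp only [map_add]
      filter_upwards [hG, hG'] with ω h h'
      rw [Pi.add_apply, h, h', Pi.add_apply, map_add]
    | single g d =>
      filter_upwards [hP.conj_expN (f : Lp ℝ 2 ν), hP.conj_expN (g : Lp ℝ 2 ν)] with ω h h'
      have e : S.gamma (S.toDom (-f)) (S.toDom (-g)) = S.gamma (S.toDom f) (S.toDom g) := by
        have e : ∀ f, S.toDom (-f) = -S.toDom f := fun _ => rfl
        rw [e, e, map_neg, map_neg, LinearMap.neg_apply, neg_neg]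
      rw [conjHom_single, conjHom_single, gammaSum_single, gammaSum_single, e]
      simp only [map_neg, map_mul, h, h', Submodule.coe_neg, Complex.conj_ofReal]

theorem genSum_conjHom (F : ExpPoly S) :
    genSum P (conjHom F) =ᵐ[P] fun ω => conj (genSum P F ω) := by
  induction F using AddMonoidAlgebra.induction_linear with
  | zero => simp; rfl
  | add F F' hF hF' =>
    simp only [map_add]
    filter_upwards [hF, hF'] with ω h h'
    rw [Pi.add_apply, h, h', Pi.add_apply, map_add]
  | single f c =>
    have e1 : S.gamma (S.toDom (-f)) (S.toDom (-f)) = S.gamma (S.toDom f) (S.toDom f) := by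
      have e : ∀ f, S.toDom (-f) = -S.toDom f := fun _ => rfl
      rw [e, map_neg, map_neg, LinearMap.neg_apply, neg_neg]
    have e2 : Ntilde P (S.gen (-f)) = -Ntilde P (S.gen f) := by
      have e : S.gen (-f) = -S.gen f := S.generator.map_neg ⟨f, f.2.1⟩
      rw [e, hP.Ntilde_eq, map_neg]
    filter_upwards [hP.conj_expN (f : Lp ℝ 2 ν), Lp.coeFn_neg (Ntilde P (S.gen f))] with ω h h'
    rw [conjHom_single, genSum_single, genSum_single, e1, e2, h', Pi.neg_apply]
    simp only [map_sub, map_mul, h, Submodule.coe_neg, Complex.conj_ofReal, Complex.conj_I,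
      Complex.ofReal_neg, map_div₀, map_one, map_ofNat]
    ring

end IsPoissonLaw

end PoissonDirichlet
end

/-! ### Real exponential sums as a diffusion algebra -/

noncomputable section

namespace PoissonDirichlet

/-- A random quadratic form that is almost surely nonnegative at each rational point is almost
surely nonnegative. -/
theorem ae_quadratic_nonneg {Y : Type*} [MeasurableSpace Y] {μ : Measure Y} {ι : Type*} [Fintype ι]
    {K : ι → ι → Y → ℝ}
    (h : ∀ q : ι → ℚ, ∀ᵐ y ∂μ, 0 ≤ ∑ i, ∑ j, (q i : ℝ) * (q j : ℝ) * K i j y) :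
    ∀ᵐ y ∂μ, ∀ x : ι → ℝ, 0 ≤ ∑ i, ∑ j, x i * x j * K i j y := by
  filter_upwards [ae_all_iff.2 h] with y hy x
  have hd : DenseRange fun (q : ι → ℚ) (i : ι) => (q i : ℝ) :=
    DenseRange.piMap fun _ => Rat.denseRange_cast
  have hc : IsClosed {x : ι → ℝ | 0 ≤ ∑ i, ∑ j, x i * x j * K i j y} :=
    isClosed_le continuous_const (by fun_prop)
  exact hd.induction_on (p := fun x => 0 ≤ ∑ i, ∑ j, x i * x j * K i j y) x hc hy

/-- For a real kernel the real part of the complex quadratic form splits into the forms of the real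
and of the imaginary parts. -/
theorem re_quadratic_nonneg {ι : Type*} [Fintype ι] {K : ι → ι → ℝ}
    (h : ∀ x : ι → ℝ, 0 ≤ ∑ i, ∑ j, x i * x j * K i j) (z : ι → ℂ) :
    0 ≤ (∑ i, ∑ j, z i * conj (z j) * (K i j : ℂ)).re := by
  have h1 := h fun i => (z i).re
  have h2 := h fun i => (z i).im
  have e : (∑ i, ∑ j, z i * conj (z j) * (K i j : ℂ)).re =
      (∑ i, ∑ j, (z i).re * (z j).re * K i j) + ∑ i, ∑ j, (z i).im * (z j).im * K i j := by
    simp only [Complex.re_sum, ← Finset.sum_add_distrib]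
    refine Finset.sum_congr rfl fun i _ => Finset.sum_congr rfl fun j _ => ?_
    rw [Complex.re_mul_ofReal, Complex.mul_re, Complex.conj_re, Complex.conj_im]
    ring
  rw [e]
  exact add_nonneg h1 h2

theorem integral_complex_re {Y : Type*} [MeasurableSpace Y] {μ : Measure Y} {f : Y → ℂ}
    (hf : Integrable f μ) : ∫ y, (f y).re ∂μ = (∫ y, f y ∂μ).re :=
  integral_re hf

variable {X : Type*} [MeasurableSpace X] {ν : Measure X}

namespace ExpPoly

open AddMonoidAlgebra

variable {S : LocalDirichletStructure ν} (P : Measure (Configuration X))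

/-- The class in `L²(P)` of `∑ λ_p e^{iÑ(f_p)}`. -/
def evalL2 [IsFiniteMeasure P] : ExpPoly S →ₗ[ℂ] Lp ℂ 2 P :=
  lin fun f => (memLp_expN P (f : Lp ℝ 2 ν)).toLp (expN P (f : Lp ℝ 2 ν))

theorem coeFn_evalL2 [IsFiniteMeasure P] (F : ExpPoly S) : evalL2 P F =ᵐ[P] eval P F := by
  induction F using AddMonoidAlgebra.induction_linear with
  | zero => rw [map_zero, map_zero]; exact Lp.coeFn_zero ℂ 2 P
  | add F G hF hG =>
    rw [map_add, map_add]
    exact (Lp.coeFn_add _ _).trans (hF.add hG)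
  | single f c =>
    simp only [evalL2, eval, lin_single]
    filter_upwards [Lp.coeFn_smul c ((memLp_expN P (f : Lp ℝ 2 ν)).toLp _),
      (memLp_expN P (f : Lp ℝ 2 ν)).coeFn_toLp] with ω h1 h2
    rw [h1, Pi.smul_apply, h2, Pi.smul_apply]

theorem range_evalL2 [IsFiniteMeasure P] :
    LinearMap.range (evalL2 P : ExpPoly S →ₗ[ℂ] Lp ℂ 2 P) = preDomain S P := by
  rw [evalL2, lin, LinearMap.range_comp, LinearEquiv.range, Submodule.map_top,
    Finsupp.range_linearCombination]
  rfl

variable (S) in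
/-- The formal exponential sums that define real random variables. -/
def realSums : Subalgebra ℝ (ExpPoly S) := AlgHom.equalizer conjHom (AlgHom.id ℝ (ExpPoly S))

theorem conjHom_coe (F : realSums S) : conjHom (F : ExpPoly S) = F := F.2

/-- The real part of a formal exponential sum. -/
def re (F : ExpPoly S) : realSums S :=
  ⟨(1 / 2 : ℝ) • (F + conjHom F), by
    change conjHom _ = _
    rw [map_smul, map_add, conjHom_conjHom, add_comm]; rfl⟩

/-- The imaginary part of a formal exponential sum. -/
def im (F : ExpPoly S) : realSums S := re (-Complex.I • F)

theorem re_add_I_smul_im (F : ExpPoly S) :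
    (re F : ExpPoly S) + Complex.I • (im F : ExpPoly S) = F := by
  change (1 / 2 : ℝ) • (F + conjHom F) + Complex.I •
    ((1 / 2 : ℝ) • (-Complex.I • F + conjHom (-Complex.I • F))) = F
  simp only [conjHom_smul, map_neg, Complex.conj_I, neg_neg, ← Complex.coe_smul, smul_add,
    smul_smul]
  have e : Complex.I * (((1 / 2 : ℝ) : ℂ) * -Complex.I) = ((1 / 2 : ℝ) : ℂ) := by
    linear_combination -(((1 / 2 : ℝ) : ℂ)) * Complex.I_mul_I
  have e' : Complex.I * (((1 / 2 : ℝ) : ℂ) * Complex.I) = -((1 / 2 : ℝ) : ℂ) := by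
    linear_combination (((1 / 2 : ℝ) : ℂ)) * Complex.I_mul_I
  rw [e, e', neg_smul, add_add_add_comm, add_neg_cancel, add_zero, ← add_smul]
  norm_num

end ExpPoly

namespace IsPoissonLaw

open AddMonoidAlgebra ExpPoly

variable {P : Measure (Configuration X)} [SigmaFinite ν] [IsProbabilityMeasure P]
  (hP : IsPoissonLaw ν P) {S : LocalDirichletStructure ν}

include hP

/-- For fixed coefficients the sum is N(γ[u]) for the corresponding combination u, hence almost
surely nonnegative. Rational coefficients provide a single null set. -/
theorem ae_N_gamma_quadratic_nonneg {ι : Type*} [Fintype ι] (u : ι → S.dom) :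
    ∀ᵐ ω ∂P, ∀ x : ι → ℝ, 0 ≤ ∑ i, ∑ j, x i * x j * N (S.gamma (u i) (u j)) ω := by
  refine ae_quadratic_nonneg (K := fun i j => N (S.gamma (u i) (u j))) fun q => ?_
  have h2 := fun i => hP.N_gamma_sum_left Finset.univ (fun j => (q j : ℝ)) u (u i)
  filter_upwards [hP.N_gamma_nonneg (∑ i, (q i : ℝ) • u i),
    hP.N_gamma_sum_left Finset.univ (fun i => (q i : ℝ)) u (∑ i, (q i : ℝ) • u i),
    ae_all_iff.2 h2] with ω h h' h''
  rw [h'] at h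
  refine h.trans_eq (Finset.sum_congr rfl fun i _ => ?_)
  rw [S.gamma_symm, h'' i, Finset.mul_sum]
  refine Finset.sum_congr rfl fun j _ => ?_
  rw [S.gamma_symm, mul_assoc]

/-- Conjugation replaces g by -g and thereby cancels the minus sign in `gammaSum`. What remains is Σ
z_f conj(z_g) N(γ[f,g]) with z_f = λ_f e^{iÑ(f)}, a form with almost surely nonnegative real matrix.
-/
theorem gammaSum_conjHom_nonneg (F : ExpPoly S) :
    ∀ᵐ ω ∂P, 0 ≤ (gammaSum P F (conjHom F) ω).re := by
  have hF : F = ∑ f : F.coeff.support, single (f : S.testDomain) (F.coeff f) := by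
    conv_lhs => rw [← sum_coeff_single F]
    rw [Finsupp.sum, ← Finset.sum_coe_sort]
  filter_upwards [hP.ae_N_gamma_quadratic_nonneg
      (fun f : F.coeff.support => S.toDom (f : S.testDomain)),
    ae_all_iff.2 fun f : F.coeff.support => hP.conj_expN ((f : S.testDomain) : Lp ℝ 2 ν),
    ae_all_iff.2 fun g : F.coeff.support => ae_all_iff.2 fun f : F.coeff.support =>
      hP.N_gamma_smul_left (-1) (S.toDom (g : S.testDomain)) (S.toDom (f : S.testDomain))]
    with ω h h' h''
  refine (re_quadratic_nonneg h fun f : F.coeff.support =>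
    F.coeff f * expN P ((f : S.testDomain) : Lp ℝ 2 ν) ω).trans_eq (congrArg Complex.re ?_)
  conv_rhs => rw [hF]
  simp only [map_sum, LinearMap.sum_apply, Finset.sum_apply]
  rw [Finset.sum_comm]
  refine Finset.sum_congr rfl fun g _ => ?_
  refine Finset.sum_congr rfl fun f _ => ?_
  have e : S.toDom (-g : S.testDomain) = (-1 : ℝ) • S.toDom (g : S.testDomain) := by
    rw [neg_one_smul]; rfl
  rw [conjHom_single, gammaSum_single, e, S.gamma_symm (S.toDom f) ((-1 : ℝ) • _),
    h'' g f, S.gamma_symm, map_mul, h' g,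
    Submodule.coe_neg]
  push_cast
  ring

/-- A vector orthogonal to all exponentials of test functions is an integrable variable that they do
not separate from 0, hence zero. -/
theorem dense_preDomain : Dense (preDomain S P : Set (Lp ℂ 2 P)) := by
  rw [Submodule.dense_iff_topologicalClosure_eq_top, Submodule.topologicalClosure_eq_top_iff,
    Submodule.eq_bot_iff]
  intro v hv
  rw [Submodule.mem_orthogonal] at hv
  refine Lp.ext (EventuallyEq.trans ?_ (Lp.coeFn_zero ℂ 2 P).symm)
  refine hP.ae_eq_zero S.dense_testDomain ((Lp.memLp v).integrable (by norm_num)) fun f hf => ?_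
  -- The exponential of -f is used because the inner product conjugates its first argument.
  have h := hv _ (Submodule.subset_span ⟨-⟨f, hf⟩, rfl⟩)
  rw [L2.inner_def] at h
  rw [← h]
  refine integral_congr_ae ?_
  filter_upwards [(memLp_expN P (-f)).coeFn_toLp, hP.conj_expN (-f)] with ω h1 h2
  rw [neg_neg] at h2
  rw [← h2, ← h1]
  rfl

theorem eval_one : eval P (1 : ExpPoly S) =ᵐ[P] 1 := by
  filter_upwards [Lp.coeFn_zero ℝ 2 P] with ω h
  rw [one_def, eval_single, expN, ZeroMemClass.coe_zero, hP.Ntilde_eq, map_zero, h]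
  simp

variable (S) in
/-- The evaluation of real formal exponential sums. -/
def evalReal : realSums S →ₐ[ℝ] (Configuration X →ₘ[P] ℝ) :=
  have hm := fun F : ExpPoly S => Complex.continuous_re.comp_aestronglyMeasurable
    (aestronglyMeasurable_eval P F)
  have h0 := fun F : realSums S => hP.eval_conjHom (F : ExpPoly S)
  AlgHom.ofLinearMap
    { toFun F := AEEqFun.mk (fun ω => (eval P (F : ExpPoly S) ω).re) (hm F)
      map_add' F G := by
        apply AEEqFun.ext
        filter_upwards [AEEqFun.coeFn_mk _ (hm (F + G)), AEEqFun.coeFn_mk _ (hm F),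
          AEEqFun.coeFn_mk _ (hm G), AEEqFun.coeFn_add (AEEqFun.mk _ (hm F))
            (AEEqFun.mk _ (hm G))] with ω h1 h2 h3 h4
        refine h1.trans ?_
        refine Eq.trans ?_ h4.symm
        rw [Pi.add_apply, h2, h3]
        simp
      map_smul' c F := by
        apply AEEqFun.ext
        filter_upwards [AEEqFun.coeFn_mk _ (hm (c • F)), AEEqFun.coeFn_mk _ (hm F),
          AEEqFun.coeFn_smul c (AEEqFun.mk _ (hm F))] with ω h1 h2 h3
        refine h1.trans ?_
        refine Eq.trans ?_ h3.symm
        rw [Pi.smul_apply, h2, ← Complex.coe_smul, map_smul]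
        simp }
    (by
      apply AEEqFun.ext
      filter_upwards [AEEqFun.coeFn_mk _ (hm 1), hP.eval_one (S := S),
        AEEqFun.coeFn_one (α := Configuration X) (μ := P) (β := ℝ)] with ω h1 h2 h3
      refine h1.trans ?_
      rw [h3, h2]
      simp)
    (fun F G => by
      apply AEEqFun.ext
      filter_upwards [AEEqFun.coeFn_mk _ (hm (F * G)), AEEqFun.coeFn_mk _ (hm F),
        AEEqFun.coeFn_mk _ (hm G), AEEqFun.coeFn_mul (AEEqFun.mk _ (hm F))
            (AEEqFun.mk _ (hm G)), hP.eval_mul (F : ExpPoly S) (G : ExpPoly S), h0 F, h0 G]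
        with ω h1 h2 h3 h4 h5 h6 h7
      refine h1.trans ?_
      refine Eq.trans ?_ h4.symm
      rw [conjHom_coe] at h6 h7
      rw [Pi.mul_apply, h2, h3, h5, Complex.mul_re, Complex.conj_eq_iff_im.1 h6.symm]
      ring)

theorem coeFn_evalReal (F : realSums S) :
    hP.evalReal S F =ᵐ[P] fun ω => (eval P (F : ExpPoly S) ω).re :=
  AEEqFun.coeFn_mk _ _

theorem im_eval_eq_zero (F : realSums S) : ∀ᵐ ω ∂P, (eval P (F : ExpPoly S) ω).im = 0 := by
  filter_upwards [hP.eval_conjHom (F : ExpPoly S)] with ω h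
  rw [conjHom_coe] at h
  exact Complex.conj_eq_iff_im.1 h.symm

theorem im_gammaSum_eq_zero (F G : realSums S) :
    ∀ᵐ ω ∂P, (gammaSum P (F : ExpPoly S) (G : ExpPoly S) ω).im = 0 := by
  filter_upwards [hP.gammaSum_conjHom (F : ExpPoly S) (G : ExpPoly S)] with ω h
  rw [conjHom_coe, conjHom_coe] at h
  exact Complex.conj_eq_iff_im.1 h.symm

variable (S) in
/-- The carré du champ on real formal exponential sums. -/
def gammaReal : realSums S →ₗ[ℝ] realSums S →ₗ[ℝ] Lp ℝ 1 P :=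
  have hi := fun F G : ExpPoly S => (hP.integrable_gammaSum F G).re
  LinearMap.mk₂ ℝ (fun F G => (hi (F : ExpPoly S) (G : ExpPoly S)).toL1 _)
    (fun F F' G => by
      apply Lp.ext
      filter_upwards [(hi (F + F') G).coeFn_toL1, (hi F G).coeFn_toL1, (hi F' G).coeFn_toL1,
        Lp.coeFn_add ((hi F G).toL1 _) ((hi F' G).toL1 _)] with ω h1 h2 h3 h4
      refine h1.trans ?_
      rw [h4, Pi.add_apply, h2, h3]
      simp)
    (fun c F G => by
      apply Lp.ext
      filter_upwards [(hi (c • F) G).coeFn_toL1, (hi F G).coeFn_toL1,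
        Lp.coeFn_smul c ((hi F G).toL1 _)] with ω h1 h2 h3
      refine h1.trans ?_
      rw [h3, Pi.smul_apply, h2, ← Complex.coe_smul, map_smul]
      simp)
    (fun F G G' => by
      apply Lp.ext
      filter_upwards [(hi F (G + G')).coeFn_toL1, (hi F G).coeFn_toL1, (hi F G').coeFn_toL1,
        Lp.coeFn_add ((hi F G).toL1 _) ((hi F G').toL1 _)] with ω h1 h2 h3 h4
      refine h1.trans ?_
      rw [h4, Pi.add_apply, h2, h3]
      simp)
    (fun c F G => by
      apply Lp.ext
      filter_upwards [(hi F (c • G)).coeFn_toL1, (hi F G).coeFn_toL1,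
        Lp.coeFn_smul c ((hi F G).toL1 _)] with ω h1 h2 h3
      refine h1.trans ?_
      rw [h3, Pi.smul_apply, h2, ← Complex.coe_smul, map_smul]
      simp)

theorem coeFn_gammaReal (F G : realSums S) : hP.gammaReal S F G =ᵐ[P]
    fun ω => (gammaSum P (F : ExpPoly S) (G : ExpPoly S) ω).re :=
  (hP.integrable_gammaSum (F : ExpPoly S) (G : ExpPoly S)).re.coeFn_toL1

theorem integral_eval_mul_genSum_re (F G : realSums S) :
    ∫ ω, hP.evalReal S F ω * (genSum P (G : ExpPoly S) ω).re ∂P =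
      -(1 / 2) * ∫ ω, hP.gammaReal S F G ω ∂P := by
  have h := congrArg Complex.re
    (hP.integral_eval_mul_genSum (F : ExpPoly S) (G : ExpPoly S))
  have e : (-(1 / 2) * ∫ ω, gammaSum P (F : ExpPoly S) (G : ExpPoly S) ω ∂P).re =
      -(1 / 2) * (∫ ω, gammaSum P (F : ExpPoly S) (G : ExpPoly S) ω ∂P).re := by
    simp [Complex.mul_re]
  rw [e] at h
  rw [integral_congr_ae (hP.coeFn_gammaReal F G)]
  have h1 : ∫ ω, (eval P (F : ExpPoly S) ω * genSum P (G : ExpPoly S) ω).re ∂P =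
      (∫ ω, eval P (F : ExpPoly S) ω * genSum P (G : ExpPoly S) ω ∂P).re :=
    integral_complex_re (integrable_eval_mul P (F : ExpPoly S)
      (hP.integrable_genSum (G : ExpPoly S)))
  have h2 : ∫ ω, (gammaSum P (F : ExpPoly S) (G : ExpPoly S) ω).re ∂P =
      (∫ ω, gammaSum P (F : ExpPoly S) (G : ExpPoly S) ω ∂P).re :=
    integral_complex_re (hP.integrable_gammaSum _ _)
  rw [h2, ← h, ← h1]
  refine integral_congr_ae ?_
  filter_upwards [hP.coeFn_evalReal F, hP.im_eval_eq_zero F] with ω h1 h2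
  rw [h1, Complex.mul_re, h2, zero_mul, sub_zero]

/-- Approximate `u` by complex exponential sums and take real parts, which are again exponential
sums and are no farther from a real function. -/
theorem exists_evalReal_near (u : Lp ℝ 2 P) (r : ℝ) (hr : 0 < r) :
    ∃ F, ∃ h : hP.evalReal S F ∈ Lp ℝ 2 P, ‖u - ⟨hP.evalReal S F, h⟩‖ < r := by
  obtain ⟨v, hv, hvr⟩ := Metric.mem_closure_iff.1
    (hP.dense_preDomain (S := S) (Complex.ofRealCLM.compLp u)) r hr
  rw [SetLike.mem_coe, ← range_evalL2] at hv
  obtain ⟨F, rfl⟩ := hv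
  have h2 : MemLp (fun ω => (eval P F ω).re) 2 P := (memLp_eval P F).re
  have e : hP.evalReal S (re F) =ᵐ[P] fun ω => (eval P F ω).re := by
    filter_upwards [hP.coeFn_evalReal (re F), hP.eval_conjHom F] with ω h1 h2
    rw [h1]
    change (eval P ((1 / 2 : ℝ) • (F + conjHom F)) ω).re = _
    rw [← Complex.coe_smul, map_smul, map_add, Pi.smul_apply, Pi.add_apply, h2]
    simp
    ring
  have hm : hP.evalReal S (re F) ∈ Lp ℝ 2 P := Lp.mem_Lp_iff_memLp.2 (h2.ae_eq e.symm)
  refine ⟨re F, hm, lt_of_le_of_lt ?_ hvr⟩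
  rw [dist_eq_norm]
  refine Lp.norm_le_norm_of_ae_le ?_
  filter_upwards [e, Lp.coeFn_sub u ⟨hP.evalReal S (re F), hm⟩,
    Lp.coeFn_sub (Complex.ofRealCLM.compLp u) (evalL2 P F), coeFn_evalL2 P F,
    Complex.ofRealCLM.coeFn_compLp u] with ω h1 h2 h3 h4 h5
  rw [h2, h3, Pi.sub_apply, Pi.sub_apply, h4, h5]
  change ‖u ω - hP.evalReal S (re F) ω‖ ≤ _
  rw [h1]
  refine le_trans (le_of_eq ?_) (Complex.abs_re_le_norm _)
  simp

variable (S) in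
/-- The real exponential sums as a diffusion algebra. -/
def diffusionAlgebra : DiffusionAlgebra P (realSums S) where
  ev := hP.evalReal S
  bdd F := by
    obtain ⟨C, hC⟩ := exists_norm_eval_le P (F : ExpPoly S)
    refine ⟨C, (hP.coeFn_evalReal F).mono fun ω h => ?_⟩
    rw [h]
    exact (Complex.abs_re_le_norm _).trans (hC ω)
  gam := hP.gammaReal S
  gam_symm F G := by
    apply Lp.ext
    filter_upwards [hP.coeFn_gammaReal F G, hP.coeFn_gammaReal G F] with ω h1 h2
    rw [h1, h2, gammaSum_symm]
  gam_nonneg F := by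
    filter_upwards [hP.coeFn_gammaReal F F, hP.gammaSum_conjHom_nonneg (F : ExpPoly S)]
      with ω h1 h2
    rw [conjHom_coe] at h2
    rw [h1]; exact h2
  gam_mul F G H := by
    filter_upwards [hP.coeFn_gammaReal (F * G) H, hP.coeFn_gammaReal G H, hP.coeFn_gammaReal F H,
      hP.coeFn_evalReal F, hP.coeFn_evalReal G, hP.im_eval_eq_zero F, hP.im_eval_eq_zero G,
      hP.gammaSum_mul (F : ExpPoly S) G H] with ω h1 h2 h3 h4 h5 h6 h7 h8
    rw [h1, h2, h3, h4, h5, Subalgebra.coe_mul, h8, Complex.add_re, Complex.mul_re, Complex.mul_re,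
      h6, h7]
    ring
  gen F ω := (genSum P (F : ExpPoly S) ω).re
  gen_integrable F := (hP.integrable_genSum (F : ExpPoly S)).re
  ibp F G := hP.integral_eval_mul_genSum_re F G
  dense u r hr := hP.exists_evalReal_near u r hr

end IsPoissonLaw

end PoissonDirichlet
end

/-! ### A criterion for self-adjointness -/

noncomputable section

namespace PoissonDirichlet

/-- A symmetric nonpositive operator `A` such that `1 - A` is onto is self-adjoint. -/
theorem isSelfAdjoint_of_surjective_one_sub {H : Type*} [NormedAddCommGroup H]
    [InnerProductSpace ℂ H] [CompleteSpace H] {A : H →ₗ.[ℂ] H} (hs : A.IsFormalAdjoint A)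
    (hn : ∀ x : A.domain, (inner ℂ (x : H) (A x)).re ≤ 0)
    (ho : ∀ w, ∃ x : A.domain, (x : H) - A x = w) : IsSelfAdjoint A := by
  -- Density is not assumed: a vector orthogonal to the domain is x - A x for some x, and pairing it
  -- with x gives ‖x‖² = Re ⟨x, A x⟩ ≤ 0.
  have hd : Dense (A.domain : Set H) := by
    rw [Submodule.dense_iff_topologicalClosure_eq_top, Submodule.topologicalClosure_eq_top_iff,
      Submodule.eq_bot_iff]
    intro v hv
    obtain ⟨x, rfl⟩ := ho v
    have h1 := congrArg Complex.re ((Submodule.mem_orthogonal _ _).1 hv x x.2)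
    rw [inner_sub_right, Complex.sub_re, Complex.zero_re] at h1
    have h2 := hn x
    have h3 : ‖(x : H)‖ ^ 2 = (inner ℂ (x : H) (x : H)).re := norm_sq_eq_re_inner (𝕜 := ℂ) _
    have h4 : (x : H) = 0 := by
      rw [← norm_eq_zero, ← sq_eq_zero_iff]
      nlinarith [sq_nonneg ‖(x : H)‖]
    have h5 : x = 0 := Subtype.ext h4
    rw [h5]; simp
  rw [LinearPMap.isSelfAdjoint_def]
  have hle : A ≤ A.adjoint := hs.le_adjoint hd
  -- For y in the domain of the adjoint, choose x with (1 - A) x = (1 - A*) y. Then y - x is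
  -- orthogonal to the range of 1 - A, which is everything.
  have hdom : A.adjoint.domain ≤ A.domain := by
    intro y hy
    obtain ⟨x, hx⟩ := ho (y - A.adjoint ⟨y, hy⟩)
    obtain ⟨z, hz⟩ := ho (y - x)
    have h1 := LinearPMap.adjoint_isFormalAdjoint hd ⟨y, hy⟩ z
    have h2 := hs x z
    have h3 : inner ℂ (y - (x : H)) (y - (x : H)) = (0 : ℂ) := by
      nth_rw 2 [← hz]
      rw [inner_sub_right, inner_sub_left, inner_sub_left, ← h1, ← h2]
      rw [← inner_sub_left, ← inner_sub_left, ← inner_sub_left]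
      have e : y - (x : H) - (A.adjoint ⟨y, hy⟩ - A x) = 0 := by
        rw [sub_sub_sub_comm, ← hx]; simp
      rw [e, inner_zero_left]
    rw [inner_self_eq_zero, sub_eq_zero] at h3
    rw [h3]; exact x.2
  exact (LinearPMap.eq_of_le_of_domain_eq hle (le_antisymm hle.1 hdom)).symm

namespace DirichletForm

variable {Y : Type*} [MeasurableSpace Y] {μ : Measure Y}

/-! ### The generator of the hermitian extension -/

theorem coeFn_rePart (F : Lp ℂ 2 μ) : rePart F =ᵐ[μ] fun y => (F y).re :=
  Complex.reCLM.coeFn_compLp F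

theorem coeFn_imPart (F : Lp ℂ 2 μ) : imPart F =ᵐ[μ] fun y => (F y).im :=
  Complex.imCLM.coeFn_compLp F

theorem rePart_add (F G : Lp ℂ 2 μ) : rePart (F + G) = rePart F + rePart G :=
  (Complex.reCLM.compLpₗ (p := 2) (μ := μ)).map_add F G

theorem imPart_add (F G : Lp ℂ 2 μ) : imPart (F + G) = imPart F + imPart G :=
  (Complex.imCLM.compLpₗ (p := 2) (μ := μ)).map_add F G

theorem rePart_sub (F G : Lp ℂ 2 μ) : rePart (F - G) = rePart F - rePart G :=
  (Complex.reCLM.compLpₗ (p := 2) (μ := μ)).map_sub F G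

theorem imPart_sub (F G : Lp ℂ 2 μ) : imPart (F - G) = imPart F - imPart G :=
  (Complex.imCLM.compLpₗ (p := 2) (μ := μ)).map_sub F G

theorem ext_parts {F G : Lp ℂ 2 μ} (h1 : rePart F = rePart G) (h2 : imPart F = imPart G) :
    F = G := by
  apply Lp.ext
  filter_upwards [coeFn_rePart F, coeFn_rePart G, coeFn_imPart F, coeFn_imPart G]
    with y a b c d
  rw [h1] at a
  rw [h2] at c
  exact Complex.ext (a.symm.trans b) (c.symm.trans d)

/-- A real function as a complex function. -/
def toComplex (u : Lp ℝ 2 μ) : Lp ℂ 2 μ := Complex.ofRealCLM.compLp u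

theorem coeFn_toComplex (u : Lp ℝ 2 μ) : toComplex u =ᵐ[μ] fun y => (u y : ℂ) :=
  Complex.ofRealCLM.coeFn_compLp u

theorem rePart_toComplex (u : Lp ℝ 2 μ) : rePart (toComplex u) = u := by
  apply Lp.ext
  filter_upwards [coeFn_rePart (toComplex u), coeFn_toComplex u] with y h1 h2
  rw [h1, h2, Complex.ofReal_re]

theorem imPart_toComplex (u : Lp ℝ 2 μ) : imPart (toComplex u) = 0 := by
  apply Lp.ext
  filter_upwards [coeFn_imPart (toComplex u), coeFn_toComplex u, Lp.coeFn_zero ℝ 2 μ]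
    with y h1 h2 h3
  rw [h1, h2, h3, Complex.ofReal_im, Pi.zero_apply]

/-- The complex function with given real and imaginary parts. -/
def ofParts (u v : Lp ℝ 2 μ) : Lp ℂ 2 μ := toComplex u + Complex.I • toComplex v

@[simp]
theorem rePart_ofParts (u v : Lp ℝ 2 μ) : rePart (ofParts u v) = u := by
  rw [ofParts, rePart_add, rePart_smul, rePart_toComplex, imPart_toComplex]
  simp

@[simp]
theorem imPart_ofParts (u v : Lp ℝ 2 μ) : imPart (ofParts u v) = v := by
  rw [ofParts, imPart_add, imPart_smul, rePart_toComplex, imPart_toComplex, imPart_toComplex]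
  simp

theorem norm_sq_eq_parts (F : Lp ℂ 2 μ) : ‖F‖ ^ 2 = ‖rePart F‖ ^ 2 + ‖imPart F‖ ^ 2 := by
  have h : ∀ u : Lp ℝ 2 μ, Integrable (fun y => u y ^ 2) μ := fun u => (Lp.memLp u).integrable_sq
  simp only [L2_norm_sq, Real.norm_eq_abs, sq_abs]
  rw [← integral_add (h _) (h _)]
  refine integral_congr_ae ?_
  filter_upwards [coeFn_rePart F, coeFn_imPart F] with y a b
  rw [a, b, Complex.sq_norm, Complex.normSq_apply]; ring

theorem integral_mul_conj (H G : Lp ℂ 2 μ) :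
    ∫ y, H y * conj (G y) ∂μ =
      ((inner ℝ (rePart H) (rePart G) + inner ℝ (imPart H) (imPart G) : ℝ) : ℂ) +
      Complex.I *
        ((inner ℝ (imPart H) (rePart G) - inner ℝ (rePart H) (imPart G) : ℝ) : ℂ) := by
  have hi := fun u v : Lp ℝ 2 μ => L2.integrable_inner (𝕜 := ℝ) u v
  simp only [L2.inner_def]
  rw [← integral_add (hi _ _) (hi _ _), ← integral_sub (hi _ _) (hi _ _),
    ← integral_complex_ofReal, ← integral_complex_ofReal, ← integral_const_mul,
    ← integral_add ((hi _ _).add (hi _ _)).ofReal (((hi _ _).sub (hi _ _)).ofReal.const_mul _)]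
  refine integral_congr_ae ?_
  filter_upwards [coeFn_rePart H, coeFn_rePart G, coeFn_imPart H, coeFn_imPart G] with y a b c d
  rw [a, b, c, d]
  apply Complex.ext <;> simp <;> ring

theorem integral_mul_conj_eq_inner (H G : Lp ℂ 2 μ) :
    ∫ y, H y * conj (G y) ∂μ = inner ℂ G H := by
  rw [L2.inner_def]; rfl

variable (E : DirichletForm μ)

theorem cform_eq {F G : E.cdom} {u v u' v' : E.dom} (h1 : rePart (F : Lp ℂ 2 μ) = u)
    (h2 : imPart (F : Lp ℂ 2 μ) = v) (h3 : rePart (G : Lp ℂ 2 μ) = u')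
    (h4 : imPart (G : Lp ℂ 2 μ) = v') :
    E.cform F G = ((E.form u u' + E.form v v' : ℝ) : ℂ) +
      Complex.I * ((E.form v u' - E.form u v' : ℝ) : ℂ) := by
  have e1 : (⟨_, F.2.1⟩ : E.dom) = u := Subtype.ext h1
  have e2 : (⟨_, F.2.2⟩ : E.dom) = v := Subtype.ext h2
  have e3 : (⟨_, G.2.1⟩ : E.dom) = u' := Subtype.ext h3
  have e4 : (⟨_, G.2.2⟩ : E.dom) = v' := Subtype.ext h4
  rw [cform, e1, e2, e3, e4]

/-- The graph of the generator of the hermitian extension. -/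
def cgeneratorGraph : Submodule ℂ (Lp ℂ 2 μ × Lp ℂ 2 μ) where
  carrier := {z | (rePart z.1, rePart z.2) ∈ E.generatorGraph ∧
    (imPart z.1, imPart z.2) ∈ E.generatorGraph}
  add_mem' := by
    rintro z w ⟨h1, h2⟩ ⟨h3, h4⟩
    simp only [Set.mem_ofPred_eq, Prod.fst_add, Prod.snd_add, rePart_add, imPart_add]
    exact ⟨add_mem h1 h3, add_mem h2 h4⟩
  zero_mem' := by
    have e : rePart (0 : Lp ℂ 2 μ) = 0 := (Complex.reCLM.compLpₗ (p := 2) (μ := μ)).map_zero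
    have e' : imPart (0 : Lp ℂ 2 μ) = 0 := (Complex.imCLM.compLpₗ (p := 2) (μ := μ)).map_zero
    simp only [Set.mem_ofPred_eq, Prod.fst_zero, Prod.snd_zero, e, e']
    exact ⟨zero_mem _, zero_mem _⟩
  smul_mem' := by
    rintro c z ⟨h1, h2⟩
    simp only [Set.mem_ofPred_eq, Prod.smul_fst, Prod.smul_snd, rePart_smul, imPart_smul]
    exact ⟨sub_mem (E.generatorGraph.smul_mem c.re h1) (E.generatorGraph.smul_mem c.im h2),
      add_mem (E.generatorGraph.smul_mem c.re h2) (E.generatorGraph.smul_mem c.im h1)⟩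

/-- The generator of the hermitian extension. -/
def cgenerator : Lp ℂ 2 μ →ₗ.[ℂ] Lp ℂ 2 μ := E.cgeneratorGraph.toLinearPMap

theorem graph_cgenerator : E.cgenerator.graph = E.cgeneratorGraph := by
  refine Submodule.toLinearPMap_graph_eq _ ?_
  rintro ⟨F, H⟩ ⟨h1, h2⟩ (rfl : F = 0)
  have e : rePart (0 : Lp ℂ 2 μ) = 0 := (Complex.reCLM.compLpₗ (p := 2) (μ := μ)).map_zero
  have e' : imPart (0 : Lp ℂ 2 μ) = 0 := (Complex.imCLM.compLpₗ (p := 2) (μ := μ)).map_zero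
  rw [← graph_generator] at h1 h2
  simp only [e, e'] at h1 h2
  refine ext_parts ?_ ?_
  · rw [e]; exact LinearPMap.graph_fst_eq_zero_snd _ h1 rfl
  · rw [e']; exact LinearPMap.graph_fst_eq_zero_snd _ h2 rfl

theorem isComplexGenerator_cgenerator : E.IsComplexGenerator E.cgenerator := by
  intro F H
  rw [graph_cgenerator]
  constructor
  · rintro ⟨⟨h1, H1⟩, ⟨h2, H2⟩⟩
    refine ⟨⟨h1, h2⟩, fun G => ?_⟩
    rw [integral_mul_conj, cform, H1, H1, H2, H2]
    push_cast
    ring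
  · rintro ⟨hF, h⟩
    -- Real test functions already separate the complex equation into its real and imaginary parts.
    have key : ∀ v : E.dom, E.form ⟨_, hF.1⟩ v = -inner ℝ (rePart H) (v : Lp ℝ 2 μ) ∧
        E.form ⟨_, hF.2⟩ v = -inner ℝ (imPart H) (v : Lp ℝ 2 μ) := by
      intro v
      have hv : toComplex (v : Lp ℝ 2 μ) ∈ E.cdom :=
        ⟨by rw [rePart_toComplex]; exact v.2, by rw [imPart_toComplex]; exact zero_mem _⟩
      have h0 := h ⟨_, hv⟩
      rw [E.cform_eq (u := ⟨_, hF.1⟩) (v := ⟨_, hF.2⟩) (u' := v) (v' := 0) rfl rfl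
        (rePart_toComplex _) (imPart_toComplex _), integral_mul_conj] at h0
      rw [rePart_toComplex, imPart_toComplex] at h0
      simp only [map_zero, add_zero, sub_zero, inner_zero_right] at h0
      have a := congrArg Complex.re h0
      have b := congrArg Complex.im h0
      simp at a b
      exact ⟨a, b⟩
    exact ⟨⟨hF.1, fun v => (key v).1⟩, ⟨hF.2, fun v => (key v).2⟩⟩

theorem isSelfAdjoint_cgenerator : IsSelfAdjoint E.cgenerator := by
  have hg : ∀ F : E.cgenerator.domain, ∃ hF : (F : Lp ℂ 2 μ) ∈ E.cdom, ∀ G : E.cdom,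
      inner ℂ (G : Lp ℂ 2 μ) (E.cgenerator F) = -E.cform ⟨F, hF⟩ G := fun F => by
    obtain ⟨hF, h⟩ := (E.isComplexGenerator_cgenerator F (E.cgenerator F)).1
      (LinearPMap.mem_graph _ F)
    refine ⟨hF, fun G => ?_⟩
    rw [h G, neg_neg, integral_mul_conj_eq_inner]
  refine isSelfAdjoint_of_surjective_one_sub ?_ ?_ ?_
  · intro F G
    obtain ⟨hF, h⟩ := hg F
    obtain ⟨hG, h'⟩ := hg G
    rw [← inner_conj_symm, h ⟨G, hG⟩, h' ⟨F, hF⟩, cform, cform]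
    simp only [map_neg, map_add, map_mul, Complex.conj_ofReal, Complex.conj_I]
    rw [E.symm ⟨rePart (G : Lp ℂ 2 μ), _⟩, E.symm ⟨imPart (G : Lp ℂ 2 μ), _⟩,
      E.symm ⟨imPart (G : Lp ℂ 2 μ), _⟩,
      E.symm ⟨rePart (G : Lp ℂ 2 μ), _⟩ ⟨imPart (F : Lp ℂ 2 μ), _⟩]
    push_cast
    ring
  · intro F
    obtain ⟨hF, h⟩ := hg F
    rw [h ⟨F, hF⟩, cform]
    have h1 := E.nonneg ⟨_, hF.1⟩
    have h2 := E.nonneg ⟨_, hF.2⟩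
    simp
    linarith
  · intro W
    -- The real resolvent solves u - a[u] = w; applied to the two parts of `W` it inverts 1 - A.
    have hr : ∀ w : Lp ℝ 2 μ, ((E.res w : Lp ℝ 2 μ), (E.res w : Lp ℝ 2 μ) - w) ∈
        E.generatorGraph := fun w => ⟨(E.res w).2, fun v => by
      rw [inner_sub_left, neg_sub]; exact E.form_res w v⟩
    have hm : (ofParts (E.res (rePart W) : Lp ℝ 2 μ) (E.res (imPart W) : Lp ℝ 2 μ),
        ofParts (E.res (rePart W) : Lp ℝ 2 μ) (E.res (imPart W) : Lp ℝ 2 μ) - W) ∈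
        E.cgenerator.graph := by
      rw [graph_cgenerator]
      refine ⟨?_, ?_⟩
      · simp only [rePart_sub, rePart_ofParts]; exact hr _
      · simp only [imPart_sub, imPart_ofParts]; exact hr _
    obtain ⟨x, hx1, hx2⟩ := (LinearPMap.mem_graph_iff _).1 hm
    refine ⟨x, ?_⟩
    simp only at hx1 hx2
    rw [hx2, hx1, sub_sub_cancel]

end DirichletForm

end PoissonDirichlet
end

noncomputable section

namespace PoissonDirichlet

variable {X : Type*} [MeasurableSpace X] {ν : Measure X}

namespace ExpPoly

open AddMonoidAlgebra

variable {S : LocalDirichletStructure ν} (P : Measure (Configuration X))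

/-- The formal sum `∑ λ_p e^{iÑ(f_p)}`. -/
def ofSum {m : ℕ} (lam : Fin m → ℂ) (f : Fin m → S.testDomain) : ExpPoly S :=
  ∑ p, single (f p) (lam p)

variable {m : ℕ} (lam : Fin m → ℂ) (f : Fin m → S.testDomain)

theorem eval_ofSum : eval P (ofSum lam f) = expSum S P lam f := by
  ext ω
  simp only [ofSum, map_sum, Finset.sum_apply, eval_single, expSum]

theorem genSum_ofSum : genSum P (ofSum lam f) = A0Sum S P lam f := by
  ext ω
  simp only [ofSum, map_sum, Finset.sum_apply, genSum_single, A0Sum, mul_assoc]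

theorem eq_evalL2_ofSum [IsFiniteMeasure P] {F : Lp ℂ 2 P} (h : F =ᵐ[P] expSum S P lam f) :
    F = evalL2 P (ofSum lam f) :=
  Lp.ext (h.trans ((eval_ofSum P lam f).symm ▸ (coeFn_evalL2 P _).symm))

theorem exists_eq_evalL2 [IsFiniteMeasure P] (F : preDomain S P) :
    ∃ G : ExpPoly S, (F : Lp ℂ 2 P) = evalL2 P G := by
  obtain ⟨F, hF⟩ := F
  rw [← range_evalL2] at hF
  obtain ⟨G, hG⟩ := hF
  exact ⟨G, hG.symm⟩

theorem evalL2_mem [IsFiniteMeasure P] (F : ExpPoly S) : evalL2 P F ∈ preDomain S P := by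
  rw [← range_evalL2]; exact ⟨F, rfl⟩

end ExpPoly

namespace IsPoissonLaw

open AddMonoidAlgebra ExpPoly

variable {P : Measure (Configuration X)} [SigmaFinite ν] [IsProbabilityMeasure P]
  (hP : IsPoissonLaw ν P) {S : LocalDirichletStructure ν}

include hP

/-! ### The operator `A₀` -/

theorem integral_genSum_mul_conj_eval (F G : ExpPoly S) :
    ∫ ω, genSum P F ω * conj (eval P G ω) ∂P =
      -(1 / 2) * ∫ ω, gammaSum P F (conjHom G) ω ∂P := by
  rw [gammaSum_symm, ← hP.integral_eval_mul_genSum]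
  refine integral_congr_ae ?_
  filter_upwards [hP.eval_conjHom G] with ω h
  rw [h, mul_comm]

theorem integrable_genSum_mul_conj_eval (F G : ExpPoly S) :
    Integrable (fun ω => genSum P F ω * conj (eval P G ω)) P := by
  refine (integrable_eval_mul P (conjHom G) (hP.integrable_genSum F)).congr ?_
  filter_upwards [hP.eval_conjHom G] with ω h
  rw [h, mul_comm]

theorem integral_genSum_mul_conj_comm (F G : ExpPoly S) :
    ∫ ω, genSum P F ω * conj (eval P G ω) ∂P = ∫ ω, eval P F ω * conj (genSum P G ω) ∂P := by
  rw [hP.integral_genSum_mul_conj_eval, ← hP.integral_eval_mul_genSum]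
  refine integral_congr_ae ?_
  filter_upwards [hP.genSum_conjHom G] with ω h
  rw [h]

/-- Random variables in `L¹(P)` are separated by formal exponential sums. -/
theorem ae_eq_zero_of_forall_eval {k : Configuration X → ℂ} (hk : Integrable k P)
    (h : ∀ F : ExpPoly S, ∫ ω, k ω * conj (eval P F ω) ∂P = 0) : k =ᵐ[P] 0 := by
  refine hP.ae_eq_zero S.dense_testDomain hk fun f hf => ?_
  rw [← h (single (-⟨f, hf⟩) 1)]
  refine integral_congr_ae ?_
  filter_upwards [hP.conj_expN (-f)] with ω h1
  rw [neg_neg] at h1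
  rw [eval_single, one_mul, ← h1]
  rfl

/-- By symmetry the pairing of A₀[F] with any exponential sum G is that of F with A₀[G], which is
zero. Separation of L¹(P) then gives independence of the representation. -/
theorem genSum_ae_eq_zero {F : ExpPoly S} (hF : eval P F =ᵐ[P] 0) : genSum P F =ᵐ[P] 0 := by
  refine hP.ae_eq_zero_of_forall_eval (S := S) (hP.integrable_genSum F) fun G => ?_
  rw [hP.integral_genSum_mul_conj_comm]
  refine integral_eq_zero_of_ae ?_
  filter_upwards [hF] with ω h
  simp [h]

variable (S) in
/-- The operator `A₀` on formal exponential sums. -/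
def genL1 : ExpPoly S →ₗ[ℂ] Lp ℂ 1 P where
  toFun F := (hP.integrable_genSum F).toL1 _
  map_add' F G := by
    apply Lp.ext
    filter_upwards [(hP.integrable_genSum (F + G)).coeFn_toL1, (hP.integrable_genSum F).coeFn_toL1,
      (hP.integrable_genSum G).coeFn_toL1, Lp.coeFn_add ((hP.integrable_genSum F).toL1 _)
        ((hP.integrable_genSum G).toL1 _)] with ω h1 h2 h3 h4
    rw [h1, h4, Pi.add_apply, h2, h3, map_add, Pi.add_apply]
  map_smul' c F := by
    apply Lp.ext
    filter_upwards [(hP.integrable_genSum (c • F)).coeFn_toL1, (hP.integrable_genSum F).coeFn_toL1,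
      Lp.coeFn_smul c ((hP.integrable_genSum F).toL1 _)] with ω h1 h2 h3
    rw [h1, RingHom.id_apply, h3, Pi.smul_apply, h2, map_smul, Pi.smul_apply]

theorem coeFn_genL1 (F : ExpPoly S) : hP.genL1 S F =ᵐ[P] genSum P F :=
  (hP.integrable_genSum F).coeFn_toL1

theorem exists_preGenerator : ∃ A₀ : preDomain S P →ₗ[ℂ] Lp ℂ 1 P,
    ∀ (F : preDomain S P) (G : ExpPoly S), (F : Lp ℂ 2 P) = evalL2 P G → A₀ F =ᵐ[P] genSum P G := by
  -- A linear choice of representations makes A₀ linear at once; that any other representation gives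
  -- the same value is `genSum_ae_eq_zero`.
  obtain ⟨s, hs⟩ := LinearMap.exists_rightInverse_of_surjective
    ((evalL2 P : ExpPoly S →ₗ[ℂ] Lp ℂ 2 P).codRestrict (preDomain S P) (evalL2_mem P))
    (LinearMap.range_eq_top.2 fun F => by
      obtain ⟨G, hG⟩ := exists_eq_evalL2 P F
      exact ⟨G, Subtype.ext hG.symm⟩)
  refine ⟨hP.genL1 S ∘ₗ s, fun F G h => ?_⟩
  have h1 : evalL2 P (s F) = F := congrArg Subtype.val (LinearMap.congr_fun hs F)
  have h2 : eval P (s F - G) =ᵐ[P] 0 := by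
    filter_upwards [coeFn_evalL2 P (s F - G), Lp.coeFn_zero ℂ 2 P] with ω a b
    rw [← a, map_sub, h1, h, sub_self, b]
  filter_upwards [hP.genSum_ae_eq_zero h2, hP.coeFn_genL1 (s F)] with ω a b
  rw [map_sub, Pi.sub_apply, Pi.zero_apply, sub_eq_zero] at a
  rw [LinearMap.comp_apply, b, a]

/-- The integrand of the integration by parts formula. -/
theorem gammaSum_ofSum {m n : ℕ} (lam : Fin m → ℂ) (f : Fin m → S.testDomain) (mu : Fin n → ℂ)
    (g : Fin n → S.testDomain) :
    gammaSum P (ofSum lam f) (conjHom (ofSum mu g)) =ᵐ[P] fun ω => ∑ p, ∑ q,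
      expSumDeriv S P lam f p ω * conj (expSumDeriv S P mu g q ω) *
        (N (S.gamma (S.toDom (f p)) (S.toDom (g q))) ω : ℂ) := by
  filter_upwards [ae_all_iff.2 fun q => hP.conj_expN (g q : Lp ℝ 2 ν),
    ae_all_iff.2 fun p => ae_all_iff.2 fun q =>
      hP.N_gamma_smul_left (-1) (S.toDom (g q)) (S.toDom (f p))] with ω h1 h2
  simp only [ofSum, map_sum, LinearMap.sum_apply, Finset.sum_apply]
  rw [Finset.sum_comm]
  refine Finset.sum_congr rfl fun p _ => Finset.sum_congr rfl fun q _ => ?_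
  have e : S.toDom (-g q) = (-1 : ℝ) • S.toDom (g q) := by rw [neg_one_smul]; rfl
  rw [conjHom_single, gammaSum_single, e, S.gamma_symm _ ((-1 : ℝ) • _), h2 p q, S.gamma_symm,
    expSumDeriv, expSumDeriv, map_mul, h1 q, map_mul, Complex.conj_I, Submodule.coe_neg]
  push_cast
  linear_combination (lam p * expN P (f p : Lp ℝ 2 ν) ω * conj (mu q) *
    expN P (-(g q : Lp ℝ 2 ν)) ω * (N (S.gamma (S.toDom (f p)) (S.toDom (g q))) ω : ℂ)) *
      Complex.I_mul_I

/-- Symmetry makes the pairing equal to its own conjugate; integration by parts makes it -½ times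
the expectation of a variable with nonnegative real part. -/
theorem integral_genSum_mul_conj_self_nonpos (F : ExpPoly S) :
    (∫ ω, genSum P F ω * conj (eval P F ω) ∂P).im = 0 ∧
      (∫ ω, genSum P F ω * conj (eval P F ω) ∂P).re ≤ 0 := by
  constructor
  · rw [← Complex.conj_eq_iff_im, ← integral_conj]
    rw [hP.integral_genSum_mul_conj_comm]
    refine integral_congr_ae (ae_of_all _ fun ω => ?_)
    simp [mul_comm]
  · rw [hP.integral_genSum_mul_conj_eval]
    have h : 0 ≤ (∫ ω, gammaSum P F (conjHom F) ω ∂P).re := by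
      rw [← integral_complex_re (hP.integrable_gammaSum _ _)]
      exact integral_nonneg_of_ae (hP.gammaSum_conjHom_nonneg F)
    have e : (-(1 / 2) * ∫ ω, gammaSum P F (conjHom F) ω ∂P).re =
      -(1 / 2) * (∫ ω, gammaSum P F (conjHom F) ω ∂P).re := by simp [Complex.mul_re]
    rw [e]; linarith

/-- `A₀` takes values in `L²` on the exponentials of functions with `γ[f] ∈ L²`. -/
theorem memLp_A0Sum {m : ℕ} (lam : Fin m → ℂ) (f : Fin m → S.testDomain)
    (h : ∀ p, MemLp (S.gamma (S.toDom (f p)) (S.toDom (f p))) 2 ν) :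
    MemLp (A0Sum S P lam f) 2 P := by
  refine memLp_finsetSum _ fun p _ => ?_
  have h1 : MemLp (fun ω => Complex.I * (Ntilde P (S.gen (f p)) ω : ℂ) -
      1 / 2 * (N (S.gamma (S.toDom (f p)) (S.toDom (f p))) ω : ℂ)) 2 P :=
    ((Lp.memLp (Ntilde P (S.gen (f p)))).ofReal.const_mul _).sub
      ((hP.memLp_N (integrable_coeFn_L1 _) (h p)).ofReal.const_mul _)
  refine MemLp.of_le_mul (c := ‖lam p‖) h1
    (((memLp_expN P _).1.const_mul _).mul h1.1) (ae_of_all _ fun ω => ?_)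
  rw [norm_mul, norm_mul, norm_expN, mul_one]

end IsPoissonLaw

end PoissonDirichlet
end

noncomputable section

namespace PoissonDirichlet

theorem DiffusionAlgebra.exists_form_lt {Y : Type*} [MeasurableSpace Y] {μ : Measure Y}
    [IsFiniteMeasure μ] {R : Type*} [CommRing R] [Algebra ℝ R] (D : DiffusionAlgebra μ R)
    (u : D.dom) {r : ℝ} (hr : 0 < r) :
    ∃ F : R, ‖((u - D.toDom F : D.dom) : Lp ℝ 2 μ)‖ ^ 2 +
      D.localDirichletStructure.form (u - D.toDom F) (u - D.toDom F) < r := by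
  obtain ⟨F, hF⟩ := D.exists_energy_lt u hr
  refine ⟨F, lt_of_le_of_lt (add_le_add le_rfl ?_) hF⟩
  have h := D.cenergy_nonneg (u - D.toDom F)
  change 1 / 2 * D.cenergy (u - D.toDom F) _ ≤ _
  linarith

variable {X : Type*} [MeasurableSpace X] {ν : Measure X}

namespace IsPoissonLaw

open AddMonoidAlgebra ExpPoly DirichletForm

variable {P : Measure (Configuration X)} [SigmaFinite ν] [IsProbabilityMeasure P]
  (hP : IsPoissonLaw ν P) {S : LocalDirichletStructure ν}

include hP

/-! ### The local Dirichlet structure on the Poisson space -/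

variable (S) in
/-- The local Dirichlet structure on the Poisson space. -/
def poissonStructure : LocalDirichletStructure P := (hP.diffusionAlgebra S).localDirichletStructure

variable (S) in
/-- A real formal exponential sum, seen in the domain of the structure on the Poisson space. -/
def realToDom : realSums S →ₗ[ℝ] (hP.poissonStructure S).dom := (hP.diffusionAlgebra S).toDom

theorem coeFn_realToDom (F : realSums S) :
    (hP.realToDom S F : Lp ℝ 2 P) =ᵐ[P] fun ω => (eval P (F : ExpPoly S) ω).re :=
  hP.coeFn_evalReal F

theorem gamma_realToDom (F G : realSums S) :
    (hP.poissonStructure S).gamma (hP.realToDom S F) (hP.realToDom S G) =ᵐ[P]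
      fun ω => (gammaSum P (F : ExpPoly S) (G : ExpPoly S) ω).re :=
  ((hP.diffusionAlgebra S).gamma_toDom F G).symm ▸ hP.coeFn_gammaReal F G

theorem form_realToDom (F G : realSums S) :
    (((hP.poissonStructure S).form (hP.realToDom S F) (hP.realToDom S G) : ℝ) : ℂ) =
      1 / 2 * ∫ ω, gammaSum P (F : ExpPoly S) (G : ExpPoly S) ω ∂P := by
  rw [(hP.poissonStructure S).form_eq_integral_gamma,
    integral_congr_ae (hP.gamma_realToDom F G), Complex.ofReal_mul, ← integral_complex_ofReal]
  push_cast
  congr 1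
  refine integral_congr_ae ?_
  filter_upwards [hP.im_gammaSum_eq_zero F G] with ω h
  apply Complex.ext <;> simp [h]

theorem evalL2_eq_ofParts (F G : realSums S) :
    evalL2 P ((F : ExpPoly S) + Complex.I • (G : ExpPoly S)) =
      ofParts (hP.realToDom S F : Lp ℝ 2 P) (hP.realToDom S G : Lp ℝ 2 P) := by
  have hre := fun ω => show eval P ((F : ExpPoly S) + Complex.I • (G : ExpPoly S)) ω =
      eval P (F : ExpPoly S) ω + Complex.I * eval P (G : ExpPoly S) ω by
    rw [map_add, map_smul]; rfl
  refine ext_parts ?_ ?_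
  · rw [rePart_ofParts]
    apply Lp.ext
    filter_upwards [coeFn_rePart (evalL2 P ((F : ExpPoly S) + Complex.I • (G : ExpPoly S))),
      coeFn_evalL2 P ((F : ExpPoly S) + Complex.I • (G : ExpPoly S)), hP.coeFn_realToDom F,
      hP.im_eval_eq_zero G] with ω h1 h2 h3 h4
    rw [h1, h2, h3, hre]
    simp [h4]
  · rw [imPart_ofParts]
    apply Lp.ext
    filter_upwards [coeFn_imPart (evalL2 P ((F : ExpPoly S) + Complex.I • (G : ExpPoly S))),
      coeFn_evalL2 P ((F : ExpPoly S) + Complex.I • (G : ExpPoly S)), hP.coeFn_realToDom G,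
      hP.im_eval_eq_zero F] with ω h1 h2 h3 h4
    rw [h1, h2, h3, hre]
    simp [h4]

theorem rePart_evalL2 (F : ExpPoly S) : rePart (evalL2 P F) = hP.realToDom S (re F) := by
  conv_lhs => rw [← re_add_I_smul_im F]
  rw [hP.evalL2_eq_ofParts, rePart_ofParts]

theorem imPart_evalL2 (F : ExpPoly S) : imPart (evalL2 P F) = hP.realToDom S (im F) := by
  conv_lhs => rw [← re_add_I_smul_im F]
  rw [hP.evalL2_eq_ofParts, imPart_ofParts]

theorem preDomain_le_cdom : preDomain S P ≤ (hP.poissonStructure S).cdom := by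
  intro F hF
  obtain ⟨G, hG⟩ := exists_eq_evalL2 P ⟨F, hF⟩
  simp only at hG
  rw [hG]
  exact ⟨hP.rePart_evalL2 G ▸ Subtype.property _, hP.imPart_evalL2 G ▸ Subtype.property _⟩

/-- Real and imaginary parts of an exponential sum are again exponential sums, so the hermitian
extension computed from parts reassembles into the sesquilinear `gammaSum`. -/
theorem cform_evalL2 (F G : ExpPoly S) (hF : evalL2 P F ∈ (hP.poissonStructure S).cdom)
    (hG : evalL2 P G ∈ (hP.poissonStructure S).cdom) :
    (hP.poissonStructure S).cform ⟨_, hF⟩ ⟨_, hG⟩ =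
      1 / 2 * ∫ ω, gammaSum P F (conjHom G) ω ∂P := by
  rw [(hP.poissonStructure S).cform_eq (hP.rePart_evalL2 F) (hP.imPart_evalL2 F)
    (hP.rePart_evalL2 G) (hP.imPart_evalL2 G)]
  push_cast
  rw [hP.form_realToDom, hP.form_realToDom, hP.form_realToDom, hP.form_realToDom]
  have e : ∀ ω, gammaSum P F (conjHom G) ω =
      gammaSum P (re F : ExpPoly S) (re G : ExpPoly S) ω +
      gammaSum P (im F : ExpPoly S) (im G : ExpPoly S) ω +
      Complex.I * (gammaSum P (im F : ExpPoly S) (re G : ExpPoly S) ω -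
        gammaSum P (re F : ExpPoly S) (im G : ExpPoly S) ω) := by
    intro ω
    conv_lhs => rw [← re_add_I_smul_im F, ← re_add_I_smul_im G]
    rw [map_add conjHom, conjHom_smul, conjHom_coe, conjHom_coe, Complex.conj_I]
    simp only [map_add, map_smul, LinearMap.add_apply, LinearMap.smul_apply, Pi.add_apply,
      Pi.smul_apply, smul_eq_mul, neg_smul, map_neg, Pi.neg_apply]
    linear_combination (-gammaSum P (im F : ExpPoly S) (im G : ExpPoly S) ω) * Complex.I_mul_I
  simp only [e]
  have hi := fun F G : realSums S => hP.integrable_gammaSum (F : ExpPoly S) (G : ExpPoly S)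
  have i1 : Integrable (fun ω => gammaSum P (re F : ExpPoly S) (re G : ExpPoly S) ω +
      gammaSum P (im F : ExpPoly S) (im G : ExpPoly S) ω) P := (hi _ _).add (hi _ _)
  have i2 : Integrable (fun ω => Complex.I * (gammaSum P (im F : ExpPoly S) (re G : ExpPoly S) ω -
      gammaSum P (re F : ExpPoly S) (im G : ExpPoly S) ω)) P :=
    ((hi _ _).sub (hi _ _)).const_mul _
  rw [integral_add i1 i2, integral_add (hi _ _) (hi _ _), integral_const_mul,
    integral_sub (hi _ _) (hi _ _)]
  ring

theorem exists_energy_lt (u : (hP.poissonStructure S).dom) {r : ℝ} (hr : 0 < r) :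
    ∃ F : realSums S, ‖((u - hP.realToDom S F : (hP.poissonStructure S).dom) : Lp ℝ 2 P)‖ ^ 2 +
      (hP.poissonStructure S).form (u - hP.realToDom S F) (u - hP.realToDom S F) < r :=
  (hP.diffusionAlgebra S).exists_form_lt u hr

theorem exists_cenergy_lt (F : (hP.poissonStructure S).cdom) {r : ℝ} (hr : 0 < r)
    (hD : preDomain S P ≤ (hP.poissonStructure S).cdom) :
    ∃ G : preDomain S P, ‖(F : Lp ℂ 2 P) - G‖ ^ 2 + ((hP.poissonStructure S).cform
      (F - ⟨G, hD G.2⟩) (F - ⟨G, hD G.2⟩)).re < r := by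
  obtain ⟨K, hK⟩ := hP.exists_energy_lt ⟨_, F.2.1⟩ (half_pos hr)
  obtain ⟨L, hL⟩ := hP.exists_energy_lt ⟨_, F.2.2⟩ (half_pos hr)
  refine ⟨⟨_, evalL2_mem P ((K : ExpPoly S) + Complex.I • (L : ExpPoly S))⟩, ?_⟩
  have e1 : rePart ((F : Lp ℂ 2 P) - evalL2 P ((K : ExpPoly S) + Complex.I • (L : ExpPoly S))) =
      ((⟨_, F.2.1⟩ - hP.realToDom S K : (hP.poissonStructure S).dom) : Lp ℝ 2 P) := by
    rw [rePart_sub, hP.evalL2_eq_ofParts, rePart_ofParts]; rfl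
  have e2 : imPart ((F : Lp ℂ 2 P) - evalL2 P ((K : ExpPoly S) + Complex.I • (L : ExpPoly S))) =
      ((⟨_, F.2.2⟩ - hP.realToDom S L : (hP.poissonStructure S).dom) : Lp ℝ 2 P) := by
    rw [imPart_sub, hP.evalL2_eq_ofParts, imPart_ofParts]; rfl
  rw [(hP.poissonStructure S).cform_eq e1 e2 e1 e2, norm_sq_eq_parts, e1, e2]
  simp only [Complex.add_re, Complex.ofReal_re, Complex.I_mul_re, Complex.ofReal_im]
  linarith

/-- A pair satisfying the weak equation of the generator against exponential sums belongs to the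
graph of the generator. -/
theorem mem_generatorGraph {u w : Lp ℝ 2 P} (hu : u ∈ (hP.poissonStructure S).dom)
    (h : ∀ F : realSums S, (hP.poissonStructure S).form ⟨u, hu⟩ (hP.realToDom S F) =
      -inner ℝ w (hP.realToDom S F : Lp ℝ 2 P)) :
    (u, w) ∈ (hP.poissonStructure S).generatorGraph := by
  refine ⟨hu, fun v => ?_⟩
  set D := hP.diffusionAlgebra S
  have ha := D.approx_seq v
  -- Both sides of the weak equation are continuous along an energy approximation of `v`, so testing
  -- on exponential sums is enough.
  have h1 : Tendsto (fun n => D.gamma ⟨u, hu⟩ (D.toDom (D.seq v n))) atTop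
      (𝓝 (D.gamma ⟨u, hu⟩ v)) :=
    tendsto_gamma D.gamma D.gamma_symm D.gamma_nonneg (u := fun _ => ⟨u, hu⟩) (by simp)
      ha.tendsto_cenergy_sub
  have h2 := (tendsto_integral_of_norm_sub (fun _ => integrable_coeFn_L1 _)
    (integrable_coeFn_L1 _) (tendsto_integral_norm_sub_of_L1 h1)).const_mul (1 / 2 : ℝ)
  have h3 : Tendsto (fun n => -inner ℝ w (D.toL2 (D.seq v n))) atTop (𝓝 (-inner ℝ w v)) :=
    (Filter.Tendsto.inner tendsto_const_nhds ha.tendsto).neg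
  exact tendsto_nhds_unique (h2.congr fun n => h (D.seq v n)) h3

end IsPoissonLaw

end PoissonDirichlet
end

noncomputable section

namespace PoissonDirichlet

theorem DiffusionAlgebra.exists_gamma_ae_eq {Y : Type*} [MeasurableSpace Y] {μ : Measure Y}
    [IsFiniteMeasure μ] {R : Type*} [CommRing R] [Algebra ℝ R] (D : DiffusionAlgebra μ R)
    {v : ℕ → D.dom} {v₀ : Lp ℝ 2 μ} {Z : Y → ℝ}
    (hv₀ : Tendsto (fun n => (v n : Lp ℝ 2 μ)) atTop (𝓝 v₀))
    (hcau : Tendsto (fun p : ℕ × ℕ => integralForm D.gamma (v p.1 - v p.2) (v p.1 - v p.2))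
      atTop (𝓝 0)) (hZ : Integrable Z μ)
    (hlim : Tendsto (fun n => ∫ y, ‖D.gamma (v n) (v n) y - Z y‖ ∂μ) atTop (𝓝 0)) :
    ∃ h : v₀ ∈ D.dom, D.gamma ⟨v₀, h⟩ ⟨v₀, h⟩ =ᵐ[μ] Z := by
  obtain ⟨h, hh⟩ := D.exists_tendsto_cenergy_sub hv₀ hcau
  exact ⟨h, ae_eq_of_tendsto_integral_norm_sub (fun _ => integrable_coeFn_L1 _)
    (integrable_coeFn_L1 _) hZ (tendsto_integral_norm_sub_of_L1
      (tendsto_gamma D.gamma D.gamma_symm D.gamma_nonneg hh hh)) hlim⟩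

variable {X : Type*} [MeasurableSpace X] {ν : Measure X}

/-- `t⁻¹ sin(t Ñ(f))` as an exponential sum. -/
def ExpPoly.sinSum (S : LocalDirichletStructure ν) (f : S.testDomain) (t : ℝ) :
    ExpPoly.realSums S :=
  ExpPoly.im (AddMonoidAlgebra.single (t • f) ((t⁻¹ : ℝ) : ℂ))

theorem tendsto_inv_mul_sin_mul {t : ℕ → ℝ} (ht : Tendsto t atTop (𝓝[≠] 0)) (x : ℝ) :
    Tendsto (fun n => (t n)⁻¹ * Real.sin (t n * x)) atTop (𝓝 x) := by
  have h : HasDerivAt (fun s : ℝ => Real.sin (s * x)) x 0 := by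
    simpa using ((hasDerivAt_id (0 : ℝ)).mul_const x).sin
  have h1 := (hasDerivAt_iff_tendsto_slope_zero.1 h).comp ht
  simpa [Function.comp_def] using h1

theorem abs_inv_mul_sin_mul_le (t x : ℝ) : |t⁻¹ * Real.sin (t * x)| ≤ |x| := by
  rcases eq_or_ne t 0 with rfl | ht
  · simp
  · rw [abs_mul, abs_inv, inv_mul_le_iff₀ (abs_pos.2 ht), ← abs_mul]
    exact Real.abs_sin_le_abs

theorem tendsto_cos_mul_cos {t : ℕ → ℝ} (ht : Tendsto t atTop (𝓝 0)) (x : ℝ) :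
    Tendsto (fun p : ℕ × ℕ => Real.cos (t p.1 * x) * Real.cos (t p.2 * x)) atTop (𝓝 1) := by
  have h1 : Tendsto (fun n => Real.cos (t n * x)) atTop (𝓝 1) := by
    have := (Real.continuous_cos.tendsto (0 * x)).comp (ht.mul_const x)
    simpa [Function.comp_def] using this
  rw [← prod_atTop_atTop_eq]
  have := (h1.comp tendsto_fst).mul (h1.comp (tendsto_snd (f := (atTop : Filter ℕ))))
  rw [one_mul] at this
  exact this

namespace IsPoissonLaw

open AddMonoidAlgebra ExpPoly DirichletForm

variable {P : Measure (Configuration X)} [SigmaFinite ν] [IsProbabilityMeasure P]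
  (hP : IsPoissonLaw ν P) {S : LocalDirichletStructure ν}

include hP

/-! ### The Friedrichs extension -/

/-- The operator of the closure and A₀ have the same pairings with all exponential sums; the
difference is integrable, hence zero by separation. -/
theorem cgenerator_evalL2 (F : ExpPoly S)
    (hF : evalL2 P F ∈ (hP.poissonStructure S).cgenerator.domain) :
    (hP.poissonStructure S).cgenerator ⟨_, hF⟩ =ᵐ[P] genSum P F := by
  set A := (hP.poissonStructure S).cgenerator
  obtain ⟨hF', h⟩ := ((hP.poissonStructure S).isComplexGenerator_cgenerator _ _).1
    (LinearPMap.mem_graph A ⟨_, hF⟩)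
  have hA : Integrable (A ⟨_, hF⟩) P := (Lp.memLp _).integrable (by norm_num)
  have h0 : (fun ω => A ⟨_, hF⟩ ω - genSum P F ω) =ᵐ[P] 0 := by
    refine hP.ae_eq_zero_of_forall_eval (S := S) (hA.sub (hP.integrable_genSum F)) fun G => ?_
    have h1 := h ⟨_, hP.preDomain_le_cdom (evalL2_mem P G)⟩
    rw [hP.cform_evalL2] at h1
    have h2 : ∫ ω, A ⟨_, hF⟩ ω * conj (evalL2 P G ω) ∂P =
        ∫ ω, A ⟨_, hF⟩ ω * conj (eval P G ω) ∂P := by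
      refine integral_congr_ae ?_
      filter_upwards [coeFn_evalL2 P G] with ω h
      rw [h]
    have h3 : Integrable (fun ω => A ⟨_, hF⟩ ω * conj (eval P G ω)) P := by
      refine (integrable_eval_mul P (conjHom G) hA).congr ?_
      filter_upwards [hP.eval_conjHom G] with ω h
      rw [h, mul_comm]
    simp only [sub_mul]
    rw [integral_sub h3 (hP.integrable_genSum_mul_conj_eval F G),
      hP.integral_genSum_mul_conj_eval, ← h2]
    linear_combination h1
  filter_upwards [h0] with ω h
  exact sub_eq_zero.1 h

/-- When A₀[F] is square integrable, integration by parts is the weak equation against exponential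
sums, and `mem_generatorGraph` extends it to the whole form domain. -/
theorem evalL2_mem_cgenerator_domain {F : ExpPoly S} (hF : MemLp (genSum P F) 2 P) :
    evalL2 P F ∈ (hP.poissonStructure S).cgenerator.domain := by
  set H := hF.toLp _ with hH
  have hd := hP.preDomain_le_cdom (evalL2_mem P F)
  have key : ∀ K : realSums S,
      (hP.poissonStructure S).form ⟨_, hd.1⟩ (hP.realToDom S K) =
        -inner ℝ (rePart H) (hP.realToDom S K : Lp ℝ 2 P) ∧
      (hP.poissonStructure S).form ⟨_, hd.2⟩ (hP.realToDom S K) =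
        -inner ℝ (imPart H) (hP.realToDom S K : Lp ℝ 2 P) := by
    intro K
    have e := hP.evalL2_eq_ofParts K 0
    rw [ZeroMemClass.coe_zero, smul_zero, add_zero, map_zero, ZeroMemClass.coe_zero] at e
    have e1 : rePart (evalL2 P (K : ExpPoly S)) = hP.realToDom S K := by rw [e, rePart_ofParts]
    have e2 : imPart (evalL2 P (K : ExpPoly S)) = 0 := by rw [e, imPart_ofParts]
    have h1 : (hP.poissonStructure S).cform ⟨_, hd⟩
        ⟨_, hP.preDomain_le_cdom (evalL2_mem P (K : ExpPoly S))⟩ =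
          -∫ ω, H ω * conj (evalL2 P (K : ExpPoly S) ω) ∂P := by
      have h2 : ∫ ω, H ω * conj (evalL2 P (K : ExpPoly S) ω) ∂P =
          ∫ ω, genSum P F ω * conj (eval P (K : ExpPoly S) ω) ∂P := by
        refine integral_congr_ae ?_
        filter_upwards [coeFn_evalL2 P (K : ExpPoly S), hF.coeFn_toLp] with ω h h'
        rw [h, h']
      rw [hP.cform_evalL2, h2, hP.integral_genSum_mul_conj_eval]
      ring
    rw [(hP.poissonStructure S).cform_eq (u := ⟨_, hd.1⟩) (v := ⟨_, hd.2⟩)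
      (u' := hP.realToDom S K) (v' := 0) rfl rfl e1 e2, integral_mul_conj, e1, e2] at h1
    simp only [map_zero, add_zero, sub_zero, inner_zero_right] at h1
    have a := congrArg Complex.re h1
    have b := congrArg Complex.im h1
    simp at a b
    exact ⟨a, b⟩
  have hm : (evalL2 P F, H) ∈ (hP.poissonStructure S).cgenerator.graph := by
    rw [graph_cgenerator]
    exact ⟨hP.mem_generatorGraph hd.1 fun K => (key K).1,
      hP.mem_generatorGraph hd.2 fun K => (key K).2⟩
  exact LinearPMap.mem_domain_of_mem_graph hm

theorem evalL2_mem_cgenerator_domain_iff (F : ExpPoly S) :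
    evalL2 P F ∈ (hP.poissonStructure S).cgenerator.domain ↔ MemLp (genSum P F) 2 P :=
  ⟨fun h => (Lp.memLp _).ae_eq (hP.cgenerator_evalL2 F h), hP.evalL2_mem_cgenerator_domain⟩

/-! ### The carré du champ of `Ñ(f)` -/

theorem gammaSum_im (F G : ExpPoly S) :
    ∀ᵐ ω ∂P, (gammaSum P (im F : ExpPoly S) (im G : ExpPoly S) ω).re =
      1 / 2 * ((gammaSum P F (conjHom G) ω).re - (gammaSum P F G ω).re) := by
  filter_upwards [hP.gammaSum_conjHom F G, hP.gammaSum_conjHom F (conjHom G)] with ω h1 h2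
  rw [conjHom_conjHom] at h2
  have e : ∀ F : ExpPoly S, (im F : ExpPoly S) =
      (((1 / 2 : ℝ) : ℂ) * Complex.I) • (conjHom F - F) := by
    intro F
    change (1 / 2 : ℝ) • (-Complex.I • F + conjHom (-Complex.I • F)) = _
    rw [conjHom_smul, map_neg, Complex.conj_I, neg_neg, ← Complex.coe_smul, mul_smul, smul_sub,
      neg_smul, neg_add_eq_sub]
  rw [e, e]
  simp only [map_smul, LinearMap.smul_apply, map_sub, LinearMap.sub_apply, Pi.smul_apply,
    Pi.sub_apply, h1, h2, smul_eq_mul]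
  simp
  ring

theorem expN_smul (t : ℝ) (f : Lp ℝ 2 ν) :
    ∀ᵐ ω ∂P, expN P (t • f) ω = Complex.exp (Complex.I * ((t * Ntilde P f ω : ℝ) : ℂ)) := by
  filter_upwards [Lp.coeFn_smul t (Ntilde P f)] with ω h
  rw [expN, hP.Ntilde_smul, h, Pi.smul_apply, smul_eq_mul]

theorem coeFn_sinSum (f : S.testDomain) (t : ℝ) :
    (hP.realToDom S (sinSum S f t) : Lp ℝ 2 P) =ᵐ[P]
      fun ω => t⁻¹ * Real.sin (t * Ntilde P (f : Lp ℝ 2 ν) ω) := by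
  rw [sinSum, ← hP.imPart_evalL2]
  filter_upwards [coeFn_imPart (evalL2 P (single (t • f) ((t⁻¹ : ℝ) : ℂ))),
    coeFn_evalL2 P (single (t • f) ((t⁻¹ : ℝ) : ℂ)), hP.expN_smul t (f : Lp ℝ 2 ν)] with ω h1 h2 h3
  rw [h1, h2, eval_single, Submodule.coe_smul, h3, Complex.im_ofReal_mul, mul_comm Complex.I,
    Complex.exp_ofReal_mul_I_im]

/-- The terms with exponents s + t and s - t recombine by the addition formulas for the cosine; the
inverse factors in the amplitudes cancel against the st coming from γ[s f, t f]. -/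
theorem gamma_sinSum (f : S.testDomain) {s t : ℝ} (hs : s ≠ 0) (ht : t ≠ 0) :
    (hP.poissonStructure S).gamma (hP.realToDom S (sinSum S f s)) (hP.realToDom S (sinSum S f t))
      =ᵐ[P] fun ω => Real.cos (s * Ntilde P (f : Lp ℝ 2 ν) ω) *
        Real.cos (t * Ntilde P (f : Lp ℝ 2 ν) ω) * N (S.gamma (S.toDom f) (S.toDom f)) ω := by
  have hγ : ∀ c : ℝ, ∀ᵐ ω ∂P, N (S.gamma (S.toDom (s • f)) (S.toDom (c • f))) ω =
      s * c * N (S.gamma (S.toDom f) (S.toDom f)) ω := by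
    intro c
    have e : ∀ c : ℝ, S.toDom (c • f) = c • S.toDom f := fun c => rfl
    filter_upwards [hP.N_gamma_smul_left s (S.toDom f) (c • S.toDom f),
      hP.N_gamma_smul_left c (S.toDom f) (S.toDom f)] with ω h1 h2
    rw [e, e, h1, S.gamma_symm, h2, mul_assoc]
  have en : -(t • f) = (-t) • f := (neg_smul t f).symm
  filter_upwards [hP.gamma_realToDom (sinSum S f s) (sinSum S f t),
    hP.gammaSum_im (single (s • f) ((s⁻¹ : ℝ) : ℂ)) (single (t • f) ((t⁻¹ : ℝ) : ℂ)),
    hγ t, hγ (-t), hP.expN_smul s (f : Lp ℝ 2 ν), hP.expN_smul t (f : Lp ℝ 2 ν),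
    hP.expN_smul (-t) (f : Lp ℝ 2 ν)] with ω h1 h2 h3 h4 h5 h6 h7
  rw [h1, sinSum, sinSum, h2, conjHom_single, gammaSum_single, gammaSum_single, en, h3, h4,
    Submodule.coe_smul, Submodule.coe_smul, Submodule.coe_smul, h5, h6, h7, Complex.conj_ofReal]
  set x := Ntilde P (f : Lp ℝ 2 ν) ω
  set z := N (S.gamma (S.toDom f) (S.toDom f)) ω
  have e2 : ∀ a b c d w : ℝ, (-((a : ℂ) * b * (Complex.exp (Complex.I * (c : ℂ)) *
      Complex.exp (Complex.I * (d : ℂ)) * (w : ℂ)))).re = -(a * b * w) * Real.cos (c + d) := by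
    intro a b c d w
    have : (-((a : ℂ) * b * (Complex.exp (Complex.I * (c : ℂ)) *
      Complex.exp (Complex.I * (d : ℂ)) * (w : ℂ)))) = ((-(a * b * w) : ℝ) : ℂ) *
        Complex.exp (((c + d : ℝ) : ℂ) * Complex.I) := by
      push_cast
      rw [add_mul, Complex.exp_add, mul_comm Complex.I, mul_comm Complex.I]; ring
    rw [this, Complex.re_ofReal_mul, Complex.exp_ofReal_mul_I_re]
  rw [e2, e2, neg_mul t x, Real.cos_add, Real.cos_add, Real.cos_neg, Real.sin_neg]
  field_simp
  ring

theorem exists_gamma_ae_eq {v : ℕ → (hP.poissonStructure S).dom} {v₀ : Lp ℝ 2 P}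
    {Z : Configuration X → ℝ} (hv₀ : Tendsto (fun n => (v n : Lp ℝ 2 P)) atTop (𝓝 v₀))
    (hcau : Tendsto (fun p : ℕ × ℕ => integralForm (hP.poissonStructure S).gamma
      (v p.1 - v p.2) (v p.1 - v p.2)) atTop (𝓝 0)) (hZ : Integrable Z P)
    (hlim : Tendsto (fun n => ∫ ω, ‖(hP.poissonStructure S).gamma (v n) (v n) ω - Z ω‖ ∂P)
      atTop (𝓝 0)) :
    ∃ h : v₀ ∈ (hP.poissonStructure S).dom,
      (hP.poissonStructure S).gamma ⟨v₀, h⟩ ⟨v₀, h⟩ =ᵐ[P] Z :=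
  (hP.diffusionAlgebra S).exists_gamma_ae_eq hv₀ hcau hZ hlim

theorem tendsto_sinSum (f : S.testDomain) {t : ℕ → ℝ} (ht : Tendsto t atTop (𝓝[≠] 0)) :
    Tendsto (fun n => (hP.realToDom S (sinSum S f (t n)) : Lp ℝ 2 P)) atTop
      (𝓝 (Ntilde P (f : Lp ℝ 2 ν))) := by
  have hve := fun n => hP.coeFn_sinSum f (t n)
  refine tendsto_L2_of_dominated ((2 : ℝ) • Ntilde P (f : Lp ℝ 2 ν)) (fun n => ?_) ?_
  · filter_upwards [hve n, Lp.coeFn_smul (2 : ℝ) (Ntilde P (f : Lp ℝ 2 ν))] with ω h1 h2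
    rw [h1, h2, Pi.smul_apply, smul_eq_mul, norm_mul, Real.norm_ofNat]
    have h3 := norm_sub_le ((t n)⁻¹ * Real.sin (t n * Ntilde P (f : Lp ℝ 2 ν) ω))
      (Ntilde P (f : Lp ℝ 2 ν) ω)
    have h4 := abs_inv_mul_sin_mul_le (t n) (Ntilde P (f : Lp ℝ 2 ν) ω)
    rw [← Real.norm_eq_abs, ← Real.norm_eq_abs] at h4
    linarith
  · filter_upwards [ae_all_iff.2 hve] with ω h
    simp only [h]
    exact tendsto_inv_mul_sin_mul ht _

/-- The limit is along pairs of parameters: the diagonal yields the carré du champ of the limit, and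
the full double limit yields the Cauchy property in energy. -/
theorem tendsto_gamma_sinSum (f : S.testDomain) {t : ℕ → ℝ} (t0 : ∀ n, t n ≠ 0)
    (ht : Tendsto t atTop (𝓝 0)) :
    Tendsto (fun p : ℕ × ℕ => ∫ ω, ‖(hP.poissonStructure S).gamma
      (hP.realToDom S (sinSum S f (t p.1))) (hP.realToDom S (sinSum S f (t p.2))) ω -
        N (S.gamma (S.toDom f) (S.toDom f)) ω‖ ∂P) atTop (𝓝 0) := by
  have hZi : Integrable (N (S.gamma (S.toDom f) (S.toDom f))) P :=
    hP.integrable_N (integrable_coeFn_L1 _)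
  have hcm : ∀ s : ℝ, AEStronglyMeasurable
      (fun ω => Real.cos (s * Ntilde P (f : Lp ℝ 2 ν) ω)) P := fun s =>
    Real.continuous_cos.comp_aestronglyMeasurable ((Lp.aestronglyMeasurable _).const_mul s)
  have h1 := tendsto_integral_norm_mul_sub (μ := P) (l := (atTop : Filter (ℕ × ℕ)))
    (φ := fun p ω => Real.cos (t p.1 * Ntilde P (f : Lp ℝ 2 ν) ω) *
      Real.cos (t p.2 * Ntilde P (f : Lp ℝ 2 ν) ω)) (φ₀ := fun _ => 1)
    (g := fun _ => N (S.gamma (S.toDom f) (S.toDom f)))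
    (g₀ := N (S.gamma (S.toDom f) (S.toDom f))) (C := 1) (fun p => (hcm _).mul (hcm _))
    (fun p => ae_of_all _ fun ω => by
      rw [norm_mul]
      exact mul_le_one₀ (Real.abs_cos_le_one _) (norm_nonneg _) (Real.abs_cos_le_one _))
    (ae_of_all _ fun ω => tendsto_cos_mul_cos ht _) (fun _ => hZi) hZi (by simp)
  refine h1.congr fun p => integral_congr_ae ?_
  filter_upwards [hP.gamma_sinSum f (t0 p.1) (t0 p.2)] with ω h
  rw [one_mul, ← h]

theorem exists_Ntilde_testDomain (f : S.testDomain) :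
    ∃ h : Ntilde P (f : Lp ℝ 2 ν) ∈ (hP.poissonStructure S).dom,
      (hP.poissonStructure S).gamma ⟨_, h⟩ ⟨_, h⟩ =ᵐ[P]
        N (S.gamma (S.toDom f) (S.toDom f)) := by
  obtain ⟨t, t0, tl⟩ : ∃ t : ℕ → ℝ, (∀ n, t n ≠ 0) ∧ Tendsto t atTop (𝓝 0) :=
    ⟨fun n => 1 / ((n : ℝ) + 1), fun n => by positivity, tendsto_one_div_add_atTop_nhds_zero_nat⟩
  have hZ : Integrable (N (S.gamma (S.toDom f) (S.toDom f))) P :=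
    hP.integrable_N (integrable_coeFn_L1 _)
  have hg := hP.tendsto_gamma_sinSum f t0 tl
  have hv := hP.tendsto_sinSum f (tendsto_nhdsWithin_iff.2 ⟨tl, Eventually.of_forall t0⟩)
  generalize hvn : (fun n => hP.realToDom S (sinSum S f (t n))) = v at hv
  have hvn' : ∀ n, hP.realToDom S (sinSum S f (t n)) = v n := fun n => congrFun hvn n
  simp only [hvn'] at hg hv
  have hcau := tendsto_form_sub_sub (integralForm (hP.poissonStructure S).gamma) (v := v)
    (fun u v => by rw [integralForm_apply, integralForm_apply, (hP.poissonStructure S).gamma_symm])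
    (tendsto_integral_of_norm_sub (fun _ => integrable_coeFn_L1 _) hZ hg)
  have hd := hg.comp tendsto_atTop_diagonal
  have h := hP.exists_gamma_ae_eq hv hcau hZ hd
  exact h

/-- The map f ↦ Ñ(f) does not increase energy on test functions, since E N(γ[f]) ≤ ∫ γ[f] dν. An
energy approximation of f by test functions is thus sent to a Cauchy sequence, and N(γ[fₙ]) →
N(γ[f]) in L¹(P). -/
theorem exists_Ntilde (f : S.dom) :
    ∃ h : Ntilde P (f : Lp ℝ 2 ν) ∈ (hP.poissonStructure S).dom,
      (hP.poissonStructure S).gamma ⟨_, h⟩ ⟨_, h⟩ =ᵐ[P] N (S.gamma f f) := by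
  choose F hF using fun n : ℕ => S.exists_testDomain_energy_lt f
    (show (0 : ℝ) < 1 / ((n : ℝ) + 1) by positivity)
  choose h hh using fun k : S.testDomain => hP.exists_Ntilde_testDomain k
  have t0 : Tendsto (fun n : ℕ => 1 / ((n : ℝ) + 1)) atTop (𝓝 0) :=
    tendsto_one_div_add_atTop_nhds_zero_nat
  have l1 : Tendsto (fun n => (F n : Lp ℝ 2 ν)) atTop (𝓝 (f : Lp ℝ 2 ν)) := by
    rw [tendsto_iff_norm_sub_tendsto_zero]
    have : Tendsto (fun n => ‖(F n : Lp ℝ 2 ν) - f‖ ^ 2) atTop (𝓝 0) := by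
      refine squeeze_zero (fun _ => sq_nonneg _) (fun n => ?_) t0
      have h1 := S.nonneg (f - S.toDom (F n))
      have h2 := (hF n).le
      rw [norm_sub_rev]
      exact (le_add_of_nonneg_right h1).trans h2
    have h2 := (Real.continuous_sqrt.tendsto 0).comp this
    simpa [Function.comp_def] using h2
  have l2 : Tendsto (fun n => integralForm S.gamma (S.toDom (F n) - f) (S.toDom (F n) - f)) atTop
      (𝓝 0) := by
    refine squeeze_zero (fun n => integralForm_nonneg _ S.gamma_nonneg _) (fun n => ?_)
      (by simpa using t0.const_mul 2)
    have h2 := (hF n).le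
    have h3 := S.energy (f - S.toDom (F n))
    rw [← integralForm_apply] at h3
    rw [← neg_sub f, map_neg, map_neg, LinearMap.neg_apply, neg_neg]
    rw [one_div] at h2
    have h4 := sq_nonneg ‖((f - S.toDom (F n) : S.dom) : Lp ℝ 2 ν)‖
    linarith
  have p1 : Tendsto (Prod.fst : ℕ × ℕ → ℕ) atTop atTop := by
    rw [← prod_atTop_atTop_eq]; exact tendsto_fst
  have p2 : Tendsto (Prod.snd : ℕ × ℕ → ℕ) atTop atTop := by
    rw [← prod_atTop_atTop_eq]; exact tendsto_snd
  have l3 : Tendsto (fun p : ℕ × ℕ => integralForm S.gamma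
      (S.toDom (F p.1) - S.toDom (F p.2)) (S.toDom (F p.1) - S.toDom (F p.2))) atTop (𝓝 0) :=
    tendsto_form_sub_sub (integralForm S.gamma) (v := fun n => S.toDom (F n))
      (fun u v => by rw [integralForm_apply, integralForm_apply, S.gamma_symm])
      (tendsto_integral_of_norm_sub (fun _ => integrable_coeFn_L1 _) (integrable_coeFn_L1 _)
        (tendsto_integral_norm_sub_of_L1 (tendsto_gamma S.gamma S.gamma_symm S.gamma_nonneg
          (l2.comp p1) (l2.comp p2))))
  -- By linearity of Ñ, a difference is Ñ of a test function again, whose carré du champ is already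
  -- known.
  have hcau : Tendsto (fun p : ℕ × ℕ => integralForm (hP.poissonStructure S).gamma
      ((⟨_, h (F p.1)⟩ : (hP.poissonStructure S).dom) - ⟨_, h (F p.2)⟩)
      ((⟨_, h (F p.1)⟩ : (hP.poissonStructure S).dom) - ⟨_, h (F p.2)⟩))
      atTop (𝓝 0) := by
    refine squeeze_zero (fun p => integralForm_nonneg _ (hP.poissonStructure S).gamma_nonneg _)
      (fun p => ?_) l3
    have e : (⟨_, h (F p.1)⟩ : (hP.poissonStructure S).dom) - ⟨_, h (F p.2)⟩ =
        ⟨_, h (F p.1 - F p.2)⟩ := by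
      apply Subtype.ext
      change Ntilde P (F p.1 : Lp ℝ 2 ν) - Ntilde P (F p.2 : Lp ℝ 2 ν) =
        Ntilde P ((F p.1 - F p.2 : S.testDomain) : Lp ℝ 2 ν)
      rw [Submodule.coe_sub, hP.Ntilde_eq, map_sub]
    have e' : S.toDom (F p.1) - S.toDom (F p.2) = S.toDom (F p.1 - F p.2) := rfl
    rw [e, e', integralForm_apply, integralForm_apply, integral_congr_ae (hh (F p.1 - F p.2))]
    have h1 := hP.integral_norm_N_le (integrable_coeFn_L1
      (S.gamma (S.toDom (F p.1 - F p.2)) (S.toDom (F p.1 - F p.2))))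
    refine (integral_mono (hP.integrable_N (integrable_coeFn_L1 _))
      (hP.integrable_N (integrable_coeFn_L1 _)).norm fun ω => le_abs_self _).trans (h1.trans_eq ?_)
    refine integral_congr_ae ?_
    filter_upwards [S.gamma_nonneg (S.toDom (F p.1 - F p.2))] with y hy
    exact abs_of_nonneg hy
  have a2 := tendsto_integral_norm_sub_of_L1
    (tendsto_gamma S.gamma S.gamma_symm S.gamma_nonneg l2 l2)
  refine hP.exists_gamma_ae_eq (S := S) (v := fun n => ⟨_, h (F n)⟩)
    ((hP.continuous_Ntilde.tendsto _).comp l1) hcau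
    (hP.integrable_N (integrable_coeFn_L1 _)) ?_
  refine squeeze_zero (fun n => integral_nonneg fun ω => norm_nonneg _) (fun n => ?_) a2
  refine le_trans (le_of_eq (integral_congr_ae ?_)) (hP.integral_norm_N_le
    ((integrable_coeFn_L1 (S.gamma (S.toDom (F n)) (S.toDom (F n)))).sub
      (integrable_coeFn_L1 (S.gamma f f))))
  filter_upwards [hh (F n), hP.N_sub
    (integrable_coeFn_L1 (S.gamma (S.toDom (F n)) (S.toDom (F n))))
    (integrable_coeFn_L1 (S.gamma f f))] with ω h1 h2
  rw [h1]
  exact congrArg norm h2.symm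

end IsPoissonLaw

end PoissonDirichlet
end

/-! ### Assembly of the theorem -/

theorem mainTheorem2 {X : Type*} [MeasurableSpace X] [MeasurableSingletonClass X]
    (ν : Measure X) [SigmaFinite ν] [NullSingletonClass ν]
    (S : LocalDirichletStructure ν) (hS : S.IsSeparable)
    (P : Measure (Configuration X)) [IsProbabilityMeasure P] (hP : IsPoissonLaw ν P) :
    -- the integration by parts formula
    (∀ (m n : ℕ) (lam : Fin m → ℂ) (f : Fin m → S.testDomain)
        (mu : Fin n → ℂ) (g : Fin n → S.testDomain),
      Integrable (fun ω => A0Sum S P lam f ω * conj (expSum S P mu g ω)) P ∧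
      Integrable (fun ω => ∑ p, ∑ q, expSumDeriv S P lam f p ω * conj (expSumDeriv S P mu g q ω) *
        (N (S.gamma (S.toDom (f p)) (S.toDom (g q))) ω : ℂ)) P ∧
      ∫ ω, A0Sum S P lam f ω * conj (expSum S P mu g ω) ∂P =
        -(1 / 2) * ∫ ω, ∑ p, ∑ q,
          expSumDeriv S P lam f p ω * conj (expSumDeriv S P mu g q ω) *
            (N (S.gamma (S.toDom (f p)) (S.toDom (g q))) ω : ℂ) ∂P) ∧
    Dense (preDomain S P : Set (Lp ℂ 2 P)) ∧
    ∃ A₀ : preDomain S P →ₗ[ℂ] Lp ℂ 1 P,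
      -- `A₀[F]` does not depend on the representation of `F`
      (∀ (m : ℕ) (lam : Fin m → ℂ) (f : Fin m → S.testDomain) (F : preDomain S P),
        (F : Lp ℂ 2 P) =ᵐ[P] expSum S P lam f → A₀ F =ᵐ[P] A0Sum S P lam f) ∧
      -- symmetry
      (∀ F G : preDomain S P,
        ∫ ω, A₀ F ω * conj ((G : Lp ℂ 2 P) ω) ∂P =
          ∫ ω, (F : Lp ℂ 2 P) ω * conj (A₀ G ω) ∂P) ∧
      -- negativity
      (∀ F : preDomain S P,
        (∫ ω, A₀ F ω * conj ((F : Lp ℂ 2 P) ω) ∂P).im = 0 ∧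
        (∫ ω, A₀ F ω * conj ((F : Lp ℂ 2 P) ω) ∂P).re ≤ 0) ∧
      -- the Friedrichs extension `A`, and the local Dirichlet structure `U` that it defines
      ∃ (U : LocalDirichletStructure P) (A : Lp ℂ 2 P →ₗ.[ℂ] Lp ℂ 2 P),
        U.IsClosureOf (preDomain S P)
          (fun F G => -∫ ω, A₀ F ω * conj ((G : Lp ℂ 2 P) ω) ∂P) ∧
        U.IsComplexGenerator A ∧
        IsSelfAdjoint A ∧
        (∀ F : preDomain S P,
          ((F : Lp ℂ 2 P) ∈ A.domain ↔ MemLp (A₀ F) 2 P) ∧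
          ∀ hF : (F : Lp ℂ 2 P) ∈ A.domain, A ⟨F, hF⟩ =ᵐ[P] A₀ F) ∧
        (∀ (m : ℕ) (lam : Fin m → ℂ) (f : Fin m → S.testDomain) (F : preDomain S P),
          (F : Lp ℂ 2 P) =ᵐ[P] expSum S P lam f →
          (∀ p, MemLp (S.gamma (S.toDom (f p)) (S.toDom (f p))) 2 ν) →
          (F : Lp ℂ 2 P) ∈ A.domain) ∧
        -- the carré du champ of `Ñ(f)`
        ∀ f : S.dom, ∃ h : Ntilde P (f : Lp ℝ 2 ν) ∈ U.dom,
          U.gamma ⟨_, h⟩ ⟨_, h⟩ =ᵐ[P] N (S.gamma f f) := by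
  obtain ⟨A₀, hA₀⟩ := hP.exists_preGenerator (S := S)
  -- Every pairing with A₀ is transported to formal sums, where symmetry, negativity and integration
  -- by parts have been proved.
  have hint : ∀ (F G : preDomain S P) (K L : ExpPoly S), (F : Lp ℂ 2 P) = ExpPoly.evalL2 P K →
      (G : Lp ℂ 2 P) = ExpPoly.evalL2 P L → ∫ ω, A₀ F ω * conj ((G : Lp ℂ 2 P) ω) ∂P =
        ∫ ω, ExpPoly.genSum P K ω * conj (ExpPoly.eval P L ω) ∂P := by
    intro F G K L hK hL
    refine integral_congr_ae ?_
    filter_upwards [hA₀ F K hK, ExpPoly.coeFn_evalL2 P L] with ω h1 h2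
    rw [h1, hL, h2]
  refine ⟨?_, hP.dense_preDomain, A₀, ?_, ?_, ?_, hP.poissonStructure S,
    (hP.poissonStructure S).cgenerator, ?_, (hP.poissonStructure S).isComplexGenerator_cgenerator,
    (hP.poissonStructure S).isSelfAdjoint_cgenerator, ?_, ?_, hP.exists_Ntilde⟩
  · intro m n lam f mu g
    have e := hP.gammaSum_ofSum lam f mu g
    have h1 := hP.integrable_genSum_mul_conj_eval (ExpPoly.ofSum lam f) (ExpPoly.ofSum mu g)
    have h2 := hP.integral_genSum_mul_conj_eval (ExpPoly.ofSum lam f) (ExpPoly.ofSum mu g)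
    rw [ExpPoly.genSum_ofSum, ExpPoly.eval_ofSum] at h1 h2
    exact ⟨h1, (hP.integrable_gammaSum _ _).congr e, h2.trans (by rw [integral_congr_ae e])⟩
  · intro m lam f F hF
    have h := hA₀ F _ (ExpPoly.eq_evalL2_ofSum P lam f hF)
    rwa [ExpPoly.genSum_ofSum] at h
  · intro F G
    obtain ⟨K, hK⟩ := ExpPoly.exists_eq_evalL2 P F
    obtain ⟨L, hL⟩ := ExpPoly.exists_eq_evalL2 P G
    rw [hint F G K L hK hL, hP.integral_genSum_mul_conj_comm]
    refine integral_congr_ae ?_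
    filter_upwards [hA₀ G L hL, ExpPoly.coeFn_evalL2 P K] with ω h1 h2
    rw [h1, hK, h2]
  · intro F
    obtain ⟨K, hK⟩ := ExpPoly.exists_eq_evalL2 P F
    rw [hint F F K K hK hK]
    exact hP.integral_genSum_mul_conj_self_nonpos K
  -- Closability is expressed by exhibiting the closure: the closed hermitian extension agrees with
  -- the form on 𝒟₀ and has 𝒟₀ as a core.
  · refine ⟨hP.preDomain_le_cdom, fun F G => ?_, fun F r hr =>
      hP.exists_cenergy_lt F hr hP.preDomain_le_cdom⟩
    obtain ⟨K, hK⟩ := ExpPoly.exists_eq_evalL2 P F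
    obtain ⟨L, hL⟩ := ExpPoly.exists_eq_evalL2 P G
    obtain ⟨F, hF⟩ := F
    obtain ⟨G, hG⟩ := G
    beta_reduce
    rw [hint _ _ K L hK hL, hP.integral_genSum_mul_conj_eval]
    simp only at hK hL
    subst hK hL
    rw [hP.cform_evalL2]
    ring
  · intro F
    obtain ⟨K, hK⟩ := ExpPoly.exists_eq_evalL2 P F
    have hA := hA₀ F K hK
    obtain ⟨F, hF⟩ := F
    simp only at hK
    subst hK
    refine ⟨?_, fun h => (hP.cgenerator_evalL2 K h).trans hA.symm⟩
    rw [hP.evalL2_mem_cgenerator_domain_iff]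
    exact ⟨fun h => h.ae_eq hA.symm, fun h => h.ae_eq hA⟩
  · intro m lam f F hF h
    rw [ExpPoly.eq_evalL2_ofSum P lam f hF]
    refine hP.evalL2_mem_cgenerator_domain ?_
    rw [ExpPoly.genSum_ofSum]
    exact hP.memLp_A0Sum lam f h
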